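/- Let $D$ be a compact connected Riemann surface, $D_\infty\subset D$ a finite (possibly empty) set, and let $\epsilon:D\setminus D_\infty\to\mathbb R^3$ be a smooth conformal minimal immersion, possibly multi-valued, whose branches differ locally by translations (the periods). Write $M/\mathcal P$ for the resulting minimal surface modulo its periods, parametrized by $D\setminus D_\infty$, and assume that it is not flat. Let $n$ be its unit normal, oriented so that $n:D\setminus D_\infty\to S$ is holomorphic into the unit sphere $S$ with complex coordinate $u=-(s_1+\mathrm i s_2)/(1+s_3)$, and let $n'(x)$ be the derivative of $n$ at $x$, viewed as a traceless symmetric endomorphism of $T_{n(x)}S$. Let $\pi: Q\to S$ be the holomorphic line bundle whose fibre over $s$ consists of the traceless symmetric endomorphisms of $T_sS$; its complex structure is given by the coordinates $(u,q)$ over $S\setminus\{-e_3\}$, in which $q^{-1}\,ds=\operatorname{Re}\bigl(-\tfrac2q(1-u^2,\mathrm i(1+u^2),2u)\,du\bigr)$, and $(v,r)=(u^{-1},u^{-4}q)$ over $S\setminus\{e_3\}$. Thus $n'$ maps $D\setminus D_\infty$ to $Q$. The Gaussian curvature is $K=\det n'$, and a finite flat point is a point of $D\setminus D_\infty$ at which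 $n'=0$. Assume that every $e\in D_\infty$ is a flat point at infinity, i.e. $K$ is integrable with respect to the area of the surface on a punctured neighbourhood of $e$, and every $C^1$ curve in a punctured neighbourhood of $e$ that converges to $e$ is mapped by $\epsilon$ to a curve of infinite Euclidean length. (So $M/\mathcal P$ is complete, of finite topological type and of finite total curvature.) Then $n'$ extends to a holomorphic map $N:D\to Q$, which maps $D_\infty$ into the zero section $0_Q$. The holomorphic extension $\pi\circ N:D\to S$ of the Gauss map has a degree $d\geq 1$, the degree of the Gauss map of $M/\mathcal P$, and the following hold. 1. $K$ is integrable over $M/\mathcal P$ and its total curvature is $\int_{M/\mathcal P}K\,dA=-4\pi d$. 2. There are finitely many finite flat points, and the number of finite flat points plus the number of flat points at infinity, each counted with its multiplicity (the order of vanishing at the point of $N$ in the fibre coordinate of $Q$), is equal to $4d$. 3. $C=N(D)$ is an algebraic curve in $Q$. If $m\ge1$ is the number of points of $D$ over all but finitely many points of $C$ (such an $m$ exists), then $m\,(C\cdot 0_Q)=4d$, where $C\cdot 0_Q$ is the intersection number of $C$ with the zero section. In particular $C\cdot 0_Q=4d$ if $D$ is the normalization of $C$, that is, if $m=1$. -/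

import Mathlib

open Set Filter Topology MeasureTheory
open scoped Manifold ContDiff Matrix

noncomputable section

namespace MinSurf

/-- Euclidean three-space. -/
abbrev E3 : Type := EuclideanSpace ℝ (Fin 3)

/-- The vector product of `ℝ³`. -/
def cross (a b : E3) : E3 := WithLp.toLp 2 (WithLp.ofLp a ⨯₃ WithLp.ofLp b)

/-! ## The unit sphere and the bundle of second order contact elements -/

/-- The unit sphere `S` of `ℝ³`. -/
abbrev S2 : Type := Metric.sphere (0 : E3) 1

/-- The vector `e₃`. -/
def e3 : E3 := !₂[0, 0, 1]

/-- The total space of the bundle `Q → S`, whose fibre over `s` consists of the traceless symmetric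
endomorphisms `q` of the tangent plane `T_s S = s^⊥`. Here `q` is represented by its extension to
`ℝ³` that vanishes on the normal line `ℝ s`; the extension has the same trace, and it is symmetric
if and only if it maps into `s^⊥` and `q` is symmetric. -/
def Q : Type :=
  {p : S2 × (E3 →L[ℝ] E3) //
    (p.2 : E3 →ₗ[ℝ] E3).IsSymmetric ∧ p.2 (p.1 : E3) = 0 ∧
      LinearMap.trace ℝ E3 (p.2 : E3 →ₗ[ℝ] E3) = 0}

instance : TopologicalSpace Q := inferInstanceAs (TopologicalSpace (Subtype _))

/-- The projection `π : Q → S`. -/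
def Q.base (p : Q) : S2 := p.1.1

/-- The endomorphism belonging to a point of `Q`. -/
def Q.endo (p : Q) : E3 →L[ℝ] E3 := p.1.2

/-- The zero section of `Q`. -/
def zeroSection : Set Q := {p | p.endo = 0}

/-- The holomorphic coordinate `u` on `S ∖ {-e₃}`; it is the inverse of
`u ↦ (1 + |u|²)⁻¹ (-2 Re u, -2 Im u, 1 - |u|²)`. -/
def coordU (s : E3) : ℂ := -((s 0 : ℂ) + Complex.I * (s 1 : ℂ)) / (1 + (s 2 : ℂ))

/-- The holomorphic coordinate `v = 1 / u` on `S ∖ {e₃}`, with `v (-e₃) = 0`. -/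
def coordV (s : E3) : ℂ := -((s 0 : ℂ) - Complex.I * (s 1 : ℂ)) / (1 - (s 2 : ℂ))

/-- The real part of a vector of `ℂ³`. -/
def reVec (w : Fin 3 → ℂ) : E3 := WithLp.toLp 2 fun i => (w i).re

/-- The imaginary part of a vector of `ℂ³`. -/
def imVec (w : Fin 3 → ℂ) : E3 := WithLp.toLp 2 fun i => (w i).im

/-- The isotropic vector `(1 - u², i (1 + u²), 2 u)` of `ℂ³`. Its real and imaginary parts are
orthogonal, of equal length, and span the tangent plane of `S` at the point with coordinate `u`. -/
def isoU (u : ℂ) : Fin 3 → ℂ := ![1 - u ^ 2, Complex.I * (1 + u ^ 2), 2 * u]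

/-- The isotropic vector `(v² - 1, i (v² + 1), 2 v)`, which is `u⁻² • isoU u` for `v = 1 / u`. -/
def isoV (v : ℂ) : Fin 3 → ℂ := ![v ^ 2 - 1, Complex.I * (v ^ 2 + 1), 2 * v]

/-- For a traceless symmetric endomorphism `A` of the plane spanned by the orthogonal vectors
`x = Re w`, `y = Im w` of equal length, the number `⟨A x, x⟩ + i ⟨A x, y⟩`. It equals one half of
the value at `(w, w)` of the complex bilinear extension of `⟨A ·, ·⟩`. -/
def fibreCoord (A : E3 →L[ℝ] E3) (w : Fin 3 → ℂ) : ℂ :=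
  ((inner ℝ (A (reVec w)) (reVec w) : ℝ) : ℂ) +
    Complex.I * ((inner ℝ (A (reVec w)) (imVec w) : ℝ) : ℂ)

/-- The base coordinate `u` of a point of `Q` not above `-e₃`. -/
def Q.u (p : Q) : ℂ := coordU (p.base : E3)

/-- The linear fibre coordinate `q` over `S ∖ {-e₃}`. It is normalized so that
`q⁻¹ ds = Re (-(2 / q) (1 - u², i (1 + u²), 2 u) du)`; at `e₃` the endomorphism with matrix
`(a, b; b, -a)` has `q = a + i b`. -/
def Q.q (p : Q) : ℂ := fibreCoord p.endo (isoU p.u)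

/-- The base coordinate `v` of a point of `Q` not above `e₃`. -/
def Q.v (p : Q) : ℂ := coordV (p.base : E3)

/-- The linear fibre coordinate `r` over `S ∖ {e₃}`, related to `q` by `r = u⁻⁴ q`. -/
def Q.r (p : Q) : ℂ := fibreCoord p.endo (isoV p.v)

/-! ## Holomorphic maps from a Riemann surface -/

section Holomorphic

variable {D : Type*} [TopologicalSpace D] [ChartedSpace ℂ D]

/-- The complex function `g` on the Riemann surface `D` is holomorphic near `p`. -/
def HolAt (g : D → ℂ) (p : D) : Prop :=
  AnalyticAt ℂ (g ∘ (chartAt ℂ p).symm) (chartAt ℂ p p)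

/-- The order of vanishing at `p` of the holomorphic function `g`
(equal to `⊤` if `g` vanishes identically near `p`). -/
def ordAt (g : D → ℂ) (p : D) : ℕ∞ :=
  analyticOrderAt (g ∘ (chartAt ℂ p).symm) (chartAt ℂ p p)

/-- Holomorphic maps from a Riemann surface to `Q`, where the complex structure of `Q` is the one
with holomorphic coordinate systems `(u, q)` and `(v, r)`. -/
def HolomorphicToQ (N : D → Q) : Prop :=
  Continuous N ∧ ∀ p : D,
    (((N p).base : E3) ≠ -e3 → HolAt (fun x => (N x).u) p ∧ HolAt (fun x => (N x).q) p) ∧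
    (((N p).base : E3) ≠ e3 → HolAt (fun x => (N x).v) p ∧ HolAt (fun x => (N x).r) p)

open Classical in
/-- The local mapping degree at `p` of a holomorphic map `G : D → S`. -/
def localDegree (G : D → S2) (p : D) : ℕ∞ :=
  if (G p : E3) ≠ -e3 then ordAt (fun x => coordU (G x : E3) - coordU (G p : E3)) p
  else ordAt (fun x => coordV (G x : E3) - coordV (G p : E3)) p

/-- The holomorphic map `G : D → S` has mapping degree `d`: every fibre is finite and has `d`
points, counted with multiplicity. -/
def HasDegree (G : D → S2) (d : ℕ) : Prop :=
  ∀ s : S2, {p | G p = s}.Finite ∧ ∑ᶠ p ∈ {p | G p = s}, localDegree G p = (d : ℕ∞)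

open Classical in
/-- The intersection number at `p` of the parametrized curve `N : D → Q` with the zero section: the
order of vanishing at `p` of the fibre coordinate. -/
def zeroOrder (N : D → Q) (p : D) : ℕ∞ :=
  if ((N p).base : E3) ≠ -e3 then ordAt (fun x => (N x).q) p else ordAt (fun x => (N x).r) p

end Holomorphic

/-! ## Curves in `Q` and their intersection number with the zero section -/

/-- The part of `C` over `S ∖ {-e₃}`, in the coordinates `(u, q)`. -/
def affineU (C : Set Q) : Set (Fin 2 → ℂ) :=
  (fun p : Q => ![p.u, p.q]) '' {p | p ∈ C ∧ (p.base : E3) ≠ -e3}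

/-- The part of `C` over `S ∖ {e₃}`, in the coordinates `(v, r)`. -/
def affineV (C : Set Q) : Set (Fin 2 → ℂ) :=
  (fun p : Q => ![p.v, p.r]) '' {p | p ∈ C ∧ (p.base : E3) ≠ e3}

/-- The set `C` is algebraic in both trivializations of `Q`. -/
def IsAlgebraic (C : Set Q) : Prop :=
  MvPolynomial.zeroLocus ℂ (MvPolynomial.vanishingIdeal ℂ (affineU C)) = affineU C ∧
  MvPolynomial.zeroLocus ℂ (MvPolynomial.vanishingIdeal ℂ (affineV C)) = affineV C

/-- The local intersection number at `x ∈ ℂ²` of the plane algebraic curve `Z` with the axis on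
which the second coordinate vanishes: the length of the local ring of `ℂ²` at `x` modulo the ideal
of `Z` and the second coordinate. -/
def localIntersection (Z : Set (Fin 2 → ℂ)) (x : Fin 2 → ℂ) : ℕ∞ :=
  Module.length (Localization.AtPrime (MvPolynomial.vanishingIdeal ℂ {x}))
    (Localization.AtPrime (MvPolynomial.vanishingIdeal ℂ {x}) ⧸
      (MvPolynomial.vanishingIdeal ℂ Z ⊔ Ideal.span {(MvPolynomial.X 1 : MvPolynomial (Fin 2) ℂ)}).map
        (algebraMap (MvPolynomial (Fin 2) ℂ)
          (Localization.AtPrime (MvPolynomial.vanishingIdeal ℂ {x}))))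

/-- The intersection number of the algebraic curve `C` in `Q` with the zero section: the sum of the
local intersection numbers at the points of the zero section with coordinate `u ∈ ℂ`, and at the
remaining point `(-e₃, 0)`. -/
def intersectionZeroSection (C : Set Q) : ℕ∞ :=
  (∑ᶠ u : ℂ, localIntersection (affineU C) ![u, 0]) + localIntersection (affineV C) ![0, 0]

/-! ## Minimal surfaces of finite topological type, modulo periods -/

section Surface

variable {D : Type*} [TopologicalSpace D] [ChartedSpace ℂ D]

/-- The differential at the point `y`, in the chart of `D` around `c`, of the branch `ε y` near `y`
of a multi-valued map. -/
def dMap (ε : D → D → E3) (c y : D) : ℂ →L[ℝ] E3 :=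
  fderiv ℝ (ε y ∘ (chartAt ℂ c).symm) (chartAt ℂ c y)

/-- The unit normal at `x`. For a conformal immersion this is the orientation of the surface for
which the Gauss map of a minimal surface is holomorphic into `S` with its coordinate `u`. -/
def normal (ε : D → D → E3) (x : D) : E3 :=
  -(‖cross (dMap ε x x 1) (dMap ε x x Complex.I)‖⁻¹ •
    cross (dMap ε x x 1) (dMap ε x x Complex.I))

/-- The differential at `x` of the unit normal, in the chart of `D` around `x`. -/
def dNormal (ε : D → D → E3) (x : D) : ℂ →L[ℝ] E3 :=
  fderiv ℝ (normal ε ∘ (chartAt ℂ x).symm) (chartAt ℂ x x)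

/-- The derivative `n'(x)` of the Gauss map of a conformal immersion as an endomorphism of the
tangent plane, extended by zero on the normal line. It sends `dε (v)` to `dn (v)`; the vectors
`dε (1)`, `dε (i)` form an orthogonal basis of the tangent plane. -/
def shape (ε : D → D → E3) (x : D) : E3 →L[ℝ] E3 :=
  (‖dMap ε x x 1‖ ^ 2)⁻¹ • (innerSL ℝ (dMap ε x x 1)).smulRight (dNormal ε x 1) +
  (‖dMap ε x x Complex.I‖ ^ 2)⁻¹ •
    (innerSL ℝ (dMap ε x x Complex.I)).smulRight (dNormal ε x Complex.I)

/-- The Gaussian curvature `K(x) = det n'(x)`. The endomorphism `shape ε x` preserves the tangent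
plane, and adding the orthogonal projection to the normal line turns its determinant on the tangent
plane into a determinant on `ℝ³`. -/
def gaussCurv (ε : D → D → E3) (x : D) : ℝ :=
  LinearMap.det ((shape ε x + (innerSL ℝ (normal ε x)).smulRight (normal ε x) : E3 →L[ℝ] E3) :
    E3 →ₗ[ℝ] E3)

/-- A multi-valued smooth conformal minimal immersion `ε : D ∖ D_∞ → ℝ³`, single-valued up to
translations. `ε x` is a branch near `x`; the branch at a nearby point is locally obtained from it
by a translation, so the normal and its derivative are single-valued on `D ∖ D_∞`. The values on
`D_∞` and away from small neighbourhoods are irrelevant. Modulo the group of periods this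
is the surface `M / 𝓟`, parametrized by `D ∖ D_∞`. -/
structure IsMinimalImmersion (Dinf : Finset D) (ε : D → D → E3) : Prop where
  smooth : ∀ x ∉ Dinf, ContDiffAt ℝ ∞ (ε x ∘ (chartAt ℂ x).symm) (chartAt ℂ x x)
  continuation : ∀ x ∉ Dinf, ∀ᶠ y in 𝓝 x, ∃ p : E3, ∀ᶠ z in 𝓝 y, ε y z = ε x z + p
  immersion : ∀ x ∉ Dinf, Function.Injective (dMap ε x x)
  conformal : ∀ x ∉ Dinf, ‖dMap ε x x 1‖ = ‖dMap ε x x Complex.I‖ ∧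
    inner ℝ (dMap ε x x 1) (dMap ε x x Complex.I) = 0
  minimal : ∀ x ∉ Dinf, LinearMap.trace ℝ E3 (shape ε x : E3 →ₗ[ℝ] E3) = 0

/-- The surface is not flat: the curvature does not vanish identically. -/
def NonFlat (Dinf : Finset D) (ε : D → D → E3) : Prop := ∃ x ∉ Dinf, shape ε x ≠ 0

/-- The finite flat points: the points of the surface at which `n'` vanishes. -/
def flatPoints (Dinf : Finset D) (ε : D → D → E3) : Set D := {x | x ∉ Dinf ∧ shape ε x = 0}

section Area

variable [CompactSpace D] [Nonempty D]

/-- Countably many chart domains cover `D`. -/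
theorem exists_chart_cover (D : Type*) [TopologicalSpace D] [ChartedSpace ℂ D] [CompactSpace D]
    [Nonempty D] : ∃ c : ℕ → D, ⋃ i, (chartAt ℂ (c i)).source = univ := by
  obtain ⟨s, hs, hU⟩ := countable_cover_nhds_of_sigmaCompact
    (fun x : D => (chartAt ℂ x).open_source.mem_nhds (mem_chart_source ℂ x))
  have hne : s.Nonempty := by
    by_contra h
    rw [not_nonempty_iff_eq_empty] at h
    subst h
    simp only [mem_empty_iff_false, iUnion_of_empty, iUnion_empty] at hU
    exact absurd hU.symm (univ_nonempty (α := D)).ne_empty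
  obtain ⟨c, rfl⟩ := hs.exists_eq_range hne
  exact ⟨c, by simpa [biUnion_range] using hU⟩

/-- Centres of countably many charts covering `D`. -/
def chartCenter (D : Type*) [TopologicalSpace D] [ChartedSpace ℂ D] [CompactSpace D]
    [Nonempty D] : ℕ → D := Classical.choose (exists_chart_cover D)

/-- Pairwise disjoint Borel sets that cover `D`, the `i`-th one inside the `i`-th chart domain. -/
def chartPiece (D : Type*) [TopologicalSpace D] [ChartedSpace ℂ D] [CompactSpace D]
    [Nonempty D] : ℕ → Set D := disjointed fun i => (chartAt ℂ (chartCenter D i)).source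

/-- The Euclidean area measure of the immersed surface, as a measure on `D` (the finite set `D_∞`
has measure zero). In a chart it is `‖∂₁ε × ∂₂ε‖ dx dy`; it does not depend on the charts used. -/
def areaMeasure [MeasurableSpace D] (Dinf : Finset D) (ε : D → D → E3) : Measure D :=
  Measure.sum fun i =>
    ((volume.restrict ((chartAt ℂ (chartCenter D i)).target ∩
        (chartAt ℂ (chartCenter D i)).symm ⁻¹' (chartPiece D i \ (Dinf : Set D)))).withDensity
      fun z => ENNReal.ofReal
        ‖cross (dMap ε (chartCenter D i) ((chartAt ℂ (chartCenter D i)).symm z) 1)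
          (dMap ε (chartCenter D i) ((chartAt ℂ (chartCenter D i)).symm z) Complex.I)‖).map
      (chartAt ℂ (chartCenter D i)).symm

/-- The end `e` is a flat point at infinity: the total curvature of a neighbourhood of the end is
finite, and every `C¹` curve in the punctured neighbourhood that converges to `e` is mapped to a
curve of infinite Euclidean length. -/
def IsFlatPointAtInfinity [MeasurableSpace D] (Dinf : Finset D) (ε : D → D → E3) (e : D) : Prop :=
  IntegrableAtFilter (gaussCurv ε) (𝓝 e) (areaMeasure Dinf ε) ∧
  ∀ γ : ℝ → ℂ, ContDiffOn ℝ 1 γ (Ici 0) →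
    (∀ t ∈ Ici (0 : ℝ), γ t ∈ (chartAt ℂ e).target ∧ (chartAt ℂ e).symm (γ t) ∉ Dinf) →
    Tendsto γ atTop (𝓝 (chartAt ℂ e e)) →
    ∫⁻ t in Ici (0 : ℝ),
      ‖dMap ε e ((chartAt ℂ e).symm (γ t)) (derivWithin γ (Ici 0) t)‖ₑ = ⊤

end Area

end Surface

end MinSurf

end

open Set Filter Topology MeasureTheory
open scoped Manifold ContDiff Matrix

noncomputable section

namespace MinSurf

/-! ## The sphere and its two coordinates -/

/-! The derivative of the Gauss map is the holomorphic data of the surface, and all the counts come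
from the fact that the fibre coordinates of `Q` satisfy `q = u⁴ r`, so that a holomorphic map `N` to
`Q` is a section of a line bundle of degree `4 d` along the map `π ∘ N` of degree `d`.

Local theory. A conformal minimal immersion `g` is harmonic (`IsMin.laplace`), hence `∂₁g - i ∂₂g`
is holomorphic and isotropic, and it equals `F · (1 - u², i(1 + u²), 2u)` with `u` the coordinate of
the Gauss map and `F` holomorphic (`IsConf.isoVec_eq`). This gives `q = -2 u' / F`
(`IsMin.fibreCoord_isoU`), so `n'` is holomorphic, and `K dA = -4 |u'|² / (1 + |u|²)² dx dy`
(`IsMin.det_mul`): the curvature form is minus the pulled back area form of the sphere. These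
formulas exclude the pole `-e₃`. The rotation `flip` exchanges the two poles and the coordinate
systems `(u, q)` and `(v, r)`, and settles the remaining case throughout.

Ends. Finite total curvature means that the Gauss map has finite spherical area near the puncture. A
small punctured disc then has so little area that two values are omitted, and arbitrarily small
circles have short images (the Courant–Lebesgue argument). A Möbius transformation turns the map
into a function bounded on such circles, and the maximum principle together with the removable
singularity theorem gives a limit (`exists_tendsto_of_finite_area`). After a rotation `u` is bounded
near the end, so completeness of the surface is completeness of the flat metric `|F| |dz|`.
Developing this metric into the plane and applying Cauchy's estimate to the inverse of the
developing map bounds `1/F`; completeness then forces `1/F → 0` (`tendsto_inv_of_flatComplete`).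
Hence `q = -2 u' / F → 0`, and `N` extends by zero.

Degree and zeros. Numbers of preimages, with multiplicity, are locally constant on the sphere, which
is connected; this defines `d`. For a section the norm `P(U, X) = ∏ (X - q(x))`, over the points `x`
above `U`, has coefficients that are entire after removal of singularities and of polynomial growth,
hence polynomials. The order of `p(U) = P(U, 0)` at `a` is the number of zeros of the section above
`a`, and the norm `p'` of `r` satisfies `p'(V) = V^(4d) p(1/V)`. So `deg p + ord₀ p' = 4 d`
(`IsSection.rootMultiplicity_total`), and this is the number of all zeros.

Image curve. The relations between `u` and `q` form a prime ideal generated by one monic polynomial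
`P₀`, and `P = P₀ ^ m`, where `m` is the number of sheets. The local intersection number with the
zero section at `(a, 0)` is the order of `P₀(·, 0)` at `a` (`IsEquation.localIntersection_eq`), so
`m` times the intersection number is again `deg p + ord₀ p' = 4 d`.

Total curvature. By the area formula on pieces where the Gauss map is injective, `-∫ K dA` is the
area `4π` of the sphere, counted `d` times (`IsMinimalImmersion.lintegral_neg_gaussCurv`). -/

theorem sphere_sq (s : S2) : (s : E3) 0 ^ 2 + (s : E3) 1 ^ 2 + (s : E3) 2 ^ 2 = 1 := by
  have h : ‖(s : E3)‖ = 1 := by simp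
  have := EuclideanSpace.norm_sq_eq (s : E3)
  rw [h, Fin.sum_univ_three] at this
  simpa using this.symm

theorem ext3 {a b : E3} (h0 : a 0 = b 0) (h1 : a 1 = b 1) (h2 : a 2 = b 2) : a = b := by
  ext i; fin_cases i <;> assumption

@[simp] theorem e3_zero : e3 0 = 0 := by simp [e3]
@[simp] theorem e3_one : e3 1 = 0 := by simp [e3]
@[simp] theorem e3_two : e3 2 = 1 := by simp [e3]

theorem ne_neg_e3_iff (s : S2) : (s : E3) ≠ -e3 ↔ (s : E3) 2 ≠ -1 := by
  rw [not_iff_not]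
  constructor
  · intro h; rw [h]; simp
  · intro h
    have := sphere_sq s
    rw [h] at this
    have h0 : (s : E3) 0 = 0 := by nlinarith [sq_nonneg ((s : E3) 0), sq_nonneg ((s : E3) 1)]
    have h1 : (s : E3) 1 = 0 := by nlinarith [sq_nonneg ((s : E3) 0), sq_nonneg ((s : E3) 1)]
    apply ext3 <;> simp [h0, h1, h]

theorem ne_e3_iff (s : S2) : (s : E3) ≠ e3 ↔ (s : E3) 2 ≠ 1 := by
  rw [not_iff_not]
  constructor
  · intro h; rw [h]; simp
  · intro h
    have := sphere_sq s
    rw [h] at this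
    have h0 : (s : E3) 0 = 0 := by nlinarith [sq_nonneg ((s : E3) 0), sq_nonneg ((s : E3) 1)]
    have h1 : (s : E3) 1 = 0 := by nlinarith [sq_nonneg ((s : E3) 0), sq_nonneg ((s : E3) 1)]
    apply ext3 <;> simp [h0, h1, h]

theorem neg_e3_ne_e3 : -e3 ≠ e3 := by
  intro h
  have := congrArg (fun v : E3 => v 2) h
  norm_num at this

theorem norm_e3 : ‖e3‖ = 1 := by
  rw [EuclideanSpace.norm_eq, Fin.sum_univ_three]; simp

/-- The pole `-e₃` of the sphere. -/
def south : S2 := ⟨-e3, by simp [norm_e3]⟩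

/-- The pole `e₃` of the sphere. -/
def north : S2 := ⟨e3, by simp [norm_e3]⟩

theorem ne_south_iff (s : S2) : s ≠ south ↔ (s : E3) ≠ -e3 := by
  rw [ne_eq, Subtype.ext_iff]; rfl

theorem ne_north_iff (s : S2) : s ≠ north ↔ (s : E3) ≠ e3 := by
  rw [ne_eq, Subtype.ext_iff]; rfl

theorem sphere_mul_conj (s : S2) :
    -(((s : E3) 0 : ℂ) + Complex.I * ((s : E3) 1 : ℂ)) *
      -(((s : E3) 0 : ℂ) - Complex.I * ((s : E3) 1 : ℂ)) =
      (1 + ((s : E3) 2 : ℂ)) * (1 - ((s : E3) 2 : ℂ)) := by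
  have h := sphere_sq s
  have h' : (((s : E3) 0 : ℂ)) ^ 2 + ((s : E3) 1 : ℂ) ^ 2 + ((s : E3) 2 : ℂ) ^ 2 = 1 := by
    have := congrArg Complex.ofReal h
    push_cast at this; exact this
  linear_combination h' - ((s : E3) 1 : ℂ) ^ 2 * Complex.I_sq

theorem one_add_ne_zero {s : S2} (h : (s : E3) ≠ -e3) : (1 + ((s : E3) 2 : ℂ)) ≠ 0 := by
  rw [ne_neg_e3_iff] at h
  intro h'
  apply h
  have : (((1 + (s : E3) 2 : ℝ)) : ℂ) = 0 := by push_cast; exact h'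
  have := Complex.ofReal_eq_zero.1 this
  linarith

theorem one_sub_ne_zero {s : S2} (h : (s : E3) ≠ e3) : (1 - ((s : E3) 2 : ℂ)) ≠ 0 := by
  rw [ne_e3_iff] at h
  intro h'
  apply h
  have : (((1 - (s : E3) 2 : ℝ)) : ℂ) = 0 := by push_cast; exact h'
  have := Complex.ofReal_eq_zero.1 this
  linarith

@[simp] theorem coordU_north : coordU e3 = 0 := by simp [coordU]
@[simp] theorem coordV_south : coordV (-e3) = 0 := by simp [coordV]
@[simp] theorem coordV_north : coordV e3 = 0 := by simp [coordV]
@[simp] theorem coordU_south : coordU (-e3) = 0 := by simp [coordU]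

theorem coordU_mul_coordV {s : S2} (h : (s : E3) ≠ -e3) (h' : (s : E3) ≠ e3) :
    coordU s * coordV s = 1 := by
  have h1 := one_add_ne_zero h
  have h2 := one_sub_ne_zero h'
  rw [coordU, coordV, div_mul_div_comm, sphere_mul_conj, div_self (mul_ne_zero h1 h2)]

theorem coordU_eq_inv (s : S2) : coordU s = (coordV s)⁻¹ := by
  by_cases h : (s : E3) = -e3
  · simp [h]
  by_cases h' : (s : E3) = e3
  · simp [h']
  exact eq_inv_of_mul_eq_one_left (coordU_mul_coordV h h')

theorem coordV_eq_inv (s : S2) : coordV s = (coordU s)⁻¹ := by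
  rw [coordU_eq_inv, inv_inv]

/-- The inverse of the coordinate `u`, as a vector. -/
def sphVec (u : ℂ) : E3 :=
  !₂[-2 * u.re / (1 + Complex.normSq u), -2 * u.im / (1 + Complex.normSq u),
    (1 - Complex.normSq u) / (1 + Complex.normSq u)]

theorem one_add_normSq_pos (u : ℂ) : 0 < 1 + Complex.normSq u := by
  have := Complex.normSq_nonneg u; linarith

theorem norm_sphVec (u : ℂ) : ‖sphVec u‖ = 1 := by
  have h := one_add_normSq_pos u
  have h2 := Complex.normSq_apply u
  rw [EuclideanSpace.norm_eq, Real.sqrt_eq_one, Fin.sum_univ_three]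
  simp only [sphVec, Real.norm_eq_abs, sq_abs]
  simp
  field_simp
  rw [h2]; ring

/-- The inverse of the coordinate `u`. -/
def sph (u : ℂ) : S2 := ⟨sphVec u, by simp [norm_sphVec]⟩

theorem continuous_sph : Continuous sph := by
  apply Continuous.subtype_mk
  apply (PiLp.continuous_toLp 2 _).comp
  have h : ∀ u : ℂ, 1 + Complex.normSq u ≠ 0 := fun u => (one_add_normSq_pos u).ne'
  refine continuous_pi fun i => ?_
  fin_cases i
  · exact ((continuous_const.mul Complex.continuous_re).div
      (continuous_const.add Complex.continuous_normSq) h)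
  · exact ((continuous_const.mul Complex.continuous_im).div
      (continuous_const.add Complex.continuous_normSq) h)
  · exact ((continuous_const.sub Complex.continuous_normSq).div
      (continuous_const.add Complex.continuous_normSq) h)

theorem sph_two (u : ℂ) :
    (sph u : E3) 2 = (1 - Complex.normSq u) / (1 + Complex.normSq u) := by simp [sph, sphVec]

theorem sph_ne_south (u : ℂ) : (sph u : E3) ≠ -e3 := by
  rw [ne_neg_e3_iff, sph_two]
  have h := one_add_normSq_pos u
  intro h'
  rw [div_eq_iff h.ne'] at h'
  linarith

theorem coordU_sph (u : ℂ) : coordU (sph u) = u := by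
  have h := one_add_normSq_pos u
  have hc : (1 + (Complex.normSq u : ℂ)) ≠ 0 := by exact_mod_cast h.ne'
  have h1 := one_add_ne_zero (sph_ne_south u)
  rw [coordU, div_eq_iff h1]
  simp only [sph, sphVec]
  simp
  field_simp
  linear_combination (2 : ℂ) * Complex.re_add_im u

theorem sph_coordU {s : S2} (h : (s : E3) ≠ -e3) : sph (coordU s) = s := by
  have h1 : 1 + (s : E3) 2 ≠ 0 := by
    rw [ne_neg_e3_iff] at h; intro h'; apply h; linarith
  have hs := sphere_sq s
  have hre : (coordU s).re = -(s : E3) 0 / (1 + (s : E3) 2) := by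
    have : coordU s = ((-(s : E3) 0 / (1 + (s : E3) 2) : ℝ) : ℂ) +
        ((-(s : E3) 1 / (1 + (s : E3) 2) : ℝ) : ℂ) * Complex.I := by
      rw [coordU]; push_cast; ring
    rw [this, Complex.add_re, Complex.ofReal_re, Complex.re_ofReal_mul]; simp
  have him : (coordU s).im = -(s : E3) 1 / (1 + (s : E3) 2) := by
    have : coordU s = ((-(s : E3) 0 / (1 + (s : E3) 2) : ℝ) : ℂ) +
        ((-(s : E3) 1 / (1 + (s : E3) 2) : ℝ) : ℂ) * Complex.I := by
      rw [coordU]; push_cast; ring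
    rw [this, Complex.add_im, Complex.ofReal_im, Complex.im_ofReal_mul]; simp
  have hn : 1 + Complex.normSq (coordU s) = 2 / (1 + (s : E3) 2) := by
    rw [Complex.normSq_apply, hre, him]; field_simp; linear_combination hs
  have hn' : 1 - Complex.normSq (coordU s) = 2 * (s : E3) 2 / (1 + (s : E3) 2) := by
    have : 1 - Complex.normSq (coordU s) = 2 - (1 + Complex.normSq (coordU s)) := by ring
    rw [this, hn]; field_simp; ring
  apply Subtype.ext
  apply ext3
  · simp only [sph, sphVec]; simp; rw [hn, hre]; field_simp
  · simp only [sph, sphVec]; simp; rw [hn, him]; field_simp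
  · simp only [sph, sphVec]; simp; rw [hn, hn']; field_simp

theorem coordU_injOn : InjOn (fun s : S2 => coordU s) {s | (s : E3) ≠ -e3} := by
  intro a ha b hb h
  rw [← sph_coordU ha, ← sph_coordU hb]; exact congrArg sph h

theorem coordV_injOn : InjOn (fun s : S2 => coordV s) {s | (s : E3) ≠ e3} := by
  intro a ha b hb h
  simp only at h
  by_cases h1 : (a : E3) = -e3
  · by_contra hab
    have hb1 : (b : E3) ≠ -e3 := fun hb1 => hab (Subtype.ext (h1.trans hb1.symm))
    have := coordU_mul_coordV hb1 hb
    rw [← h, h1] at this; simp at this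
  by_cases h2 : (b : E3) = -e3
  · have := coordU_mul_coordV h1 ha
    rw [h, h2] at this; simp at this
  apply coordU_injOn h1 h2
  simp only [coordU_eq_inv, h]

theorem continuous_coord (i : Fin 3) : Continuous fun s : E3 => s i := by
  exact (continuous_apply i).comp (PiLp.continuous_ofLp 2 _)

theorem continuousAt_coordU {s : S2} (h : (s : E3) ≠ -e3) : ContinuousAt coordU (s : E3) := by
  have h1 := one_add_ne_zero h
  unfold coordU
  refine ContinuousAt.div ?_ ?_ h1
  · exact (((Complex.continuous_ofReal.comp (continuous_coord 0)).add
      (continuous_const.mul (Complex.continuous_ofReal.comp (continuous_coord 1)))).neg).continuousAt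
  · exact (continuous_const.add (Complex.continuous_ofReal.comp (continuous_coord 2))).continuousAt

theorem continuousAt_coordV {s : S2} (h : (s : E3) ≠ e3) : ContinuousAt coordV (s : E3) := by
  have h1 := one_sub_ne_zero h
  unfold coordV
  refine ContinuousAt.div ?_ ?_ h1
  · exact (((Complex.continuous_ofReal.comp (continuous_coord 0)).sub
      (continuous_const.mul (Complex.continuous_ofReal.comp (continuous_coord 1)))).neg).continuousAt
  · exact (continuous_const.sub (Complex.continuous_ofReal.comp (continuous_coord 2))).continuousAt

/-- Rotation by the angle `π` about the first axis. -/
def flip : E3 ≃ₗᵢ[ℝ] E3 :=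
  LinearIsometryEquiv.piLpCongrRight 2
    ![LinearIsometryEquiv.refl ℝ ℝ, LinearIsometryEquiv.neg ℝ, LinearIsometryEquiv.neg ℝ]

@[simp] theorem flip_zero (a : E3) : flip a 0 = a 0 := by simp [flip]
@[simp] theorem flip_one (a : E3) : flip a 1 = -a 1 := by simp [flip]
@[simp] theorem flip_two (a : E3) : flip a 2 = -a 2 := by simp [flip]

@[simp] theorem flip_flip (a : E3) : flip (flip a) = a := by apply ext3 <;> simp

theorem flip_e3 : flip e3 = -e3 := by apply ext3 <;> simp

theorem flip_eq_neg_e3 {a : E3} : flip a = -e3 ↔ a = e3 := by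
  rw [← flip_e3]; exact flip.injective.eq_iff

theorem flip_eq_e3 {a : E3} : flip a = e3 ↔ a = -e3 := by
  have : flip (-e3) = e3 := by rw [map_neg, flip_e3, neg_neg]
  constructor
  · intro h; rw [← flip_flip a, h, flip_e3]
  · rintro rfl; exact this

/-- This is the purpose of `flip`: it exchanges the poles and the coordinates `u` and `v`, so that a
statement proved away from `-e₃` also yields its counterpart away from `e₃`. -/
theorem coordU_flip (a : E3) : coordU (flip a) = coordV a := by
  simp [coordU, coordV, sub_eq_add_neg]

theorem coordV_flip (a : E3) : coordV (flip a) = coordU a := by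
  simp [coordU, coordV, sub_eq_add_neg]

theorem cross_flip (a b : E3) : cross (flip a) (flip b) = flip (cross a b) := by
  apply ext3 <;> simp [cross, cross_apply] <;> ring

/-! ## Charts, orders and the identity theorem on a Riemann surface -/

section Charts

variable {D : Type*} [TopologicalSpace D] [ChartedSpace ℂ D]

theorem transition_analyticAt [IsManifold 𝓘(ℂ, ℂ) ω D] {p q y : D}
    (hp : y ∈ (chartAt ℂ p).source) (hq : y ∈ (chartAt ℂ q).source) :
    AnalyticAt ℂ (chartAt ℂ q ∘ (chartAt ℂ p).symm) (chartAt ℂ p y) := by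
  have h := (contDiffGroupoid ω 𝓘(ℂ, ℂ)).compatible (chart_mem_atlas ℂ p) (chart_mem_atlas ℂ q)
  have h1 : ContDiffOn ℂ ω ((chartAt ℂ p).symm ≫ₕ chartAt ℂ q)
      ((chartAt ℂ p).symm ≫ₕ chartAt ℂ q).source := by
    rw [contDiffGroupoid, mem_groupoid_of_pregroupoid] at h
    simpa [contDiffPregroupoid] using h.1
  have hmem : chartAt ℂ p y ∈ ((chartAt ℂ p).symm ≫ₕ chartAt ℂ q).source := by
    simp [(chartAt ℂ p).left_inv hp, hq, (chartAt ℂ p).map_source hp]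
  have := (h1 _ hmem).contDiffAt (((chartAt ℂ p).symm ≫ₕ chartAt ℂ q).open_source.mem_nhds hmem)
  exact this.analyticAt

theorem transition_deriv_mul [IsManifold 𝓘(ℂ, ℂ) ω D] {p q y : D}
    (hp : y ∈ (chartAt ℂ p).source) (hq : y ∈ (chartAt ℂ q).source) :
    deriv (chartAt ℂ p ∘ (chartAt ℂ q).symm) (chartAt ℂ q y) *
      deriv (chartAt ℂ q ∘ (chartAt ℂ p).symm) (chartAt ℂ p y) = 1 := by
  have h1 := (transition_analyticAt hp hq).differentiableAt.hasDerivAt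
  have h2 := (transition_analyticAt hq hp).differentiableAt.hasDerivAt
  have e1 : (chartAt ℂ q ∘ (chartAt ℂ p).symm) (chartAt ℂ p y) = chartAt ℂ q y := by
    simp [(chartAt ℂ p).left_inv hp]
  rw [← e1] at h2
  have h3 := h2.comp _ h1
  rw [e1] at h3
  refine h3.unique ?_
  refine (hasDerivAt_id _).congr_of_eventuallyEq ?_
  have hc : ContinuousAt (chartAt ℂ p).symm (chartAt ℂ p y) :=
    (chartAt ℂ p).continuousAt_symm ((chartAt ℂ p).map_source hp)
  have : ∀ᶠ z in 𝓝 (chartAt ℂ p y), (chartAt ℂ p).symm z ∈ (chartAt ℂ q).source := by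
    apply hc
    rw [(chartAt ℂ p).left_inv hp]
    exact (chartAt ℂ q).open_source.mem_nhds hq
  filter_upwards [this, (chartAt ℂ p).open_target.mem_nhds ((chartAt ℂ p).map_source hp)]
    with z hz hz'
  simp [(chartAt ℂ q).left_inv hz, (chartAt ℂ p).right_inv hz']

theorem transition_deriv_ne_zero [IsManifold 𝓘(ℂ, ℂ) ω D] {p q y : D}
    (hp : y ∈ (chartAt ℂ p).source) (hq : y ∈ (chartAt ℂ q).source) :
    deriv (chartAt ℂ q ∘ (chartAt ℂ p).symm) (chartAt ℂ p y) ≠ 0 :=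
  right_ne_zero_of_mul_eq_one (transition_deriv_mul hp hq)

theorem chart_change_eventuallyEq {β : Type*} (g : D → β) {p q y : D}
    (hp : y ∈ (chartAt ℂ p).source) (hq : y ∈ (chartAt ℂ q).source) :
    g ∘ (chartAt ℂ p).symm =ᶠ[𝓝 (chartAt ℂ p y)]
      (g ∘ (chartAt ℂ q).symm) ∘ (chartAt ℂ q ∘ (chartAt ℂ p).symm) := by
  have hc : ContinuousAt (chartAt ℂ p).symm (chartAt ℂ p y) :=
    (chartAt ℂ p).continuousAt_symm ((chartAt ℂ p).map_source hp)
  have : ∀ᶠ z in 𝓝 (chartAt ℂ p y), (chartAt ℂ p).symm z ∈ (chartAt ℂ q).source := by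
    apply hc
    rw [(chartAt ℂ p).left_inv hp]
    exact (chartAt ℂ q).open_source.mem_nhds hq
  filter_upwards [this] with z hz
  simp [(chartAt ℂ q).left_inv hz]

/-- Transition maps are analytic with nonvanishing derivative, so analyticity can be tested in any
chart around the point and not only in the preferred one; the same reason makes the order of
vanishing independent of the chart. -/
theorem holAt_iff [IsManifold 𝓘(ℂ, ℂ) ω D] {g : D → ℂ} {p y : D}
    (hp : y ∈ (chartAt ℂ p).source) :
    HolAt g y ↔ AnalyticAt ℂ (g ∘ (chartAt ℂ p).symm) (chartAt ℂ p y) := by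
  have hy := mem_chart_source ℂ y
  rw [HolAt, analyticAt_congr (chart_change_eventuallyEq g hy hp),
    analyticAt_comp_iff_of_deriv_ne_zero (transition_analyticAt hy hp)
      (transition_deriv_ne_zero hy hp)]
  simp

theorem ordAt_eq [IsManifold 𝓘(ℂ, ℂ) ω D] {g : D → ℂ} {p y : D}
    (hp : y ∈ (chartAt ℂ p).source) :
    ordAt g y = analyticOrderAt (g ∘ (chartAt ℂ p).symm) (chartAt ℂ p y) := by
  have hy := mem_chart_source ℂ y
  rw [ordAt, analyticOrderAt_congr (chart_change_eventuallyEq g hy hp),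
    analyticOrderAt_comp_of_deriv_ne_zero (transition_analyticAt hy hp)
      (transition_deriv_ne_zero hy hp)]
  simp

theorem tendsto_chart_symm (p : D) : Tendsto (chartAt ℂ p).symm (𝓝 (chartAt ℂ p p)) (𝓝 p) :=
  (chartAt ℂ p).tendsto_symm (mem_chart_source ℂ p)

theorem eventually_chart {p : D} {P : D → Prop} :
    (∀ᶠ z in 𝓝 (chartAt ℂ p p), P ((chartAt ℂ p).symm z)) ↔ ∀ᶠ x in 𝓝 p, P x := by
  rw [← (chartAt ℂ p).symm_map_nhds_eq (mem_chart_source ℂ p), eventually_map]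

theorem eventually_chart_ne {p : D} {P : D → Prop} :
    (∀ᶠ z in 𝓝[≠] (chartAt ℂ p p), P ((chartAt ℂ p).symm z)) ↔ ∀ᶠ x in 𝓝[≠] p, P x := by
  have hs : ∀ᶠ x in 𝓝 p, x ∈ (chartAt ℂ p).source := chart_source_mem_nhds ℂ p
  rw [eventually_nhdsWithin_iff, eventually_nhdsWithin_iff, ← eventually_chart (p := p)]
  apply eventually_congr
  have := (chartAt ℂ p).open_target.mem_nhds (mem_chart_target ℂ p)
  filter_upwards [this] with z hz
  have : z = chartAt ℂ p p ↔ (chartAt ℂ p).symm z = p := by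
    constructor
    · rintro rfl; exact (chartAt ℂ p).left_inv (mem_chart_source ℂ p)
    · intro h
      have := congrArg (chartAt ℂ p) h
      rwa [(chartAt ℂ p).right_inv hz] at this
  simp only [mem_compl_iff, mem_singleton_iff, this]

theorem map_chart_symm_ne (p : D) :
    map (chartAt ℂ p).symm (𝓝[≠] (chartAt ℂ p p)) = 𝓝[≠] p := by
  ext s
  exact eventually_chart_ne (P := (· ∈ s))

instance nhdsNE_neBot (p : D) : (𝓝[≠] p).NeBot := by
  rw [← map_chart_symm_ne]; infer_instance

theorem HolAt.continuousAt {g : D → ℂ} {p : D} (h : HolAt g p) : ContinuousAt g p := by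
  have h1 : ContinuousAt (g ∘ (chartAt ℂ p).symm) (chartAt ℂ p p) := AnalyticAt.continuousAt h
  have h2 : ContinuousAt (chartAt ℂ p) p := (chartAt ℂ p).continuousAt (mem_chart_source ℂ p)
  refine (ContinuousAt.comp h1 h2).congr ?_
  filter_upwards [chart_source_mem_nhds ℂ p] with x hx
  simp [(chartAt ℂ p).left_inv hx]

/-- The function `g` is meromorphic at `p`; the value at `p` is irrelevant. -/
def MeroAt (g : D → ℂ) (p : D) : Prop :=
  MeromorphicAt (g ∘ (chartAt ℂ p).symm) (chartAt ℂ p p)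

theorem HolAt.meroAt {g : D → ℂ} {p : D} (h : HolAt g p) : MeroAt g p :=
  AnalyticAt.meromorphicAt h

theorem MeroAt.congr {f g : D → ℂ} {p : D} (h : MeroAt f p) (hfg : f =ᶠ[𝓝[≠] p] g) :
    MeroAt g p :=
  MeromorphicAt.congr h (eventually_chart_ne.2 hfg)

theorem HolAt.congr {f g : D → ℂ} {p : D} (h : HolAt f p) (hfg : f =ᶠ[𝓝 p] g) :
    HolAt g p :=
  AnalyticAt.congr h (eventually_chart.2 hfg)

theorem ordAt_congr {f g : D → ℂ} {p : D} (hfg : f =ᶠ[𝓝 p] g) : ordAt f p = ordAt g p :=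
  analyticOrderAt_congr (eventually_chart.2 hfg)

theorem ordAt_mul {f g : D → ℂ} {p : D} (hf : HolAt f p) (hg : HolAt g p) :
    ordAt (fun x => f x * g x) p = ordAt f p + ordAt g p :=
  analyticOrderAt_mul hf hg

theorem ordAt_eq_zero {f : D → ℂ} {p : D} (hf : HolAt f p) : ordAt f p = 0 ↔ f p ≠ 0 := by
  rw [ordAt, AnalyticAt.analyticOrderAt_eq_zero hf]
  simp

theorem ordAt_eq_top {f : D → ℂ} {p : D} : ordAt f p = ⊤ ↔ ∀ᶠ x in 𝓝 p, f x = 0 := by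
  rw [ordAt, analyticOrderAt_eq_top, ← eventually_chart (p := p)]; rfl

theorem MeroAt.eventually_zero_or {g : D → ℂ} {p : D} (h : MeroAt g p) :
    (∀ᶠ x in 𝓝[≠] p, g x = 0) ∨ ∀ᶠ x in 𝓝[≠] p, g x ≠ 0 := by
  rcases MeromorphicAt.eventually_eq_zero_or_eventually_ne_zero h with h | h
  · exact Or.inl (eventually_chart_ne.1 h)
  · exact Or.inr (eventually_chart_ne.1 h)

/-- A property that holds everywhere or nowhere in a punctured neighbourhood of each point,
does so globally. -/
theorem identity_dichotomy [T1Space D] [PreconnectedSpace D] {Z : D → Prop}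
    (h : ∀ p, (∀ᶠ x in 𝓝[≠] p, Z x) ∨ ∀ᶠ x in 𝓝[≠] p, ¬ Z x) :
    (∀ p, ∀ᶠ x in 𝓝[≠] p, Z x) ∨ ∀ p, ∀ᶠ x in 𝓝[≠] p, ¬ Z x := by
  have key : ∀ P : D → Prop, IsOpen {p | ∀ᶠ x in 𝓝[≠] p, P x} := by
    intro P
    rw [isOpen_iff_mem_nhds]
    intro p hp
    have hp' := (eventually_nhdsWithin_iff.1 hp).eventually_nhds
    filter_upwards [hp'] with y hy
    by_cases hyp : y = p
    · rw [hyp]; exact hp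
    · have : ∀ᶠ z in 𝓝 y, z ∈ ({p}ᶜ : Set D) := isOpen_compl_singleton.mem_nhds hyp
      exact ((hy.and this).mono fun z hz => hz.1 hz.2).filter_mono nhdsWithin_le_nhds
  -- By hypothesis the complement is the set belonging to `¬ Z`, since no punctured neighbourhood
  -- filter is trivial; both sets are open by `key`.
  have hcl : IsClopen {p | ∀ᶠ x in 𝓝[≠] p, Z x} := by
    refine ⟨⟨?_⟩, key _⟩
    have : {p | ∀ᶠ x in 𝓝[≠] p, Z x}ᶜ = {p | ∀ᶠ x in 𝓝[≠] p, ¬ Z x} := by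
      ext p
      refine ⟨fun hp => (h p).resolve_left hp, fun hp hp' => ?_⟩
      have hp : ∀ᶠ x in 𝓝[≠] p, ¬ Z x := hp
      have hp' : ∀ᶠ x in 𝓝[≠] p, Z x := hp'
      obtain ⟨x, hx, hx'⟩ := (hp.and hp').exists
      exact hx hx'
    rw [this]; exact key _
  rcases isClopen_iff.1 hcl with h0 | h0
  · right
    intro p
    refine (h p).resolve_left fun hp => ?_
    have : p ∈ (∅ : Set D) := h0 ▸ hp
    exact this
  · left
    intro p
    have : p ∈ {p | ∀ᶠ x in 𝓝[≠] p, Z x} := h0 ▸ mem_univ p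
    exact this

/-- The identity theorem for meromorphic functions. -/
theorem mero_identity [T1Space D] [PreconnectedSpace D] {g : D → ℂ} (h : ∀ p, MeroAt g p) :
    (∀ p, ∀ᶠ x in 𝓝[≠] p, g x = 0) ∨ ∀ p, ∀ᶠ x in 𝓝[≠] p, g x ≠ 0 :=
  identity_dichotomy fun p => (h p).eventually_zero_or

/-- A set without accumulation points in a compact space is finite. -/
theorem finite_of_eventually_ne {X : Type*} [TopologicalSpace X] [CompactSpace X] {s : Set X}
    (h : ∀ p, ∀ᶠ x in 𝓝[≠] p, x ∉ s) : s.Finite := by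
  obtain ⟨t, ht⟩ := CompactSpace.elim_nhds_subcover
    (fun p => {x | x ≠ p → x ∉ s}) (fun p => eventually_nhdsWithin_iff.1 (h p))
  refine t.finite_toSet.subset fun x hx => ?_
  have : x ∈ ⋃ p ∈ t, {x | x ≠ p → x ∉ s} := by rw [ht]; trivial
  simp only [mem_iUnion, mem_ofPred_eq] at this
  obtain ⟨p, hpt, hp⟩ := this
  by_contra hxt
  exact hp (fun h => hxt (h ▸ hpt)) hx

end Charts

/-! ## Local behaviour of analytic functions of one variable -/

/-- Write `g = (z - z₀)^k h` with `h z₀ ≠ 0`. Near `z₀` the quotient `h / h z₀` is close to `1`,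
where the principal logarithm is analytic, so `h` has the analytic `k`-th root `c · exp (log (h / h
z₀) / k)` with `c ^ k = h z₀`. -/
theorem exists_analytic_root {g : ℂ → ℂ} {z₀ : ℂ} (hg : AnalyticAt ℂ g z₀) {k : ℕ} (hk : 0 < k)
    (ho : analyticOrderAt g z₀ = k) :
    ∃ T : ℂ → ℂ, AnalyticAt ℂ T z₀ ∧ T z₀ = 0 ∧ deriv T z₀ ≠ 0 ∧ ∀ᶠ z in 𝓝 z₀, g z = T z ^ k := by
  obtain ⟨h, hh, hh0, hgh⟩ := (hg.analyticOrderAt_eq_natCast).1 ho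
  obtain ⟨c, hc⟩ := IsAlgClosed.exists_pow_nat_eq (h z₀) hk
  have hc0 : c ≠ 0 := by rintro rfl; rw [zero_pow hk.ne'] at hc; exact hh0 hc.symm
  have hk' : (k : ℂ) ≠ 0 := by exact_mod_cast hk.ne'
  have hq : AnalyticAt ℂ (fun z => h z / h z₀) z₀ := hh.div analyticAt_const hh0
  have hE : AnalyticAt ℂ (fun z => c * Complex.exp (Complex.log (h z / h z₀) / k)) z₀ := by
    refine analyticAt_const.mul (AnalyticAt.cexp (AnalyticAt.div (AnalyticAt.clog hq ?_)
      analyticAt_const hk'))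
    simp [div_self hh0]
  refine ⟨fun z => (z - z₀) * (c * Complex.exp (Complex.log (h z / h z₀) / k)),
    (analyticAt_id.sub analyticAt_const).mul hE, by simp, ?_, ?_⟩
  · have h1 : HasDerivAt (fun z : ℂ => z - z₀) 1 z₀ := (hasDerivAt_id _).sub_const _
    have h2 := h1.mul hE.differentiableAt.hasDerivAt
    have h3 := h2.deriv
    rw [show (fun z => (z - z₀) * (c * Complex.exp (Complex.log (h z / h z₀) / k))) =
      (fun z => z - z₀) * fun z => (c * Complex.exp (Complex.log (h z / h z₀) / k)) from rfl, h3]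
    simp [div_self hh0, hc0]
  · have hne : ∀ᶠ z in 𝓝 z₀, h z ≠ 0 := hh.continuousAt.eventually_ne hh0
    filter_upwards [hgh, hne] with z hz hz'
    rw [hz, mul_pow, mul_pow, hc, ← Complex.exp_nat_mul, mul_div_cancel₀ _ hk',
      Complex.exp_log (div_ne_zero hz' hh0), mul_div_cancel₀ _ hh0, smul_eq_mul]

/-- The `k`-th roots of a nonzero complex number. -/
theorem exists_roots_finset {k : ℕ} (hk : 0 < k) {a : ℂ} (ha : a ≠ 0) :
    ∃ F : Finset ℂ, F.card = k ∧ ∀ t, t ∈ F ↔ t ^ k = a := by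
  classical
  refine ⟨(Polynomial.nthRoots k a).toFinset, ?_, fun t => ?_⟩
  · have hp := Complex.isPrimitiveRoot_exp k hk.ne'
    rw [Multiset.toFinset_card_of_nodup (hp.nthRoots_nodup ha), hp.card_nthRoots, if_pos]
    exact IsAlgClosed.exists_pow_nat_eq a hk
  · rw [Multiset.mem_toFinset, Polynomial.mem_nthRoots hk]

/-- Near a point where `g` takes its value with multiplicity `k`, each nearby value is taken
exactly `k` times, and with nonzero derivative. -/
theorem local_fibres {g : ℂ → ℂ} {z₀ : ℂ} (hg : AnalyticAt ℂ g z₀) {k : ℕ} (hk : 0 < k)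
    (ho : analyticOrderAt (fun z => g z - g z₀) z₀ = k) {U : Set ℂ} (hU : U ∈ 𝓝 z₀) :
    ∃ W ⊆ U, IsOpen W ∧ z₀ ∈ W ∧ ∀ᶠ s in 𝓝[≠] (g z₀), ∃ F : Finset ℂ, F.card = k ∧
      (∀ z, z ∈ F ↔ z ∈ W ∧ g z = s) ∧ ∀ z ∈ F, AnalyticAt ℂ g z ∧ deriv g z ≠ 0 := by
  -- With `g - g z₀ = T ^ k` and `T` a local coordinate, `W` is the preimage of a small disc under
  -- `T`; the points of `W` over `s` correspond to the `k`-th roots of `s - g z₀`.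
  obtain ⟨T, hT, hT0, hT', hgT⟩ := exists_analytic_root (hg.sub analyticAt_const) hk ho
  have hs := hT.hasStrictDerivAt.hasStrictFDerivAt_equiv hT'
  set e := hs.toOpenPartialHomeomorph T with he
  have hes : z₀ ∈ e.source := hs.mem_toOpenPartialHomeomorph_source
  have hcoe : (e : ℂ → ℂ) = T := hs.toOpenPartialHomeomorph_coe
  have hnice : ∀ᶠ z in 𝓝 z₀, (g z - g z₀ = T z ^ k ∧ AnalyticAt ℂ g z ∧ AnalyticAt ℂ T z ∧
      deriv T z ≠ 0 ∧ z ∈ U ∧ z ∈ e.source ∧ g =ᶠ[𝓝 z] fun w => g z₀ + T w ^ k) := by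
    have h1 : ∀ᶠ z in 𝓝 z₀, g z = g z₀ + T z ^ k := by
      filter_upwards [hgT] with z hz; rw [← hz]; simp
    filter_upwards [hgT, hg.eventually_analyticAt, hT.eventually_analyticAt,
      hT.deriv.continuousAt.eventually_ne hT', hU, e.open_source.mem_nhds hes,
      h1.eventually_nhds] with z h1 h2 h3 h4 h5 h6 h7
    exact ⟨h1, h2, h3, h4, h5, h6, h7⟩
  have hsymm : Tendsto e.symm (𝓝 0) (𝓝 z₀) := by
    have := e.tendsto_symm hes
    rwa [hcoe, hT0] at this
  have htar : e.target ∈ 𝓝 (0 : ℂ) := by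
    have := e.open_target.mem_nhds (e.map_source hes)
    rwa [hcoe, hT0] at this
  obtain ⟨r, hr, hball⟩ := Metric.mem_nhds_iff.1 (inter_mem (hsymm.eventually hnice) htar)
  have hWopen : IsOpen (e.symm '' Metric.ball 0 r) :=
    e.isOpen_image_symm_of_subset_target Metric.isOpen_ball fun t ht => (hball ht).2
  refine ⟨e.symm '' Metric.ball 0 r, ?_, hWopen, ?_, ?_⟩
  · rintro _ ⟨t, ht, rfl⟩
    exact (hball ht).1.2.2.2.2.1
  · refine ⟨0, Metric.mem_ball_self hr, ?_⟩
    rw [← hT0, ← hcoe]; exact e.left_inv hes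
  -- The radius `r ^ k` ensures that all `k`-th roots of `s - g z₀` lie in the disc of radius `r`.
  · have hsmall : ∀ᶠ s in 𝓝 (g z₀), s ∈ Metric.ball (g z₀) (r ^ k) :=
      Metric.ball_mem_nhds _ (by positivity)
    filter_upwards [nhdsWithin_le_nhds hsmall, self_mem_nhdsWithin] with s hs1 hs2
    obtain ⟨F, hF, hFm⟩ := exists_roots_finset hk (sub_ne_zero.2 hs2)
    have hFb : ∀ t ∈ F, t ∈ Metric.ball (0 : ℂ) r := by
      intro t ht
      have h1 := (hFm t).1 ht
      rw [mem_ball_zero_iff]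
      rw [Metric.mem_ball, dist_eq_norm, ← h1, norm_pow] at hs1
      exact lt_of_pow_lt_pow_left₀ k hr.le hs1
    have hinj : InjOn e.symm (F : Set ℂ) := fun a ha b hb hab =>
      e.symm.injOn (hball (hFb a ha)).2 (hball (hFb b hb)).2 hab
    have hval : ∀ t ∈ Metric.ball (0 : ℂ) r, T (e.symm t) = t := by
      intro t ht
      rw [← hcoe]; exact e.right_inv (hball ht).2
    have hmem : ∀ z, z ∈ F.image e.symm ↔ z ∈ e.symm '' Metric.ball 0 r ∧ g z = s := by
      intro z
      rw [Finset.mem_image]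
      constructor
      · rintro ⟨t, ht, rfl⟩
        refine ⟨⟨t, hFb t ht, rfl⟩, ?_⟩
        have h1 := (hball (hFb t ht)).1.1
        rw [hval t (hFb t ht), (hFm t).1 ht] at h1
        simpa using h1
      · rintro ⟨⟨t, ht, rfl⟩, h⟩
        refine ⟨t, (hFm t).2 ?_, rfl⟩
        have h1 := (hball ht).1.1
        rw [hval t ht, h] at h1
        exact h1.symm
    refine ⟨F.image e.symm, by rw [Finset.card_image_of_injOn hinj, hF], hmem, ?_⟩
    intro z hz
    obtain ⟨t, ht, rfl⟩ := Finset.mem_image.1 hz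
    obtain ⟨-, h2, h3, h4, -, -, h7⟩ := (hball (hFb t ht)).1
    refine ⟨h2, ?_⟩
    have hd := (h3.differentiableAt.hasDerivAt.pow k).const_add (g z₀)
    rw [h7.deriv_eq]

    rw [show (fun w => g z₀ + T w ^ k) = fun x => g z₀ + (T ^ k) x from rfl, hd.deriv,
      hval t (hFb t ht)]
    have ht0 : t ≠ 0 := by
      rintro rfl
      have := (hFm 0).1 ht
      rw [zero_pow hk.ne'] at this
      exact hs2 (sub_eq_zero.1 this.symm)
    have hk' : (k : ℂ) ≠ 0 := by exact_mod_cast hk.ne'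
    exact mul_ne_zero (mul_ne_zero hk' (pow_ne_zero _ ht0)) h4

/-- Comparison of an analytic function with a power of the distance. -/
theorem norm_comparable {g : ℂ → ℂ} {z₀ : ℂ} (hg : AnalyticAt ℂ g z₀) {k : ℕ}
    (ho : analyticOrderAt g z₀ = k) :
    ∃ c C : ℝ, 0 < c ∧ 0 < C ∧ ∀ᶠ z in 𝓝 z₀, c * ‖z - z₀‖ ^ k ≤ ‖g z‖ ∧
      ‖g z‖ ≤ C * ‖z - z₀‖ ^ k := by
  obtain ⟨h, hh, hh0, hgh⟩ := (hg.analyticOrderAt_eq_natCast).1 ho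
  have hp : 0 < ‖h z₀‖ := norm_pos_iff.2 hh0
  refine ⟨‖h z₀‖ / 2, 2 * ‖h z₀‖, by positivity, by positivity, ?_⟩
  have h1 := hh.continuousAt.norm.eventually (lt_mem_nhds (by linarith : ‖h z₀‖ / 2 < ‖h z₀‖))
  have h2 := hh.continuousAt.norm.eventually (gt_mem_nhds (by linarith : ‖h z₀‖ < 2 * ‖h z₀‖))
  filter_upwards [hgh, h1, h2] with z hz h1 h2
  have := pow_nonneg (norm_nonneg (z - z₀)) k
  have e : ‖g z‖ = ‖h z‖ * ‖z - z₀‖ ^ k := by rw [hz, norm_smul, norm_pow, mul_comm]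
  rw [e]
  exact ⟨by gcongr, by gcongr⟩

/-! ## Holomorphic maps to the sphere and their degree -/

section Degree

variable {D : Type*} [TopologicalSpace D] [ChartedSpace ℂ D]

/-- Holomorphic maps from a Riemann surface to the sphere. -/
def HolToS2 (f : D → S2) : Prop :=
  Continuous f ∧ ∀ p : D,
    ((f p : E3) ≠ -e3 → HolAt (fun x => coordU (f x)) p) ∧
    ((f p : E3) ≠ e3 → HolAt (fun x => coordV (f x)) p)

/-- The rotation `flip` on the sphere. -/
def flipS (s : S2) : S2 := ⟨flip s, by simp⟩

@[simp] theorem coe_flipS (s : S2) : (flipS s : E3) = flip s := rfl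

@[simp] theorem flipS_flipS (s : S2) : flipS (flipS s) = s := Subtype.ext (by simp)

theorem continuous_flipS : Continuous flipS :=
  (flip.continuous.comp continuous_subtype_val).subtype_mk _

theorem HolToS2.flip {f : D → S2} (hf : HolToS2 f) : HolToS2 fun x => flipS (f x) := by
  refine ⟨continuous_flipS.comp hf.1, fun p => ⟨fun h => ?_, fun h => ?_⟩⟩
  · have : (f p : E3) ≠ e3 := fun h' => h (flip_eq_neg_e3.2 h')
    simpa only [coe_flipS, coordU_flip] using (hf.2 p).2 this
  · have : (f p : E3) ≠ -e3 := fun h' => h (flip_eq_e3.2 h')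
    simpa only [coe_flipS, coordV_flip] using (hf.2 p).1 this

theorem HolToS2.eventually_ne_south {f : D → S2} (hf : HolToS2 f) {p : D}
    (hp : (f p : E3) ≠ -e3) : ∀ᶠ x in 𝓝 p, (f x : E3) ≠ -e3 :=
  ((continuous_subtype_val.comp hf.1).continuousAt).eventually_ne hp

theorem HolToS2.eventually_ne_north {f : D → S2} (hf : HolToS2 f) {p : D}
    (hp : (f p : E3) ≠ e3) : ∀ᶠ x in 𝓝 p, (f x : E3) ≠ e3 :=
  ((continuous_subtype_val.comp hf.1).continuousAt).eventually_ne hp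

theorem HolAt.sub_const {g : D → ℂ} {p : D} (h : HolAt g p) (c : ℂ) :
    HolAt (fun x => g x - c) p :=
  AnalyticAt.sub (f := g ∘ (chartAt ℂ p).symm) (g := fun _ => c) h analyticAt_const

theorem HolAt.mul {f g : D → ℂ} {p : D} (hf : HolAt f p) (hg : HolAt g p) :
    HolAt (fun x => f x * g x) p :=
  AnalyticAt.mul (f := f ∘ (chartAt ℂ p).symm) (g := g ∘ (chartAt ℂ p).symm) hf hg

theorem HolAt.const_mul {g : D → ℂ} {p : D} (c : ℂ) (hg : HolAt g p) :
    HolAt (fun x => c * g x) p :=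
  AnalyticAt.mul (f := fun _ => c) (g := g ∘ (chartAt ℂ p).symm) analyticAt_const hg

theorem HolAt.inv {g : D → ℂ} {p : D} (hg : HolAt g p) (h0 : g p ≠ 0) :
    HolAt (fun x => (g x)⁻¹) p :=
  AnalyticAt.inv (f := g ∘ (chartAt ℂ p).symm) hg (by simpa using h0)

theorem coordV_ne_zero {s : S2} (h : (s : E3) ≠ -e3) (h' : (s : E3) ≠ e3) : coordV s ≠ 0 :=
  right_ne_zero_of_mul_eq_one (coordU_mul_coordV h h')

/-- A holomorphic map that is not constant takes each value at isolated points only. -/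
theorem HolToS2.isolated [T1Space D] [PreconnectedSpace D] {f : D → S2} (hf : HolToS2 f)
    (hc : ¬ ∃ s, ∀ x, f x = s) (s : S2) (p : D) : ∀ᶠ x in 𝓝[≠] p, f x ≠ s := by
  have key : ∀ p, (∀ᶠ x in 𝓝[≠] p, f x = s) ∨ ∀ᶠ x in 𝓝[≠] p, ¬ f x = s := by
    intro p
    by_cases h : f p = s
    · by_cases hs : (s : E3) = -e3
      · have hp : (f p : E3) ≠ e3 := by rw [h, hs]; exact neg_e3_ne_e3
        have hs' : (s : E3) ≠ e3 := by rw [hs]; exact neg_e3_ne_e3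
        have hh := (((hf.2 p).2 hp).sub_const (coordV s)).meroAt.eventually_zero_or
        have hn := (hf.eventually_ne_north hp).filter_mono (nhdsWithin_le_nhds (s := {p}ᶜ))
        refine hh.imp (fun hh => ?_) fun hh => ?_
        · filter_upwards [hh, hn] with x hx hx'
          exact coordV_injOn hx' hs' (sub_eq_zero.1 hx)
        · filter_upwards [hh] with x hx hx'
          exact hx (by rw [hx', sub_self])
      · have hp : (f p : E3) ≠ -e3 := by rw [h]; exact hs
        have hh := (((hf.2 p).1 hp).sub_const (coordU s)).meroAt.eventually_zero_or
        have hn := (hf.eventually_ne_south hp).filter_mono (nhdsWithin_le_nhds (s := {p}ᶜ))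
        refine hh.imp (fun hh => ?_) fun hh => ?_
        · filter_upwards [hh, hn] with x hx hx'
          exact coordU_injOn hx' hs (sub_eq_zero.1 hx)
        · filter_upwards [hh] with x hx hx'
          exact hx (by rw [hx', sub_self])
    · right
      exact (hf.1.continuousAt.eventually_ne h).filter_mono nhdsWithin_le_nhds
  rcases identity_dichotomy key with h | h
  · exfalso
    refine hc ⟨s, fun x => ?_⟩
    have h1 : Tendsto f (𝓝[≠] x) (𝓝 (f x)) := hf.1.continuousAt.mono_left nhdsWithin_le_nhds
    have h2 : Tendsto f (𝓝[≠] x) (𝓝 s) :=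
      tendsto_const_nhds.congr' ((h x).mono fun y hy => hy.symm)
    exact tendsto_nhds_unique h1 h2
  · exact h p

theorem localDegree_of_ne_south {f : D → S2} {p : D} (hp : (f p : E3) ≠ -e3) :
    localDegree f p = ordAt (fun x => coordU (f x) - coordU (f p)) p := by
  rw [localDegree, if_pos hp]

/-- Away from both poles `u - u(p) = (v - v(p)) · (-1 / (v(p) v))`, and the second factor is a unit;
so both coordinates give the same order. -/
theorem localDegree_of_ne_north {f : D → S2} (hf : HolToS2 f) {p : D} (hp : (f p : E3) ≠ e3) :
    localDegree f p = ordAt (fun x => coordV (f x) - coordV (f p)) p := by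
  by_cases hs : (f p : E3) = -e3
  · rw [localDegree, if_neg (by simpa using hs)]
  rw [localDegree_of_ne_south hs]
  have hv := (hf.2 p).2 hp
  have h0 : coordV (f p) ≠ 0 := coordV_ne_zero hs hp
  have hw : HolAt (fun x => -(coordV (f p))⁻¹ * (coordV (f x))⁻¹) p := (hv.inv h0).const_mul _
  have e : (fun x => coordU (f x) - coordU (f p)) =ᶠ[𝓝 p]
      fun x => (coordV (f x) - coordV (f p)) * (-(coordV (f p))⁻¹ * (coordV (f x))⁻¹) := by
    filter_upwards [hv.continuousAt.eventually_ne h0] with x hx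
    rw [coordU_eq_inv, coordU_eq_inv]
    field_simp; ring
  rw [ordAt_congr e, ordAt_mul (hv.sub_const _) hw, (ordAt_eq_zero hw).2, add_zero]
  exact mul_ne_zero (neg_ne_zero.2 (inv_ne_zero h0)) (inv_ne_zero h0)

theorem localDegree_flip {f : D → S2} (hf : HolToS2 f) (p : D) :
    localDegree (fun x => flipS (f x)) p = localDegree f p := by
  by_cases hp : (f p : E3) = e3
  · rw [localDegree, if_neg (by simpa [flip_eq_neg_e3] using hp), localDegree_of_ne_south]
    · simp only [coe_flipS, coordV_flip]
    · rw [hp]; exact neg_e3_ne_e3.symm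
  · rw [localDegree_of_ne_north hf hp, localDegree_of_ne_south]
    · simp only [coe_flipS, coordU_flip]
    · simpa [flip_eq_neg_e3] using hp

section Local

variable [IsManifold 𝓘(ℂ, ℂ) ω D]

theorem fibre_local_aux {f : D → S2} (hf : HolToS2 f)
    (hc : ∀ s p, ∀ᶠ x in 𝓝[≠] p, f x ≠ s) {p : D} (hp : (f p : E3) ≠ -e3)
    {U : Set D} (hU : U ∈ 𝓝 p) :
    ∃ k : ℕ, 0 < k ∧ localDegree f p = k ∧ ∃ W ⊆ U, IsOpen W ∧ p ∈ W ∧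
      ∀ᶠ s in 𝓝[≠] (f p), ∃ F : Finset D, F.card = k ∧ (∀ x, x ∈ F ↔ x ∈ W ∧ f x = s) ∧
        ∀ x ∈ F, localDegree f x = 1 := by
  classical
  set c := chartAt ℂ p with hcdef
  set g : ℂ → ℂ := (fun x => coordU (f x)) ∘ c.symm with hgdef
  have hps : p ∈ c.source := mem_chart_source ℂ p
  have hg : AnalyticAt ℂ g (c p) := (hf.2 p).1 hp
  have hgp : g (c p) = coordU (f p) := by simp [hgdef, c.left_inv hps]
  have hld : localDegree f p = analyticOrderAt (fun z => g z - g (c p)) (c p) := by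
    rw [localDegree_of_ne_south hp, ordAt, hgp]; rfl
  have h0 : localDegree f p ≠ 0 := by
    rw [localDegree_of_ne_south hp, ne_eq, ordAt_eq_zero (((hf.2 p).1 hp).sub_const _)]
    simp
  have htop : localDegree f p ≠ ⊤ := by
    rw [localDegree_of_ne_south hp, ne_eq, ordAt_eq_top]
    intro h
    have h1 : ∀ᶠ x in 𝓝[≠] p, f x = f p := by
      filter_upwards [nhdsWithin_le_nhds h, nhdsWithin_le_nhds (hf.eventually_ne_south hp)]
        with x hx hx'
      exact coordU_injOn hx' hp (sub_eq_zero.1 hx)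
    obtain ⟨x, hx, hx'⟩ := (h1.and (hc (f p) p)).exists
    exact hx' hx
  obtain ⟨k, hk⟩ := ENat.ne_top_iff_exists.1 htop
  have hkpos : 0 < k := by
    rw [pos_iff_ne_zero]; rintro rfl; exact h0 (by rw [← hk]; rfl)
  have hU' : {z | z ∈ c.target ∧ c.symm z ∈ U ∧ (f (c.symm z) : E3) ≠ -e3} ∈ 𝓝 (c p) := by
    filter_upwards [c.open_target.mem_nhds (c.map_source hps),
      eventually_chart.2 hU, eventually_chart.2 (hf.eventually_ne_south hp)] with z h1 h2 h3
    exact ⟨h1, h2, h3⟩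
  obtain ⟨W, hWU, hWo, hpW, hW⟩ := local_fibres hg hkpos (by rw [← hld, hk]) hU'
  refine ⟨k, hkpos, hk.symm, c.symm '' W, ?_, ?_, ⟨c p, hpW, c.left_inv hps⟩, ?_⟩
  · rintro _ ⟨z, hz, rfl⟩; exact (hWU hz).2.1
  · exact c.isOpen_image_symm_of_subset_target hWo fun z hz => (hWU hz).1
  have ht : Tendsto (fun s : S2 => coordU s) (𝓝[≠] (f p)) (𝓝[≠] (g (c p))) := by
    rw [hgp]
    have hcu : ContinuousAt (fun s : S2 => coordU s) (f p) :=
      (continuousAt_coordU hp).comp continuous_subtype_val.continuousAt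
    refine tendsto_nhdsWithin_iff.2 ⟨hcu.mono_left nhdsWithin_le_nhds, ?_⟩
    have : ∀ᶠ s : S2 in 𝓝 (f p), (s : E3) ≠ -e3 :=
      continuous_subtype_val.continuousAt.eventually_ne hp
    filter_upwards [nhdsWithin_le_nhds this, self_mem_nhdsWithin] with s hs hs' h
    exact hs' (coordU_injOn hs hp h)
  have hns : ∀ᶠ s : S2 in 𝓝[≠] (f p), (s : E3) ≠ -e3 :=
    nhdsWithin_le_nhds (continuous_subtype_val.continuousAt.eventually_ne hp)
  filter_upwards [ht.eventually hW, hns] with s ⟨F, hF, hFm, hFd⟩ hs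
  have hinj : InjOn c.symm (F : Set ℂ) := fun a ha b hb hab =>
    c.symm.injOn (hWU ((hFm a).1 ha).1).1 (hWU ((hFm b).1 hb).1).1 hab
  refine ⟨F.image c.symm, by rw [Finset.card_image_of_injOn hinj, hF], ?_, ?_⟩
  · intro x
    rw [Finset.mem_image]
    constructor
    · rintro ⟨z, hz, rfl⟩
      obtain ⟨h1, h2⟩ := (hFm z).1 hz
      exact ⟨⟨z, h1, rfl⟩, coordU_injOn (hWU h1).2.2 hs h2⟩
    · rintro ⟨⟨z, hz, rfl⟩, h⟩
      exact ⟨z, (hFm z).2 ⟨hz, by simp [hgdef, h]⟩, rfl⟩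
  · intro x hx
    obtain ⟨z, hz, rfl⟩ := Finset.mem_image.1 hx
    obtain ⟨h1, h2⟩ := (hFm z).1 hz
    have hzt := (hWU h1).1
    rw [localDegree_of_ne_south (hWU h1).2.2, ordAt_eq (p := p) (c.map_target hzt)]
    have h3 := (hFd z hz).1.analyticOrderAt_sub_eq_one_of_deriv_ne_zero (hFd z hz).2
    rw [← hcdef, c.right_inv hzt]
    exact h3

/-- Near a point `p`, each value near `f p` is taken as often as the local degree says. -/
theorem fibre_local {f : D → S2} (hf : HolToS2 f)
    (hc : ∀ s p, ∀ᶠ x in 𝓝[≠] p, f x ≠ s) (p : D) {U : Set D} (hU : U ∈ 𝓝 p) :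
    ∃ k : ℕ, 0 < k ∧ localDegree f p = k ∧ ∃ W ⊆ U, IsOpen W ∧ p ∈ W ∧
      ∀ᶠ s in 𝓝[≠] (f p), ∃ F : Finset D, F.card = k ∧ (∀ x, x ∈ F ↔ x ∈ W ∧ f x = s) ∧
        ∀ x ∈ F, localDegree f x = 1 := by
  by_cases hp : (f p : E3) = -e3
  · have hp' : (flipS (f p) : E3) ≠ -e3 := by
      rw [coe_flipS, hp, ne_eq, flip_eq_neg_e3]; exact neg_e3_ne_e3
    have hc' : ∀ s p, ∀ᶠ x in 𝓝[≠] p, flipS (f x) ≠ s := by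
      intro s p
      filter_upwards [hc (flipS s) p] with x hx h
      exact hx (by rw [← h, flipS_flipS])
    obtain ⟨k, hk, hld, W, hWU, hWo, hpW, hW⟩ := fibre_local_aux hf.flip hc' hp' hU
    refine ⟨k, hk, by rw [← hld, localDegree_flip hf], W, hWU, hWo, hpW, ?_⟩
    have ht : Tendsto flipS (𝓝[≠] (f p)) (𝓝[≠] (flipS (f p))) := by
      refine tendsto_nhdsWithin_iff.2
        ⟨continuous_flipS.continuousAt.mono_left nhdsWithin_le_nhds, ?_⟩
      filter_upwards [self_mem_nhdsWithin] with s hs h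
      exact hs (by rw [← flipS_flipS s, h, flipS_flipS]; rfl)
    filter_upwards [ht.eventually hW] with s ⟨F, hF, hFm, hFd⟩
    refine ⟨F, hF, fun x => ?_, fun x hx => by rw [← localDegree_flip hf]; exact hFd x hx⟩
    rw [hFm]
    refine and_congr_right fun _ => ⟨fun h => ?_, fun h => by rw [h]⟩
    rw [← flipS_flipS (f x), h, flipS_flipS]
  · exact fibre_local_aux hf hc hp hU

end Local

end Degree

/-! ### Fibres near a given fibre, and the global degree. -/

section DegreeGlobal

variable {D : Type*} [TopologicalSpace D] [ChartedSpace ℂ D]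

/-- A nonconstant holomorphic map from a Riemann surface to the sphere. -/
structure NonconstHol (f : D → S2) : Prop where
  hol : HolToS2 f
  isolated : ∀ s p, ∀ᶠ x in 𝓝[≠] p, f x ≠ s

theorem NonconstHol.flip {f : D → S2} (hf : NonconstHol f) :
    NonconstHol fun x => flipS (f x) := by
  refine ⟨hf.hol.flip, fun s p => ?_⟩
  filter_upwards [hf.isolated (flipS s) p] with x hx h
  exact hx (by rw [← h, flipS_flipS])

theorem NonconstHol.finite [CompactSpace D] {f : D → S2} (hf : NonconstHol f) (s : S2) :
    {x | f x = s}.Finite :=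
  finite_of_eventually_ne (hf.isolated s)

/-- The fibre of `f` over `s` as a finite set. -/
def fib (f : D → S2) (s : S2) : Finset D := by
  classical
  exact if h : {x | f x = s}.Finite then h.toFinset else ∅

theorem NonconstHol.mem_fib [CompactSpace D] {f : D → S2} (hf : NonconstHol f) {s : S2} {x : D} :
    x ∈ fib f s ↔ f x = s := by
  rw [fib, dif_pos (hf.finite s), Finite.mem_toFinset]; rfl

theorem NonconstHol.coe_fib [CompactSpace D] {f : D → S2} (hf : NonconstHol f) (s : S2) :
    (fib f s : Set D) = {x | f x = s} := by
  ext x; simp [hf.mem_fib]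

/-- The local degree as a natural number. -/
def locDeg (f : D → S2) (p : D) : ℕ := (localDegree f p).toNat

variable [IsManifold 𝓘(ℂ, ℂ) ω D]

theorem NonconstHol.localDegree_eq {f : D → S2} (hf : NonconstHol f) (p : D) :
    localDegree f p = locDeg f p := by
  obtain ⟨k, -, h, -⟩ := fibre_local hf.hol hf.isolated p univ_mem
  rw [locDeg, h]; rfl

theorem NonconstHol.locDeg_pos {f : D → S2} (hf : NonconstHol f) (p : D) : 0 < locDeg f p := by
  obtain ⟨k, hk, h, -⟩ := fibre_local hf.hol hf.isolated p univ_mem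
  rw [locDeg, h]; exact hk

/-- The branch values of `f`. -/
def branchValues (f : D → S2) : Set S2 := {s | ∃ x, f x = s ∧ locDeg f x ≠ 1}

variable [CompactSpace D] [T2Space D]

/-- The structure of the fibres near the fibre over `s₀`. -/
theorem NonconstHol.fibres_near {f : D → S2} (hf : NonconstHol f) (s₀ : S2) {U : D → Set D}
    (hU : ∀ p, U p ∈ 𝓝 p) :
    ∃ W : D → Set D, (∀ p ∈ fib f s₀, W p ⊆ U p ∧ IsOpen (W p) ∧ p ∈ W p) ∧
      (fib f s₀ : Set D).PairwiseDisjoint W ∧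
      ∀ᶠ s in 𝓝[≠] s₀, (∀ x, f x = s → ∃ p ∈ fib f s₀, x ∈ W p) ∧
        (∀ x, f x = s → locDeg f x = 1) ∧
        ∀ p ∈ fib f s₀, ∃ F : Finset D, F.card = locDeg f p ∧
          ∀ x, x ∈ F ↔ x ∈ W p ∧ f x = s := by
  obtain ⟨V, hV, hVd⟩ := (fib f s₀).finite_toSet.t2_separation
  choose k hk hkd W hWU hWo hpW hW using fun p =>
    fibre_local hf.hol hf.isolated p (inter_mem (hU p) ((hV p).2.mem_nhds (hV p).1))
  refine ⟨W, fun p _ => ⟨(hWU p).trans inter_subset_left, hWo p, hpW p⟩,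
    fun p hp q hq hpq => (hVd hp hq hpq).mono ((hWU p).trans inter_subset_right)
      ((hWU q).trans inter_subset_right), ?_⟩
  -- The complement of the sets `W p` is compact, so its image is closed; it does not contain `s₀`.
  -- Hence fibres over values near `s₀` lie inside the sets `W p`.
  have hK : IsClosed (⋃ p ∈ fib f s₀, W p)ᶜ :=
    (isOpen_biUnion fun p _ => hWo p).isClosed_compl
  have hfK : IsClosed (f '' (⋃ p ∈ fib f s₀, W p)ᶜ) := (hK.isCompact.image hf.hol.1).isClosed
  have hs₀ : s₀ ∉ f '' (⋃ p ∈ fib f s₀, W p)ᶜ := by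
    rintro ⟨x, hx, rfl⟩
    exact hx (mem_biUnion (hf.mem_fib.2 rfl) (hpW x))
  have h1 : ∀ᶠ s in 𝓝[≠] s₀, s ∉ f '' (⋃ p ∈ fib f s₀, W p)ᶜ :=
    nhdsWithin_le_nhds (hfK.isOpen_compl.mem_nhds hs₀)
  have h2 : ∀ᶠ s in 𝓝[≠] s₀, ∀ p ∈ fib f s₀, ∃ F : Finset D, F.card = k p ∧
      (∀ x, x ∈ F ↔ x ∈ W p ∧ f x = s) ∧ ∀ x ∈ F, localDegree f x = 1 := by
    rw [eventually_all_finset]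
    intro p hp
    have := hW p
    rwa [hf.mem_fib.1 hp] at this
  filter_upwards [h1, h2] with s hs1 hs2
  have hcov : ∀ x, f x = s → ∃ p ∈ fib f s₀, x ∈ W p := by
    intro x hx
    by_contra hn
    refine hs1 ⟨x, fun hx' => hn ?_, hx⟩
    simpa using hx'
  refine ⟨hcov, fun x hx => ?_, fun p hp => ?_⟩
  · obtain ⟨p, hp, hxp⟩ := hcov x hx
    obtain ⟨F, -, hFm, hFd⟩ := hs2 p hp
    rw [locDeg, hFd x ((hFm x).2 ⟨hxp, hx⟩)]; rfl
  · obtain ⟨F, hF, hFm, -⟩ := hs2 p hp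
    exact ⟨F, by rw [hF, locDeg, hkd]; rfl, hFm⟩

theorem NonconstHol.branchValues_finite {f : D → S2} (hf : NonconstHol f) :
    (branchValues f).Finite := by
  refine finite_of_eventually_ne fun s₀ => ?_
  obtain ⟨W, -, -, hW⟩ := hf.fibres_near s₀ (U := fun _ => univ) fun _ => univ_mem
  filter_upwards [hW] with s hs
  rintro ⟨x, hx, hx'⟩
  exact hx' (hs.2.1 x hx)

omit [IsManifold 𝓘(ℂ, ℂ) ω D] [T2Space D] in
/-- Products over a nearby fibre can be arranged according to the points of the given fibre. -/
theorem prod_fib_eq {f : D → S2} (hf : NonconstHol f) {s₀ s : S2} {W : D → Set D}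
    (hWd : (fib f s₀ : Set D).PairwiseDisjoint W)
    (hcov : ∀ x, f x = s → ∃ p ∈ fib f s₀, x ∈ W p) {F : D → Finset D}
    (hF : ∀ p ∈ fib f s₀, ∀ x, x ∈ F p ↔ x ∈ W p ∧ f x = s)
    {M : Type*} [CommMonoid M] (φ : D → M) :
    ∏ x ∈ fib f s, φ x = ∏ p ∈ fib f s₀, ∏ x ∈ F p, φ x := by
  classical
  rw [← Finset.prod_biUnion]
  · refine Finset.prod_congr ?_ fun _ _ => rfl
    ext x
    rw [hf.mem_fib, Finset.mem_biUnion]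
    constructor
    · intro hx
      obtain ⟨p, hp, hxp⟩ := hcov x hx
      exact ⟨p, hp, (hF p hp x).2 ⟨hxp, hx⟩⟩
    · rintro ⟨p, hp, hxp⟩
      exact ((hF p hp x).1 hxp).2
  · intro p hp q hq hpq
    rw [Function.onFun, Finset.disjoint_left]
    intro x hx hx'
    exact disjoint_left.1 (hWd hp hq hpq) ((hF p hp x).1 hx).1 ((hF q hq x).1 hx').1

/-- The number of preimages of `s`, with multiplicity. -/
def degAt (f : D → S2) (s : S2) : ℕ := ∑ x ∈ fib f s, locDeg f x

/-- Over a value near `s₀` each point `p` of the fibre splits into `locDeg f p` points, all of local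
degree one, so the weighted count does not change. -/
theorem NonconstHol.degAt_eventually {f : D → S2} (hf : NonconstHol f) (s₀ : S2) :
    ∀ᶠ s in 𝓝 s₀, degAt f s = degAt f s₀ := by
  have : ∀ᶠ s in 𝓝[≠] s₀, degAt f s = degAt f s₀ := by
    obtain ⟨W, -, hWd, hW⟩ := hf.fibres_near s₀ (U := fun _ => univ) fun _ => univ_mem
    filter_upwards [hW] with s ⟨hcov, hone, hF⟩
    choose! F hFc hFm using hF
    -- The additive statement is the product formula in `Multiplicative ℕ`.
    have h := prod_fib_eq hf hWd hcov hFm (fun x => Multiplicative.ofAdd (locDeg f x))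
    have h' : ∑ x ∈ fib f s, locDeg f x = ∑ p ∈ fib f s₀, ∑ x ∈ F p, locDeg f x := by
      simpa only [← ofAdd_sum, Multiplicative.ofAdd.injective.eq_iff] using h
    rw [degAt, h', degAt]
    refine Finset.sum_congr rfl fun p hp => ?_
    rw [Finset.sum_congr rfl fun x hx => hone x ((hFm p hp x).1 hx).2]
    simp [hFc p hp]
  rw [eventually_nhdsWithin_iff] at this
  filter_upwards [this] with s hs
  by_cases h : s = s₀
  · rw [h]
  · exact hs h

instance : PreconnectedSpace S2 := by
  apply Subtype.preconnectedSpace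
  apply isPreconnected_sphere
  rw [← Module.finrank_eq_rank]
  simp

theorem NonconstHol.degAt_eq {f : D → S2} (hf : NonconstHol f) (s t : S2) :
    degAt f s = degAt f t := by
  have : IsLocallyConstant (degAt f) := (IsLocallyConstant.iff_eventually_eq _).2 hf.degAt_eventually
  exact this.apply_eq_of_isPreconnected isPreconnected_univ (mem_univ s) (mem_univ t)

/-- The mapping degree of `f`. -/
def deg (f : D → S2) : ℕ := degAt f north

theorem NonconstHol.sum_locDeg {f : D → S2} (hf : NonconstHol f) (s : S2) :
    ∑ x ∈ fib f s, locDeg f x = deg f := hf.degAt_eq s north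

theorem NonconstHol.deg_pos [Nonempty D] {f : D → S2} (hf : NonconstHol f) : 0 < deg f := by
  obtain ⟨x⟩ := ‹Nonempty D›
  rw [← hf.sum_locDeg (f x)]
  exact Finset.sum_pos (fun y _ => hf.locDeg_pos y) ⟨x, hf.mem_fib.2 rfl⟩

theorem NonconstHol.surjective [Nonempty D] {f : D → S2} (hf : NonconstHol f) (s : S2) :
    ∃ x, f x = s := by
  have h := hf.deg_pos
  rw [← hf.sum_locDeg s] at h
  obtain ⟨x, hx, -⟩ := Finset.exists_ne_zero_of_sum_ne_zero h.ne'
  exact ⟨x, hf.mem_fib.1 hx⟩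

theorem NonconstHol.card_fib {f : D → S2} (hf : NonconstHol f) {s : S2}
    (hs : s ∉ branchValues f) : (fib f s).card = deg f := by
  rw [← hf.sum_locDeg s, Finset.card_eq_sum_ones]
  refine Finset.sum_congr rfl fun x hx => ?_
  by_contra h
  exact hs ⟨x, hf.mem_fib.1 hx, fun h' => h h'.symm⟩

theorem NonconstHol.hasDegree {f : D → S2} (hf : NonconstHol f) : HasDegree f (deg f) := by
  intro s
  refine ⟨hf.finite s, ?_⟩
  rw [← hf.coe_fib s, finsum_mem_coe_finset, ← hf.sum_locDeg s, Nat.cast_sum]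
  exact Finset.sum_congr rfl fun x _ => hf.localDegree_eq x

end DegreeGlobal

/-! ## Entire functions of polynomial growth, and norms -/

section Growth

/-- Liouville's theorem is the case `n = 0`. For the induction step `(f z - f 0) / z` is entire and
its growth exponent is smaller by one. -/
theorem exists_polynomial_of_growth {C : ℝ} (n : ℕ) {f : ℂ → ℂ} (hf : Differentiable ℂ f)
    (hb : ∀ z, ‖f z‖ ≤ C * (1 + ‖z‖) ^ n) : ∃ p : Polynomial ℂ, ∀ z, p.eval z = f z := by
  induction n generalizing f C with
  | zero =>
    have : Bornology.IsBounded (range f) := by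
      rw [isBounded_iff_forall_norm_le]
      exact ⟨C, by rintro _ ⟨z, rfl⟩; simpa using hb z⟩
    obtain ⟨c, hc⟩ := hf.exists_const_forall_eq_of_bounded this
    exact ⟨Polynomial.C c, fun z => by simp [hc z]⟩
  | succ n ih =>
    have hg : Differentiable ℂ (dslope f 0) := by
      rw [← differentiableOn_univ, Complex.differentiableOn_dslope univ_mem]
      exact hf.differentiableOn
    obtain ⟨B, hB⟩ := (isCompact_closedBall (0 : ℂ) 1).exists_bound_of_continuousOn
      hg.continuous.continuousOn
    have hC : 0 ≤ C := by simpa using (norm_nonneg _).trans (hb 0)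
    -- The constant `|B|` takes care of the unit disc. Outside, `|f z - f 0| ≤ 2C (1 + |z|)^(n+1)`
    -- and `1 + |z| ≤ 2 |z|`, which gives `4C`.
    have hbound : ∀ z, ‖dslope f 0 z‖ ≤ (|B| + 4 * C) * (1 + ‖z‖) ^ n := by
      intro z
      have h1 : (1 : ℝ) ≤ (1 + ‖z‖) ^ n := one_le_pow₀ (by linarith [norm_nonneg z])
      by_cases hz : ‖z‖ ≤ 1
      · calc ‖dslope f 0 z‖ ≤ B := hB z (by simpa using hz)
          _ ≤ (|B| + 4 * C) * 1 := by linarith [le_abs_self B]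
          _ ≤ _ := by gcongr
      · push Not at hz
        have hz0 : z ≠ 0 := by rintro rfl; simp at hz; linarith
        rw [dslope_of_ne _ hz0, slope_def_field, sub_zero, norm_div, div_le_iff₀ (by linarith)]
        have h0 : ‖f 0‖ ≤ C := by simpa using hb 0
        have h2 : C ≤ C * (1 + ‖z‖) ^ (n + 1) :=
          le_mul_of_one_le_right hC (one_le_pow₀ (by linarith))
        calc ‖f z - f 0‖ ≤ ‖f z‖ + ‖f 0‖ := norm_sub_le _ _
          _ ≤ 2 * C * (1 + ‖z‖) ^ n * (1 + ‖z‖) := by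
            have := hb z
            have e : C * (1 + ‖z‖) ^ (n + 1) = C * (1 + ‖z‖) ^ n * (1 + ‖z‖) := by ring
            nlinarith
          _ ≤ 2 * C * (1 + ‖z‖) ^ n * (2 * ‖z‖) := by gcongr; linarith
          _ ≤ (|B| + 4 * C) * (1 + ‖z‖) ^ n * ‖z‖ := by
            have h3 : 0 ≤ |B| * ((1 + ‖z‖) ^ n * ‖z‖) := by positivity
            nlinarith
    obtain ⟨p, hp⟩ := ih hg hbound
    refine ⟨Polynomial.C (f 0) + Polynomial.X * p, fun z => ?_⟩
    have := sub_smul_dslope f 0 z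
    simp only [Polynomial.eval_add, Polynomial.eval_C, Polynomial.eval_mul, Polynomial.eval_X, hp]
    rw [sub_zero, smul_eq_mul] at this
    rw [this]; ring

/-- The growth bound makes `f` bounded near each exceptional point, so the singularities can be
removed one after the other; the bound survives at the new value by passing to the limit. -/
theorem exists_polynomial_of_growth_off_finite {C : ℝ} {n : ℕ} (F : Finset ℂ) {f : ℂ → ℂ}
    (hf : ∀ z ∉ F, DifferentiableAt ℂ f z) (hb : ∀ z ∉ F, ‖f z‖ ≤ C * (1 + ‖z‖) ^ n) :
    ∃ p : Polynomial ℂ, ∀ z ∉ F, p.eval z = f z := by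
  classical
  induction F using Finset.induction_on generalizing f with
  | empty =>
    obtain ⟨p, hp⟩ := exists_polynomial_of_growth (C := C) n (f := f) (fun z => hf z (by simp))
      fun z => hb z (by simp)
    exact ⟨p, fun z _ => hp z⟩
  | insert a F ha ih =>
    set f' := Function.update f a (limUnder (𝓝[≠] a) f) with hf'
    have hFo : IsOpen ((F : Set ℂ)ᶜ) := F.finite_toSet.isClosed.isOpen_compl
    have hs : Metric.ball a 1 ∩ (F : Set ℂ)ᶜ ∈ 𝓝 a :=
      inter_mem (Metric.ball_mem_nhds a one_pos) (hFo.mem_nhds (by simpa using ha))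
    have hne : ∀ z ∉ insert a F, f' =ᶠ[𝓝 z] f := by
      intro z hz
      have : z ≠ a := fun h => hz (by simp [h])
      filter_upwards [isOpen_ne.mem_nhds this] with w hw
      exact Function.update_of_ne hw _ _
    have hda : DifferentiableAt ℂ f' a := by
      refine (Complex.differentiableOn_update_limUnder_of_bddAbove hs ?_ ?_).differentiableAt hs
      · intro z hz
        exact (hf z (by simpa using ⟨hz.2, hz.1.2⟩)).differentiableWithinAt
      · refine ⟨|C| * (2 + ‖a‖) ^ n, ?_⟩
        rintro _ ⟨z, hz, rfl⟩
        have h1 := hb z (by simpa using ⟨hz.2, hz.1.2⟩)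
        have h2 : ‖z‖ ≤ 1 + ‖a‖ := by
          have h3 := hz.1.1
          rw [Metric.mem_ball, dist_eq_norm] at h3
          have := norm_sub_norm_le z a
          linarith
        calc ‖f z‖ ≤ C * (1 + ‖z‖) ^ n := h1
          _ ≤ |C| * (1 + ‖z‖) ^ n := by gcongr; exact le_abs_self C
          _ ≤ |C| * (2 + ‖a‖) ^ n := mul_le_mul_of_nonneg_left
              (pow_le_pow_left₀ (by positivity) (by linarith) n) (abs_nonneg C)
    have hA : ∀ z ∉ F, DifferentiableAt ℂ f' z := by
      intro z hz
      by_cases hza : z = a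
      · rw [hza]; exact hda
      · have hz' : z ∉ insert a F := by simp [hza, hz]
        exact (hf z hz').congr_of_eventuallyEq (hne z hz')
    have hB : ∀ z ∉ F, ‖f' z‖ ≤ C * (1 + ‖z‖) ^ n := by
      intro z hz
      by_cases hza : z = a
      · rw [hza]
        have h1 : Tendsto (fun z => ‖f' z‖) (𝓝[≠] a) (𝓝 ‖f' a‖) :=
          hda.continuousAt.norm.mono_left nhdsWithin_le_nhds
        have h2 : Tendsto (fun z : ℂ => C * (1 + ‖z‖) ^ n) (𝓝[≠] a) (𝓝 (C * (1 + ‖a‖) ^ n)) := by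
          apply (Continuous.tendsto _ _).mono_left nhdsWithin_le_nhds
          fun_prop
        refine le_of_tendsto_of_tendsto h1 h2 ?_
        filter_upwards [nhdsWithin_le_nhds hs, self_mem_nhdsWithin] with w hw hwa
        have : w ∉ insert a F := by
          simp only [Finset.mem_insert, not_or]; exact ⟨hwa, by simpa using hw.2⟩
        rw [(hne w this).eq_of_nhds]
        exact hb w this
      · have hz' : z ∉ insert a F := by simp [hza, hz]
        rw [(hne z hz').eq_of_nhds]; exact hb z hz'
    obtain ⟨p, hp⟩ := ih hA hB
    refine ⟨p, fun z hz => ?_⟩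
    rw [hp z fun h => hz (Finset.mem_insert_of_mem h)]
    exact (hne z hz).eq_of_nhds

open Polynomial in
theorem differentiableAt_coeff_prod {ι : Type*} (A : Finset ι) {a : ι → ℂ → ℂ} {z : ℂ}
    (ha : ∀ i ∈ A, DifferentiableAt ℂ (a i) z) (j : ℕ) :
    DifferentiableAt ℂ (fun w => (∏ i ∈ A, (X - C (a i w))).coeff j) z := by
  classical
  induction A using Finset.induction_on generalizing j with
  | empty => simp
  | insert i A hi ih =>
    have h1 := ih fun k hk => ha k (Finset.mem_insert_of_mem hk)
    have h2 := ha i (Finset.mem_insert_self _ _)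
    simp only [Finset.prod_insert hi, sub_mul, coeff_sub, coeff_C_mul]
    cases j with
    | zero => simpa using (h2.fun_mul (h1 0)).fun_neg
    | succ j => simpa only [coeff_X_mul] using (h1 j).fun_sub (h2.fun_mul (h1 (j + 1)))

open Polynomial in
theorem norm_coeff_prod_le {ι : Type*} (A : Finset ι) (a : ι → ℂ) (j : ℕ) :
    ‖(∏ i ∈ A, (X - C (a i))).coeff j‖ ≤ ∏ i ∈ A, (1 + ‖a i‖) := by
  classical
  induction A using Finset.induction_on generalizing j with
  | empty =>
    simp only [Finset.prod_empty, coeff_one]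
    split_ifs <;> simp
  | insert i A hi ih =>
    simp only [Finset.prod_insert hi, sub_mul, coeff_sub, coeff_C_mul]
    have hp : 0 ≤ ∏ i ∈ A, (1 + ‖a i‖) := Finset.prod_nonneg fun _ _ => by positivity
    have h2 : ∀ j, ‖a i * (∏ i ∈ A, (X - C (a i))).coeff j‖ ≤ ‖a i‖ * ∏ i ∈ A, (1 + ‖a i‖) := by
      intro j; rw [norm_mul]; gcongr; exact ih j
    cases j with
    | zero =>
      simp only [mul_coeff_zero, coeff_X_zero, zero_mul, zero_sub, norm_neg]
      have := h2 0
      rw [norm_mul] at this ⊢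
      linarith
    | succ j =>
      rw [coeff_X_mul]
      calc _ ≤ _ := norm_sub_le _ _
        _ ≤ (∏ i ∈ A, (1 + ‖a i‖)) + ‖a i‖ * ∏ i ∈ A, (1 + ‖a i‖) := add_le_add (ih j) (h2 _)
        _ = _ := by ring

end Growth

section Norm

variable {D : Type*} [TopologicalSpace D] [ChartedSpace ℂ D] [IsManifold 𝓘(ℂ, ℂ) ω D]
  [CompactSpace D] [T2Space D]

theorem sph_injective : Function.Injective sph := fun a b h => by
  rw [← coordU_sph a, h, coordU_sph]

/-- The finite set of coordinates of branch values. -/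
def branchU (f : D → S2) (hf : NonconstHol f) : Finset ℂ :=
  (hf.branchValues_finite.preimage sph_injective.injOn).toFinset

theorem mem_branchU {f : D → S2} {hf : NonconstHol f} {U : ℂ} :
    U ∈ branchU f hf ↔ sph U ∈ branchValues f := by
  rw [branchU, Finite.mem_toFinset]; rfl

open Classical in
/-- Local sections of an unbranched holomorphic map. -/
theorem NonconstHol.local_sections {f : D → S2} (hf : NonconstHol f) {U₀ : ℂ}
    (hU₀ : U₀ ∉ branchU f hf) :
    ∃ σ : D → ℂ → D,
      (∀ p ∈ fib f (sph U₀), ∀ φ : D → ℂ, HolAt φ p → AnalyticAt ℂ (fun U => φ (σ p U)) U₀) ∧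
      ∀ᶠ U in 𝓝 U₀, fib f (sph U) = (fib f (sph U₀)).image (fun p => σ p U) ∧
        InjOn (fun p => σ p U) (fib f (sph U₀)) := by
  have hloc : ∀ p : D, ∃ σ : ℂ → D, p ∈ fib f (sph U₀) →
      (∀ φ : D → ℂ, HolAt φ p → AnalyticAt ℂ (fun U => φ (σ U)) U₀) ∧
      Tendsto σ (𝓝 U₀) (𝓝 p) ∧ ∀ᶠ U in 𝓝 U₀, f (σ U) = sph U := by
    intro p
    by_cases hp : p ∈ fib f (sph U₀)
    swap
    · exact ⟨fun _ => p, fun h => absurd h hp⟩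
    have hfp := hf.mem_fib.1 hp
    have hps : (f p : E3) ≠ -e3 := by rw [hfp]; exact sph_ne_south U₀
    set c := chartAt ℂ p
    have hpc : p ∈ c.source := mem_chart_source ℂ p
    have hg : AnalyticAt ℂ ((fun x => coordU (f x)) ∘ c.symm) (c p) := (hf.hol.2 p).1 hps
    have hgp : ((fun x => coordU (f x)) ∘ c.symm) (c p) = U₀ := by
      simp [c.left_inv hpc, hfp, coordU_sph]
    -- Since `U₀` is no branch value, the local degree is one, which means that `u ∘ f` has nonzero
    -- derivative in the chart; the section is its local inverse.
    have h1 : locDeg f p = 1 := by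
      by_contra h
      exact hU₀ (mem_branchU.2 ⟨p, hfp, h⟩)
    have hd : deriv ((fun x => coordU (f x)) ∘ c.symm) (c p) ≠ 0 := by
      have h2 := hf.localDegree_eq p
      rw [h1, localDegree_of_ne_south hps, ordAt] at h2
      have h3 := hg.analyticOrderAt_deriv_add_one
      rw [hgp] at h3
      have h4 : (fun x => ((fun x => coordU (f x)) ∘ c.symm) x - U₀) =
          (fun x => coordU (f x) - coordU (f p)) ∘ c.symm := by
        funext z; simp [hfp, coordU_sph]
      rw [h4, h2] at h3
      have h5 : analyticOrderAt (deriv ((fun x => coordU (f x)) ∘ c.symm)) (c p) = 0 := by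
        have : analyticOrderAt (deriv ((fun x => coordU (f x)) ∘ c.symm)) (c p) + 1 = 0 + 1 := by
          rw [h3]; rfl
        exact (ENat.add_left_injective_of_ne_top ENat.one_ne_top) this
      exact (hg.deriv.analyticOrderAt_eq_zero).1 h5
    have hs := hg.hasStrictDerivAt
    set r := hs.localInverse _ _ _ hd with hr
    have hra : AnalyticAt ℂ r U₀ := by
      rw [← hgp]; exact hg.analyticAt_localInverse hd
    have hr0 : r U₀ = c p := by
      rw [← hgp]; exact HasStrictFDerivAt.localInverse_apply_image ..
    have hrt : Tendsto r (𝓝 U₀) (𝓝 (c p)) := by rw [← hr0]; exact hra.continuousAt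
    have ht : Tendsto (c.symm ∘ r) (𝓝 U₀) (𝓝 p) := (tendsto_chart_symm p).comp hrt
    refine ⟨c.symm ∘ r, fun _ => ⟨fun φ hφ => ?_, ht, ?_⟩⟩
    · have : AnalyticAt ℂ (φ ∘ c.symm) (r U₀) := by rw [hr0]; exact hφ
      exact this.comp hra
    · have h2 : ∀ᶠ U in 𝓝 U₀, ((fun x => coordU (f x)) ∘ c.symm) (r U) = U := by
        have := hs.eventually_right_inverse hd
        rwa [hgp] at this
      filter_upwards [h2, ht.eventually (hf.hol.eventually_ne_south hps)] with U hU hU'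
      rw [← sph_coordU hU']
      exact congrArg sph hU
  choose σ hσ using hloc
  refine ⟨σ, fun p hp => (hσ p hp).1, ?_⟩
  obtain ⟨V, hV, hVd⟩ := (fib f (sph U₀)).finite_toSet.t2_separation
  have h1 : ∀ᶠ U in 𝓝 U₀, ∀ p ∈ fib f (sph U₀), σ p U ∈ V p ∧ f (σ p U) = sph U := by
    rw [eventually_all_finset]
    intro p hp
    exact ((hσ p hp).2.1.eventually ((hV p).2.mem_nhds (hV p).1)).and (hσ p hp).2.2
  have h2 : ∀ᶠ U in 𝓝 U₀, U ∉ branchU f hf :=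
    (branchU f hf).finite_toSet.isClosed.isOpen_compl.mem_nhds (by simpa using hU₀)
  filter_upwards [h1, h2] with U h1 h2
  have hinj : InjOn (fun p => σ p U) (fib f (sph U₀)) := by
    intro p hp q hq hpq
    by_contra hne
    refine disjoint_left.1 (hVd hp hq hne) (h1 p hp).1 ?_
    have : σ p U = σ q U := hpq
    rw [this]; exact (h1 q hq).1
  -- The local sections inject the fibre over `U₀` into the fibre over `U`. Both fibres have `deg f`
  -- points, because neither value is a branch value, so nothing is missed.
  refine ⟨(Finset.eq_of_subset_of_card_le ?_ ?_).symm, hinj⟩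
  · intro x hx
    obtain ⟨p, hp, rfl⟩ := Finset.mem_image.1 hx
    exact hf.mem_fib.2 (h1 p hp).2
  · rw [Finset.card_image_of_injOn hinj, hf.card_fib (mem_branchU.not.1 h2),
      hf.card_fib (mem_branchU.not.1 hU₀)]

open Polynomial in
/-- The norm polynomial of a function of polynomial growth with respect to `f`. -/
theorem NonconstHol.exists_norm_polynomial {f : D → S2} (hf : NonconstHol f) {φ : D → ℂ}
    (hφ : ∀ p, (f p : E3) ≠ -e3 → HolAt φ p) {B : ℝ} {K : ℕ}
    (hB : ∀ p, (f p : E3) ≠ -e3 → ‖φ p‖ ≤ B * (1 + ‖coordU (f p)‖) ^ K) :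
    ∃ P : ℂ[X][X], P.Monic ∧ P.natDegree = deg f ∧ ∀ U ∉ branchU f hf,
      P.map (evalRingHom U) = ∏ x ∈ fib f (sph U), (X - C (φ x)) := by
  classical
  have hcoef : ∀ j : ℕ, ∃ p : ℂ[X], ∀ U ∉ branchU f hf,
      p.eval U = (∏ x ∈ fib f (sph U), (X - C (φ x))).coeff j := by
    intro j
    -- Each of the `deg f` factors contributes at most `(1 + |B|) (1 + |U|)^K`, and a coefficient of
    -- `∏ (X - aᵢ)` is at most `∏ (1 + |aᵢ|)`.
    refine exists_polynomial_of_growth_off_finite (C := (1 + |B|) ^ deg f) (n := K * deg f)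
      (branchU f hf) ?_ ?_
    · intro U₀ hU₀
      obtain ⟨σ, hσ, hσ'⟩ := hf.local_sections hU₀
      have hd := differentiableAt_coeff_prod (fib f (sph U₀)) (a := fun p U => φ (σ p U)) (z := U₀)
        (fun p hp => (hσ p hp φ (hφ p (by rw [hf.mem_fib.1 hp]; exact sph_ne_south _))
          ).differentiableAt) j
      refine hd.congr_of_eventuallyEq ?_
      filter_upwards [hσ'] with U ⟨h1, h2⟩
      rw [h1, Finset.prod_image h2]
    · intro U hU
      refine (norm_coeff_prod_le _ _ _).trans ?_
      have h1 : ∀ x ∈ fib f (sph U), 1 + ‖φ x‖ ≤ (1 + |B|) * (1 + ‖U‖) ^ K := by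
        intro x hx
        have hfx := hf.mem_fib.1 hx
        have h2 := hB x (by rw [hfx]; exact sph_ne_south _)
        rw [hfx, coordU_sph] at h2
        have h3 : (1 : ℝ) ≤ (1 + ‖U‖) ^ K := one_le_pow₀ (by linarith [norm_nonneg U])
        have h4 : B * (1 + ‖U‖) ^ K ≤ |B| * (1 + ‖U‖) ^ K := by gcongr; exact le_abs_self B
        linarith
      calc ∏ x ∈ fib f (sph U), (1 + ‖φ x‖)
          ≤ ∏ x ∈ fib f (sph U), (1 + |B|) * (1 + ‖U‖) ^ K :=
            Finset.prod_le_prod (fun _ _ => by positivity) h1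
        _ = _ := by
            rw [Finset.prod_const, hf.card_fib (mem_branchU.not.1 hU), mul_pow, ← pow_mul]
  choose p hp using hcoef
  -- Only the coefficients below `deg f` are taken from `p`; the leading one is put in by hand,
  -- which makes the polynomial monic also over the branch values.
  have hdeg : (∑ j ∈ Finset.range (deg f), monomial j (p j)).degree < (deg f : ℕ) := by
    refine lt_of_le_of_lt (degree_sum_le _ _) ?_
    rw [Finset.sup_lt_iff (WithBot.bot_lt_coe _)]
    intro j hj
    refine lt_of_le_of_lt (degree_monomial_le _ _) ?_
    exact_mod_cast Finset.mem_range.1 hj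
  have hmon : (X ^ deg f + ∑ j ∈ Finset.range (deg f), monomial j (p j)).Monic :=
    monic_X_pow_add hdeg
  refine ⟨X ^ deg f + ∑ j ∈ Finset.range (deg f), monomial j (p j), hmon, ?_, ?_⟩
  · rw [natDegree_add_eq_left_of_degree_lt (by rwa [degree_X_pow]), natDegree_X_pow]
  · intro U hU
    have hmon' : (∏ x ∈ fib f (sph U), (X - C (φ x))).Monic :=
      monic_prod_of_monic _ _ fun _ _ => monic_X_sub_C _
    have hnd : (∏ x ∈ fib f (sph U), (X - C (φ x))).natDegree = deg f := by
      rw [natDegree_prod_of_monic _ _ fun _ _ => monic_X_sub_C _]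
      simp [hf.card_fib (mem_branchU.not.1 hU)]
    ext j
    simp only [Polynomial.map_add, Polynomial.map_pow, map_X, Polynomial.map_sum, map_monomial,
      coeff_add, coeff_X_pow, finsetSum_coeff, coeff_monomial, coe_evalRingHom, hp _ U hU]
    rcases lt_trichotomy j (deg f) with h | h | h
    · simp [h.ne, h]
    · rw [h, ← hnd, hmon'.coeff_natDegree, hnd]
      simp
    · rw [coeff_eq_zero_of_natDegree_lt (by rw [hnd]; exact h)]
      simp only [Finset.sum_ite_eq', Finset.mem_range, if_neg h.ne', if_neg (not_lt.2 h.le),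
        add_zero]

end Norm

/-! ## Sections of the pulled back bundle in coordinates, and their zeros -/

section Sections

variable {D : Type*} [TopologicalSpace D] [ChartedSpace ℂ D]

/-- A holomorphic section along `f` of the bundle with transition function `q = u⁴ r`, with
isolated zeros. -/
structure IsSection (f : D → S2) (q r : D → ℂ) : Prop where
  base : NonconstHol f
  holq : ∀ p, (f p : E3) ≠ -e3 → HolAt q p
  holr : ∀ p, (f p : E3) ≠ e3 → HolAt r p
  rel : ∀ p, (f p : E3) ≠ -e3 → (f p : E3) ≠ e3 → q p = coordU (f p) ^ 4 * r p
  isolated : ∀ p, ∀ᶠ x in 𝓝[≠] p, q x ≠ 0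

theorem NonconstHol.isolated_ne_south {f : D → S2} (hf : NonconstHol f) (p : D) :
    ∀ᶠ x in 𝓝[≠] p, (f x : E3) ≠ -e3 := by
  filter_upwards [hf.isolated south p] with x hx
  exact (ne_south_iff _).1 hx

theorem NonconstHol.isolated_ne_north {f : D → S2} (hf : NonconstHol f) (p : D) :
    ∀ᶠ x in 𝓝[≠] p, (f x : E3) ≠ e3 := by
  filter_upwards [hf.isolated north p] with x hx
  exact (ne_north_iff _).1 hx

/-- Since `u v = 1`, the relation `q = u⁴ r` reads `r = v⁴ q`: the notion is symmetric under the
exchange of the two trivializations. -/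
theorem IsSection.flip {f : D → S2} {q r : D → ℂ} (h : IsSection f q r) :
    IsSection (fun x => flipS (f x)) r q := by
  refine ⟨h.base.flip, fun p hp => h.holr p ?_, fun p hp => h.holq p ?_, fun p hp hp' => ?_,
    fun p => ?_⟩
  · rw [coe_flipS, ne_eq, flip_eq_neg_e3] at hp; exact hp
  · rw [coe_flipS, ne_eq, flip_eq_e3] at hp; exact hp
  · rw [coe_flipS, ne_eq, flip_eq_neg_e3] at hp
    rw [coe_flipS, ne_eq, flip_eq_e3] at hp'
    rw [coe_flipS, coordU_flip, h.rel p hp' hp, ← mul_assoc, ← mul_pow, mul_comm (coordV _),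
      coordU_mul_coordV hp' hp, one_pow, one_mul]
  · filter_upwards [h.isolated p, h.base.isolated_ne_south p, h.base.isolated_ne_north p]
      with x hx h1 h2 h3
    exact hx (by rw [h.rel x h1 h2, h3, mul_zero])

open Classical in
/-- The order of vanishing of the section at `p`, as a natural number. -/
def secOrd (f : D → S2) (q r : D → ℂ) (p : D) : ℕ :=
  if (f p : E3) ≠ -e3 then (ordAt q p).toNat else (ordAt r p).toNat

theorem IsSection.ordAt_q {f : D → S2} {q r : D → ℂ} (h : IsSection f q r) {p : D}
    (hp : (f p : E3) ≠ -e3) : ordAt q p = secOrd f q r p := by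
  rw [secOrd, if_pos hp]
  refine (ENat.natCast_toNat ?_).symm
  rw [ne_eq, ordAt_eq_top]
  intro h0
  obtain ⟨x, hx, hx'⟩ := ((h0.filter_mono (nhdsWithin_le_nhds (s := {p}ᶜ))).and
    (h.isolated p)).exists
  exact hx' hx

/-- Where both trivializations are defined, `u⁴` is a unit, so `q` and `r` vanish to the same order;
at the poles only one of them is used on either side. -/
theorem IsSection.secOrd_flip {f : D → S2} {q r : D → ℂ} (h : IsSection f q r) (p : D) :
    secOrd (fun x => flipS (f x)) r q p = secOrd f q r p := by
  by_cases hp : (f p : E3) = e3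
  · rw [secOrd, secOrd, if_neg (by simpa [flip_eq_neg_e3] using hp),
      if_pos (by rw [hp]; exact neg_e3_ne_e3.symm)]
  · rw [secOrd, if_pos (by simpa [flip_eq_neg_e3] using hp)]
    by_cases hp' : (f p : E3) = -e3
    · rw [secOrd, if_neg (by simpa using hp')]
    rw [secOrd, if_pos hp']
    have hu : HolAt (fun x => coordU (f x)) p := (h.base.hol.2 p).1 hp'
    have hu2 : HolAt (fun x => coordU (f x) * coordU (f x)) p := hu.mul hu
    have hu4 : HolAt (fun x => (coordU (f x) * coordU (f x)) * (coordU (f x) * coordU (f x))) p :=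
      hu2.mul hu2
    have hu0 : coordU (f p) ≠ 0 := left_ne_zero_of_mul_eq_one (coordU_mul_coordV hp' hp)
    have e : q =ᶠ[𝓝 p] fun x =>
        ((coordU (f x) * coordU (f x)) * (coordU (f x) * coordU (f x))) * r x := by
      filter_upwards [h.base.hol.eventually_ne_south hp', h.base.hol.eventually_ne_north hp]
        with x h1 h2
      rw [h.rel x h1 h2]; ring
    rw [ordAt_congr e, ordAt_mul hu4 (h.holr p hp), (ordAt_eq_zero hu4).2, zero_add]
    exact mul_ne_zero (mul_ne_zero hu0 hu0) (mul_ne_zero hu0 hu0)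

/-- The preimages of the two closed hemispheres are compact. So `q` is bounded over the upper one
and `r` over the lower one, where `q = u⁴ r`. -/
theorem IsSection.growth [CompactSpace D] {f : D → S2} {q r : D → ℂ} (h : IsSection f q r) :
    ∃ B : ℝ, ∀ p, (f p : E3) ≠ -e3 → ‖q p‖ ≤ B * (1 + ‖coordU (f p)‖) ^ 4 := by
  have hc2 : Continuous fun x => (f x : E3) 2 :=
    (continuous_coord 2).comp (continuous_subtype_val.comp h.base.hol.1)
  have hK1 : IsCompact {x | 0 ≤ (f x : E3) 2} :=
    (isClosed_le continuous_const hc2).isCompact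
  have hK2 : IsCompact {x | (f x : E3) 2 ≤ 0} :=
    (isClosed_le hc2 continuous_const).isCompact
  obtain ⟨B₁, hB₁⟩ := hK1.exists_bound_of_continuousOn (f := q) fun x hx =>
    (h.holq x (by
      rw [ne_neg_e3_iff]; intro h'
      have : 0 ≤ (f x : E3) 2 := hx
      linarith)).continuousAt.continuousWithinAt
  obtain ⟨B₂, hB₂⟩ := hK2.exists_bound_of_continuousOn (f := r) fun x hx =>
    (h.holr x (by
      rw [ne_e3_iff]; intro h'
      have : (f x : E3) 2 ≤ 0 := hx
      linarith)).continuousAt.continuousWithinAt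
  refine ⟨|B₁| + |B₂|, fun p hp => ?_⟩
  have h1 : (1 : ℝ) ≤ (1 + ‖coordU (f p)‖) ^ 4 :=
    one_le_pow₀ (by linarith [norm_nonneg (coordU (f p))])
  have h2 : ‖coordU (f p)‖ ^ 4 ≤ (1 + ‖coordU (f p)‖) ^ 4 := by gcongr; linarith
  rcases le_total 0 ((f p : E3) 2) with h0 | h0
  · have := hB₁ p h0
    nlinarith [le_abs_self B₁, abs_nonneg B₂, abs_nonneg B₁]
  · have hn : (f p : E3) ≠ e3 := by rw [ne_e3_iff]; intro h'; linarith
    rw [h.rel p hp hn, norm_mul, norm_pow]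
    have h3 : ‖r p‖ ≤ |B₂| := (hB₂ p h0).trans (le_abs_self _)
    calc _ ≤ (1 + ‖coordU (f p)‖) ^ 4 * |B₂| := by gcongr
      _ ≤ _ := by nlinarith [abs_nonneg B₁]

/-- If `μ > E`, division by `|U|^E` leaves the positive constant `A` below a multiple of a positive
power of `|U|`, which tends to `0`. -/
theorem le_of_pow_comparison {A B : ℝ} (hA : 0 < A) {E μ : ℕ}
    (h : ∀ᶠ U : ℂ in 𝓝[≠] 0, A * ‖U‖ ^ E ≤ B * ‖U‖ ^ μ) : μ ≤ E := by
  by_contra hlt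
  push Not at hlt
  obtain ⟨j, rfl⟩ := Nat.exists_eq_add_of_lt hlt
  have h1 : ∀ᶠ U : ℂ in 𝓝[≠] 0, A ≤ B * ‖U‖ ^ (j + 1) := by
    filter_upwards [h, self_mem_nhdsWithin] with U hU hU0
    have : 0 < ‖U‖ ^ E := by
      have : 0 < ‖U‖ := norm_pos_iff.2 hU0
      positivity
    rw [add_assoc, pow_add] at hU
    by_contra hlt'
    push Not at hlt'
    nlinarith
  have h2 : Tendsto (fun U : ℂ => B * ‖U‖ ^ (j + 1)) (𝓝[≠] 0) (𝓝 (B * ‖(0 : ℂ)‖ ^ (j + 1))) := by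
    apply (Continuous.tendsto _ _).mono_left nhdsWithin_le_nhds
    fun_prop
  have := ge_of_tendsto h2 h1
  simp at this
  linarith

variable [IsManifold 𝓘(ℂ, ℂ) ω D]

/-- Comparison of the section with the coordinate `u` near a point. -/
theorem IsSection.local_compare {f : D → S2} {q r : D → ℂ} (h : IsSection f q r) {p : D}
    (hp : (f p : E3) ≠ -e3) :
    ∃ α β : ℝ, 0 < α ∧ 0 < β ∧ ∀ᶠ x in 𝓝 p,
      α * ‖coordU (f x) - coordU (f p)‖ ^ secOrd f q r p ≤ ‖q x‖ ^ locDeg f p ∧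
      ‖q x‖ ^ locDeg f p ≤ β * ‖coordU (f x) - coordU (f p)‖ ^ secOrd f q r p := by
  have h1 := h.base.localDegree_eq p
  rw [localDegree_of_ne_south hp] at h1
  obtain ⟨c, C, hc, hC, hcC⟩ := norm_comparable (((h.base.hol.2 p).1 hp).sub_const _) h1
  obtain ⟨c', C', hc', hC', hcC'⟩ := norm_comparable (h.holq p hp) (h.ordAt_q hp)
  set e := secOrd f q r p
  set k := locDeg f p
  -- With `t` the distance in the chart, `|q|` is comparable to `t^e` and `|u - u(p)|` to `t^k`.
  -- Hence `|q|^k` and `|u - u(p)|^e` are both comparable to `t^(k e)`, without fractional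
  -- exponents.
  refine ⟨c' ^ k / C ^ e, C' ^ k / c ^ e, by positivity, by positivity, ?_⟩
  have hx : ∀ᶠ x in 𝓝 p, x ∈ (chartAt ℂ p).source := chart_source_mem_nhds ℂ p
  have hz := ((chartAt ℂ p).continuousAt (mem_chart_source ℂ p)).eventually (hcC.and hcC')
  filter_upwards [hx, hz] with x hx ⟨⟨h1, h2⟩, h3, h4⟩
  simp only [Function.comp_apply, (chartAt ℂ p).left_inv hx] at h1 h2 h3 h4
  set t := ‖chartAt ℂ p x - chartAt ℂ p p‖
  have ht : 0 ≤ t := norm_nonneg _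
  have htt : (t ^ k) ^ e = (t ^ e) ^ k := by rw [← pow_mul, ← pow_mul, mul_comm]
  constructor
  · rw [div_mul_eq_mul_div, div_le_iff₀ (by positivity)]
    calc c' ^ k * ‖coordU (f x) - coordU (f p)‖ ^ e ≤ c' ^ k * (C * t ^ k) ^ e := by gcongr
      _ = (c' * t ^ e) ^ k * C ^ e := by rw [mul_pow, mul_pow, htt]; ring
      _ ≤ _ := by gcongr
  · rw [div_mul_eq_mul_div, le_div_iff₀ (by positivity)]
    calc ‖q x‖ ^ k * c ^ e ≤ (C' * t ^ e) ^ k * c ^ e := by gcongr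
      _ = C' ^ k * (c * t ^ k) ^ e := by rw [mul_pow, mul_pow, htt]; ring
      _ ≤ _ := by gcongr

variable [CompactSpace D] [T2Space D]

/-- The order at `a` of the norm of a section. -/
theorem IsSection.rootMultiplicity_norm {f : D → S2} {q r : D → ℂ} (h : IsSection f q r)
    {p : Polynomial ℂ} (hp0 : p ≠ 0)
    (hp : ∀ U ∉ branchU f h.base, ‖p.eval U‖ = ∏ x ∈ fib f (sph U), ‖q x‖) (a : ℂ) :
    p.rootMultiplicity a = ∑ x ∈ fib f (sph a), secOrd f q r x := by
  have hs : ∀ x ∈ fib f (sph a), (f x : E3) ≠ -e3 := fun x hx => by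
    rw [h.base.mem_fib.1 hx]; exact sph_ne_south a
  have hfa : ∀ x ∈ fib f (sph a), coordU (f x) = a := fun x hx => by
    rw [h.base.mem_fib.1 hx, coordU_sph]
  have hloc : ∀ x : D, ∃ α β : ℝ, 0 < α ∧ 0 < β ∧ (x ∈ fib f (sph a) → ∀ᶠ y in 𝓝 x,
      α * ‖coordU (f y) - a‖ ^ secOrd f q r x ≤ ‖q y‖ ^ locDeg f x ∧
      ‖q y‖ ^ locDeg f x ≤ β * ‖coordU (f y) - a‖ ^ secOrd f q r x) := by
    intro x
    by_cases hx : x ∈ fib f (sph a)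
    · obtain ⟨α, β, hα, hβ, hh⟩ := h.local_compare (hs x hx)
      rw [hfa x hx] at hh
      exact ⟨α, β, hα, hβ, fun _ => hh⟩
    · exact ⟨1, 1, one_pos, one_pos, fun h' => absurd h' hx⟩
  choose α β hα hβ hαβ using hloc
  obtain ⟨W, hW, hWd, hWs⟩ := h.base.fibres_near (sph a)
    (U := fun x => {y | x ∈ fib f (sph a) →
      α x * ‖coordU (f y) - a‖ ^ secOrd f q r x ≤ ‖q y‖ ^ locDeg f x ∧
      ‖q y‖ ^ locDeg f x ≤ β x * ‖coordU (f y) - a‖ ^ secOrd f q r x})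
    (fun x => by
      by_cases hx : x ∈ fib f (sph a)
      · filter_upwards [hαβ x hx] with y hy _; exact hy
      · filter_upwards with y hy; exact absurd hy hx)
  have hst : Tendsto sph (𝓝[≠] a) (𝓝[≠] (sph a)) := by
    refine tendsto_nhdsWithin_iff.2 ⟨continuous_sph.continuousAt.mono_left nhdsWithin_le_nhds, ?_⟩
    filter_upwards [self_mem_nhdsWithin] with U hU h'
    exact hU (sph_injective h')
  set E := ∑ x ∈ fib f (sph a), secOrd f q r x with hE
  have hcmp : ∀ᶠ U in 𝓝[≠] a, (∏ x ∈ fib f (sph a), α x) * ‖U - a‖ ^ E ≤ ‖p.eval U‖ ∧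
      ‖p.eval U‖ ≤ (∏ x ∈ fib f (sph a), β x) * ‖U - a‖ ^ E := by
    have hnb : ∀ᶠ U in 𝓝[≠] a, U ∉ branchU f h.base := by
      filter_upwards [hst.eventually hWs] with U hU hbU
      obtain ⟨x, hx, hx'⟩ := mem_branchU.1 hbU
      exact hx' (hU.2.1 x hx)
    filter_upwards [hst.eventually hWs, hnb] with U ⟨hcov, _, hF⟩ hU
    choose! F hFc hFm using hF
    rw [hp U hU, prod_fib_eq h.base hWd hcov hFm, hE, ← Finset.prod_pow_eq_pow_sum,
      ← Finset.prod_mul_distrib, ← Finset.prod_mul_distrib]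
    -- Near `x` there are `k = locDeg f x` points over `U`, each with `|q|^k` comparable to `|U -
    -- a|^e`, where `e` is the order of the section at `x`. The product of the `k` factors `|q|` is
    -- therefore comparable to `|U - a|^e`, as one sees after raising it to the power `k`.
    have key : ∀ x ∈ fib f (sph a), α x * ‖U - a‖ ^ secOrd f q r x ≤ ∏ y ∈ F x, ‖q y‖ ∧
        ∏ y ∈ F x, ‖q y‖ ≤ β x * ‖U - a‖ ^ secOrd f q r x := by
      intro x hx
      have hk := (h.base.locDeg_pos x).ne'
      have hb : ∀ y ∈ F x, α x * ‖U - a‖ ^ secOrd f q r x ≤ ‖q y‖ ^ locDeg f x ∧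
          ‖q y‖ ^ locDeg f x ≤ β x * ‖U - a‖ ^ secOrd f q r x := by
        intro y hy
        obtain ⟨hy1, hy2⟩ := (hFm x hx y).1 hy
        have := (hW x hx).1 hy1 hx
        rwa [hy2, coordU_sph] at this
      have h0 := (hα x).le
      have h0' := (hβ x).le
      have hpn : 0 ≤ ∏ y ∈ F x, ‖q y‖ := Finset.prod_nonneg fun _ _ => norm_nonneg _
      constructor
      · refine le_of_pow_le_pow_left₀ hk hpn ?_
        rw [← Finset.prod_pow]
        calc _ = ∏ y ∈ F x, (α x * ‖U - a‖ ^ secOrd f q r x) := by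
              rw [Finset.prod_const, hFc x hx]
          _ ≤ _ := Finset.prod_le_prod (fun _ _ => by positivity) fun y hy => (hb y hy).1
      · refine le_of_pow_le_pow_left₀ hk (by positivity) ?_
        rw [← Finset.prod_pow]
        calc _ ≤ ∏ y ∈ F x, (β x * ‖U - a‖ ^ secOrd f q r x) :=
              Finset.prod_le_prod (fun _ _ => by positivity) fun y hy => (hb y hy).2
          _ = _ := by rw [Finset.prod_const, hFc x hx]
    exact ⟨Finset.prod_le_prod (fun x _ => mul_nonneg (hα x).le (by positivity))
      fun x hx => (key x hx).1, Finset.prod_le_prod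
      (fun x _ => Finset.prod_nonneg fun _ _ => norm_nonneg _) fun x hx => (key x hx).2⟩
  set μ := p.rootMultiplicity a with hμ
  -- Splitting off the root, `|p(U)|` is comparable to `|U - a|^μ`; the two comparisons force `μ =
  -- E`.
  obtain ⟨g, hg, hg'⟩ := p.exists_eq_pow_rootMultiplicity_mul_and_not_dvd hp0 a
  have hga : g.eval a ≠ 0 := fun h' => hg' (Polynomial.dvd_iff_isRoot.2 h')
  have hpe : ∀ U, ‖p.eval U‖ = ‖U - a‖ ^ μ * ‖g.eval U‖ := by
    intro U
    conv_lhs => rw [hg]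
    simp [hμ]
  have hgc : ContinuousAt (fun U => ‖g.eval U‖) a := g.continuous.norm.continuousAt
  have hgp : 0 < ‖g.eval a‖ := norm_pos_iff.2 hga
  have hg1 : ∀ᶠ U in 𝓝[≠] a, ‖g.eval a‖ / 2 < ‖g.eval U‖ :=
    nhdsWithin_le_nhds (hgc.eventually (lt_mem_nhds (by linarith)))
  have hg2 : ∀ᶠ U in 𝓝[≠] a, ‖g.eval U‖ < 2 * ‖g.eval a‖ :=
    nhdsWithin_le_nhds (hgc.eventually (gt_mem_nhds (by linarith)))
  have hshift : Tendsto (fun U : ℂ => U + a) (𝓝[≠] 0) (𝓝[≠] a) := by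
    refine tendsto_nhdsWithin_iff.2 ⟨?_, ?_⟩
    · have : Tendsto (fun U : ℂ => U + a) (𝓝 0) (𝓝 (0 + a)) :=
        (continuous_id.add continuous_const).tendsto 0
      rw [zero_add] at this
      exact this.mono_left nhdsWithin_le_nhds
    · filter_upwards [self_mem_nhdsWithin] with U hU h'
      exact hU (by simpa using h')
  apply le_antisymm
  · refine le_of_pow_comparison (A := ∏ x ∈ fib f (sph a), α x) (B := 2 * ‖g.eval a‖)
      (Finset.prod_pos fun x _ => hα x) ?_
    filter_upwards [hshift.eventually hcmp, hshift.eventually hg2] with U h1 h2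
    have := h1.1
    rw [hpe, add_sub_cancel_right] at this
    have h3 : 0 ≤ ‖U‖ ^ μ := by positivity
    nlinarith
  · refine le_of_pow_comparison (A := ‖g.eval a‖ / 2) (B := ∏ x ∈ fib f (sph a), β x)
      (by positivity) ?_
    filter_upwards [hshift.eventually hcmp, hshift.eventually hg1] with U h1 h2
    have := h1.2
    rw [hpe, add_sub_cancel_right] at this
    have h3 : 0 ≤ ‖U‖ ^ μ := by positivity
    nlinarith

end Sections

/-! ### The norm of a section and the number of its zeros. -/

section NormOfSection

variable {D : Type*} [TopologicalSpace D] [ChartedSpace ℂ D] [IsManifold 𝓘(ℂ, ℂ) ω D]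
  [CompactSpace D] [T2Space D]

open Polynomial in
/-- `P` is the norm, with respect to `f`, of the difference of a variable and `q`. -/
structure IsNorm (f : D → S2) (hf : NonconstHol f) (q : D → ℂ) (P : ℂ[X][X]) : Prop where
  monic : P.Monic
  natDegree : P.natDegree = deg f
  map_eq : ∀ U ∉ branchU f hf, P.map (evalRingHom U) = ∏ x ∈ fib f (sph U), (X - C (q x))

theorem IsSection.exists_norm {f : D → S2} {q r : D → ℂ} (h : IsSection f q r) :
    ∃ P, IsNorm f h.base q P := by
  obtain ⟨B, hB⟩ := h.growth
  obtain ⟨P, h1, h2, h3⟩ := h.base.exists_norm_polynomial h.holq hB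
  exact ⟨P, h1, h2, h3⟩

theorem IsNorm.eval_coeff {f : D → S2} {hf : NonconstHol f} {q : D → ℂ}
    {P : Polynomial (Polynomial ℂ)} (hP : IsNorm f hf q P) {U : ℂ} (hU : U ∉ branchU f hf) :
    (P.coeff 0).eval U = ∏ x ∈ fib f (sph U), (-q x) := by
  have h1 := congrArg (fun p : Polynomial ℂ => p.coeff 0) (hP.map_eq U hU)
  simp only [Polynomial.coeff_map, Polynomial.coe_evalRingHom] at h1
  rw [h1, Polynomial.coeff_zero_eq_eval_zero, Polynomial.eval_prod]
  simp

omit [IsManifold 𝓘(ℂ, ℂ) ω D] [T2Space D] in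
theorem IsSection.zeros_finite {f : D → S2} {q r : D → ℂ} (h : IsSection f q r) :
    {x | q x = 0}.Finite :=
  finite_of_eventually_ne h.isolated

/-- The section has only finitely many zeros, so a general fibre contains none of them, and the
product of the values `-q x` over it is nonzero. -/
theorem IsSection.norm_coeff_ne_zero {f : D → S2} {q r : D → ℂ} (h : IsSection f q r)
    {P : Polynomial (Polynomial ℂ)} (hP : IsNorm f h.base q P) : P.coeff 0 ≠ 0 := by
  intro h0
  have hfin : ((branchU f h.base : Set ℂ) ∪ (fun x => coordU (f x)) '' {x | q x = 0}).Finite :=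
    (branchU f h.base).finite_toSet.union (h.zeros_finite.image _)
  obtain ⟨U, hU⟩ := hfin.infinite_compl.nonempty
  simp only [mem_compl_iff, mem_union, not_or] at hU
  have h1 := hP.eval_coeff (by simpa using hU.1)
  rw [h0, Polynomial.eval_zero] at h1
  obtain ⟨x, hx, hx'⟩ := Finset.prod_eq_zero_iff.1 h1.symm
  refine hU.2 ⟨x, neg_eq_zero.1 hx', ?_⟩
  simp only [h.base.mem_fib.1 hx, coordU_sph]

theorem IsSection.rootMultiplicity_coeff {f : D → S2} {q r : D → ℂ} (h : IsSection f q r)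
    {P : Polynomial (Polynomial ℂ)} (hP : IsNorm f h.base q P) (a : ℂ) :
    (P.coeff 0).rootMultiplicity a = ∑ x ∈ fib f (sph a), secOrd f q r x := by
  refine h.rootMultiplicity_norm (h.norm_coeff_ne_zero hP) (fun U hU => ?_) a
  rw [hP.eval_coeff hU, norm_prod]
  simp

theorem sph_zero : sph 0 = north := by
  apply Subtype.ext
  apply ext3 <;> simp [sph, sphVec, north]

theorem flipS_north : flipS north = south := Subtype.ext flip_e3

theorem flipS_sph {V : ℂ} (hV : V ≠ 0) : flipS (sph V) = sph V⁻¹ := by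
  have hne : (sph V : E3) ≠ e3 := by
    intro h
    have := coordU_sph V
    rw [h, coordU_north] at this
    exact hV this.symm
  have h1 : (flipS (sph V) : E3) ≠ -e3 := by
    rw [coe_flipS, ne_eq, flip_eq_neg_e3]; exact hne
  rw [← sph_coordU h1, coe_flipS, coordU_flip, coordV_eq_inv, coordU_sph]

omit [IsManifold 𝓘(ℂ, ℂ) ω D] [T2Space D] in
theorem fib_flip {f : D → S2} (hf : NonconstHol f) (s : S2) :
    fib (fun x => flipS (f x)) (flipS s) = fib f s := by
  ext x
  rw [hf.flip.mem_fib, hf.mem_fib]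
  exact ⟨fun h => by rw [← flipS_flipS (f x), h, flipS_flipS], fun h => by rw [h]⟩

/-- The place where the transition function `u⁴` enters. Multiplying `r = V⁴ q` over the `d` points
of a fibre gives `p'(V) = V^(4d) p(1/V)`, and `p(1/V) = V^(-deg p) · reverse p (V)`. As `reverse p`
does not vanish at `0`, comparing orders at `0` gives the formula. -/
theorem IsSection.rootMultiplicity_total {f : D → S2} {q r : D → ℂ} (h : IsSection f q r)
    {P P' : Polynomial (Polynomial ℂ)} (hP : IsNorm f h.base q P)
    (hP' : IsNorm (fun x => flipS (f x)) h.flip.base r P') :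
    (P.coeff 0).natDegree + (P'.coeff 0).rootMultiplicity 0 = 4 * deg f := by
  set p := P.coeff 0
  set p' := P'.coeff 0
  have hp : p ≠ 0 := h.norm_coeff_ne_zero hP
  have hp' : p' ≠ 0 := h.flip.norm_coeff_ne_zero hP'
  have hrev : p.reverse ≠ 0 := by simpa using hp
  -- A polynomial identity can be checked at infinitely many points, so `0` and the branch values of
  -- both coordinates may be avoided.
  have key : Polynomial.X ^ p.natDegree * p' = Polynomial.X ^ (4 * deg f) * p.reverse := by
    refine Polynomial.eq_of_infinite_eval_eq _ _ (Infinite.mono (s :=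
      ({0} ∪ (branchU _ h.flip.base : Set ℂ) ∪
        (fun z => z⁻¹) '' (branchU f h.base : Set ℂ))ᶜ) ?_ ?_)
    · intro V hV
      simp only [mem_compl_iff, mem_union, not_or, mem_singleton_iff] at hV
      obtain ⟨⟨hV0, hV1⟩, hV2⟩ := hV
      have hV2' : V⁻¹ ∉ branchU f h.base := fun h' => hV2 ⟨V⁻¹, h', inv_inv V⟩
      have e1 := hP'.eval_coeff (U := V) (by simpa using hV1)
      have e2 := hP.eval_coeff hV2'
      rw [← flipS_flipS (sph V), fib_flip h.base, flipS_sph hV0] at e1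
      have e3 : ∏ x ∈ fib f (sph V⁻¹), (-r x) = V ^ (4 * deg f) * ∏ x ∈ fib f (sph V⁻¹), (-q x) := by
        rw [pow_mul, ← h.base.card_fib (mem_branchU.not.1 hV2'), ← Finset.prod_const,
          ← Finset.prod_mul_distrib]
        refine Finset.prod_congr rfl fun x hx => ?_
        have hfx := h.base.mem_fib.1 hx
        have hs : (f x : E3) ≠ -e3 := by rw [hfx]; exact sph_ne_south _
        have hn : (f x : E3) ≠ e3 := by
          rw [hfx, ← ne_north_iff, ← sph_zero]
          exact fun h' => inv_ne_zero hV0 (sph_injective h')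
        rw [h.rel x hs hn, hfx, coordU_sph]
        field_simp
      have hinv : Invertible V⁻¹ := invertibleOfNonzero (inv_ne_zero hV0)
      have e4 := Polynomial.eval₂_reverse_mul_pow (RingHom.id ℂ) V⁻¹ p
      rw [invOf_eq_inv, inv_inv, Polynomial.eval₂_id, Polynomial.eval₂_id] at e4
      show Polynomial.eval V _ = Polynomial.eval V _
      simp only [Polynomial.eval_mul, Polynomial.eval_pow, Polynomial.eval_X]
      rw [e1, e3, ← e2, ← e4, inv_pow]
      field_simp
    · refine Set.Finite.infinite_compl ?_
      exact ((finite_singleton _).union (Finset.finite_toSet _)).union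
        ((Finset.finite_toSet _).image _)
  -- The trailing degree is the order at `0`; that of a reversed polynomial is zero.
  have h1 := congrArg Polynomial.natTrailingDegree key
  rw [mul_comm, Polynomial.natTrailingDegree_mul_X_pow hp', mul_comm,
    Polynomial.natTrailingDegree_mul_X_pow hrev, Polynomial.natTrailingDegree_reverse,
    ← Polynomial.rootMultiplicity_eq_natTrailingDegree'] at h1
  omega

open Classical in
/-- The number of zeros of a section, with multiplicity. -/
theorem IsSection.sum_secOrd {f : D → S2} {q r : D → ℂ} (h : IsSection f q r) {Z : Finset D}
    (hZ : ∀ x, secOrd f q r x ≠ 0 → x ∈ Z) : ∑ x ∈ Z, secOrd f q r x = 4 * deg f := by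
  obtain ⟨P, hP⟩ := h.exists_norm
  obtain ⟨P', hP'⟩ := h.flip.exists_norm
  rw [← h.rootMultiplicity_total hP hP']
  -- The zeros above `-e₃` are seen by `p'` at `0`. All the others lie above roots of `p`, whose
  -- multiplicities add up to `deg p`.
  have e0 : (P'.coeff 0).rootMultiplicity 0 = ∑ x ∈ fib f south, secOrd f q r x := by
    rw [h.flip.rootMultiplicity_coeff hP' 0, sph_zero, ← flipS_flipS north, flipS_north,
      fib_flip h.base]
    exact Finset.sum_congr rfl fun x _ => h.secOrd_flip x
  have e1 : (P.coeff 0).natDegree =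
      ∑ a ∈ (P.coeff 0).roots.toFinset, ∑ x ∈ fib f (sph a), secOrd f q r x := by
    rw [← (IsAlgClosed.splits (P.coeff 0)).natDegree_eq_card_roots.symm,
      ← Multiset.toFinset_sum_count_eq]
    refine Finset.sum_congr rfl fun a _ => ?_
    rw [Polynomial.count_roots, h.rootMultiplicity_coeff hP]
  have hd : ∀ a b : ℂ, a ≠ b → Disjoint (fib f (sph a)) (fib f (sph b)) := by
    intro a b hab
    rw [Finset.disjoint_left]
    intro x hx hx'
    rw [h.base.mem_fib] at hx hx'
    exact hab (sph_injective (hx.symm.trans hx'))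
  rw [e0, e1, ← Finset.sum_biUnion fun a _ b _ hab => hd a b hab, ← Finset.sum_union]
  · set T := (P.coeff 0).roots.toFinset.biUnion (fun a => fib f (sph a)) ∪ fib f south
    have hT : ∀ x, secOrd f q r x ≠ 0 → x ∈ T := by
      intro x hx
      by_cases hs : (f x : E3) = -e3
      · refine Finset.mem_union_right _ (h.base.mem_fib.2 (Subtype.ext hs))
      · refine Finset.mem_union_left _ (Finset.mem_biUnion.2 ⟨coordU (f x), ?_, ?_⟩)
        · rw [Multiset.mem_toFinset, ← Multiset.count_pos, Polynomial.count_roots,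
            h.rootMultiplicity_coeff hP, sph_coordU hs]
          exact Finset.sum_pos' (fun _ _ => Nat.zero_le _)
            ⟨x, h.base.mem_fib.2 rfl, Nat.pos_of_ne_zero hx⟩
        · rw [h.base.mem_fib, sph_coordU hs]
    rw [Finset.sum_subset (Finset.subset_union_left (s₂ := T)),
      Finset.sum_subset (Finset.subset_union_right (s₁ := Z) (s₂ := T))]
    · intro x _ hx; by_contra h'; exact hx (hT x h')
    · intro x _ hx; by_contra h'; exact hx (hZ x h')
  · rw [Finset.disjoint_left]
    intro x hx hx'
    obtain ⟨a, -, ha⟩ := Finset.mem_biUnion.1 hx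
    rw [h.base.mem_fib] at ha hx'
    exact sph_ne_south a (by rw [← ha, hx']; rfl)

end NormOfSection

/-! ## The equation of the image curve -/

section Equation

open Polynomial

/-- The kernel of a map from a polynomial ring over an integrally closed domain to a domain is
generated by a monic polynomial, if it contains one and no constants. -/
theorem exists_monic_generator {R S : Type*} [CommRing R] [IsDomain R] [IsIntegrallyClosed R]
    [CommRing S] [IsDomain S] (φ : R[X] →+* S) {P : R[X]} (hP : P.Monic) (hφ : φ P = 0)
    (hC : ∀ a, φ (C a) = 0 → a = 0) :
    ∃ P₀ : R[X], P₀.Monic ∧ 0 < P₀.natDegree ∧ ∀ g, φ g = 0 ↔ P₀ ∣ g := by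
  let _ : Algebra R S := (φ.comp C).toAlgebra
  have hae : ∀ g : R[X], aeval (φ X) g = φ g := by
    intro g
    rw [aeval_def, RingHom.algebraMap_toAlgebra, ← hom_eval₂, eval₂_C_X]
  have hint : IsIntegral R (φ X) := ⟨P, hP, by rw [← aeval_def, hae, hφ]⟩
  have htf : Module.IsTorsionFree R S := by
    rw [Module.isTorsionFree_iff_algebraMap_injective, injective_iff_map_eq_zero]
    exact fun a ha => hC a ha
  -- `P` makes `φ X` integral over `R`, and `hC` makes `S` torsion-free. Over an integrally closed
  -- domain the minimal polynomial of an integral element then divides every polynomial that it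
  -- satisfies.
  refine ⟨minpoly R (φ X), minpoly.monic hint, minpoly.natDegree_pos hint, fun g => ?_⟩
  rw [← minpoly.isIntegrallyClosed_dvd_iff hint, hae]

variable {D : Type*} [TopologicalSpace D] [ChartedSpace ℂ D]

/-- Evaluation of a polynomial in two variables at the point `(u, q)`. -/
def evUQ (f : D → S2) (q : D → ℂ) (x : D) : ℂ[X][X] →+* ℂ :=
  eval₂RingHom (evalRingHom (coordU (f x))) (q x)

omit [TopologicalSpace D] [ChartedSpace ℂ D] in
theorem evUQ_eq (f : D → S2) (q : D → ℂ) (x : D) (g : ℂ[X][X]) :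
    evUQ f q x g = (g.map (evalRingHom (coordU (f x)))).eval (q x) := by
  rw [evUQ, coe_eval₂RingHom, eval_map]

theorem MeroAt.add {f g : D → ℂ} {p : D} (hf : MeroAt f p) (hg : MeroAt g p) :
    MeroAt (fun x => f x + g x) p :=
  MeromorphicAt.add (f := f ∘ (chartAt ℂ p).symm) (g := g ∘ (chartAt ℂ p).symm) hf hg

theorem MeroAt.mul {f g : D → ℂ} {p : D} (hf : MeroAt f p) (hg : MeroAt g p) :
    MeroAt (fun x => f x * g x) p :=
  MeromorphicAt.mul (f := f ∘ (chartAt ℂ p).symm) (g := g ∘ (chartAt ℂ p).symm) hf hg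

theorem meroAt_const (c : ℂ) (p : D) : MeroAt (fun _ => c) p :=
  MeromorphicAt.const c _

theorem HolAt.add {f g : D → ℂ} {p : D} (hf : HolAt f p) (hg : HolAt g p) :
    HolAt (fun x => f x + g x) p :=
  AnalyticAt.add (f := f ∘ (chartAt ℂ p).symm) (g := g ∘ (chartAt ℂ p).symm) hf hg

theorem holAt_const (c : ℂ) (p : D) : HolAt (fun _ => c) p := analyticAt_const

theorem HolToS2.meroAt {f : D → S2} (hf : HolToS2 f) (p : D) :
    MeroAt (fun x => coordU (f x)) p := by
  by_cases hp : (f p : E3) = -e3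
  · have h1 : HolAt (fun x => coordV (f x)) p := (hf.2 p).2 (by rw [hp]; exact neg_e3_ne_e3)
    simp only [coordU_eq_inv]
    exact MeromorphicAt.inv (f := (fun x => coordV (f x)) ∘ (chartAt ℂ p).symm) h1.meroAt
  · exact ((hf.2 p).1 hp).meroAt

theorem IsSection.meroAt {f : D → S2} {q r : D → ℂ} (h : IsSection f q r) (p : D) :
    MeroAt q p := by
  by_cases hp : (f p : E3) = -e3
  · have h1 : HolAt r p := h.holr p (by rw [hp]; exact neg_e3_ne_e3)
    have h2 := h.base.hol.meroAt p
    refine (((h2.mul h2).mul (h2.mul h2)).mul h1.meroAt).congr ?_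
    filter_upwards [h.base.isolated_ne_south p, h.base.isolated_ne_north p] with x h3 h4
    rw [h.rel x h3 h4]; ring
  · exact (h.holq p hp).meroAt

omit [TopologicalSpace D] [ChartedSpace ℂ D] in
-- Every class of functions that contains the constants, `u` and `q` and is closed under sums and
-- products contains all polynomials in `u` and `q`. It is applied to meromorphic and to holomorphic
-- functions.
theorem evUQ_induction {f : D → S2} {q : D → ℂ} {M : (D → ℂ) → Prop}
    (hadd : ∀ a b, M a → M b → M fun x => a x + b x)
    (hmul : ∀ a b, M a → M b → M fun x => a x * b x) (hconst : ∀ c, M fun _ => c)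
    (hu : M fun x => coordU (f x)) (hq : M q) (g : ℂ[X][X]) : M fun x => evUQ f q x g := by
  induction g using Polynomial.induction_on with
  | C a =>
    simp only [evUQ, coe_eval₂RingHom, eval₂_C, coe_evalRingHom]
    induction a using Polynomial.induction_on with
    | C c => simpa using hconst c
    | add a b ha hb => simpa using hadd _ _ ha hb
    | monomial n c ih =>
      have := hmul _ _ ih hu
      simp only [eval_mul, eval_C, eval_pow, eval_X] at this ⊢
      simpa only [pow_succ, mul_assoc] using this
  | add a b ha hb => simpa using hadd _ _ ha hb
  | monomial n c ih =>
    have := hmul _ _ ih hq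
    simp only [evUQ, coe_eval₂RingHom, eval₂_mul, eval₂_pow, eval₂_X] at this ⊢
    simpa only [pow_succ, mul_assoc] using this

/-- The ideal of polynomial relations between `u` and `q`. -/
def relIdeal (f : D → S2) (q : D → ℂ) : Ideal ℂ[X][X] where
  carrier := {g | ∀ x, (f x : E3) ≠ -e3 → evUQ f q x g = 0}
  add_mem' := fun ha hb x hx => by rw [map_add, ha x hx, hb x hx, add_zero]
  zero_mem' := fun x _ => map_zero _
  smul_mem' := fun c a ha x hx => by rw [smul_eq_mul, map_mul, ha x hx, mul_zero]

omit [TopologicalSpace D] [ChartedSpace ℂ D] in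
theorem mem_relIdeal {f : D → S2} {q : D → ℂ} {g : ℂ[X][X]} :
    g ∈ relIdeal f q ↔ ∀ x, (f x : E3) ≠ -e3 → evUQ f q x g = 0 := Iff.rfl

/-- The function `g(u, q)` is meromorphic on all of `D`, also above `-e₃`, so the identity theorem
applies. If it vanished on all punctured neighbourhoods, continuity would make it vanish at every
point not above `-e₃`, and `g` would be a relation. -/
theorem IsSection.isolated_of_not_mem [T1Space D] [PreconnectedSpace D]
    {f : D → S2} {q r : D → ℂ} (h : IsSection f q r)
    {g : ℂ[X][X]} (hg : g ∉ relIdeal f q) (p : D) : ∀ᶠ x in 𝓝[≠] p, evUQ f q x g ≠ 0 := by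
  have hm : ∀ p, MeroAt (fun x => evUQ f q x g) p := fun p =>
    evUQ_induction (M := fun a => MeroAt a p) (fun _ _ => MeroAt.add) (fun _ _ => MeroAt.mul)
      (fun c => meroAt_const c p) (h.base.hol.meroAt p) (h.meroAt p) g
  rcases mero_identity hm with h0 | h0
  · exfalso
    refine hg (mem_relIdeal.2 fun x hx => ?_)
    have hh : HolAt (fun x => evUQ f q x g) x :=
      evUQ_induction (M := fun a => HolAt a x) (fun _ _ => HolAt.add) (fun _ _ => HolAt.mul)
        (fun c => holAt_const c x) ((h.base.hol.2 x).1 hx) (h.holq x hx) g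
    exact tendsto_nhds_unique (hh.continuousAt.mono_left nhdsWithin_le_nhds)
      (tendsto_const_nhds.congr' ((h0 x).mono fun y hy => hy.symm))
  · exact h0 p

theorem IsSection.finite_of_not_mem [CompactSpace D] [T1Space D] [PreconnectedSpace D]
    {f : D → S2} {q r : D → ℂ} (h : IsSection f q r)
    {g : ℂ[X][X]} (hg : g ∉ relIdeal f q) : {x | evUQ f q x g = 0}.Finite :=
  finite_of_eventually_ne (h.isolated_of_not_mem hg)

/-- Two polynomials outside the ideal have isolated zeros on `D`, so near any point there is another
one at which neither vanishes. -/
theorem IsSection.relIdeal_isPrime [T1Space D] [ConnectedSpace D]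
    {f : D → S2} {q r : D → ℂ} (h : IsSection f q r) : (relIdeal f q).IsPrime := by
  obtain ⟨p⟩ := (inferInstance : Nonempty D)
  rw [Ideal.isPrime_iff]
  refine ⟨fun htop => ?_, fun {a b} hab => ?_⟩
  · obtain ⟨x, hx⟩ := (h.base.isolated_ne_south p).exists
    have : (1 : ℂ[X][X]) ∈ relIdeal f q := by rw [htop]; trivial
    have := this x hx
    rw [map_one] at this
    exact one_ne_zero this
  · by_contra hn
    push Not at hn
    obtain ⟨x, ⟨hx1, hx2⟩, hx3⟩ := (((h.isolated_of_not_mem hn.1 p).and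
      (h.isolated_of_not_mem hn.2 p)).and (h.base.isolated_ne_south p)).exists
    have := hab x hx3
    rw [map_mul] at this
    exact (mul_ne_zero hx1 hx2) this

variable [IsManifold 𝓘(ℂ, ℂ) ω D] [CompactSpace D] [T2Space D] [ConnectedSpace D]

theorem infinite_domain (D : Type*) [TopologicalSpace D] [ChartedSpace ℂ D] [Nonempty D]
    [T1Space D] : Infinite D := by
  obtain ⟨p⟩ := ‹Nonempty D›
  exact infinite_univ_iff.1 (infinite_of_mem_nhds p univ_mem)

/-- Off the finitely many points above `-e₃` and above branch values, `X - q(x)` is a factor of the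
norm over `u(x)`, so `P` vanishes there. If `P` were no relation, its zeros would be finite in
number, and `D` would be finite. -/
theorem IsSection.norm_mem {f : D → S2} {q r : D → ℂ} (h : IsSection f q r) {P : ℂ[X][X]}
    (hP : IsNorm f h.base q P) : P ∈ relIdeal f q := by
  by_contra hn
  have h1 := h.finite_of_not_mem hn
  have h2 : {x : D | ¬ evUQ f q x P = 0} ⊆
      {x | f x = south} ∪ ⋃ U ∈ branchU f h.base, {x | f x = sph U} := by
    intro x hx
    by_contra hx'
    simp only [mem_union, mem_iUnion, not_or, not_exists] at hx'
    obtain ⟨hs, hb⟩ := hx'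
    have hs' : (f x : E3) ≠ -e3 := (ne_south_iff _).1 hs
    have hU : coordU (f x) ∉ branchU f h.base := fun hU => hb _ hU (sph_coordU hs').symm
    apply hx
    rw [evUQ_eq, hP.map_eq _ hU, eval_prod]
    refine Finset.prod_eq_zero (h.base.mem_fib.2 (sph_coordU hs').symm) ?_
    simp
  have h3 : {x : D | ¬ evUQ f q x P = 0}.Finite :=
    ((h.base.finite south).union ((branchU f h.base).finite_toSet.biUnion
      fun U _ => h.base.finite (sph U))).subset h2
  have := infinite_domain D
  refine (h1.union h3).not_infinite ?_
  convert infinite_univ (α := D)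
  ext x
  simp only [mem_union, mem_univ, iff_true]
  exact em _

/-- The ideal of relations is generated by a monic polynomial, and the norm is a power of it. -/
theorem IsSection.exists_equation {f : D → S2} {q r : D → ℂ} (h : IsSection f q r) {P : ℂ[X][X]}
    (hP : IsNorm f h.base q P) :
    ∃ (P₀ : ℂ[X][X]) (m : ℕ), P₀.Monic ∧ (∀ g, g ∈ relIdeal f q ↔ P₀ ∣ g) ∧ 0 < m ∧
      P = P₀ ^ m ∧ P₀.derivative ∉ relIdeal f q := by
  have hI := h.relIdeal_isPrime
  have hdom : IsDomain (ℂ[X][X] ⧸ relIdeal f q) := Ideal.Quotient.isDomain _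
  have hPm : Ideal.Quotient.mk (relIdeal f q) P = 0 :=
    Ideal.Quotient.eq_zero_iff_mem.2 (h.norm_mem hP)
  obtain ⟨P₀, hmon, hdeg, hgen'⟩ := exists_monic_generator (R := ℂ[X])
    -- A relation in `u` alone vanishes at every complex number, because `f` is surjective.
    (S := ℂ[X][X] ⧸ relIdeal f q) (Ideal.Quotient.mk (relIdeal f q)) hP.monic hPm (fun a ha => by
      have ha' : (C a : ℂ[X][X]) ∈ relIdeal f q := Ideal.Quotient.eq_zero_iff_mem.1 ha
      refine eq_zero_of_infinite_isRoot a ((infinite_univ (α := ℂ)).mono fun U _ => ?_)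
      obtain ⟨x, hx⟩ := h.base.surjective (sph U)
      have := ha' x (by rw [hx]; exact sph_ne_south U)
      rw [evUQ_eq, map_C, eval_C, hx, coordU_sph] at this
      exact this)
  have hgen : ∀ g, g ∈ relIdeal f q ↔ P₀ ∣ g := fun g => by
    rw [← hgen', Ideal.Quotient.eq_zero_iff_mem]
  -- In characteristic zero the derivative is a nonzero polynomial of smaller degree, hence no
  -- multiple of the monic `P₀`.
  have hder : P₀.derivative ∉ relIdeal f q := by
    rw [hgen]
    refine hmon.not_dvd_of_natDegree_lt ?_ (natDegree_derivative_lt hdeg.ne')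
    intro h0
    exact hdeg.ne' (derivative_eq_zero.1 h0)
  obtain ⟨B, hB, hB'⟩ := (finiteMultiplicity_of_degree_pos_of_monic
    (natDegree_pos_iff_degree_pos.1 hdeg) hmon hP.monic.ne_zero).exists_eq_pow_mul_and_not_dvd
  set m := multiplicity P₀ P
  have hBmon : B.Monic := by
    refine Monic.of_mul_monic_left (hmon.pow m) ?_
    rw [← hB]; exact hP.monic
  -- The cofactor `B` of the highest power of `P₀` in `P` is no relation, so `B(u, q)` vanishes at
  -- only finitely many points. If `B` had positive degree, then over a general `U` it would have a
  -- root; that is a root of `P(U, ·)`, hence of the form `q(x)` with `u(x) = U`, a contradiction.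
  have hB1 : B = 1 := by
    rw [← Polynomial.Monic.natDegree_eq_zero hBmon]
    by_contra hBd
    have hfin := h.finite_of_not_mem (mt (hgen B).1 hB')
    obtain ⟨U, hU⟩ := ((hfin.image fun x => coordU (f x)).union
      (branchU f h.base).finite_toSet).infinite_compl.nonempty
    simp only [mem_compl_iff, mem_union, not_or] at hU
    obtain ⟨hU1, hU2⟩ := hU
    have hU2' : U ∉ branchU f h.base := by simpa using hU2
    have hd : (B.map (evalRingHom U)).degree ≠ 0 := by
      rw [hBmon.degree_map, degree_eq_natDegree hBmon.ne_zero]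
      exact_mod_cast hBd
    obtain ⟨c, hc⟩ := IsAlgClosed.exists_root _ hd
    have h1 : (P.map (evalRingHom U)).eval c = 0 := by
      rw [hB, Polynomial.map_mul, eval_mul, hc.eq_zero, mul_zero]
    rw [hP.map_eq U hU2', eval_prod] at h1
    obtain ⟨x, hx, hx'⟩ := Finset.prod_eq_zero_iff.1 h1
    have hfx : coordU (f x) = U := by rw [h.base.mem_fib.1 hx, coordU_sph]
    have hcx : c = q x := by simpa [sub_eq_zero] using hx'
    refine hU1 ⟨x, ?_, hfx⟩
    show evUQ f q x B = 0
    rw [evUQ_eq, hfx, ← hcx]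
    exact hc
  rw [hB1, mul_one] at hB
  refine ⟨P₀, m, hmon, hgen, ?_, hB, hder⟩
  rw [pos_iff_ne_zero]
  intro hm
  rw [hm, pow_zero] at hB
  have := hP.natDegree
  rw [hB, natDegree_one] at this
  have := h.base.deg_pos
  omega

/-- The number of points over a general point of the image. -/
theorem IsSection.generic_card {f : D → S2} {q r : D → ℂ} (h : IsSection f q r) {P P₀ : ℂ[X][X]}
    (hP : IsNorm f h.base q P) {m : ℕ} (hm : P = P₀ ^ m)
    (h0 : P₀ ∈ relIdeal f q) (hder : P₀.derivative ∉ relIdeal f q) :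
    {x | (f x : E3) = -e3 ∨ {y | f y = f x ∧ q y = q x}.ncard ≠ m}.Finite := by
  classical
  have hfin : ({x | f x = south} ∪ (⋃ U ∈ branchU f h.base, {x | f x = sph U}) ∪
      {x | evUQ f q x P₀.derivative = 0}).Finite :=
    ((h.base.finite south).union ((branchU f h.base).finite_toSet.biUnion
      fun U _ => h.base.finite (sph U))).union (h.finite_of_not_mem hder)
  refine hfin.subset fun x hx => ?_
  by_contra hx'
  simp only [mem_union, mem_iUnion, not_or, not_exists] at hx'
  obtain ⟨⟨hs, hb⟩, hd⟩ := hx'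
  have hs' : (f x : E3) ≠ -e3 := (ne_south_iff _).1 hs
  have hU : coordU (f x) ∉ branchU f h.base := fun hU => hb _ hU (sph_coordU hs').symm
  have hfx := sph_coordU hs'
  refine hx.elim hs' fun hx => hx ?_
  set U := coordU (f x) with hUdef
  have hPU := hP.map_eq U hU
  have hroots : (P.map (evalRingHom U)).roots = (fib f (sph U)).val.map q := by
    rw [hPU]
    have := roots_multiset_prod_X_sub_C ((fib f (sph U)).val.map q)
    rw [Multiset.map_map] at this
    exact this
  have hne0 : P₀.map (evalRingHom U) ≠ 0 := by
    intro h'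
    rw [hm, Polynomial.map_pow, h'] at hPU
    rcases Nat.eq_zero_or_pos m with hm0 | hm0
    · apply hd
      have : evUQ f q x P = 0 := (h.norm_mem hP) x hs'
      rw [hm, hm0, pow_zero, map_one] at this
      exact absurd this one_ne_zero
    · rw [zero_pow hm0.ne'] at hPU
      exact (monic_prod_of_monic _ _ fun _ _ => monic_X_sub_C _).ne_zero hPU.symm
  -- Off the zeros of the derivative of `P₀`, `q x` is a simple root of `P₀(U, ·)`. So it is a root
  -- of multiplicity exactly `m` of `P₀ ^ m = ∏ (X - q y)`, and this multiplicity counts the points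
  -- `y` of the fibre with `q y = q x`.
  have hone : (P₀.map (evalRingHom U)).rootMultiplicity (q x) = 1 := by
    have h1 : (P₀.map (evalRingHom U)).IsRoot (q x) := by
      have := h0 x hs'
      rwa [evUQ_eq] at this
    have h2 : ¬ (P₀.map (evalRingHom U)).derivative.IsRoot (q x) := by
      rw [derivative_map]
      intro h'
      apply hd
      show evUQ f q x _ = 0
      rw [evUQ_eq]; exact h'
    have h3 := (one_lt_rootMultiplicity_iff_isRoot hne0 (t := q x)).not.2 fun h' => h2 h'.2
    have h4 := (rootMultiplicity_pos hne0).2 h1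
    omega
  have hcount : ((fib f (sph U)).val.map q).count (q x) = m := by
    rw [← hroots, hm, Polynomial.map_pow, roots_pow, Multiset.count_nsmul, count_roots, hone,
      mul_one]
  rw [Multiset.count_map] at hcount
  have hset : {y | f y = f x ∧ q y = q x} =
      ((fib f (sph U)).filter fun y => q x = q y : Finset D) := by
    ext y
    rw [Finset.coe_filter]
    show _ ∧ _ ↔ _ ∧ _
    rw [h.base.mem_fib, hfx, eq_comm (a := q y)]
  rw [hset, ncard_coe_finset, ← hcount]
  rfl

omit [ConnectedSpace D] in
/-- Every zero of the norm comes from a point of the surface. -/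
theorem IsSection.exists_of_root {f : D → S2} {q r : D → ℂ} (h : IsSection f q r) {P : ℂ[X][X]}
    (hP : IsNorm f h.base q P) {U c : ℂ} (hUc : (P.map (evalRingHom U)).eval c = 0) :
    ∃ x, f x = sph U ∧ q x = c := by
  by_contra hn
  push Not at hn
  have hev : ∀ V, (P.map (evalRingHom V)).eval c = (P.eval (C c)).eval V := fun V => by
    rw [map_evalRingHom_eval]
  have hη : ∀ x, x ∈ fib f (sph U) → 0 < ‖c - q x‖ := fun x hx =>
    norm_pos_iff.2 (sub_ne_zero.2 (hn x (h.base.mem_fib.1 hx)).symm)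
  obtain ⟨W, hW, hWd, hWs⟩ := h.base.fibres_near (sph U)
    (U := fun x => {y | x ∈ fib f (sph U) → ‖c - q x‖ / 2 ≤ ‖c - q y‖})
    (fun x => by
      by_cases hx : x ∈ fib f (sph U)
      · have hs : (f x : E3) ≠ -e3 := by rw [h.base.mem_fib.1 hx]; exact sph_ne_south U
        have hc : ContinuousAt (fun y => ‖c - q y‖) x :=
          (continuousAt_const.sub (h.holq x hs).continuousAt).norm
        filter_upwards [hc.eventually (lt_mem_nhds (by linarith [hη x hx] :
          ‖c - q x‖ / 2 < ‖c - q x‖))] with y hy _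
        exact hy.le
      · filter_upwards with y hy; exact absurd hy hx)
  have hst : Tendsto sph (𝓝[≠] U) (𝓝[≠] (sph U)) := by
    refine tendsto_nhdsWithin_iff.2 ⟨continuous_sph.continuousAt.mono_left nhdsWithin_le_nhds, ?_⟩
    filter_upwards [self_mem_nhdsWithin] with V hV h'
    exact hV (sph_injective h')
  -- The product formula for `P` is known only off the branch values. If `c` is not taken by `q`
  -- over `U`, the formula bounds `|P(V, c)|` from below for `V` near `U`, and by continuity also at
  -- `V = U`.
  have hlow : ∀ᶠ V in 𝓝[≠] U,
      ∏ x ∈ fib f (sph U), (‖c - q x‖ / 2) ^ locDeg f x ≤ ‖(P.eval (C c)).eval V‖ := by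
    have hnb : ∀ᶠ V in 𝓝[≠] U, V ∉ branchU f h.base := by
      filter_upwards [hst.eventually hWs] with V hV hbV
      obtain ⟨x, hx, hx'⟩ := mem_branchU.1 hbV
      exact hx' (hV.2.1 x hx)
    filter_upwards [hst.eventually hWs, hnb] with V ⟨hcov, _, hF⟩ hV
    choose! F hFc hFm using hF
    rw [← hev, hP.map_eq V hV, eval_prod, norm_prod, prod_fib_eq h.base hWd hcov hFm]
    refine Finset.prod_le_prod (fun x _ => by positivity) fun x hx => ?_
    rw [← hFc x hx, ← Finset.prod_const]
    refine Finset.prod_le_prod (fun _ _ => by positivity) fun y hy => ?_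
    simpa using (hW x hx).1 ((hFm x hx y).1 hy).1 hx
  have hlim : Tendsto (fun V => ‖(P.eval (C c)).eval V‖) (𝓝[≠] U)
      (𝓝 ‖(P.eval (C c)).eval U‖) :=
    (P.eval (C c)).continuous.norm.continuousAt.mono_left nhdsWithin_le_nhds
  have h1 := ge_of_tendsto hlim hlow
  rw [← hev, hUc, norm_zero] at h1
  have h2 : 0 < ∏ x ∈ fib f (sph U), (‖c - q x‖ / 2) ^ locDeg f x :=
    Finset.prod_pos fun x hx => by have := hη x hx; positivity
  linarith

end Equation

/-! ## Plane curves given by one equation -/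

section PlaneCurve

open Polynomial

/-- A polynomial in two variables as an iterated polynomial. -/
def toBiv : MvPolynomial (Fin 2) ℂ →ₐ[ℂ] ℂ[X][X] := MvPolynomial.aeval ![C X, X]

/-- An iterated polynomial as a polynomial in two variables. -/
def ofBiv : ℂ[X][X] →+* MvPolynomial (Fin 2) ℂ :=
  eval₂RingHom (aeval (MvPolynomial.X 0 : MvPolynomial (Fin 2) ℂ)).toRingHom (MvPolynomial.X 1)

/-- Evaluation of an iterated polynomial. -/
def evBiv (z : Fin 2 → ℂ) : ℂ[X][X] →+* ℂ := eval₂RingHom (evalRingHom (z 0)) (z 1)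

@[simp] theorem ofBiv_X : ofBiv X = MvPolynomial.X 1 := by simp [ofBiv]

@[simp] theorem ofBiv_C (p : ℂ[X]) : ofBiv (C p) = aeval (MvPolynomial.X 0) p := by
  simp [ofBiv]

theorem ofBiv_toBiv (p : MvPolynomial (Fin 2) ℂ) : ofBiv (toBiv p) = p := by
  have : ofBiv.comp toBiv.toRingHom = RingHom.id _ := by
    apply MvPolynomial.ringHom_ext
    · intro c
      simp [toBiv, Polynomial.algebraMap_apply]
    · intro i
      fin_cases i <;> simp [toBiv]
  exact congrArg (fun φ : MvPolynomial (Fin 2) ℂ →+* MvPolynomial (Fin 2) ℂ => φ p) this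

theorem aeval_ofBiv (z : Fin 2 → ℂ) (g : ℂ[X][X]) :
    MvPolynomial.aeval z (ofBiv g) = evBiv z g := by
  have : (MvPolynomial.aeval z : MvPolynomial (Fin 2) ℂ →ₐ[ℂ] ℂ).toRingHom.comp ofBiv = evBiv z := by
    apply Polynomial.ringHom_ext'
    · apply Polynomial.ringHom_ext'
      · ext c; simp [evBiv]
      · simp [evBiv]
    · simp [evBiv]
  exact congrArg (fun φ : ℂ[X][X] →+* ℂ => φ g) this

theorem evBiv_toBiv (z : Fin 2 → ℂ) (p : MvPolynomial (Fin 2) ℂ) :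
    evBiv z (toBiv p) = MvPolynomial.aeval z p := by
  rw [← aeval_ofBiv, ofBiv_toBiv]

theorem ofBiv_eq (g : ℂ[X][X]) :
    ofBiv g = aeval (MvPolynomial.X 0) (g.coeff 0) + MvPolynomial.X 1 * ofBiv g.divX := by
  conv_lhs => rw [← divX_mul_X_add g]
  rw [map_add, map_mul, ofBiv_X, ofBiv_C]; ring

/-- `Z` is the zero set of `P₀`, which generates the ideal of `Z`. -/
structure IsEquation (Z : Set (Fin 2 → ℂ)) (P₀ : ℂ[X][X]) : Prop where
  mem_iff : ∀ z, z ∈ Z ↔ evBiv z P₀ = 0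
  dvd : ∀ g, (∀ z ∈ Z, evBiv z g = 0) → P₀ ∣ g

theorem IsEquation.vanishingIdeal_eq {Z : Set (Fin 2 → ℂ)} {P₀ : ℂ[X][X]} (h : IsEquation Z P₀) :
    MvPolynomial.vanishingIdeal ℂ Z = Ideal.span {ofBiv P₀} := by
  ext p
  rw [MvPolynomial.mem_vanishingIdeal_iff, Ideal.mem_span_singleton]
  constructor
  · intro hp
    rw [← ofBiv_toBiv p]
    exact map_dvd ofBiv (h.dvd _ fun z hz => by rw [evBiv_toBiv]; exact hp z hz)
  · rintro ⟨g, rfl⟩ z hz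
    rw [map_mul, aeval_ofBiv, (h.mem_iff z).1 hz, zero_mul]

theorem IsEquation.zeroLocus_eq {Z : Set (Fin 2 → ℂ)} {P₀ : ℂ[X][X]} (h : IsEquation Z P₀) :
    MvPolynomial.zeroLocus ℂ (MvPolynomial.vanishingIdeal ℂ Z) = Z := by
  apply subset_antisymm
  · intro z hz
    rw [h.mem_iff, ← aeval_ofBiv]
    apply hz
    rw [h.vanishingIdeal_eq]
    exact Ideal.mem_span_singleton_self _
  · exact MvPolynomial.zeroLocus_vanishingIdeal_le Z

/-- The length of the quotient by `(tᵉ, y)`, if `(t, y)` is maximal and `t` is regular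
modulo `y`. -/
theorem length_quotient_pow {R : Type*} [CommRing R] (t y : R)
    (hmax : (Ideal.span {t, y}).IsMaximal)
    (hreg : ∀ a, t * a ∈ Ideal.span {y} → a ∈ Ideal.span {y}) (e : ℕ) :
    Module.length R (R ⧸ Ideal.span {t ^ e, y}) = e := by
  induction e with
  | zero =>
    have : Ideal.span {t ^ 0, y} = ⊤ := by
      rw [Ideal.eq_top_iff_one, pow_zero]
      exact Ideal.subset_span (by simp)
    rw [this]
    have : Subsingleton (R ⧸ (⊤ : Ideal R)) := Ideal.Quotient.subsingleton_iff.2 rfl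
    simp
  | succ e ih =>
    have hle : Ideal.span {t ^ (e + 1), y} ≤ Ideal.span {t, y} := by
      rw [Ideal.span_le]
      rintro x (rfl | rfl)
      · exact Ideal.pow_mem_of_mem _ (Ideal.subset_span (by simp)) _ (Nat.succ_pos e)
      · exact Ideal.subset_span (by simp)
    have hmap : Ideal.span {t ^ e, y} ≤
        Submodule.comap (LinearMap.mulLeft R t) (Ideal.span {t ^ (e + 1), y}) := by
      rw [Ideal.span_le]
      intro x hx
      change t * x ∈ Ideal.span {t ^ (e + 1), y}
      rcases hx with hx | hx
      · rw [hx, ← pow_succ']; exact Ideal.subset_span (by simp)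
      · rw [mem_singleton_iff.1 hx]
        exact Ideal.mul_mem_left _ _ (Ideal.subset_span (by simp))
    -- Lengths are additive in `0 → R/(tᵉ, y) → R/(tᵉ⁺¹, y) → R/(t, y) → 0`, where the first map is
    -- multiplication by `t`, injective because `t` is regular modulo `y`. The last module is
    -- simple.
    have h1 := Module.length_eq_add_of_exact
      (Submodule.mapQ _ _ (LinearMap.mulLeft R t) hmap)
      (Submodule.factor hle) ?_ (Submodule.factor_surjective hle) ?_
    · rw [h1, ih]
      have : IsSimpleModule R (R ⧸ Ideal.span {t, y}) := by
        rw [isSimpleModule_iff_isCoatom]; exact hmax.out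
      rw [Module.length_eq_one]; push_cast; rfl
    · rw [← LinearMap.ker_eq_bot, Submodule.eq_bot_iff]
      intro a ha
      obtain ⟨a, rfl⟩ := Submodule.Quotient.mk_surjective _ a
      rw [LinearMap.mem_ker, Submodule.mapQ_apply, Submodule.Quotient.mk_eq_zero] at ha
      rw [Submodule.Quotient.mk_eq_zero]
      change t * a ∈ _ at ha
      rw [Ideal.mem_span_pair] at ha
      obtain ⟨b, c, hbc⟩ := ha
      have h2 : t * (a - b * t ^ e) ∈ Ideal.span {y} := by
        rw [Ideal.mem_span_singleton']
        exact ⟨c, by linear_combination hbc⟩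
      have h3 := hreg _ h2
      rw [Ideal.mem_span_singleton'] at h3
      obtain ⟨d, hd⟩ := h3
      rw [Ideal.mem_span_pair]
      exact ⟨b, d, by rw [hd]; ring⟩
    · intro a
      obtain ⟨a, rfl⟩ := Submodule.Quotient.mk_surjective _ a
      have e1 : Submodule.factor hle (Submodule.Quotient.mk a) = Submodule.Quotient.mk a := rfl
      rw [e1, Submodule.Quotient.mk_eq_zero]
      constructor
      · intro ha
        rw [Ideal.mem_span_pair] at ha
        obtain ⟨b, c, rfl⟩ := ha
        refine ⟨Submodule.Quotient.mk b, ?_⟩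
        rw [Submodule.mapQ_apply, Submodule.Quotient.eq]
        change t * b - _ ∈ _
        rw [Ideal.mem_span_pair]
        exact ⟨0, -c, by ring⟩
      · rintro ⟨b, hb⟩
        obtain ⟨b, rfl⟩ := Submodule.Quotient.mk_surjective _ b
        rw [Submodule.mapQ_apply, Submodule.Quotient.eq] at hb
        change t * b - a ∈ _ at hb
        have h2 := hle hb
        have h3 : t * b ∈ Ideal.span {t, y} := Ideal.mul_mem_right _ _ (Ideal.subset_span (by simp))
        have h4 := Ideal.sub_mem _ h3 h2
        rwa [sub_sub_cancel] at h4

theorem vanishingIdeal_point (a : ℂ) :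
    (MvPolynomial.vanishingIdeal ℂ {![a, 0]} : Ideal (MvPolynomial (Fin 2) ℂ)) =
      Ideal.span {MvPolynomial.X 0 - MvPolynomial.C a, MvPolynomial.X 1} := by
  apply le_antisymm
  · intro p hp
    rw [MvPolynomial.mem_vanishingIdeal_singleton_iff, ← evBiv_toBiv] at hp
    have h1 : (toBiv p).coeff 0 |>.IsRoot a := by
      have : evBiv ![a, 0] (toBiv p) = ((toBiv p).coeff 0).eval a := by
        conv_lhs => rw [← divX_mul_X_add (toBiv p)]
        simp [evBiv]
      rw [IsRoot, ← this, hp]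
    obtain ⟨g, hg⟩ := dvd_iff_isRoot.2 h1
    rw [← ofBiv_toBiv p, ofBiv_eq, hg, map_mul]
    refine Ideal.add_mem _ (Ideal.mul_mem_right _ _ ?_) (Ideal.mul_mem_right _ _ ?_)
    · apply Ideal.subset_span
      left
      simp [MvPolynomial.algebraMap_eq]
    · exact Ideal.subset_span (by simp)
  · rw [Ideal.span_le]
    rintro x (rfl | rfl) <;>
    · rw [SetLike.mem_coe, MvPolynomial.mem_vanishingIdeal_singleton_iff]
      simp

/-- Modulo the second coordinate `y`, the equation `P₀` becomes its constant coefficient `(x - a)^e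
g(x)` with `g(a) ≠ 0`. In the local ring `g` is a unit, so the quotient is the one by `((x - a)^e,
y)`, of length `e`. -/
theorem IsEquation.localIntersection_eq {Z : Set (Fin 2 → ℂ)} {P₀ : ℂ[X][X]} (h : IsEquation Z P₀)
    (h0 : P₀.coeff 0 ≠ 0) (a : ℂ) :
    localIntersection Z ![a, 0] = (P₀.coeff 0).rootMultiplicity a := by
  obtain ⟨g, hg, hga⟩ := (P₀.coeff 0).exists_eq_pow_rootMultiplicity_mul_and_not_dvd h0 a
  set e := (P₀.coeff 0).rootMultiplicity a
  set 𝔭 : Ideal (MvPolynomial (Fin 2) ℂ) := MvPolynomial.vanishingIdeal ℂ {![a, 0]} with h𝔭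
  set A := Localization.AtPrime 𝔭
  set ι := algebraMap (MvPolynomial (Fin 2) ℂ) A
  set t : MvPolynomial (Fin 2) ℂ := MvPolynomial.X 0 - MvPolynomial.C a with ht
  set y : MvPolynomial (Fin 2) ℂ := MvPolynomial.X 1 with hy
  set G : MvPolynomial (Fin 2) ℂ := aeval (MvPolynomial.X 0) g with hG
  have hI : MvPolynomial.vanishingIdeal ℂ Z ⊔ Ideal.span {y} = Ideal.span {t ^ e * G, y} := by
    have h1 : ofBiv P₀ = t ^ e * G + y * ofBiv P₀.divX := by
      rw [ofBiv_eq P₀]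
      conv_lhs => rw [hg]
      simp [ht, hG, hy, MvPolynomial.algebraMap_eq]
    rw [h.vanishingIdeal_eq, h1, ← Ideal.span_union]
    apply le_antisymm
    · rw [Ideal.span_le]
      rintro x (rfl | rfl)
      · exact Ideal.add_mem _ (Ideal.subset_span (by simp))
          (Ideal.mul_mem_right _ _ (Ideal.subset_span (by simp)))
      · exact Ideal.subset_span (by simp)
    · rw [Ideal.span_le]
      rintro x (rfl | rfl)
      · have h2 : t ^ e * G + y * ofBiv P₀.divX ∈
            Ideal.span ({t ^ e * G + y * ofBiv P₀.divX} ∪ {y}) := Ideal.subset_span (by simp)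
        have h3 : y * ofBiv P₀.divX ∈
            Ideal.span ({t ^ e * G + y * ofBiv P₀.divX} ∪ {y}) :=
          Ideal.mul_mem_right _ _ (Ideal.subset_span (by simp))
        have := Ideal.sub_mem _ h2 h3
        rwa [add_sub_cancel_right] at this
      · exact Ideal.subset_span (by simp)
  have hGu : IsUnit (ι G) := by
    refine IsLocalization.map_units A (⟨G, ?_⟩ : 𝔭.primeCompl)
    intro hG''
    have hG' : G ∈ 𝔭 := hG''
    rw [h𝔭, MvPolynomial.mem_vanishingIdeal_singleton_iff] at hG'
    apply hga
    rw [dvd_iff_isRoot, IsRoot, ← hG', hG, ← ofBiv_C, aeval_ofBiv]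
    simp [evBiv]
  have hmapI : (MvPolynomial.vanishingIdeal ℂ Z ⊔ Ideal.span {y}).map ι =
      Ideal.span {ι t ^ e, ι y} := by
    rw [hI, Ideal.map_span, image_pair, map_mul, map_pow]
    apply le_antisymm
    · rw [Ideal.span_le]
      rintro x (rfl | rfl)
      · exact Ideal.mul_mem_right _ _ (Ideal.subset_span (by simp))
      · exact Ideal.subset_span (by simp)
    · rw [Ideal.span_le]
      rintro x (rfl | rfl)
      · obtain ⟨w, hw⟩ := hGu
        have h2 : ι t ^ e * ι G ∈ Ideal.span {ι t ^ e * ι G, ι y} := Ideal.subset_span (by simp)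
        have := Ideal.mul_mem_right (↑w⁻¹ : A) _ h2
        rwa [← hw, mul_assoc, Units.mul_inv, mul_one, hw] at this
      · exact Ideal.subset_span (by simp)
  have hmax : (Ideal.span {ι t, ι y}).IsMaximal := by
    have : Ideal.span {ι t, ι y} = IsLocalRing.maximalIdeal A := by
      have h𝔭' : 𝔭 = Ideal.span {t, y} := vanishingIdeal_point a
      have e1 : 𝔭.map ι = Ideal.span {ι t, ι y} :=
        (congrArg (Ideal.map ι) h𝔭').trans (by rw [Ideal.map_span, image_pair])
      rw [← e1, Localization.AtPrime.map_eq_maximalIdeal]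
    rw [this]; infer_instance
  have hyp : (Ideal.span {y}).IsPrime := by
    rw [Ideal.span_singleton_prime (MvPolynomial.X_ne_zero 1)]
    exact MvPolynomial.X_prime
  have hyd : Disjoint (𝔭.primeCompl : Set (MvPolynomial (Fin 2) ℂ)) (Ideal.span {y}) := by
    rw [disjoint_right]
    intro x hx hx'
    refine hx' ?_
    rw [h𝔭, vanishingIdeal_point]
    exact Ideal.span_mono (by simp [hy]) hx
  have hspan : Ideal.span {ι y} = (Ideal.span {y}).map ι := by
    rw [Ideal.map_span, image_singleton]
  have hreg : ∀ b, ι t * b ∈ Ideal.span {ι y} → b ∈ Ideal.span {ι y} := by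
    intro b hb
    have hpr := IsLocalization.isPrime_of_isPrime_disjoint 𝔭.primeCompl A _ hyp hyd
    rw [hspan] at hb ⊢
    refine (hpr.mem_or_mem hb).resolve_left fun h' => ?_
    have h2 : t ∈ Ideal.span {y} := by
      rw [← IsLocalization.under_map_of_isPrime_disjoint 𝔭.primeCompl A hyp hyd]
      exact h'
    obtain ⟨c, hc⟩ := Ideal.mem_span_singleton.1 h2
    -- `x - a` is no multiple of `y`: at the point `(a + 1, 0)` it has the value `1`, whereas `y`
    -- vanishes.
    have := congrArg (MvPolynomial.aeval ![a + 1, 0] : MvPolynomial (Fin 2) ℂ →ₐ[ℂ] ℂ) hc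
    simp [ht, hy] at this
  have := length_quotient_pow (ι t) (ι y) hmax hreg e
  rw [← hmapI] at this
  exact this

end PlaneCurve

/-! ## Endomorphisms in an orthogonal frame -/

theorem inner3 (a b : E3) : inner ℝ a b = a 0 * b 0 + a 1 * b 1 + a 2 * b 2 := by
  rw [PiLp.inner_apply, Fin.sum_univ_three]
  simp [mul_comm]

/-- `x`, `y` are orthogonal vectors of equal length that span the orthogonal complement of the unit
vector `n`. -/
structure IsFrame (x y n : E3) : Prop where
  norm_n : ‖n‖ = 1
  ne_zero : x ≠ 0
  norm_eq : ‖x‖ = ‖y‖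
  xy : inner ℝ x y = 0
  xn : inner ℝ x n = 0
  yn : inner ℝ y n = 0

namespace IsFrame

variable {x y n : E3}

theorem exists_basis (h : IsFrame x y n) : ∃ b : OrthonormalBasis (Fin 3) ℝ E3,
    b 0 = ‖x‖⁻¹ • x ∧ b 1 = ‖x‖⁻¹ • y ∧ b 2 = n := by
  have hx : ‖x‖ ≠ 0 := norm_ne_zero_iff.2 h.ne_zero
  have hon : Orthonormal ℝ ![‖x‖⁻¹ • x, ‖x‖⁻¹ • y, n] := by
    refine ⟨fun i => ?_, fun i j hij => ?_⟩
    · fin_cases i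
      · simp [norm_smul, hx]
      · simp [norm_smul, ← h.norm_eq, hx]
      · exact h.norm_n
    · have h1 := h.xy
      have h2 := h.xn
      have h3 := h.yn
      have h4 := (real_inner_comm x y).trans h.xy
      have h5 := (real_inner_comm x n).trans h.xn
      have h6 := (real_inner_comm y n).trans h.yn
      fin_cases i <;> fin_cases j <;> first
        | exact absurd rfl hij
        | simp [real_inner_smul_left, real_inner_smul_right, *]
  obtain ⟨b, hb⟩ := Orthonormal.exists_orthonormalBasis_extension_of_card_eq
    (v := ![‖x‖⁻¹ • x, ‖x‖⁻¹ • y, n]) (s := univ) (by simp)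
    (hon.comp _ Subtype.val_injective)
  exact ⟨b, hb 0 trivial, hb 1 trivial, hb 2 trivial⟩

theorem expand (h : IsFrame x y n) (z : E3) :
    z = (‖x‖ ^ 2)⁻¹ • (inner ℝ x z • x + inner ℝ y z • y) + inner ℝ n z • n := by
  obtain ⟨b, h0, h1, h2⟩ := h.exists_basis
  conv_lhs => rw [← b.sum_repr' z, Fin.sum_univ_three, h0, h1, h2]
  simp only [real_inner_smul_left, smul_smul, smul_add]
  congr 2 <;> · congr 1; ring

theorem trace_eq (h : IsFrame x y n) (A : E3 →L[ℝ] E3) :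
    LinearMap.trace ℝ E3 (A : E3 →ₗ[ℝ] E3) =
      (‖x‖ ^ 2)⁻¹ * (inner ℝ (A x) x + inner ℝ (A y) y) + inner ℝ (A n) n := by
  obtain ⟨b, h0, h1, h2⟩ := h.exists_basis
  rw [LinearMap.trace_eq_sum_inner _ b, Fin.sum_univ_three, h0, h1, h2]
  simp only [ContinuousLinearMap.coe_coe, map_smul, real_inner_smul_left, real_inner_smul_right]
  rw [real_inner_comm x, real_inner_comm y, real_inner_comm n]
  ring

theorem det_eq (h : IsFrame x y n) {A : E3 →L[ℝ] E3} (hn : A n = 0)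
    (hxn : inner ℝ (A x) n = 0) (hyn : inner ℝ (A y) n = 0) :
    LinearMap.det ((A + (innerSL ℝ n).smulRight n : E3 →L[ℝ] E3) : E3 →ₗ[ℝ] E3) =
      ((‖x‖ ^ 2)⁻¹) ^ 2 * (inner ℝ (A x) x * inner ℝ (A y) y -
        inner ℝ (A x) y * inner ℝ (A y) x) := by
  obtain ⟨b, h0, h1, h2⟩ := h.exists_basis
  have hnn : inner ℝ n n = 1 := by rw [real_inner_self_eq_norm_sq, h.norm_n]; norm_num
  rw [← LinearMap.det_toMatrix b.toBasis, Matrix.det_fin_three]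
  simp only [LinearMap.toMatrix_apply, OrthonormalBasis.coe_toBasis,
    OrthonormalBasis.coe_toBasis_repr_apply, b.repr_apply_apply, h0, h1, h2]
  simp only [ContinuousLinearMap.coe_coe, add_apply,
    ContinuousLinearMap.smulRight_apply, innerSL_apply_apply, map_smul,
    real_inner_smul_left, real_inner_smul_right, inner_add_right, hn, inner_zero_right, hnn,
    real_inner_comm x n, h.xn, h.yn, real_inner_comm y n]
  simp only [real_inner_comm _ (A x), real_inner_comm _ (A y)]
  rw [real_inner_comm (A x) n, real_inner_comm (A y) n]
  simp only [hxn, hyn]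
  ring

end IsFrame

/-- The traceless symmetric endomorphism `A` with `⟨A x, x⟩ = a`, `⟨A x, y⟩ = b` in the frame
`x`, `y`. -/
def frameEndo (x y : E3) (a b : ℝ) : E3 →L[ℝ] E3 :=
  ((‖x‖ ^ 2)⁻¹ ^ 2) • (a • ((innerSL ℝ x).smulRight x - (innerSL ℝ y).smulRight y) +
    b • ((innerSL ℝ x).smulRight y + (innerSL ℝ y).smulRight x))

section Traceless

variable {x y n : E3} {A : E3 →L[ℝ] E3}

theorem IsFrame.apply_yy (h : IsFrame x y n) (hn : A n = 0)
    (ht : LinearMap.trace ℝ E3 (A : E3 →ₗ[ℝ] E3) = 0) :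
    inner ℝ (A y) y = -inner ℝ (A x) x := by
  have hx : ‖x‖ ≠ 0 := norm_ne_zero_iff.2 h.ne_zero
  rw [h.trace_eq, hn, inner_zero_left, add_zero] at ht
  have := (mul_eq_zero.1 ht).resolve_left (by positivity)
  linarith

theorem IsFrame.endo_eq (h : IsFrame x y n) (hs : (A : E3 →ₗ[ℝ] E3).IsSymmetric) (hn : A n = 0)
    (ht : LinearMap.trace ℝ E3 (A : E3 →ₗ[ℝ] E3) = 0) :
    A = frameEndo x y (inner ℝ (A x) x) (inner ℝ (A x) y) := by
  have hyy := h.apply_yy hn ht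
  have hs' : ∀ a b, inner ℝ (A a) b = inner ℝ a (A b) := hs
  ext1 z
  have h1 := h.expand (A z)
  rw [← hs' n, hn, inner_zero_left, zero_smul, add_zero, ← hs' x, ← hs' y] at h1
  rw [h1]
  have h2 := h.expand z
  have ex : inner ℝ (A x) z = (‖x‖ ^ 2)⁻¹ * (inner ℝ x z * inner ℝ (A x) x +
      inner ℝ y z * inner ℝ (A x) y) := by
    conv_lhs => rw [h2]
    rw [inner_add_right, inner_smul_right, inner_add_right, inner_smul_right, inner_smul_right,
      inner_smul_right, hs' x n, hn, inner_zero_right]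
    ring
  have ey : inner ℝ (A y) z = (‖x‖ ^ 2)⁻¹ * (inner ℝ x z * inner ℝ (A x) y -
      inner ℝ y z * inner ℝ (A x) x) := by
    conv_lhs => rw [h2]
    rw [inner_add_right, inner_smul_right, inner_add_right, inner_smul_right, inner_smul_right,
      inner_smul_right, hs' y n, hn, inner_zero_right, hyy, hs' y x, real_inner_comm (A x) y]
    ring
  rw [ex, ey]
  simp only [frameEndo, smul_apply, add_apply, sub_apply, ContinuousLinearMap.smulRight_apply,
    innerSL_apply_apply]
  module

/-- For a traceless symmetric `A` the number `fibreCoord A w` is half the value at `(w, w)` of a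
complex bilinear form, hence quadratic in `w`. Applied to `c = u⁻²` this is the origin of the fourth
power in the transition function of `Q`. -/
theorem fibreCoord_smul {w : Fin 3 → ℂ} (h : IsFrame (reVec w) (imVec w) n)
    (hs : (A : E3 →ₗ[ℝ] E3).IsSymmetric) (hn : A n = 0)
    (ht : LinearMap.trace ℝ E3 (A : E3 →ₗ[ℝ] E3) = 0) (c : ℂ) :
    fibreCoord A (c • w) = c ^ 2 * fibreCoord A w := by
  have e1 : reVec (c • w) = c.re • reVec w - c.im • imVec w := by
    ext i; simp [reVec, imVec]
  have e2 : imVec (c • w) = c.re • imVec w + c.im • reVec w := by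
    ext i; simp [reVec, imVec]
  have hyy := h.apply_yy hn ht
  have hyx : inner ℝ (A (imVec w)) (reVec w) = inner ℝ (A (reVec w)) (imVec w) := by
    have hs' : ∀ a b, inner ℝ (A a) b = inner ℝ a (A b) := hs
    rw [hs', real_inner_comm]
  simp only [fibreCoord, e1, e2, map_sub, map_smul, inner_sub_left, inner_sub_right,
    inner_add_right, real_inner_smul_left, real_inner_smul_right, hyy, hyx]
  apply Complex.ext <;> simp [pow_two] <;> ring

end Traceless

/-! ## The isotropic frame of the coordinates -/

theorem norm_isoU (u : ℂ) : ‖reVec (isoU u)‖ = 1 + Complex.normSq u := by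
  have h := one_add_normSq_pos u
  rw [← sq_eq_sq₀ (norm_nonneg _) h.le, ← real_inner_self_eq_norm_sq, inner3, Complex.normSq_apply]
  simp [reVec, isoU, pow_two]
  ring

theorem isFrame_isoU (u : ℂ) : IsFrame (reVec (isoU u)) (imVec (isoU u)) (sph u) := by
  have h := one_add_normSq_pos u
  have h1 := norm_isoU u
  have h2 : ‖imVec (isoU u)‖ = 1 + Complex.normSq u := by
    rw [← sq_eq_sq₀ (norm_nonneg _) h.le, ← real_inner_self_eq_norm_sq, inner3,
      Complex.normSq_apply]
    simp [imVec, isoU, pow_two]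
    ring
  have h3 := Complex.normSq_apply u
  refine ⟨by simp, ?_, by rw [h1, h2], ?_, ?_, ?_⟩
  · rw [← norm_pos_iff, h1]; exact h
  · rw [inner3]
    simp [reVec, imVec, isoU, pow_two]
    ring
  · rw [inner3]
    simp [reVec, isoU, pow_two, sph, sphVec]
    field_simp
    rw [h3]; ring
  · rw [inner3]
    simp [imVec, isoU, pow_two, sph, sphVec]
    field_simp
    rw [h3]; ring

/-- Conjugation of an endomorphism by the rotation `flip`. -/
def flipE (A : E3 →L[ℝ] E3) : E3 →L[ℝ] E3 :=
  (flip : E3 →L[ℝ] E3) ∘L A ∘L (flip : E3 →L[ℝ] E3)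

@[simp] theorem flipE_apply (A : E3 →L[ℝ] E3) (z : E3) : flipE A z = flip (A (flip z)) := rfl

@[simp] theorem flipE_flipE (A : E3 →L[ℝ] E3) : flipE (flipE A) = A := by
  ext1 z; simp

theorem inner_flip (a b : E3) : inner ℝ (flip a) b = inner ℝ a (flip b) := by
  rw [← flip_flip b, flip.inner_map_map, flip_flip]

theorem continuous_flipE : Continuous flipE :=
  continuous_const.clm_comp (continuous_id.clm_comp continuous_const)

theorem trace_flipE (A : E3 →L[ℝ] E3) :
    LinearMap.trace ℝ E3 (flipE A : E3 →ₗ[ℝ] E3) = LinearMap.trace ℝ E3 (A : E3 →ₗ[ℝ] E3) := by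
  have : (flipE A : E3 →ₗ[ℝ] E3) = flip.toLinearEquiv.conj (A : E3 →ₗ[ℝ] E3) := by
    apply LinearMap.ext
    intro z
    have h1 : flip.symm z = flip z := flip.injective (by simp)
    rw [LinearEquiv.conj_apply_apply]
    show flip (A (flip z)) = flip (A (flip.symm z))
    rw [h1]
  rw [this, LinearMap.trace_conj']

/-- The rotation maps `isoV v` to `-isoU v`; the sign drops out, the fibre coordinate being
quadratic. -/
theorem fibreCoord_flipE (A : E3 →L[ℝ] E3) (v : ℂ) :
    fibreCoord (flipE A) (isoU v) = fibreCoord A (isoV v) := by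
  have e1 : reVec (isoU v) = -flip (reVec (isoV v)) := by
    apply ext3 <;> simp [reVec, isoU, isoV]
  have e2 : imVec (isoU v) = -flip (imVec (isoV v)) := by
    apply ext3 <;> simp [imVec, isoU, isoV, add_comm]
  simp [fibreCoord, e1, e2]

/-! ## Points of `Q` in coordinates -/

/-- The involution of `Q` induced by `flip`. -/
def Q.flip (p : Q) : Q :=
  ⟨(flipS p.base, flipE p.endo), fun a b => by
    show inner ℝ (MinSurf.flip (p.endo (MinSurf.flip a))) b =
      inner ℝ a (MinSurf.flip (p.endo (MinSurf.flip b)))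
    rw [inner_flip, ← inner_flip a]
    exact p.2.1 _ _, by
    show MinSurf.flip (p.endo (MinSurf.flip (MinSurf.flip _))) = 0
    rw [flip_flip]
    show MinSurf.flip (p.1.2 p.1.1) = 0
    rw [p.2.2.1, map_zero], by rw [trace_flipE]; exact p.2.2.2⟩

theorem Q.base_flip (p : Q) : p.flip.base = flipS p.base := rfl

theorem Q.endo_flip (p : Q) : p.flip.endo = flipE p.endo := rfl

theorem Q.u_flip (p : Q) : p.flip.u = p.v := coordU_flip _

theorem Q.q_flip (p : Q) : p.flip.q = p.r := by
  rw [Q.q, Q.u_flip, Q.endo_flip, fibreCoord_flipE]; rfl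

theorem Q.isFrame {p : Q} (hp : (p.base : E3) ≠ -e3) :
    IsFrame (reVec (isoU p.u)) (imVec (isoU p.u)) p.base := by
  have := isFrame_isoU p.u
  rwa [Q.u, sph_coordU hp] at this

/-- The endomorphism with coordinates `u`, `q`. -/
def endoUQ (u q : ℂ) : E3 →L[ℝ] E3 := frameEndo (reVec (isoU u)) (imVec (isoU u)) q.re q.im

theorem Q.endo_eq {p : Q} (hp : (p.base : E3) ≠ -e3) : p.endo = endoUQ p.u p.q := by
  have h := (Q.isFrame hp).endo_eq p.2.1 p.2.2.1 p.2.2.2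
  rw [endoUQ]
  have e1 : p.q.re = inner ℝ (p.endo (reVec (isoU p.u))) (reVec (isoU p.u)) := by
    simp [Q.q, fibreCoord]
  have e2 : p.q.im = inner ℝ (p.endo (reVec (isoU p.u))) (imVec (isoU p.u)) := by
    simp [Q.q, fibreCoord]
  rw [e1, e2]
  exact h

theorem Q.ext_coord {p p' : Q} (hp : (p.base : E3) ≠ -e3) (hb : p.base = p'.base)
    (hq : p.q = p'.q) : p = p' := by
  apply Subtype.ext
  apply Prod.ext
  · exact hb
  · have h1 := Q.endo_eq hp
    have h2 := Q.endo_eq (p := p') (by rw [← hb]; exact hp)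
    have hu : p.u = p'.u := by rw [Q.u, hb]; rfl
    show p.endo = p'.endo
    rw [h1, h2, hu, hq]

theorem Q.q_eq_zero_iff {p : Q} (hp : (p.base : E3) ≠ -e3) : p.q = 0 ↔ p.endo = 0 := by
  constructor
  · intro h
    rw [Q.endo_eq hp, h]
    simp [endoUQ, frameEndo]
  · intro h
    simp [Q.q, h, fibreCoord]

theorem Q.r_eq_zero_iff {p : Q} (hp : (p.base : E3) ≠ e3) : p.r = 0 ↔ p.endo = 0 := by
  rw [← Q.q_flip, Q.q_eq_zero_iff (by rwa [Q.base_flip, coe_flipS, ne_eq, flip_eq_neg_e3]),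
    Q.endo_flip]
  constructor
  · intro h; rw [← flipE_flipE p.endo, h]; ext1; simp
  · intro h; rw [h]; ext1; simp

/-- `isoV v = u⁻² isoU u` when `u v = 1`, and the fibre coordinate is quadratic in the isotropic
vector. -/
theorem Q.rel {p : Q} (hp : (p.base : E3) ≠ -e3) (hp' : (p.base : E3) ≠ e3) :
    p.q = p.u ^ 4 * p.r := by
  have huv : p.u * p.v = 1 := coordU_mul_coordV hp hp'
  have hu0 : p.u ≠ 0 := left_ne_zero_of_mul_eq_one huv
  have hv : p.v = p.u⁻¹ := eq_inv_of_mul_eq_one_right huv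
  have hw : isoV p.v = (p.u⁻¹) ^ 2 • isoU p.u := by
    rw [hv]
    ext i
    fin_cases i <;> simp [isoU, isoV] <;> field_simp
  rw [Q.r, hw, fibreCoord_smul (A := p.endo) (Q.isFrame hp) p.2.1 p.2.2.1 p.2.2.2]
  change p.q = p.u ^ 4 * ((p.u⁻¹ ^ 2) ^ 2 * p.q)
  field_simp

theorem continuous_isoU_re : Continuous fun u : ℂ => reVec (isoU u) := by
  apply (PiLp.continuous_toLp 2 _).comp
  refine continuous_pi fun i => Complex.continuous_re.comp ?_
  fin_cases i <;> simp [isoU] <;> fun_prop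

theorem continuous_isoU_im : Continuous fun u : ℂ => imVec (isoU u) := by
  apply (PiLp.continuous_toLp 2 _).comp
  refine continuous_pi fun i => Complex.continuous_im.comp ?_
  fin_cases i <;> simp [isoU] <;> fun_prop

/-- `Q` carries the topology of pairs of a point and an endomorphism; this lemma is what makes a map
to `Q` continuous as soon as its coordinates are. -/
theorem continuous_endoUQ : Continuous fun p : ℂ × ℂ => endoUQ p.1 p.2 := by
  have hx : Continuous fun p : ℂ × ℂ => reVec (isoU p.1) := continuous_isoU_re.comp continuous_fst
  have hy : Continuous fun p : ℂ × ℂ => imVec (isoU p.1) := continuous_isoU_im.comp continuous_fst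
  have hr : ∀ {f g : ℂ × ℂ → E3}, Continuous f → Continuous g →
      Continuous fun p => (innerSL ℝ (f p)).smulRight (g p) := fun hf hg =>
    (ContinuousLinearMap.smulRightL ℝ E3 E3).continuous₂.comp
      (((innerSL ℝ).continuous.comp hf).prodMk hg)
  have hre : Continuous fun p : ℂ × ℂ => p.2.re := Complex.continuous_re.comp continuous_snd
  have him : Continuous fun p : ℂ × ℂ => p.2.im := Complex.continuous_im.comp continuous_snd
  have hn : Continuous fun p : ℂ × ℂ => (‖reVec (isoU p.1)‖ ^ 2)⁻¹ ^ 2 := by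
    refine ((hx.norm.pow 2).inv₀ fun p => ?_).pow 2
    show ‖reVec (isoU p.1)‖ ^ 2 ≠ 0
    rw [norm_isoU]
    exact pow_ne_zero 2 (one_add_normSq_pos _).ne'
  exact hn.smul ((hre.smul ((hr hx hx).sub (hr hy hy))).add
    (him.smul ((hr hx hy).add (hr hy hx))))

/-! ## The image curve and its intersection with the zero section -/

section ImageCurve

open Polynomial

variable {D : Type*} [TopologicalSpace D] [ChartedSpace ℂ D]

/-- The image of a surface in the coordinates `u`, `q`. -/
def imgU (f : D → S2) (q : D → ℂ) : Set (Fin 2 → ℂ) :=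
  (fun x => ![coordU (f x), q x]) '' {x | (f x : E3) ≠ -e3}

variable [IsManifold 𝓘(ℂ, ℂ) ω D] [CompactSpace D] [T2Space D] [ConnectedSpace D]

theorem IsSection.exists_curve {f : D → S2} {q r : D → ℂ} (h : IsSection f q r) :
    ∃ (P P₀ : ℂ[X][X]) (m : ℕ), IsNorm f h.base q P ∧ IsEquation (imgU f q) P₀ ∧ 0 < m ∧
      P = P₀ ^ m ∧ {x | (f x : E3) = -e3 ∨ {y | f y = f x ∧ q y = q x}.ncard ≠ m}.Finite := by
  obtain ⟨P, hP⟩ := h.exists_norm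
  obtain ⟨P₀, m, -, hgen, hm, hPm, hder⟩ := h.exists_equation hP
  have h0 : P₀ ∈ relIdeal f q := (hgen P₀).2 dvd_rfl
  refine ⟨P, P₀, m, hP, ⟨fun z => ⟨?_, fun hz => ?_⟩, fun g hg => ?_⟩, hm, hPm,
    h.generic_card hP hPm h0 hder⟩
  · rintro ⟨x, hx, rfl⟩
    exact h0 x hx
  · have h1 : (P.map (evalRingHom (z 0))).eval (z 1) = 0 := by
      have : evBiv z P = 0 := by rw [hPm, map_pow, hz, zero_pow hm.ne']
      rwa [evBiv, coe_eval₂RingHom, ← eval_map] at this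
    obtain ⟨x, hx, hx'⟩ := h.exists_of_root hP h1
    refine ⟨x, ?_, ?_⟩
    · show (f x : E3) ≠ -e3
      rw [hx]; exact sph_ne_south _
    · ext i
      fin_cases i
      · show coordU (f x) = z 0
        rw [hx, coordU_sph]
      · exact hx'
  · rw [← hgen, mem_relIdeal]
    exact fun x hx => hg _ ⟨x, hx, rfl⟩

omit [IsManifold 𝓘(ℂ, ℂ) ω D] [CompactSpace D] [T2Space D] [ConnectedSpace D] in
-- Points above the same value have the same factor `u⁴ ≠ 0`, so equal `r` and equal `q` mean the
-- same.
theorem IsSection.sheets_flip {f : D → S2} {q r : D → ℂ} (h : IsSection f q r) {x : D}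
    (hs : (f x : E3) ≠ -e3) (hn : (f x : E3) ≠ e3) :
    {y | flipS (f y) = flipS (f x) ∧ r y = r x} = {y | f y = f x ∧ q y = q x} := by
  ext y
  have h1 : flipS (f y) = flipS (f x) ↔ f y = f x :=
    ⟨fun h' => by rw [← flipS_flipS (f y), h', flipS_flipS], fun h' => by rw [h']⟩
  simp only [mem_ofPred_eq, h1]
  refine and_congr_right fun hy => ?_
  have hu0 : coordU (f x) ≠ 0 := left_ne_zero_of_mul_eq_one (coordU_mul_coordV hs hn)
  rw [h.rel x hs hn, h.rel y (by rwa [hy]) (by rwa [hy]), hy,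
    mul_right_inj' (pow_ne_zero 4 hu0)]

omit [ConnectedSpace D] in
theorem IsSection.norm_coeff {f : D → S2} {q r : D → ℂ} (h : IsSection f q r) {P P₀ : ℂ[X][X]}
    {m : ℕ} (hP : IsNorm f h.base q P) (hm : 0 < m) (hPm : P = P₀ ^ m) :
    P.coeff 0 = P₀.coeff 0 ^ m ∧ P₀.coeff 0 ≠ 0 := by
  have h1 : P.coeff 0 = P₀.coeff 0 ^ m := by
    rw [hPm]; exact map_pow constantCoeff P₀ m
  refine ⟨h1, fun h0 => h.norm_coeff_ne_zero hP ?_⟩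
  rw [h1, h0, zero_pow hm.ne']

/-- The image of a section is given by equations in both charts, and the number of its sheets times
its intersection number with the zero section is four times the degree. -/
theorem IsSection.curve {f : D → S2} {q r : D → ℂ} (h : IsSection f q r) :
    ∃ P₀ P₁ : ℂ[X][X], IsEquation (imgU f q) P₀ ∧ IsEquation (imgU (fun x => flipS (f x)) r) P₁ ∧
      ∃ m : ℕ, 0 < m ∧ {x | (f x : E3) = -e3 ∨ {y | f y = f x ∧ q y = q x}.ncard ≠ m}.Finite ∧
      (m : ℕ∞) * ((∑ᶠ u : ℂ, localIntersection (imgU f q) ![u, 0]) +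
        localIntersection (imgU (fun x => flipS (f x)) r) ![0, 0]) = 4 * (deg f : ℕ∞) := by
  obtain ⟨P, P₀, m, hP, hE, hm, hPm, hfin⟩ := h.exists_curve
  obtain ⟨P', P₁, m', hP', hE', hm', hPm', hfin'⟩ := h.flip.exists_curve
  refine ⟨P₀, P₁, hE, hE', m, hm, hfin, ?_⟩
  have := infinite_domain D
  -- The exponents of the two norms are both the number of sheets at a general point, and a point
  -- general for both charts exists because `D` is infinite.
  have hmm : m' = m := by
    obtain ⟨x, hx⟩ := ((hfin.union hfin').infinite_compl (α := D)).nonempty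
    simp only [mem_compl_iff, mem_union, mem_ofPred_eq, not_or, not_not] at hx
    obtain ⟨⟨h1, h2⟩, h3, h4⟩ := hx
    rw [coe_flipS, flip_eq_neg_e3] at h3
    rw [← h2, ← h4, h.sheets_flip h1 h3]
  subst hmm
  obtain ⟨h1, h1'⟩ := h.norm_coeff hP hm hPm
  obtain ⟨h2, h2'⟩ := h.flip.norm_coeff hP' hm hPm'
  have htot := h.rootMultiplicity_total hP hP'
  have e : (P₁.coeff 0 ^ m').rootMultiplicity 0 = m' * (P₁.coeff 0).rootMultiplicity 0 := by
    rw [← count_roots, roots_pow, Multiset.count_nsmul, count_roots]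
  rw [h1, h2, natDegree_pow, e, ← mul_add] at htot
  rw [hE'.localIntersection_eq h2']
  have hsum : ∑ᶠ u : ℂ, localIntersection (imgU f q) ![u, 0] = ((P₀.coeff 0).natDegree : ℕ∞) := by
    rw [finsum_eq_sum_of_support_subset (s := (P₀.coeff 0).roots.toFinset)]
    · rw [← (IsAlgClosed.splits (P₀.coeff 0)).natDegree_eq_card_roots.symm,
        ← Multiset.toFinset_sum_count_eq, Nat.cast_sum]
      refine Finset.sum_congr rfl fun a _ => ?_
      rw [hE.localIntersection_eq h1', count_roots]
    · intro a ha
      rw [Function.mem_support, hE.localIntersection_eq h1'] at ha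
      simp only [Finset.mem_coe, Multiset.mem_toFinset, ← Multiset.count_pos, count_roots]
      exact Nat.pos_of_ne_zero fun h0 => ha (by rw [h0]; rfl)
  rw [hsum]
  exact_mod_cast htot

end ImageCurve

/-! ## Holomorphic maps to `Q` -/

section MapsToQ

variable {D : Type*} [TopologicalSpace D] [ChartedSpace ℂ D]

theorem Q.continuous_base : Continuous Q.base := continuous_fst.comp continuous_subtype_val

/-- Only the isolation of the zeros needs an argument. `q` is meromorphic everywhere, being `u⁴ r`
near points above `-e₃`; if it vanished identically, so would `r` by continuity, and all
endomorphisms would be zero. -/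
theorem HolomorphicToQ.isSection [T1Space D] [PreconnectedSpace D] {N : D → Q}
    (h : HolomorphicToQ N) (hc : ¬∃ s, ∀ x, (N x).base = s) (h0 : ∃ x, (N x).endo ≠ 0) :
    IsSection (fun x => (N x).base) (fun x => (N x).q) (fun x => (N x).r) := by
  have hol : HolToS2 fun x => (N x).base :=
    ⟨Q.continuous_base.comp h.1, fun p => ⟨fun hp => ((h.2 p).1 hp).1, fun hp => ((h.2 p).2 hp).1⟩⟩
  have hb : NonconstHol fun x => (N x).base := ⟨hol, hol.isolated hc⟩
  have hq : ∀ p, MeroAt (fun x => (N x).q) p := by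
    intro p
    by_cases hp : ((N p).base : E3) = -e3
    · have h1 : HolAt (fun x => (N x).r) p := ((h.2 p).2 (by rw [hp]; exact neg_e3_ne_e3)).2
      have h2 := hol.meroAt p
      refine (((h2.mul h2).mul (h2.mul h2)).mul h1.meroAt).congr ?_
      filter_upwards [hb.isolated_ne_south p, hb.isolated_ne_north p] with x h3 h4
      rw [Q.rel h3 h4, Q.u]; ring
    · exact ((h.2 p).1 hp).2.meroAt
  refine ⟨hb, fun p hp => ((h.2 p).1 hp).2, fun p hp => ((h.2 p).2 hp).2,
    fun p hp hp' => Q.rel hp hp', ?_⟩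
  refine (mero_identity hq).resolve_left fun hz => ?_
  obtain ⟨x, hx⟩ := h0
  by_cases hp : ((N x).base : E3) = -e3
  · have hn : ((N x).base : E3) ≠ e3 := by rw [hp]; exact neg_e3_ne_e3
    refine hx ((Q.r_eq_zero_iff hn).1 ?_)
    refine tendsto_nhds_unique (((h.2 x).2 hn).2.continuousAt.mono_left nhdsWithin_le_nhds)
      (tendsto_const_nhds.congr' ?_ : Tendsto _ (𝓝[≠] x) _)
    filter_upwards [hz x, hb.isolated_ne_south x, hb.isolated_ne_north x] with y h1 h2 h3
    rw [Q.q_eq_zero_iff h2, ← Q.r_eq_zero_iff h3] at h1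
    exact h1.symm
  · refine hx ((Q.q_eq_zero_iff hp).1 ?_)
    exact tendsto_nhds_unique (((h.2 x).1 hp).2.continuousAt.mono_left nhdsWithin_le_nhds)
      (tendsto_const_nhds.congr' ((hz x).mono fun y hy => hy.symm))

omit [TopologicalSpace D] [ChartedSpace ℂ D] in
theorem affineU_range (N : D → Q) :
    affineU (range N) = imgU (fun x => (N x).base) (fun x => (N x).q) := by
  ext z
  constructor
  · rintro ⟨_, ⟨⟨x, rfl⟩, hx⟩, rfl⟩
    exact ⟨x, hx, rfl⟩
  · rintro ⟨x, hx, rfl⟩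
    exact ⟨N x, ⟨⟨x, rfl⟩, hx⟩, rfl⟩

omit [TopologicalSpace D] [ChartedSpace ℂ D] in
theorem affineV_range (N : D → Q) :
    affineV (range N) = imgU (fun x => flipS (N x).base) (fun x => (N x).r) := by
  have key : ∀ x, ![(N x).v, (N x).r] = ![coordU (flipS (N x).base), (N x).r] := fun x => by
    rw [coe_flipS, coordU_flip]; rfl
  have hs : ∀ s : S2, (flipS s : E3) ≠ -e3 ↔ (s : E3) ≠ e3 := fun s => by
    rw [coe_flipS, ne_eq, flip_eq_neg_e3]
  ext z
  constructor
  · rintro ⟨_, ⟨⟨x, rfl⟩, hx⟩, rfl⟩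
    exact ⟨x, (hs _).2 hx, (key x).symm⟩
  · rintro ⟨x, hx, rfl⟩
    exact ⟨N x, ⟨⟨x, rfl⟩, (hs _).1 hx⟩, key x⟩

variable [IsManifold 𝓘(ℂ, ℂ) ω D] [CompactSpace D] [T2Space D] [ConnectedSpace D]

/-- The image of a holomorphic map to `Q` is algebraic. Its intersection number with the zero
section, times the number of sheets, is four times the degree of the base map. -/
theorem HolomorphicToQ.image_curve {N : D → Q}
    (h : IsSection (fun x => (N x).base) (fun x => (N x).q) (fun x => (N x).r)) :
    IsAlgebraic (range N) ∧ ∃ m : ℕ, 0 < m ∧ {c ∈ range N | {x | N x = c}.ncard ≠ m}.Finite ∧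
      (m : ℕ∞) * intersectionZeroSection (range N) = 4 * (deg fun x => (N x).base : ℕ∞) := by
  obtain ⟨P₀, P₁, h0, h1, m, hm, hfin, hint⟩ := h.curve
  rw [IsAlgebraic, intersectionZeroSection, affineU_range, affineV_range]
  refine ⟨⟨h0.zeroLocus_eq, h1.zeroLocus_eq⟩, m, hm, (hfin.image N).subset ?_, hint⟩
  rintro _ ⟨⟨x, rfl⟩, hx⟩
  refine ⟨x, ?_, rfl⟩
  by_cases hs : ((N x).base : E3) = -e3
  · exact Or.inl hs
  · refine Or.inr ?_
    convert hx using 2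
    congr 1
    ext y
    refine ⟨fun hy => ?_, fun hy => ?_⟩
    · exact (Q.ext_coord hs hy.1.symm hy.2.symm).symm
    · have hy' : N y = N x := hy
      show (N y).base = (N x).base ∧ (N y).q = (N x).q
      rw [hy']; exact ⟨rfl, rfl⟩

omit [IsManifold 𝓘(ℂ, ℂ) ω D] [CompactSpace D] [T2Space D] [ConnectedSpace D] in
theorem zeroOrder_eq {N : D → Q}
    (h : IsSection (fun x => (N x).base) (fun x => (N x).q) (fun x => (N x).r)) (p : D) :
    zeroOrder N p = secOrd (fun x => (N x).base) (fun x => (N x).q) (fun x => (N x).r) p := by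
  rw [zeroOrder]
  split_ifs with hp
  · exact h.ordAt_q hp
  · rw [not_not] at hp
    have hp' : (flipS (N p).base : E3) ≠ -e3 := by
      rw [coe_flipS, ne_eq, flip_eq_neg_e3, hp]; exact neg_e3_ne_e3
    rw [h.flip.ordAt_q hp', h.secOrd_flip]

omit [IsManifold 𝓘(ℂ, ℂ) ω D] [CompactSpace D] [T2Space D] [ConnectedSpace D] in
theorem zeroOrder_eq_zero {N : D → Q} (h : HolomorphicToQ N)
    {p : D} (hp : (N p).endo ≠ 0) : zeroOrder N p = 0 := by
  rw [zeroOrder]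
  split_ifs with hs
  · rw [ordAt_eq_zero ((h.2 p).1 hs).2, ne_eq, Q.q_eq_zero_iff hs]; exact hp
  · rw [not_not] at hs
    have hn : ((N p).base : E3) ≠ e3 := by rw [hs]; exact neg_e3_ne_e3
    rw [ordAt_eq_zero ((h.2 p).2 hn).2, ne_eq, Q.r_eq_zero_iff hn]; exact hp

omit [ConnectedSpace D] in
/-- The number of zeros of a holomorphic map to `Q`, with multiplicity. -/
theorem sum_zeroOrder {N : D → Q} (hN : HolomorphicToQ N)
    (h : IsSection (fun x => (N x).base) (fun x => (N x).q) (fun x => (N x).r)) (E : Finset D) :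
    {x | x ∉ E ∧ (N x).endo = 0}.Finite ∧
      (∑ᶠ x ∈ {x | x ∉ E ∧ (N x).endo = 0}, zeroOrder N x) + ∑ e ∈ E, zeroOrder N e =
        4 * (deg fun x => (N x).base : ℕ∞) := by
  classical
  have hz : {x | x ∉ E ∧ (N x).endo = 0}.Finite := by
    refine h.zeros_finite.subset fun x hx => ?_
    show (N x).q = 0
    simp [Q.q, hx.2, fibreCoord]
  refine ⟨hz, ?_⟩
  rw [finsum_mem_eq_finite_toFinset_sum _ hz, ← Finset.sum_union]
  · have := h.sum_secOrd (Z := hz.toFinset ∪ E) fun x hx => by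
      by_contra hx'
      rw [Finset.mem_union, not_or, hz.mem_toFinset] at hx'
      have h1 : (N x).endo ≠ 0 := fun h' => hx'.1 ⟨hx'.2, h'⟩
      have h2 := zeroOrder_eq_zero hN h1
      rw [zeroOrder_eq h] at h2
      exact hx (by exact_mod_cast h2)
    rw [Finset.sum_congr rfl fun x _ => zeroOrder_eq h x]
    exact_mod_cast this
  · rw [Finset.disjoint_left]
    intro x hx
    exact (hz.mem_toFinset.1 hx).1

end MapsToQ

/-! ## Conformal linear maps from `ℂ` to `ℝ³` -/

theorem cross_zero (a b : E3) : cross a b 0 = a 1 * b 2 - a 2 * b 1 := by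
  simp [cross, cross_apply]
theorem cross_one (a b : E3) : cross a b 1 = a 2 * b 0 - a 0 * b 2 := by
  simp [cross, cross_apply]
theorem cross_two (a b : E3) : cross a b 2 = a 0 * b 1 - a 1 * b 0 := by
  simp [cross, cross_apply]

/-- The real linear map `L : ℂ → ℝ³` is an injective similarity. -/
structure IsConf (L : ℂ →L[ℝ] E3) : Prop where
  norm_eq : ‖L 1‖ = ‖L Complex.I‖
  inner_eq : inner ℝ (L 1) (L Complex.I) = 0
  ne_zero : L 1 ≠ 0

/-- The unit normal determined by the linear map `L`. -/
def nrm (L : ℂ →L[ℝ] E3) : E3 :=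
  -(‖cross (L 1) (L Complex.I)‖⁻¹ • cross (L 1) (L Complex.I))

/-- The endomorphism that maps `L v` to `B v` and vanishes on the normal of `L`. -/
def shapeOf (L B : ℂ →L[ℝ] E3) : E3 →L[ℝ] E3 :=
  (‖L 1‖ ^ 2)⁻¹ • (innerSL ℝ (L 1)).smulRight (B 1) +
  (‖L Complex.I‖ ^ 2)⁻¹ • (innerSL ℝ (L Complex.I)).smulRight (B Complex.I)

theorem apply_eq (L : ℂ →L[ℝ] E3) (a : ℂ) : L a = a.re • L 1 + a.im • L Complex.I := by
  have : a = a.re • (1 : ℂ) + a.im • Complex.I := by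
    apply Complex.ext <;> simp
  conv_lhs => rw [this]
  rw [map_add, map_smul, map_smul]

/-- Multiplication by a complex number, as a real linear map. -/
def mulL (a : ℂ) : ℂ →L[ℝ] ℂ := ContinuousLinearMap.mul ℝ ℂ a

@[simp] theorem mulL_apply (a v : ℂ) : mulL a v = a * v := rfl

namespace IsConf

variable {L : ℂ →L[ℝ] E3}

theorem sq_one (_h : IsConf L) : (L 1) 0 ^ 2 + (L 1) 1 ^ 2 + (L 1) 2 ^ 2 = ‖L 1‖ ^ 2 := by
  rw [← real_inner_self_eq_norm_sq, inner3]; ring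

theorem sq_I (h : IsConf L) :
    (L Complex.I) 0 ^ 2 + (L Complex.I) 1 ^ 2 + (L Complex.I) 2 ^ 2 = ‖L 1‖ ^ 2 := by
  rw [h.norm_eq, ← real_inner_self_eq_norm_sq, inner3]; ring

theorem dot (h : IsConf L) : (L 1) 0 * (L Complex.I) 0 + (L 1) 1 * (L Complex.I) 1 +
    (L 1) 2 * (L Complex.I) 2 = 0 := by
  rw [← inner3, h.inner_eq]

theorem sq_pos (h : IsConf L) : 0 < ‖L 1‖ ^ 2 := by
  have := norm_pos_iff.2 h.ne_zero
  positivity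

theorem norm_cross (h : IsConf L) : ‖cross (L 1) (L Complex.I)‖ = ‖L 1‖ ^ 2 := by
  rw [← sq_eq_sq₀ (norm_nonneg _) (by positivity), ← real_inner_self_eq_norm_sq, inner3,
    cross_zero, cross_one, cross_two]
  have h1 := h.sq_one
  have h2 := h.sq_I
  have h3 := h.dot
  linear_combination ((L Complex.I) 0 ^ 2 + (L Complex.I) 1 ^ 2 + (L Complex.I) 2 ^ 2) * h1 +
    ‖L 1‖ ^ 2 * h2 - ((L 1) 0 * (L Complex.I) 0 + (L 1) 1 * (L Complex.I) 1 +
    (L 1) 2 * (L Complex.I) 2) * h3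

theorem nrm_eq (h : IsConf L) : ‖L 1‖ ^ 2 • nrm L = -cross (L 1) (L Complex.I) := by
  rw [nrm, h.norm_cross, smul_neg, smul_smul, mul_inv_cancel₀ h.sq_pos.ne', one_smul]

theorem isFrame (h : IsConf L) : IsFrame (L 1) (L Complex.I) (nrm L) := by
  have h0 := h.norm_cross
  have hp := h.sq_pos
  refine ⟨?_, h.ne_zero, h.norm_eq, h.inner_eq, ?_, ?_⟩
  · rw [nrm, norm_neg, norm_smul, norm_inv, norm_norm, h0]
    exact inv_mul_cancel₀ hp.ne'
  · rw [nrm, inner_neg_right, inner_smul_right, inner3, cross_zero, cross_one, cross_two]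
    ring
  · rw [nrm, inner_neg_right, inner_smul_right, inner3, cross_zero, cross_one, cross_two]
    ring

theorem norm_apply (h : IsConf L) (v : ℂ) : ‖L v‖ = ‖L 1‖ * ‖v‖ := by
  rw [← sq_eq_sq₀ (norm_nonneg _) (by positivity), mul_pow, ← real_inner_self_eq_norm_sq,
    apply_eq L v, inner_add_left, inner_add_right, inner_add_right]
  simp only [real_inner_smul_left, real_inner_smul_right, h.inner_eq, real_inner_comm (L 1)]
  rw [real_inner_self_eq_norm_sq, real_inner_self_eq_norm_sq, ← h.norm_eq, Complex.sq_norm,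
    Complex.normSq_apply]
  ring

theorem comp (h : IsConf L) {a : ℂ} (ha : a ≠ 0) : IsConf (L ∘L mulL a) := by
  have e1 : (L ∘L mulL a) 1 = a.re • L 1 + a.im • L Complex.I := by
    rw [← apply_eq]; simp
  have e2 : (L ∘L mulL a) Complex.I = -a.im • L 1 + a.re • L Complex.I := by
    show L (a * Complex.I) = _
    rw [apply_eq]; simp
  have hc := (real_inner_comm (L 1) (L Complex.I)).trans h.inner_eq
  refine ⟨?_, ?_, ?_⟩
  · show ‖L (a * 1)‖ = ‖L (a * Complex.I)‖
    rw [h.norm_apply (a * 1), h.norm_apply (a * Complex.I)]; simp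
  · rw [e1, e2]
    simp only [inner_add_left, inner_add_right, real_inner_smul_left, real_inner_smul_right,
      h.inner_eq, real_inner_comm (L 1)]
    rw [real_inner_self_eq_norm_sq, real_inner_self_eq_norm_sq, h.norm_eq]
    ring
  · show L (a * 1) ≠ 0
    rw [← norm_ne_zero_iff, h.norm_apply]
    simp [h.ne_zero, ha]

/-- A holomorphic change of chart composes the differential with a complex multiplication, which
only scales the cross product, by the positive number `|a|²`. -/
theorem nrm_comp (h : IsConf L) {a : ℂ} (ha : a ≠ 0) : nrm (L ∘L mulL a) = nrm L := by
  have h1 := (h.comp ha).nrm_eq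
  have h2 : ‖(L ∘L mulL a) 1‖ ^ 2 = ‖a‖ ^ 2 * ‖L 1‖ ^ 2 := by
    show ‖L (a * 1)‖ ^ 2 = _
    rw [h.norm_apply, mul_one]; ring
  have h3 : cross ((L ∘L mulL a) 1) ((L ∘L mulL a) Complex.I) =
      ‖a‖ ^ 2 • cross (L 1) (L Complex.I) := by
    show cross (L (a * 1)) (L (a * Complex.I)) = _
    rw [apply_eq L (a * 1), apply_eq L (a * Complex.I), Complex.sq_norm, Complex.normSq_apply]
    apply ext3 <;> simp [cross_zero, cross_one, cross_two] <;> ring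
  rw [h3, ← smul_neg, ← h.nrm_eq, smul_smul, ← h2] at h1
  exact smul_right_injective E3 (h.comp ha).sq_pos.ne' h1

theorem shapeOf_nrm (h : IsConf L) (B : ℂ →L[ℝ] E3) : shapeOf L B (nrm L) = 0 := by
  simp [shapeOf, h.isFrame.xn, h.isFrame.yn]

theorem shapeOf_apply (h : IsConf L) (B : ℂ →L[ℝ] E3) (v : ℂ) : shapeOf L B (L v) = B v := by
  have hc := (real_inner_comm (L 1) (L Complex.I)).trans h.inner_eq
  have hI : ‖L Complex.I‖ ^ 2 ≠ 0 := by rw [← h.norm_eq]; exact h.sq_pos.ne'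
  rw [apply_eq L v, apply_eq B v]
  simp only [shapeOf, add_apply, smul_apply, ContinuousLinearMap.smulRight_apply,
    innerSL_apply_apply, inner_add_right, real_inner_smul_right, h.inner_eq, hc,
    real_inner_self_eq_norm_sq, mul_zero, add_zero, zero_add, smul_smul]
  rw [← mul_assoc, ← mul_assoc, mul_comm _ v.re, mul_comm _ v.im]
  congr 2
  · exact inv_mul_cancel_right₀ h.sq_pos.ne' _
  · exact inv_mul_cancel_right₀ hI _

theorem shapeOf_unique (h : IsConf L) {B : ℂ →L[ℝ] E3} {A : E3 →L[ℝ] E3} (hn : A (nrm L) = 0)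
    (hA : ∀ v, A (L v) = B v) : A = shapeOf L B := by
  ext1 z
  rw [h.isFrame.expand z]
  simp only [map_add, map_smul, hn, hA, h.shapeOf_nrm, h.shapeOf_apply]

/-- The differentials of the immersion and of the normal pick up the same factor under a change of
chart, so the endomorphism relating them is independent of the chart. -/
theorem shapeOf_comp (h : IsConf L) {a : ℂ} (ha : a ≠ 0) (B : ℂ →L[ℝ] E3) :
    shapeOf (L ∘L mulL a) (B ∘L mulL a) = shapeOf L B := by
  symm
  apply (h.comp ha).shapeOf_unique
  · rw [h.nrm_comp ha, h.shapeOf_nrm]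
  · intro v
    exact h.shapeOf_apply B _

end IsConf

theorem isSymmetric_of_frame {x y n : E3} (h : IsFrame x y n) {A : E3 →L[ℝ] E3} (hn : A n = 0)
    (hxn : inner ℝ (A x) n = 0) (hyn : inner ℝ (A y) n = 0)
    (hxy : inner ℝ (A x) y = inner ℝ (A y) x) : (A : E3 →ₗ[ℝ] E3).IsSymmetric := by
  intro a b
  show inner ℝ (A a) b = inner ℝ a (A b)
  rw [h.expand a, h.expand b]
  have h1 := (real_inner_comm (A x) n).trans hxn
  have h2 := (real_inner_comm (A y) n).trans hyn
  have hxy' : inner ℝ y (A x) = inner ℝ x (A y) := by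
    rw [real_inner_comm, hxy, real_inner_comm]
  simp only [map_add, map_smul, hn, inner_add_left, inner_add_right, real_inner_smul_left,
    real_inner_smul_right, inner_zero_left, inner_zero_right, smul_zero, hxn, hyn, h1, h2, hxy]
  rw [real_inner_comm x (A x), real_inner_comm y (A y), real_inner_comm x (A y),
    hxy']
  ring

/-- The complex derivative `∂₁ - i ∂₂` of a map with differential `L`. -/
def isoVec (L : ℂ →L[ℝ] E3) : Fin 3 → ℂ := fun k => (L 1 k : ℂ) - Complex.I * (L Complex.I k : ℂ)

/-- The factor of proportionality between `isoVec L` and the isotropic vector of the normal. -/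
def isoFactor (L : ℂ →L[ℝ] E3) : ℂ := (isoVec L 0 - Complex.I * isoVec L 1) / 2

theorem reVec_isoVec (L : ℂ →L[ℝ] E3) : reVec (isoVec L) = L 1 := by
  ext k; simp [reVec, isoVec]

theorem imVec_isoVec (L : ℂ →L[ℝ] E3) : imVec (isoVec L) = -L Complex.I := by
  ext k; simp [imVec, isoVec]

namespace IsConf

variable {L : ℂ →L[ℝ] E3}

theorem isFrame' (h : IsConf L) : IsFrame (reVec (isoVec L)) (imVec (isoVec L)) (nrm L) := by
  have hf := h.isFrame
  rw [reVec_isoVec, imVec_isoVec]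
  exact ⟨hf.norm_n, hf.ne_zero, by rw [norm_neg, hf.norm_eq], by simp [hf.xy], hf.xn,
    by simp [hf.yn]⟩

theorem norm_nrm (h : IsConf L) : ‖nrm L‖ = 1 := h.isFrame.norm_n

/-- The real part of the isotropy relation says that the partial derivatives have equal length, the
imaginary part that they are orthogonal. -/
theorem sum_sq (h : IsConf L) : isoVec L 0 ^ 2 + isoVec L 1 ^ 2 + isoVec L 2 ^ 2 = 0 := by
  have h1 := h.sq_one
  have h2 := h.sq_I
  have h3 := h.dot
  have h4 : (L 1) 0 ^ 2 + (L 1) 1 ^ 2 + (L 1) 2 ^ 2 =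
    (L Complex.I) 0 ^ 2 + (L Complex.I) 1 ^ 2 + (L Complex.I) 2 ^ 2 := h1.trans h2.symm
  simp only [isoVec]
  apply Complex.ext
  · simp [pow_two]
    linear_combination h4
  · simp [pow_two]
    linear_combination -2 * h3

/-- Its purpose is to show that the Weierstrass factor vanishes only where the normal is `-e₃`. -/
theorem norm_isoFactor_aux (h : IsConf L) :
    4 * ‖isoFactor L‖ ^ 2 = ‖L 1‖ ^ 2 * (1 + nrm L 2) ^ 2 := by
  have h1 := h.sq_one
  have h2 := h.sq_I
  have h3 := h.dot
  have h4 := congrArg (fun v : E3 => v 2) h.nrm_eq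
  simp only [PiLp.smul_apply, PiLp.neg_apply, cross_two, smul_eq_mul] at h4
  have hp := h.sq_pos
  have h5 : 4 * ‖isoFactor L‖ ^ 2 = ((L 1) 0 - (L Complex.I) 1) ^ 2 +
      ((L Complex.I) 0 + (L 1) 1) ^ 2 := by
    rw [Complex.sq_norm, Complex.normSq_apply]
    simp [isoFactor, isoVec]
    ring
  have h6 : ((L 1) 2) ^ 2 + ((L Complex.I) 2) ^ 2 = ‖L 1‖ ^ 2 * (1 - (nrm L 2) ^ 2) := by
    have := h.isFrame.expand e3
    have e : inner ℝ e3 e3 = (1 : ℝ) := by rw [inner3]; simp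
    have ex : ∀ a : E3, inner ℝ a e3 = a 2 := fun a => by rw [inner3]; simp
    have h7 := congrArg (fun v : E3 => v 2) this
    simp only [ex, PiLp.add_apply, PiLp.smul_apply, smul_eq_mul, e3_two] at h7
    have h8 := inv_mul_cancel₀ hp.ne'
    linear_combination ((L 1) 2 ^ 2 + (L Complex.I) 2 ^ 2) * (-h8) - ‖L 1‖ ^ 2 * h7
  rw [h5]
  linear_combination h1 + h2 - h6 - 2 * h4

theorem isoFactor_ne_zero (h : IsConf L) (hs : nrm L ≠ -e3) : isoFactor L ≠ 0 := by
  have h1 := h.norm_isoFactor_aux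
  intro h0
  rw [h0, norm_zero] at h1
  have h2 : (1 + nrm L 2) ^ 2 = 0 := by
    refine (mul_eq_zero.1 (h1.symm.trans (by norm_num))).resolve_left h.sq_pos.ne'
  have h3 := (ne_neg_e3_iff ⟨nrm L, by simp [h.norm_nrm]⟩).1 hs
  apply h3
  have := pow_eq_zero_iff (two_ne_zero) |>.1 h2
  show nrm L 2 = -1
  linarith

/-- The classical formula `u = φ₃ / (φ₁ - i φ₂)` for the Gauss map of the isotropic vector `φ`,
cleared of its denominator `2 F`. The orientation of the normal is the one that makes `u`, and not
its conjugate, appear here. -/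
theorem coordU_mul (h : IsConf L) (hs : nrm L ≠ -e3) :
    coordU (nrm L) * (2 * isoFactor L) = isoVec L 2 := by
  have hne := one_add_ne_zero (s := ⟨nrm L, by simp [h.norm_nrm]⟩) hs
  have hne' : (1 + (nrm L 2 : ℂ)) ≠ 0 := hne
  have h0 := h.sq_pos
  rw [coordU, div_mul_eq_mul_div, div_eq_iff hne']
  have h1 := h.sq_one
  have h2 := h.sq_I
  have h3 := h.dot
  have k0 := congrArg (fun v : E3 => v 0) h.nrm_eq
  have k1 := congrArg (fun v : E3 => v 1) h.nrm_eq
  have k2 := congrArg (fun v : E3 => v 2) h.nrm_eq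
  simp only [PiLp.smul_apply, PiLp.neg_apply, cross_zero, cross_one, cross_two, smul_eq_mul]
    at k0 k1 k2
  have c0 : ‖L 1‖ ^ 2 * (nrm L 0 * L 1 1 - nrm L 1 * L 1 0) = ‖L 1‖ ^ 2 * (-(L Complex.I) 2) := by
    linear_combination (L 1 1) * k0 - (L 1 0) * k1 - (L Complex.I 2) * h1 + (L 1 2) * h3
  have c1 : ‖L 1‖ ^ 2 * (nrm L 0 * L Complex.I 1 - nrm L 1 * L Complex.I 0) =
      ‖L 1‖ ^ 2 * (L 1 2) := by
    linear_combination (L Complex.I 1) * k0 - (L Complex.I 0) * k1 + (L 1 2) * h2 -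
      (L Complex.I 2) * h3
  have d0 := mul_left_cancel₀ h0.ne' c0
  have d1 := mul_left_cancel₀ h0.ne' c1
  have f1 := h.isFrame.xn
  have f2 := h.isFrame.yn
  rw [inner3] at f1 f2
  simp only [isoFactor, isoVec]
  apply Complex.ext
  · simp
    linear_combination -f1 + d1
  · simp
    linear_combination f2 + d0

/-- The algebraic form of the Weierstrass representation: `φ₁ - i φ₂ = 2F` and `φ₃ = 2F u`, and
isotropy gives `φ₁ + i φ₂ = -φ₃² / (2F) = -2F u²`. -/
theorem isoVec_eq (h : IsConf L) (hs : nrm L ≠ -e3) :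
    isoVec L = isoFactor L • isoU (coordU (nrm L)) := by
  have h1 := h.coordU_mul hs
  have h2 := h.isoFactor_ne_zero hs
  have h3 := h.sum_sq
  set u := coordU (nrm L)
  have hF : 2 * isoFactor L = isoVec L 0 - Complex.I * isoVec L 1 := by
    rw [isoFactor]; ring
  have hI := Complex.I_sq
  have e0 : isoFactor L * isoVec L 0 = isoFactor L * (isoFactor L * (1 - u ^ 2)) := by
    have : (2 * isoFactor L) * (2 * isoVec L 0) = (2 * isoFactor L) ^ 2 -
        (u * (2 * isoFactor L)) ^ 2 := by
      rw [h1, hF]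
      linear_combination h3 - (isoVec L 1 ^ 2) * hI
    linear_combination this / 4
  have e0' := mul_left_cancel₀ h2 e0
  ext k
  fin_cases k
  · exact e0'
  · show isoVec L 1 = isoFactor L * (Complex.I * (1 + u ^ 2))
    linear_combination -Complex.I * hF - Complex.I * e0' + isoVec L 1 * hI
  · show isoVec L 2 = isoFactor L * (2 * u)
    rw [← h1]; ring

theorem norm_one_eq (h : IsConf L) (hs : nrm L ≠ -e3) :
    ‖L 1‖ = ‖isoFactor L‖ * (1 + Complex.normSq (coordU (nrm L))) := by
  have h1 := congrArg reVec (h.isoVec_eq hs)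
  set u := coordU (nrm L)
  set c := isoFactor L
  rw [reVec_isoVec] at h1
  have e1 : reVec (c • isoU u) = c.re • reVec (isoU u) - c.im • imVec (isoU u) := by
    ext i; simp [reVec, imVec]
  have hf := isFrame_isoU u
  have hp := one_add_normSq_pos u
  rw [h1, e1, ← sq_eq_sq₀ (norm_nonneg _) (by positivity), norm_sub_sq_real, norm_smul, norm_smul,
    real_inner_smul_left, real_inner_smul_right, hf.xy, ← hf.norm_eq, norm_isoU, mul_pow, mul_pow,
    mul_pow, Complex.sq_norm c, Complex.normSq_apply c, Real.norm_eq_abs, Real.norm_eq_abs, sq_abs,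
    sq_abs]
  ring

end IsConf

/-! ## The Weierstrass representation in a domain of the plane -/

theorem inner_deriv_of_const {f g : ℂ → E3} {z : ℂ} {f' g' : ℂ →L[ℝ] E3} (hf : HasFDerivAt f f' z)
    (hg : HasFDerivAt g g' z) {c : ℝ} (h : ∀ᶠ w in 𝓝 z, inner ℝ (f w) (g w) = c) (v : ℂ) :
    inner ℝ (f' v) (g z) + inner ℝ (f z) (g' v) = 0 := by
  have h1 := hf.inner ℝ hg
  have h2 : HasFDerivAt (fun w => inner ℝ (f w) (g w)) (0 : ℂ →L[ℝ] ℝ) z :=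
    (hasFDerivAt_const c z).congr_of_eventuallyEq h
  have h3 := congrArg (fun l : ℂ →L[ℝ] ℝ => l v) (h1.unique h2)
  simp at h3
  linarith

theorem contDiffAt_nrm {L : ℂ →L[ℝ] E3} (h : IsConf L) {n : ℕ∞} : ContDiffAt ℝ n nrm L := by
  have hc : ∀ v k, ContDiff ℝ n fun L : ℂ →L[ℝ] E3 => L v k := fun v k =>
    ((EuclideanSpace.proj k : E3 →L[ℝ] ℝ).comp (ContinuousLinearMap.apply ℝ E3 v)).contDiff
  have hx : ContDiff ℝ n fun L : ℂ →L[ℝ] E3 => cross (L 1) (L Complex.I) := by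
    rw [contDiff_euclidean]
    intro i
    fin_cases i
    · simp only [Fin.zero_eta, cross_zero]
      exact ((hc _ _).mul (hc _ _)).sub ((hc _ _).mul (hc _ _))
    · simp only [Fin.mk_one, cross_one]
      exact ((hc _ _).mul (hc _ _)).sub ((hc _ _).mul (hc _ _))
    · simp only [Fin.reduceFinMk, cross_two]
      exact ((hc _ _).mul (hc _ _)).sub ((hc _ _).mul (hc _ _))
  have h0 : cross (L 1) (L Complex.I) ≠ 0 := by
    rw [← norm_ne_zero_iff, h.norm_cross]; exact h.sq_pos.ne'
  exact (((hx.contDiffAt.norm ℝ h0).inv (norm_ne_zero_iff.2 h0)).smul hx.contDiffAt).neg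

/-- A conformal minimal immersion of a domain of the plane. -/
structure IsMin (g : ℂ → E3) (U : Set ℂ) : Prop where
  isOpen : IsOpen U
  smooth : ContDiffOn ℝ 3 g U
  conf : ∀ z ∈ U, IsConf (fderiv ℝ g z)
  minimal : ∀ z ∈ U, LinearMap.trace ℝ E3 (shapeOf (fderiv ℝ g z)
    (fderiv ℝ (fun w => nrm (fderiv ℝ g w)) z) : E3 →ₗ[ℝ] E3) = 0

namespace IsMin

variable {g : ℂ → E3} {U : Set ℂ} (h : IsMin g U) {z : ℂ} (hz : z ∈ U)

include h hz

theorem hasFDerivAt_fderiv : HasFDerivAt (fderiv ℝ g) (fderiv ℝ (fderiv ℝ g) z) z := by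
  have h1 : ContDiffOn ℝ 2 (fderiv ℝ g) U := h.smooth.fderiv_of_isOpen h.isOpen (by norm_num)
  exact ((h1.contDiffAt (h.isOpen.mem_nhds hz)).differentiableAt (by norm_num)).hasFDerivAt

theorem hasFDerivAt_apply (w : ℂ) : HasFDerivAt (fun z => fderiv ℝ g z w)
    ((fderiv ℝ (fderiv ℝ g) z).flip w) z :=
  (ContinuousLinearMap.apply ℝ E3 w).hasFDerivAt.comp z (h.hasFDerivAt_fderiv hz)

theorem symm (v w : ℂ) : fderiv ℝ (fderiv ℝ g) z v w = fderiv ℝ (fderiv ℝ g) z w v := by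
  have h1 : ContDiffAt ℝ 3 g z := h.smooth.contDiffAt (h.isOpen.mem_nhds hz)
  exact h1.isSymmSndFDerivAt (by simp; norm_num) v w

theorem hasFDerivAt_nrm : HasFDerivAt (fun w => nrm (fderiv ℝ g w))
    (fderiv ℝ (fun w => nrm (fderiv ℝ g w)) z) z := by
  have h1 : DifferentiableAt ℝ nrm (fderiv ℝ g z) :=
    (contDiffAt_nrm (n := 1) (h.conf z hz)).differentiableAt (by norm_num)
  exact (DifferentiableAt.comp z h1 (h.hasFDerivAt_fderiv hz).differentiableAt).hasFDerivAt

theorem eventually : ∀ᶠ w in 𝓝 z, w ∈ U := h.isOpen.mem_nhds hz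

theorem inner_dnrm (v w : ℂ) : inner ℝ (fderiv ℝ (fun w => nrm (fderiv ℝ g w)) z v)
    (fderiv ℝ g z w) = -inner ℝ (nrm (fderiv ℝ g z)) (fderiv ℝ (fderiv ℝ g) z v w) := by
  have h1 := inner_deriv_of_const (h.hasFDerivAt_nrm hz) (h.hasFDerivAt_apply hz w) (c := 0)
    (by
      filter_upwards [h.eventually hz] with y hy
      have hf := (h.conf y hy).isFrame
      rw [real_inner_comm, apply_eq, inner_add_left, real_inner_smul_left, real_inner_smul_left,
        hf.xn, hf.yn]
      simp) v
  have e : (fderiv ℝ (fderiv ℝ g) z).flip w v = fderiv ℝ (fderiv ℝ g) z v w := rfl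
  rw [e] at h1
  linarith

theorem inner_dnrm_nrm (v : ℂ) : inner ℝ (fderiv ℝ (fun w => nrm (fderiv ℝ g w)) z v)
    (nrm (fderiv ℝ g z)) = 0 := by
  have h1 := inner_deriv_of_const (h.hasFDerivAt_nrm hz) (h.hasFDerivAt_nrm hz) (c := 1)
    (by
      filter_upwards [h.eventually hz] with y hy
      rw [real_inner_self_eq_norm_sq, (h.conf y hy).norm_nrm]; norm_num) v
  rw [real_inner_comm (fderiv ℝ (fun w => nrm (fderiv ℝ g w)) z v)] at h1
  linarith

/-- Differentiating the two conformality relations shows that the Laplacian of the immersion is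
orthogonal to the tangent plane. Its normal component is, up to a factor, the trace of the
derivative of the normal, which vanishes by minimality. -/
theorem laplace : fderiv ℝ (fderiv ℝ g) z 1 1 +
    fderiv ℝ (fderiv ℝ g) z Complex.I Complex.I = 0 := by
  have hc := h.conf z hz
  have hf := hc.isFrame
  have hsymm := h.symm hz 1 Complex.I
  have hA := h.hasFDerivAt_apply hz 1
  have hB := h.hasFDerivAt_apply hz Complex.I
  have e : ∀ v w, (fderiv ℝ (fderiv ℝ g) z).flip w v = fderiv ℝ (fderiv ℝ g) z v w :=
    fun _ _ => rfl
  have h1 : ∀ v, inner ℝ (fderiv ℝ (fderiv ℝ g) z v 1) (fderiv ℝ g z 1) =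
      inner ℝ (fderiv ℝ (fderiv ℝ g) z v Complex.I) (fderiv ℝ g z Complex.I) := by
    intro v
    -- The relation `|g₁|² = |g₂|²` is used in the form `⟨g₁ + g₂, g₁ - g₂⟩ = 0`.
    have k1 := inner_deriv_of_const (hA.add hB) (hA.sub hB) (c := 0) (by
      filter_upwards [h.eventually hz] with y hy
      show inner ℝ (fderiv ℝ g y 1 + fderiv ℝ g y Complex.I)
        (fderiv ℝ g y 1 - fderiv ℝ g y Complex.I) = (0 : ℝ)
      rw [inner_add_left, inner_sub_right, inner_sub_right, real_inner_self_eq_norm_sq,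
        real_inner_self_eq_norm_sq, (h.conf y hy).norm_eq, real_inner_comm]
      ring) v
    simp only [add_apply, sub_apply, Pi.add_apply, Pi.sub_apply, e, inner_add_left,
      inner_sub_right] at k1
    rw [real_inner_comm (fderiv ℝ (fderiv ℝ g) z v 1) (fderiv ℝ g z 1),
      real_inner_comm (fderiv ℝ (fderiv ℝ g) z v 1) (fderiv ℝ g z Complex.I),
      real_inner_comm (fderiv ℝ (fderiv ℝ g) z v Complex.I) (fderiv ℝ g z 1),
      real_inner_comm (fderiv ℝ (fderiv ℝ g) z v Complex.I) (fderiv ℝ g z Complex.I)] at k1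
    linarith
  have h2 : ∀ v, inner ℝ (fderiv ℝ (fderiv ℝ g) z v 1) (fderiv ℝ g z Complex.I) +
      inner ℝ (fderiv ℝ g z 1) (fderiv ℝ (fderiv ℝ g) z v Complex.I) = 0 := by
    intro v
    have k1 := inner_deriv_of_const hA hB (c := 0) (by
      filter_upwards [h.eventually hz] with y hy
      exact (h.conf y hy).inner_eq) v
    simpa only [e] using k1
  have h3 := h.minimal z hz
  rw [hf.trace_eq, hc.shapeOf_nrm, inner_zero_left, add_zero, hc.shapeOf_apply, hc.shapeOf_apply,
    h.inner_dnrm hz, h.inner_dnrm hz] at h3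
  have h4 := (mul_eq_zero.1 h3).resolve_left (inv_ne_zero hc.sq_pos.ne')
  set P := fderiv ℝ (fderiv ℝ g) z 1 1
  set R := fderiv ℝ (fderiv ℝ g) z Complex.I Complex.I
  have a1 : inner ℝ (fderiv ℝ g z 1) (P + R) = 0 := by
    have k1 := h1 1
    have k2 := h2 Complex.I
    rw [← hsymm] at k2
    rw [inner_add_right, real_inner_comm, k1]
    exact k2
  have a2 : inner ℝ (fderiv ℝ g z Complex.I) (P + R) = 0 := by
    have k1 := h1 Complex.I
    have k2 := h2 1
    rw [← hsymm] at k1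
    rw [inner_add_right]
    linarith [real_inner_comm (fderiv ℝ g z 1) (fderiv ℝ (fderiv ℝ g) z 1 Complex.I),
      real_inner_comm R (fderiv ℝ g z Complex.I), real_inner_comm P (fderiv ℝ g z Complex.I)]
  have a3 : inner ℝ (nrm (fderiv ℝ g z)) (P + R) = 0 := by
    rw [inner_add_right]; linarith
  rw [hf.expand (P + R), a1, a2, a3]
  simp

/-- Harmonicity and the symmetry of second derivatives are exactly the Cauchy–Riemann equations of
`∂₁g - i ∂₂g`. -/
theorem hasDerivAt_isoVec (k : Fin 3) : HasDerivAt (fun w => isoVec (fderiv ℝ g w) k)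
    (((fderiv ℝ (fderiv ℝ g) z 1 1) k : ℂ) -
      Complex.I * ((fderiv ℝ (fderiv ℝ g) z 1 Complex.I) k : ℂ)) z := by
  have hA : HasFDerivAt (fun w => ((fderiv ℝ g w 1) k : ℂ))
      (Complex.ofRealCLM ∘L (EuclideanSpace.proj k : E3 →L[ℝ] ℝ) ∘L
        (fderiv ℝ (fderiv ℝ g) z).flip 1) z :=
    Complex.ofRealCLM.hasFDerivAt.comp z
      ((EuclideanSpace.proj k : E3 →L[ℝ] ℝ).hasFDerivAt.comp z (h.hasFDerivAt_apply hz 1))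
  have hB : HasFDerivAt (fun w => ((fderiv ℝ g w Complex.I) k : ℂ))
      (Complex.ofRealCLM ∘L (EuclideanSpace.proj k : E3 →L[ℝ] ℝ) ∘L
        (fderiv ℝ (fderiv ℝ g) z).flip Complex.I) z :=
    Complex.ofRealCLM.hasFDerivAt.comp z
      ((EuclideanSpace.proj k : E3 →L[ℝ] ℝ).hasFDerivAt.comp z (h.hasFDerivAt_apply hz Complex.I))
  have hF := hA.sub (hB.const_mul Complex.I)
  have hl := congrArg (fun v : E3 => ((v k : ℝ) : ℂ)) (h.laplace hz)
  have hs := h.symm hz 1 Complex.I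
  rw [hasDerivAt_iff_hasFDerivAt]
  refine hasFDerivAt_of_restrictScalars ℝ hF ?_
  apply ContinuousLinearMap.ext
  intro v
  have e : ∀ v w, (fderiv ℝ (fderiv ℝ g) z).flip w v = fderiv ℝ (fderiv ℝ g) z v w :=
    fun _ _ => rfl
  have hv : ∀ w, fderiv ℝ (fderiv ℝ g) z v w = v.re • fderiv ℝ (fderiv ℝ g) z 1 w +
      v.im • fderiv ℝ (fderiv ℝ g) z Complex.I w := fun w => by
    rw [← e, apply_eq]; rfl
  simp at hl
  simp [e, hv, ← hs]
  conv_lhs => rw [← Complex.re_add_im v]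
  linear_combination (v.im * Complex.I) * hl -
    v.im * ((fderiv ℝ (fderiv ℝ g) z 1 Complex.I) k) * Complex.I_sq

omit hz in
theorem differentiableOn_isoVec (k : Fin 3) :
    DifferentiableOn ℂ (fun w => isoVec (fderiv ℝ g w) k) U := fun _ hz =>
  (h.hasDerivAt_isoVec hz k).differentiableAt.differentiableWithinAt

omit hz in
theorem differentiableOn_isoFactor : DifferentiableOn ℂ (fun w => isoFactor (fderiv ℝ g w)) U :=
  ((h.differentiableOn_isoVec 0).sub ((h.differentiableOn_isoVec 1).const_mul _)).div_const _

theorem analyticAt_isoFactor : AnalyticAt ℂ (fun w => isoFactor (fderiv ℝ g w)) z :=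
  h.differentiableOn_isoFactor.analyticAt (h.isOpen.mem_nhds hz)

theorem eventually_ne_south (hs : nrm (fderiv ℝ g z) ≠ -e3) :
    ∀ᶠ w in 𝓝 z, w ∈ U ∧ nrm (fderiv ℝ g w) ≠ -e3 :=
  (h.eventually hz).and ((h.hasFDerivAt_nrm hz).continuousAt.eventually_ne hs)

theorem analyticAt_coordU (hs : nrm (fderiv ℝ g z) ≠ -e3) :
    AnalyticAt ℂ (fun w => coordU (nrm (fderiv ℝ g w))) z := by
  have h2 : AnalyticAt ℂ (fun w => isoVec (fderiv ℝ g w) 2) z :=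
    (h.differentiableOn_isoVec 2).analyticAt (h.isOpen.mem_nhds hz)
  have h0 := (h.conf z hz).isoFactor_ne_zero hs
  refine (h2.div (analyticAt_const.mul (h.analyticAt_isoFactor hz))
    (mul_ne_zero two_ne_zero h0)).congr ?_
  filter_upwards [h.eventually_ne_south hz hs] with w hw
  have h1 := (h.conf w hw.1).isoFactor_ne_zero hw.2
  exact (div_eq_iff (mul_ne_zero two_ne_zero h1)).2 ((h.conf w hw.1).coordU_mul hw.2).symm

theorem isSymmetric : (shapeOf (fderiv ℝ g z) (fderiv ℝ (fun w => nrm (fderiv ℝ g w)) z) :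
    E3 →ₗ[ℝ] E3).IsSymmetric := by
  have hc := h.conf z hz
  refine isSymmetric_of_frame hc.isFrame (hc.shapeOf_nrm _) ?_ ?_ ?_
  · rw [hc.shapeOf_apply, h.inner_dnrm_nrm hz]
  · rw [hc.shapeOf_apply, h.inner_dnrm_nrm hz]
  · rw [hc.shapeOf_apply, hc.shapeOf_apply, h.inner_dnrm hz, h.inner_dnrm hz, h.symm hz]

/-- By `⟨dn v, dg w⟩ = -⟨n, D²g(v, w)⟩` the fibre coordinate is `-⟨n, φ'⟩` with `φ = F · isoU u`. In
`φ' = F' · isoU u + F u' · (-2u, 2iu, 2)` the normal annihilates the first vector and has product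
`2` with the second; these are `k1` and `k2`, multiplied by `1 + |u|²`. -/
theorem fibreCoord_shapeOf (hs : nrm (fderiv ℝ g z) ≠ -e3) :
    fibreCoord (shapeOf (fderiv ℝ g z) (fderiv ℝ (fun w => nrm (fderiv ℝ g w)) z))
      (isoVec (fderiv ℝ g z)) =
    -2 * isoFactor (fderiv ℝ g z) * deriv (fun w => coordU (nrm (fderiv ℝ g w))) z := by
  have hc := h.conf z hz
  set n := nrm (fderiv ℝ g z)
  have e1 : fibreCoord (shapeOf (fderiv ℝ g z) (fderiv ℝ (fun w => nrm (fderiv ℝ g w)) z))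
      (isoVec (fderiv ℝ g z)) = -∑ k, (n k : ℂ) * (((fderiv ℝ (fderiv ℝ g) z 1 1) k : ℂ) -
      Complex.I * ((fderiv ℝ (fderiv ℝ g) z 1 Complex.I) k : ℂ)) := by
    rw [fibreCoord, reVec_isoVec, imVec_isoVec, hc.shapeOf_apply, inner_neg_right,
      h.inner_dnrm hz, h.inner_dnrm hz, inner3, inner3, Fin.sum_univ_three]
    push_cast
    ring
  have hu := (h.analyticAt_coordU hz hs).differentiableAt.hasDerivAt
  have hF := (h.analyticAt_isoFactor hz).differentiableAt.hasDerivAt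
  set u := coordU n
  set u' := deriv (fun w => coordU (nrm (fderiv ℝ g w))) z
  set F' := deriv (fun w => isoFactor (fderiv ℝ g w)) z
  have hk : ∀ k, isoVec (fderiv ℝ g z) k = isoFactor (fderiv ℝ g z) * isoU u k := fun k =>
    congrFun (hc.isoVec_eq hs) k
  have hev : ∀ k, (fun w => isoVec (fderiv ℝ g w) k) =ᶠ[𝓝 z] fun w =>
      isoFactor (fderiv ℝ g w) * isoU (coordU (nrm (fderiv ℝ g w))) k := fun k => by
    filter_upwards [h.eventually_ne_south hz hs] with w hw
    exact congrFun ((h.conf w hw.1).isoVec_eq hw.2) k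
  have d : ∀ k (c : ℂ), HasDerivAt (fun w => isoU (coordU (nrm (fderiv ℝ g w))) k) c z →
      (((fderiv ℝ (fderiv ℝ g) z 1 1) k : ℂ) -
        Complex.I * ((fderiv ℝ (fderiv ℝ g) z 1 Complex.I) k : ℂ)) =
        F' * isoU u k + isoFactor (fderiv ℝ g z) * c := fun k c hc' =>
    (h.hasDerivAt_isoVec hz k).unique ((hF.mul hc').congr_of_eventuallyEq (hev k))
  have d0 := d 0 (-(2 * u * u')) (by
    have := (hu.fun_pow 2).const_sub 1
    simpa [isoU] using this)
  have d1 := d 1 (Complex.I * (2 * u * u')) (by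
    have := ((hu.fun_pow 2).const_add 1).const_mul Complex.I
    simpa [isoU] using this)
  have d2 := d 2 (2 * u') (by
    have := hu.const_mul 2
    simpa [isoU] using this)
  rw [e1, Fin.sum_univ_three, d0, d1, d2]
  have hn : n = sph u := by
    have := sph_coordU (s := ⟨n, by simp [n, hc.norm_nrm]⟩) hs
    exact (congrArg Subtype.val this).symm
  have hp : (1 + (Complex.normSq u : ℂ)) ≠ 0 := by exact_mod_cast (one_add_normSq_pos u).ne'
  have m0 : (n 0 : ℂ) * (1 + (Complex.normSq u : ℂ)) = -2 * u.re := by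
    rw [hn]; simp [sph, sphVec]; field_simp
  have m1 : (n 1 : ℂ) * (1 + (Complex.normSq u : ℂ)) = -2 * u.im := by
    rw [hn]; simp [sph, sphVec]; field_simp
  have m2 : (n 2 : ℂ) * (1 + (Complex.normSq u : ℂ)) = 1 - Complex.normSq u := by
    rw [hn]; simp [sph, sphVec]; field_simp
  have hu2 : (Complex.normSq u : ℂ) = u.re ^ 2 + u.im ^ 2 := by
    rw [Complex.normSq_apply]; push_cast; ring
  have hre := Complex.re_add_im u
  have hI := Complex.I_sq
  apply mul_right_cancel₀ hp
  have k1 : ((n 0 : ℂ) * (1 - u ^ 2) + (n 1 : ℂ) * (Complex.I * (1 + u ^ 2)) +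
      (n 2 : ℂ) * (2 * u)) * (1 + (Complex.normSq u : ℂ)) = 0 := by
    linear_combination (1 - u ^ 2) * m0 + Complex.I * (1 + u ^ 2) * m1 + 2 * u * m2 -
      2 * u * hu2 - (2 + 2 * u * (u.re - u.im * Complex.I)) * hre - 2 * u * u.im ^ 2 * hI
  have k2 : ((n 0 : ℂ) * (-(2 * u)) + (n 1 : ℂ) * (Complex.I * (2 * u)) +
      (n 2 : ℂ) * 2) * (1 + (Complex.normSq u : ℂ)) = 2 * (1 + (Complex.normSq u : ℂ)) := by
    linear_combination -2 * u * m0 + 2 * u * Complex.I * m1 + 2 * m2 - 4 * hu2 -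
      4 * (u.re - u.im * Complex.I) * hre - 4 * u.im ^ 2 * hI
  simp only [isoU, Matrix.cons_val_zero, Matrix.cons_val_one, Matrix.cons_val]
  linear_combination (-F') * k1 - isoFactor (fderiv ℝ g z) * u' * k2

/-- Passing from `φ = F · isoU u` to `isoU u` divides the quadratic fibre coordinate `-2 F u'` by
`F²`. -/
theorem fibreCoord_isoU (hs : nrm (fderiv ℝ g z) ≠ -e3) :
    fibreCoord (shapeOf (fderiv ℝ g z) (fderiv ℝ (fun w => nrm (fderiv ℝ g w)) z))
      (isoU (coordU (nrm (fderiv ℝ g z)))) =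
    -2 * deriv (fun w => coordU (nrm (fderiv ℝ g w))) z / isoFactor (fderiv ℝ g z) := by
  have hc := h.conf z hz
  have h0 := hc.isoFactor_ne_zero hs
  have h1 : isoU (coordU (nrm (fderiv ℝ g z))) =
      (isoFactor (fderiv ℝ g z))⁻¹ • isoVec (fderiv ℝ g z) := by
    rw [hc.isoVec_eq hs, smul_smul, inv_mul_cancel₀ h0, one_smul]
  rw [h1, fibreCoord_smul hc.isFrame' (h.isSymmetric hz) (hc.shapeOf_nrm _) (h.minimal z hz),
    h.fibreCoord_shapeOf hz hs]
  field_simp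

/-- In the frame of the partial derivatives the determinant is minus the squared norm of the fibre
coordinate `-2 F u'`, divided by `|g₁|⁴`. The area density is `|g₁|²` and `|g₁| = |F| (1 + |u|²)`,
so `F` cancels and minus the pulled back spherical area remains. -/
theorem det_mul (hs : nrm (fderiv ℝ g z) ≠ -e3) :
    LinearMap.det ((shapeOf (fderiv ℝ g z) (fderiv ℝ (fun w => nrm (fderiv ℝ g w)) z) +
      (innerSL ℝ (nrm (fderiv ℝ g z))).smulRight (nrm (fderiv ℝ g z)) : E3 →L[ℝ] E3) :
        E3 →ₗ[ℝ] E3) * ‖cross (fderiv ℝ g z 1) (fderiv ℝ g z Complex.I)‖ =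
      -(4 * ‖deriv (fun w => coordU (nrm (fderiv ℝ g w))) z‖ ^ 2 /
        (1 + ‖coordU (nrm (fderiv ℝ g z))‖ ^ 2) ^ 2) := by
  have hc := h.conf z hz
  have h0 := norm_ne_zero_iff.2 (hc.isoFactor_ne_zero hs)
  have hq := congrArg (fun c : ℂ => ‖c‖ ^ 2) (h.fibreCoord_shapeOf hz hs)
  set A := shapeOf (fderiv ℝ g z) (fderiv ℝ (fun w => nrm (fderiv ℝ g w)) z)
  have hsy : inner ℝ (A (fderiv ℝ g z 1)) (fderiv ℝ g z Complex.I) =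
      inner ℝ (A (fderiv ℝ g z Complex.I)) (fderiv ℝ g z 1) := by
    rw [hc.shapeOf_apply, hc.shapeOf_apply, h.inner_dnrm hz, h.inner_dnrm hz, h.symm hz]
  have hyy := hc.isFrame.apply_yy (hc.shapeOf_nrm _) (h.minimal z hz)
  have hq' : ‖fibreCoord A (isoVec (fderiv ℝ g z))‖ ^ 2 =
      (inner ℝ (A (fderiv ℝ g z 1)) (fderiv ℝ g z 1)) ^ 2 +
      (inner ℝ (A (fderiv ℝ g z 1)) (fderiv ℝ g z Complex.I)) ^ 2 := by
    rw [Complex.sq_norm, Complex.normSq_apply, fibreCoord, reVec_isoVec, imVec_isoVec]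
    simp
    ring
  have hdet := hc.isFrame.det_eq (A := A) (hc.shapeOf_nrm _)
    (by rw [hc.shapeOf_apply, h.inner_dnrm_nrm hz]) (by rw [hc.shapeOf_apply, h.inner_dnrm_nrm hz])
  have hρ := hc.sq_pos
  rw [hdet, hc.norm_cross, hyy, ← hsy]
  have hq2 : (inner ℝ (A (fderiv ℝ g z 1)) (fderiv ℝ g z 1)) ^ 2 +
      (inner ℝ (A (fderiv ℝ g z 1)) (fderiv ℝ g z Complex.I)) ^ 2 =
      4 * ‖isoFactor (fderiv ℝ g z)‖ ^ 2 *
        ‖deriv (fun w => coordU (nrm (fderiv ℝ g w))) z‖ ^ 2 := by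
    rw [← hq']
    refine hq.trans ?_
    simp only [norm_mul, norm_neg, mul_pow, Complex.norm_ofNat]
    ring
  have hρ2 := hc.norm_one_eq hs
  rw [← Complex.sq_norm] at hρ2
  have e1 : ∀ ρ a b : ℝ, ρ ≠ 0 → ρ⁻¹ ^ 2 * (a * -a - b * b) * ρ = -((a ^ 2 + b ^ 2) / ρ) := by
    intro ρ a b hρ; field_simp; ring
  rw [e1 _ _ _ hρ.ne', hq2, hρ2]
  have h3 : (1 + ‖coordU (nrm (fderiv ℝ g z))‖ ^ 2) ≠ 0 := by positivity
  field_simp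

end IsMin

/-! ## The Weierstrass representation in charts -/

section Regular

variable {D : Type*} [TopologicalSpace D] [ChartedSpace ℂ D]

theorem normal_eq_nrm (ε : D → D → E3) (x : D) : normal ε x = nrm (dMap ε x x) := rfl

theorem shape_eq_shapeOf (ε : D → D → E3) (x : D) :
    shape ε x = shapeOf (dMap ε x x) (dNormal ε x) := rfl

theorem hasFDerivAt_of_transition [IsManifold 𝓘(ℂ, ℂ) ω D] {g : D → E3} {p q y : D}
    (hp : y ∈ (chartAt ℂ p).source) (hq : y ∈ (chartAt ℂ q).source) {B : ℂ →L[ℝ] E3}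
    (hB : HasFDerivAt (g ∘ (chartAt ℂ q).symm) B (chartAt ℂ q y)) :
    HasFDerivAt (g ∘ (chartAt ℂ p).symm)
      (B ∘L mulL (deriv (chartAt ℂ q ∘ (chartAt ℂ p).symm) (chartAt ℂ p y)))
      (chartAt ℂ p y) := by
  have h1 := (transition_analyticAt hp hq).differentiableAt.hasDerivAt.hasFDerivAt.restrictScalars ℝ
  have e1 : (chartAt ℂ q ∘ (chartAt ℂ p).symm) (chartAt ℂ p y) = chartAt ℂ q y := by
    simp [(chartAt ℂ p).left_inv hp]
  rw [← e1] at hB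
  have h2 := hB.comp _ h1
  refine (h2.congr_of_eventuallyEq (chart_change_eventuallyEq g hp hq)).congr_fderiv ?_
  ext1 v
  simp [mul_comm]

theorem IsMinimalImmersion.isConf {Dinf : Finset D} {ε : D → D → E3}
    (h : IsMinimalImmersion Dinf ε) {x : D} (hx : x ∉ Dinf) : IsConf (dMap ε x x) :=
  ⟨(h.conformal x hx).1, (h.conformal x hx).2, fun h0 =>
    one_ne_zero (h.immersion x hx (h0.trans (map_zero _).symm))⟩

/-- Branches at nearby points differ by translations and charts by holomorphic maps. So one branch
in one chart computes the differential, the normal and its derivative at all nearby points, although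
each of them is defined by the branch and the chart belonging to that point. This reduces the local
theory on `D` to a domain of the plane. -/
theorem IsMinimalImmersion.exists_isMin [IsManifold 𝓘(ℂ, ℂ) ω D] [T1Space D] {Dinf : Finset D}
    {ε : D → D → E3} (h : IsMinimalImmersion Dinf ε) {c y : D} (hy : y ∈ (chartAt ℂ c).source)
    (hyD : y ∉ Dinf) :
    ∃ U, IsMin (ε y ∘ (chartAt ℂ c).symm) U ∧ chartAt ℂ c y ∈ U ∧ U ⊆ (chartAt ℂ c).target ∧
      ∀ z ∈ U, (chartAt ℂ c).symm z ∉ Dinf ∧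
        dMap ε c ((chartAt ℂ c).symm z) = fderiv ℝ (ε y ∘ (chartAt ℂ c).symm) z ∧
        normal ε ((chartAt ℂ c).symm z) = nrm (fderiv ℝ (ε y ∘ (chartAt ℂ c).symm) z) ∧
        shape ε ((chartAt ℂ c).symm z) = shapeOf (fderiv ℝ (ε y ∘ (chartAt ℂ c).symm) z)
          (fderiv ℝ (fun w => nrm (fderiv ℝ (ε y ∘ (chartAt ℂ c).symm) w)) z) := by
  obtain ⟨V, hVp, hV, hyV⟩ := eventually_nhds_iff.1 ((h.continuation y hyD).and
    (((Dinf.finite_toSet.isClosed).isOpen_compl.mem_nhds (show y ∈ (Dinf : Set D)ᶜ from hyD))))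
  set g := ε y ∘ (chartAt ℂ c).symm with hg
  set U := (chartAt ℂ c).target ∩ (chartAt ℂ c).symm ⁻¹' V with hUdef
  have hU : IsOpen U := (chartAt ℂ c).isOpen_inter_preimage_symm hV
  have key : ∀ z ∈ U, (chartAt ℂ c).symm z ∉ Dinf ∧ ContDiffAt ℝ 3 g z ∧
      dMap ε c ((chartAt ℂ c).symm z) = fderiv ℝ g z ∧
      IsConf (fderiv ℝ g z) ∧ normal ε ((chartAt ℂ c).symm z) = nrm (fderiv ℝ g z) ∧
      dMap ε ((chartAt ℂ c).symm z) ((chartAt ℂ c).symm z) = fderiv ℝ g z ∘L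
        mulL (deriv (chartAt ℂ c ∘ (chartAt ℂ ((chartAt ℂ c).symm z)).symm)
          (chartAt ℂ ((chartAt ℂ c).symm z) ((chartAt ℂ c).symm z))) := by
    rintro z ⟨hz, hzV⟩
    set x := (chartAt ℂ c).symm z with hx
    have hxs : x ∈ (chartAt ℂ c).source := (chartAt ℂ c).map_target hz
    have hxx := mem_chart_source ℂ x
    have hzx : chartAt ℂ c x = z := (chartAt ℂ c).right_inv hz
    have hxD : x ∉ Dinf := (hVp x hzV).2
    obtain ⟨p, hp⟩ := (hVp x hzV).1
    have hct : Tendsto (chartAt ℂ c).symm (𝓝 z) (𝓝 x) := (chartAt ℂ c).continuousAt_symm hz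
    have e1 : (ε x ∘ (chartAt ℂ c).symm) =ᶠ[𝓝 z] fun w => g w + p := hct.eventually hp
    have e2 : g =ᶠ[𝓝 z] fun w => (ε x ∘ (chartAt ℂ c).symm) w - p := by
      filter_upwards [e1] with w hw
      rw [hw]; exact (add_sub_cancel_right _ _).symm
    have hsm : ContDiffAt ℝ 3 (ε x ∘ (chartAt ℂ c).symm) z := by
      have h1 : ContDiffAt ℝ 3 (ε x ∘ (chartAt ℂ x).symm) (chartAt ℂ x x) :=
        (h.smooth x hxD).of_le (WithTop.coe_le_coe.2 (le_top : (3 : ℕ∞) ≤ ⊤))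
      have h2 : ContDiffAt ℝ 3 (chartAt ℂ x ∘ (chartAt ℂ c).symm) (chartAt ℂ c x) :=
        ((transition_analyticAt hxs hxx).contDiffAt (n := 3)).restrict_scalars ℝ
      have e3 : (chartAt ℂ x ∘ (chartAt ℂ c).symm) (chartAt ℂ c x) = chartAt ℂ x x := by
        simp [(chartAt ℂ c).left_inv hxs]
      have h3 := (ContDiffAt.comp (chartAt ℂ c x) (e3 ▸ h1) h2).congr_of_eventuallyEq
        (chart_change_eventuallyEq (ε x) hxs hxx)
      rwa [hzx] at h3
    have hd : dMap ε c x = fderiv ℝ g z := by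
      rw [dMap, hzx, e1.fderiv_eq, fderiv_add_const]
    have hfd : HasFDerivAt (ε x ∘ (chartAt ℂ c).symm) (fderiv ℝ g z) (chartAt ℂ c x) := by
      rw [← hd]
      exact ((hzx ▸ hsm : ContDiffAt ℝ 3 _ (chartAt ℂ c x)).differentiableAt
        (by norm_num)).hasFDerivAt
    have hdx : dMap ε x x = fderiv ℝ g z ∘L
        mulL (deriv (chartAt ℂ c ∘ (chartAt ℂ x).symm) (chartAt ℂ x x)) :=
      (hasFDerivAt_of_transition hxx hxs hfd).fderiv
    have ha := transition_deriv_ne_zero hxs hxx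
    have ha' := transition_deriv_ne_zero hxx hxs
    have hconf : IsConf (fderiv ℝ g z) := by
      have h1 := (h.isConf hxD).comp ha
      rw [hdx] at h1
      convert h1 using 1
      ext1 v
      show _ = fderiv ℝ g z (_ * (_ * v))
      rw [← mul_assoc, transition_deriv_mul hxs hxx, one_mul]
    refine ⟨hxD, (hsm.sub contDiffAt_const).congr_of_eventuallyEq e2, hd, hconf, ?_, hdx⟩
    rw [normal_eq_nrm, hdx, hconf.nrm_comp ha']
  have hshape : ∀ z ∈ U, shape ε ((chartAt ℂ c).symm z) = shapeOf (fderiv ℝ g z)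
      (fderiv ℝ (fun w => nrm (fderiv ℝ g w)) z) := by
    intro z hz
    obtain ⟨-, hsm, -, hconf, -, hdx⟩ := key z hz
    set x := (chartAt ℂ c).symm z with hx
    have hxs : x ∈ (chartAt ℂ c).source := (chartAt ℂ c).map_target hz.1
    have hxx := mem_chart_source ℂ x
    have hzx : chartAt ℂ c x = z := (chartAt ℂ c).right_inv hz.1
    have hdn : DifferentiableAt ℝ (fun w => nrm (fderiv ℝ g w)) z := by
      have h1 : DifferentiableAt ℝ nrm (fderiv ℝ g z) :=
        (contDiffAt_nrm (n := 1) hconf).differentiableAt (by norm_num)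
      have h2 : ContDiffAt ℝ 2 (fderiv ℝ g) z := hsm.fderiv_right (by norm_num)
      exact DifferentiableAt.comp (g := nrm) z h1 (h2.differentiableAt (by norm_num))
    have e1 : normal ε ∘ (chartAt ℂ c).symm =ᶠ[𝓝 z] fun w => nrm (fderiv ℝ g w) := by
      filter_upwards [hU.mem_nhds hz] with w hw
      exact (key w hw).2.2.2.2.1
    have hN : HasFDerivAt (normal ε ∘ (chartAt ℂ c).symm)
        (fderiv ℝ (fun w => nrm (fderiv ℝ g w)) z) (chartAt ℂ c x) := by
      rw [hzx]
      exact hdn.hasFDerivAt.congr_of_eventuallyEq e1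
    have hdN : dNormal ε x = _ := (hasFDerivAt_of_transition hxx hxs hN).fderiv
    rw [shape_eq_shapeOf, hdx, hdN, hconf.shapeOf_comp (transition_deriv_ne_zero hxx hxs)]
  refine ⟨U, ⟨hU, fun z hz => (key z hz).2.1.contDiffWithinAt, fun z hz => (key z hz).2.2.2.1,
    fun z hz => ?_⟩, ⟨(chartAt ℂ c).map_source hy, ?_⟩, inter_subset_left, fun z hz =>
    ⟨(key z hz).1, (key z hz).2.2.1, (key z hz).2.2.2.2.1, hshape z hz⟩⟩
  · rw [← hshape z hz]
    exact h.minimal _ (key z hz).1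
  · show (chartAt ℂ c).symm (chartAt ℂ c y) ∈ V
    rwa [(chartAt ℂ c).left_inv hy]

/-- The coordinate `u` of the Gauss map. -/
def gaussU (ε : D → D → E3) (x : D) : ℂ := coordU (normal ε x)

/-- The holomorphic factor of the differential of the immersion in the chart around `c`. -/
def factor (ε : D → D → E3) (c : D) (z : ℂ) : ℂ := isoFactor (dMap ε c ((chartAt ℂ c).symm z))

/-- The coordinate `q` of the derivative of the Gauss map. -/
def gaussQ (ε : D → D → E3) (x : D) : ℂ := fibreCoord (shape ε x) (isoU (gaussU ε x))

namespace IsMinimalImmersion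

variable [IsManifold 𝓘(ℂ, ℂ) ω D] [T1Space D] {Dinf : Finset D}
    {ε : D → D → E3} (h : IsMinimalImmersion Dinf ε) {c y : D}
    (hyD : y ∉ Dinf) (hy : y ∈ (chartAt ℂ c).source)

include h hyD

include hy in
theorem isConf_dMap : IsConf (dMap ε c y) := by
  obtain ⟨U, hm, hyU, -, hU⟩ := h.exists_isMin hy hyD
  have h1 := (hU _ hyU).2.1
  rw [(chartAt ℂ c).left_inv hy] at h1
  rw [h1]
  exact hm.conf _ hyU

include hy in
theorem normal_eq : normal ε y = nrm (dMap ε c y) := by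
  obtain ⟨U, hm, hyU, -, hU⟩ := h.exists_isMin hy hyD
  have h1 := hU _ hyU
  rw [(chartAt ℂ c).left_inv hy] at h1
  rw [h1.2.1, h1.2.2.1]

omit [IsManifold 𝓘(ℂ, ℂ) ω D] [T1Space D] in
theorem norm_normal : ‖normal ε y‖ = 1 := (h.isConf hyD).norm_nrm

theorem shape_mem : (shape ε y : E3 →ₗ[ℝ] E3).IsSymmetric ∧ shape ε y (normal ε y) = 0 ∧
    LinearMap.trace ℝ E3 (shape ε y : E3 →ₗ[ℝ] E3) = 0 := by
  have hy := mem_chart_source ℂ y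
  obtain ⟨U, hm, hyU, -, hU⟩ := h.exists_isMin hy hyD
  have h1 := hU _ hyU
  rw [(chartAt ℂ y).left_inv hy] at h1
  refine ⟨?_, ?_, h.minimal y hyD⟩
  · rw [h1.2.2.2]; exact hm.isSymmetric hyU
  · exact (h.isConf hyD).shapeOf_nrm _

theorem continuousAt_normal : ContinuousAt (normal ε) y := by
  have hy := mem_chart_source ℂ y
  obtain ⟨U, hm, hyU, -, hU⟩ := h.exists_isMin hy hyD
  refine (ContinuousAt.comp (hm.hasFDerivAt_nrm hyU).continuousAt
    ((chartAt ℂ y).continuousAt hy)).congr ?_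
  filter_upwards [((chartAt ℂ y).continuousAt hy).eventually (hm.eventually hyU),
    chart_source_mem_nhds ℂ y] with w hw hw'
  have := (hU _ hw).2.2.1
  rw [(chartAt ℂ y).left_inv hw'] at this
  exact this.symm

variable (hs : normal ε y ≠ -e3)

include hs hy

theorem gaussU_chart : ∃ g U, IsMin g U ∧ chartAt ℂ c y ∈ U ∧
    nrm (fderiv ℝ g (chartAt ℂ c y)) ≠ -e3 ∧
    dMap ε c y = fderiv ℝ g (chartAt ℂ c y) ∧
    normal ε y = nrm (fderiv ℝ g (chartAt ℂ c y)) ∧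
    shape ε y = shapeOf (fderiv ℝ g (chartAt ℂ c y))
      (fderiv ℝ (fun w => nrm (fderiv ℝ g w)) (chartAt ℂ c y)) ∧
    gaussU ε ∘ (chartAt ℂ c).symm =ᶠ[𝓝 (chartAt ℂ c y)] (fun w => coordU (nrm (fderiv ℝ g w))) ∧
    factor ε c =ᶠ[𝓝 (chartAt ℂ c y)] fun w => isoFactor (fderiv ℝ g w) := by
  obtain ⟨U, hm, hyU, -, hU⟩ := h.exists_isMin hy hyD
  have h1 := hU _ hyU
  rw [(chartAt ℂ c).left_inv hy] at h1
  refine ⟨_, U, hm, hyU, ?_, h1.2.1, h1.2.2.1, h1.2.2.2, ?_, ?_⟩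
  · rw [← h1.2.2.1]; exact hs
  · filter_upwards [hm.eventually hyU] with w hw
    show coordU _ = _
    rw [(hU w hw).2.2.1]
  · filter_upwards [hm.eventually hyU] with w hw
    rw [factor, (hU w hw).2.1]

theorem analyticAt_gaussU : AnalyticAt ℂ (gaussU ε ∘ (chartAt ℂ c).symm) (chartAt ℂ c y) := by
  obtain ⟨g, U, hm, hyU, hs', h1, h2, h3, h4, h5⟩ := h.gaussU_chart hyD hy hs
  exact (hm.analyticAt_coordU hyU hs').congr h4.symm

theorem analyticAt_factor : AnalyticAt ℂ (factor ε c) (chartAt ℂ c y) := by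
  obtain ⟨g, U, hm, hyU, hs', h1, h2, h3, h4, h5⟩ := h.gaussU_chart hyD hy hs
  exact (hm.analyticAt_isoFactor hyU).congr h5.symm

theorem factor_ne_zero : factor ε c (chartAt ℂ c y) ≠ 0 := by
  obtain ⟨g, U, hm, hyU, hs', h1, h2, h3, h4, h5⟩ := h.gaussU_chart hyD hy hs
  rw [h5.self_of_nhds]
  exact (hm.conf _ hyU).isoFactor_ne_zero hs'

theorem gaussQ_eq : gaussQ ε y =
    -2 * deriv (gaussU ε ∘ (chartAt ℂ c).symm) (chartAt ℂ c y) / factor ε c (chartAt ℂ c y) := by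
  obtain ⟨g, U, hm, hyU, hs', h1, h2, h3, h4, h5⟩ := h.gaussU_chart hyD hy hs
  rw [h4.deriv_eq, h5.self_of_nhds, gaussQ, gaussU, h3, h2]
  exact hm.fibreCoord_isoU hyU hs'

theorem gaussCurv_mul : gaussCurv ε y * ‖cross (dMap ε c y 1) (dMap ε c y Complex.I)‖ =
    -(4 * ‖deriv (gaussU ε ∘ (chartAt ℂ c).symm) (chartAt ℂ c y)‖ ^ 2 /
      (1 + ‖gaussU ε y‖ ^ 2) ^ 2) := by
  obtain ⟨g, U, hm, hyU, hs', h1, h2, h3, h4, h5⟩ := h.gaussU_chart hyD hy hs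
  rw [h4.deriv_eq, gaussU, gaussCurv, h3, h2, h1]
  exact hm.det_mul hyU hs'

theorem norm_dMap (v : ℂ) : ‖dMap ε c y v‖ =
    ‖factor ε c (chartAt ℂ c y)‖ * (1 + ‖gaussU ε y‖ ^ 2) * ‖v‖ := by
  obtain ⟨g, U, hm, hyU, hs', h1, h2, h3, h4, h5⟩ := h.gaussU_chart hyD hy hs
  rw [h5.self_of_nhds, gaussU, h2, h1, (hm.conf _ hyU).norm_apply, (hm.conf _ hyU).norm_one_eq hs',
    Complex.sq_norm]

end IsMinimalImmersion

/-! ### The rotated surface -/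

/-- The surface rotated by `flip`. -/
def flipEps (ε : D → D → E3) : D → D → E3 := fun x y => flip (ε x y)

theorem dMap_flipEps (ε : D → D → E3) (c y : D) :
    dMap (flipEps ε) c y = (flip : E3 →L[ℝ] E3) ∘L dMap ε c y :=
  flip.comp_fderiv

theorem nrm_flip (L : ℂ →L[ℝ] E3) : nrm ((flip : E3 →L[ℝ] E3) ∘L L) = flip (nrm L) := by
  show -(‖cross (flip (L 1)) (flip (L Complex.I))‖⁻¹ • cross (flip (L 1)) (flip (L Complex.I))) = _
  rw [cross_flip, flip.norm_map, nrm, map_neg, map_smul]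

theorem normal_flipEps (ε : D → D → E3) (x : D) : normal (flipEps ε) x = flip (normal ε x) := by
  rw [normal_eq_nrm, dMap_flipEps, nrm_flip]; rfl

theorem dNormal_flipEps (ε : D → D → E3) (x : D) :
    dNormal (flipEps ε) x = (flip : E3 →L[ℝ] E3) ∘L dNormal ε x := by
  have : normal (flipEps ε) ∘ (chartAt ℂ x).symm = flip ∘ (normal ε ∘ (chartAt ℂ x).symm) := by
    ext1 z; exact normal_flipEps ε _
  rw [dNormal, this]
  exact flip.comp_fderiv

theorem shape_flipEps (ε : D → D → E3) (x : D) : shape (flipEps ε) x = flipE (shape ε x) := by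
  rw [shape_eq_shapeOf, dMap_flipEps, dNormal_flipEps, shape_eq_shapeOf]
  ext1 z
  have h1 : ∀ v, ((flip : E3 →L[ℝ] E3) ∘L dMap ε x x) v = flip (dMap ε x x v) := fun _ => rfl
  have h2 : ∀ v, ((flip : E3 →L[ℝ] E3) ∘L dNormal ε x) v = flip (dNormal ε x v) := fun _ => rfl
  simp only [shapeOf, flipE_apply, h1, h2, flip.norm_map, add_apply, smul_apply,
    ContinuousLinearMap.smulRight_apply, innerSL_apply_apply, inner_flip, map_add, map_smul]

theorem gaussCurv_flipEps (ε : D → D → E3) (x : D) : gaussCurv (flipEps ε) x = gaussCurv ε x := by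
  rw [gaussCurv, gaussCurv, shape_flipEps, normal_flipEps]
  have h1 : ∀ z, flip.symm z = flip z := fun z => flip.injective (by simp)
  rw [← LinearMap.det_conj ((shape ε x + (innerSL ℝ (normal ε x)).smulRight (normal ε x) :
    E3 →L[ℝ] E3) : E3 →ₗ[ℝ] E3) flip.toLinearEquiv]
  congr 1
  apply LinearMap.ext
  intro z
  show flipE (shape ε x) z + inner ℝ (flip (normal ε x)) z • flip (normal ε x) =
    flip (shape ε x (flip.symm z) + inner ℝ (normal ε x) (flip.symm z) • normal ε x)
  rw [h1, map_add, map_smul, inner_flip, flipE_apply]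

/-- The rotated surface has the rotated Gauss map; it serves at points with normal `-e₃`, which the
formulas in the coordinate `u` exclude. -/
theorem IsMinimalImmersion.flipEps {Dinf : Finset D} {ε : D → D → E3}
    (h : IsMinimalImmersion Dinf ε) : IsMinimalImmersion Dinf (flipEps ε) where
  smooth x hx := flip.contDiff.contDiffAt.comp _ (h.smooth x hx)
  continuation x hx := by
    filter_upwards [h.continuation x hx] with y ⟨p, hp⟩
    refine ⟨flip p, ?_⟩
    filter_upwards [hp] with z hz
    show flip (ε y z) = flip (ε x z) + flip p
    rw [hz, map_add]
  immersion x hx := by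
    rw [dMap_flipEps]
    exact flip.injective.comp (h.immersion x hx)
  conformal x hx := by
    rw [dMap_flipEps]
    show ‖flip _‖ = ‖flip _‖ ∧ inner ℝ (flip _) (flip _) = (0 : ℝ)
    rw [flip.norm_map, flip.norm_map, flip.inner_map_map]
    exact h.conformal x hx
  minimal x hx := by
    rw [shape_flipEps, trace_flipE]
    exact h.minimal x hx

end Regular

/-! ## The area measure in charts -/

section AreaMeasure

variable {D : Type*} [TopologicalSpace D] [ChartedSpace ℂ D]

/-- The area density of the surface in the chart around `c`. -/
def areaDensity (ε : D → D → E3) (c : D) (z : ℂ) : ℝ :=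
  ‖cross (dMap ε c ((chartAt ℂ c).symm z) 1) (dMap ε c ((chartAt ℂ c).symm z) Complex.I)‖

/-- The image of `A` in the chart around `c`. -/
def chartSet (c : D) (A : Set D) : Set ℂ := (chartAt ℂ c).target ∩ (chartAt ℂ c).symm ⁻¹' A

theorem chartSet_subset (c : D) (A : Set D) : chartSet c A ⊆ (chartAt ℂ c).target :=
  inter_subset_left

theorem measurableSet_chartSet [MeasurableSpace D] [BorelSpace D] (c : D) {A : Set D}
    (hA : MeasurableSet A) : MeasurableSet (chartSet c A) := by
  have h1 : Measurable fun z : (chartAt ℂ c).target => (chartAt ℂ c).symm z :=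
    (continuousOn_iff_continuous_domRestrict.1 (chartAt ℂ c).continuousOn_symm).measurable
  have h2 := (chartAt ℂ c).open_target.measurableSet.subtype_image (h1 hA)
  convert h2 using 1
  ext z
  simp [chartSet, and_comm]

theorem image_transition {c c' : D} {A : Set D} (hA : A ⊆ (chartAt ℂ c).source)
    (hA' : A ⊆ (chartAt ℂ c').source) :
    (chartAt ℂ c' ∘ (chartAt ℂ c).symm) '' chartSet c A = chartSet c' A := by
  ext w
  constructor
  · rintro ⟨z, ⟨hz, hzA⟩, rfl⟩
    refine ⟨(chartAt ℂ c').map_source (hA' hzA), ?_⟩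
    show (chartAt ℂ c').symm ((chartAt ℂ c') _) ∈ A
    rwa [(chartAt ℂ c').left_inv (hA' hzA)]
  · rintro ⟨hw, hwA⟩
    refine ⟨chartAt ℂ c ((chartAt ℂ c').symm w), ⟨(chartAt ℂ c).map_source (hA hwA), ?_⟩, ?_⟩
    · show (chartAt ℂ c).symm ((chartAt ℂ c) _) ∈ A
      rwa [(chartAt ℂ c).left_inv (hA hwA)]
    · simp [(chartAt ℂ c).left_inv (hA hwA), (chartAt ℂ c').right_inv hw]

theorem det_mulL (a : ℂ) : (mulL a).det = ‖a‖ ^ 2 := by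
  rw [Complex.sq_norm, ← Algebra.norm_complex_apply]
  rfl

variable [IsManifold 𝓘(ℂ, ℂ) ω D] [T1Space D] {Dinf : Finset D} {ε : D → D → E3}
  (h : IsMinimalImmersion Dinf ε)

include h

theorem IsMinimalImmersion.areaDensity_transition {c c' y : D} (hyD : y ∉ Dinf)
    (hy : y ∈ (chartAt ℂ c).source) (hy' : y ∈ (chartAt ℂ c').source) :
    areaDensity ε c (chartAt ℂ c y) =
      ‖deriv (chartAt ℂ c' ∘ (chartAt ℂ c).symm) (chartAt ℂ c y)‖ ^ 2 *
        areaDensity ε c' (chartAt ℂ c' y) := by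
  rw [areaDensity, areaDensity, (chartAt ℂ c).left_inv hy, (chartAt ℂ c').left_inv hy']
  have h1 := h.isConf_dMap hyD hy
  have h2 := h.isConf_dMap hyD hy'
  have hd : DifferentiableAt ℝ (ε y ∘ (chartAt ℂ c').symm) (chartAt ℂ c' y) := by
    obtain ⟨U, hm, hyU, -⟩ := h.exists_isMin hy' hyD
    exact (hm.smooth.contDiffAt (hm.isOpen.mem_nhds hyU)).differentiableAt (by norm_num)
  have h3 : dMap ε c y = dMap ε c' y ∘L
      mulL (deriv (chartAt ℂ c' ∘ (chartAt ℂ c).symm) (chartAt ℂ c y)) :=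
    (hasFDerivAt_of_transition hy hy' hd.hasFDerivAt).fderiv
  rw [h1.norm_cross, h2.norm_cross, h3]
  show ‖dMap ε c' y (_ * 1)‖ ^ 2 = _
  rw [h2.norm_apply, mul_one]
  ring

theorem IsMinimalImmersion.continuousAt_areaDensity {c y : D} (hyD : y ∉ Dinf)
    (hy : y ∈ (chartAt ℂ c).source) : ContinuousAt (areaDensity ε c) (chartAt ℂ c y) := by
  obtain ⟨U, hm, hyU, -, hU⟩ := h.exists_isMin hy hyD
  have h1 : ContinuousAt (fun z => ‖fderiv ℝ (ε y ∘ (chartAt ℂ c).symm) z 1‖ ^ 2)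
      (chartAt ℂ c y) := ((hm.hasFDerivAt_apply hyU 1).continuousAt.norm).pow 2
  refine h1.congr ?_
  filter_upwards [hm.eventually hyU] with z hz
  rw [areaDensity, (hU z hz).2.1, (hm.conf z hz).norm_cross]

theorem IsMinimalImmersion.aemeasurable_areaDensity [MeasurableSpace D] [BorelSpace D] (c : D)
    {A : Set D} (hA : MeasurableSet A) (hAD : ∀ x ∈ A, x ∉ Dinf) :
    AEMeasurable (areaDensity ε c) (volume.restrict (chartSet c A)) := by
  refine ContinuousOn.aemeasurable (fun z hz => ?_) (measurableSet_chartSet c hA)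
  have h1 := h.continuousAt_areaDensity (c := c) (hAD _ hz.2) ((chartAt ℂ c).map_target hz.1)
  rw [(chartAt ℂ c).right_inv hz.1] at h1
  exact h1.continuousWithinAt

/-- The Jacobian of the holomorphic transition map is the squared modulus of its derivative, which
is also the factor by which the area density changes. -/
theorem IsMinimalImmersion.lintegral_transition [MeasurableSpace D] [BorelSpace D] {c c' : D}
    {A : Set D} (hA : MeasurableSet A) (hAc : A ⊆ (chartAt ℂ c).source)
    (hAc' : A ⊆ (chartAt ℂ c').source) (hAD : ∀ x ∈ A, x ∉ Dinf) (F : D → ENNReal) :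
    ∫⁻ z in chartSet c A, F ((chartAt ℂ c).symm z) * ENNReal.ofReal (areaDensity ε c z) =
      ∫⁻ z in chartSet c' A, F ((chartAt ℂ c').symm z) * ENNReal.ofReal (areaDensity ε c' z) := by
  rw [← image_transition hAc hAc', lintegral_image_eq_lintegral_abs_det_fderiv_mul volume
    (f' := fun z => mulL (deriv (chartAt ℂ c' ∘ (chartAt ℂ c).symm) z))
    (measurableSet_chartSet c hA)]
  · refine setLIntegral_congr_fun (measurableSet_chartSet c hA) fun z hz => ?_
    have hs := hAc hz.2
    have hs' := hAc' hz.2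
    have h1 := h.areaDensity_transition (hAD _ hz.2) hs hs'
    rw [(chartAt ℂ c).right_inv hz.1] at h1
    simp only [Function.comp_apply]
    rw [(chartAt ℂ c').left_inv hs', h1, det_mulL, abs_of_nonneg (by positivity),
      ENNReal.ofReal_mul (by positivity)]
    ring
  · intro z hz
    have hs := hAc hz.2
    have hs' := hAc' hz.2
    have h1 := (transition_analyticAt hs hs').differentiableAt.hasDerivAt
    rw [(chartAt ℂ c).right_inv hz.1] at h1
    refine (h1.hasFDerivAt.restrictScalars ℝ).hasFDerivWithinAt.congr_fderiv ?_
    ext1 v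
    simp [mul_comm]
  · intro z hz w hw hzw
    have h1 := (chartAt ℂ c').injOn (hAc' hz.2) (hAc' hw.2) hzw
    exact (chartAt ℂ c).symm.injOn hz.1 hw.1 h1

variable [CompactSpace D] [Nonempty D] [MeasurableSpace D] [BorelSpace D]

omit h [IsManifold 𝓘(ℂ, ℂ) ω D] [T1Space D] [MeasurableSpace D] [BorelSpace D] in
theorem chartPiece_subset (i : ℕ) :
    chartPiece D i ⊆ (chartAt ℂ (chartCenter D i)).source :=
  disjointed_subset _ i

omit h [IsManifold 𝓘(ℂ, ℂ) ω D] [T1Space D] in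
theorem measurableSet_chartPiece (i : ℕ) : MeasurableSet (chartPiece D i) :=
  MeasurableSet.disjointed (fun i => (chartAt ℂ (chartCenter D i)).open_source.measurableSet) i

omit h [IsManifold 𝓘(ℂ, ℂ) ω D] [T1Space D] [MeasurableSpace D] [BorelSpace D] in
theorem iUnion_chartPiece : ⋃ i, chartPiece D i = univ := by
  rw [chartPiece, iUnion_disjointed]
  exact Classical.choose_spec (exists_chart_cover D)

/-- The integral of a function over a part of a chart domain in terms of this chart. -/
theorem IsMinimalImmersion.lintegral_areaMeasure {c : D} {F : D → ENNReal} (hF : Measurable F)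
    {A : Set D} (hA : MeasurableSet A) (hAc : A ⊆ (chartAt ℂ c).source)
    (hAD : ∀ x ∈ A, x ∉ Dinf) :
    ∫⁻ x in A, F x ∂areaMeasure Dinf ε =
      ∫⁻ z in chartSet c A, F ((chartAt ℂ c).symm z) * ENNReal.ofReal (areaDensity ε c z) := by
  have hD : MeasurableSet (Dinf : Set D) := Dinf.measurableSet
  -- The measure is defined by pieces that live in different charts; `A` is cut along these pieces,
  -- and each part is transferred to the chart around `c`.
  have hcov : chartSet c A = ⋃ i, chartSet c (A ∩ chartPiece D i) := by
    rw [← inter_univ A, ← iUnion_chartPiece (D := D), inter_iUnion]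
    ext z
    simp [chartSet]
  rw [areaMeasure, Measure.restrict_sum _ hA, lintegral_sum_measure, hcov,
    lintegral_iUnion (fun i => measurableSet_chartSet c (hA.inter (measurableSet_chartPiece i)))]
  · refine tsum_congr fun i => ?_
    set c' := chartCenter D i
    have hB := hA.inter (measurableSet_chartPiece (D := D) i)
    rw [h.lintegral_transition (c' := c') hB (inter_subset_left.trans hAc)
      (inter_subset_right.trans (chartPiece_subset i)) (fun x hx => hAD x hx.1)]
    have hT := measurableSet_chartSet c' ((measurableSet_chartPiece (D := D) i).diff hD)
    change ∫⁻ x in A, F x ∂(Measure.map (chartAt ℂ c').symm ((volume.restrict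
      (chartSet c' (chartPiece D i \ Dinf))).withDensity
        fun z => ENNReal.ofReal (areaDensity ε c' z))) = _
    have hJ : AEMeasurable (fun z => ENNReal.ofReal (areaDensity ε c' z))
        (volume.restrict (chartSet c' (chartPiece D i \ Dinf))) :=
      (h.aemeasurable_areaDensity c' ((measurableSet_chartPiece i).diff hD)
        (fun x hx => hx.2)).ennreal_ofReal
    have hsm : AEMeasurable (chartAt ℂ c').symm
        (volume.restrict (chartSet c' (chartPiece D i \ Dinf))) :=
      ((chartAt ℂ c').continuousOn_symm.mono (chartSet_subset _ _)).aemeasurable hT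
    have hG : Measurable (A.indicator F) := hF.indicator hA
    rw [← lintegral_indicator hA, lintegral_map' hG.aemeasurable
      (hsm.mono_ac (withDensity_absolutelyContinuous _ _)),
      lintegral_withDensity_eq_lintegral_mul₀ hJ
        (g := fun z => A.indicator F ((chartAt ℂ c').symm z)) (hG.comp_aemeasurable hsm),
      ← lintegral_indicator hT, ← lintegral_indicator (measurableSet_chartSet c' hB)]
    refine lintegral_congr fun z => ?_
    by_cases hz : z ∈ chartSet c' (A ∩ chartPiece D i)
    · have hz' : z ∈ chartSet c' (chartPiece D i \ Dinf) := ⟨hz.1, hz.2.2, hAD _ hz.2.1⟩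
      rw [indicator_of_mem hz, indicator_of_mem hz']
      simp only [Pi.mul_apply]
      rw [indicator_of_mem (show (chartAt ℂ c').symm z ∈ A from hz.2.1), mul_comm]
    · rw [indicator_of_notMem hz]
      by_cases hz' : z ∈ chartSet c' (chartPiece D i \ Dinf)
      · rw [indicator_of_mem hz']
        simp only [Pi.mul_apply]
        rw [indicator_of_notMem (fun hA' => hz ⟨hz'.1, hA', hz'.2.1⟩), mul_zero]
      · rw [indicator_of_notMem hz']
  · intro i j hij
    rw [Function.onFun, disjoint_left]
    intro z hz hz'
    exact disjoint_left.1 (disjoint_disjointed (fun i => (chartAt ℂ (chartCenter D i)).source) hij)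
      hz.2.2 hz'.2.2

omit h [IsManifold 𝓘(ℂ, ℂ) ω D] in
theorem areaMeasure_ends (Dinf : Finset D) (ε : D → D → E3) :
    areaMeasure Dinf ε (Dinf : Set D) = 0 := by
  have hD : MeasurableSet (Dinf : Set D) := Dinf.measurableSet
  rw [areaMeasure, Measure.sum_apply _ hD, ENNReal.tsum_eq_zero]
  intro i
  set c' := chartCenter D i
  have hT := measurableSet_chartSet c' ((measurableSet_chartPiece (D := D) i).diff hD)
  have hsm : AEMeasurable (chartAt ℂ c').symm
      (volume.restrict (chartSet c' (chartPiece D i \ Dinf))) :=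
    ((chartAt ℂ c').continuousOn_symm.mono (chartSet_subset _ _)).aemeasurable hT
  change Measure.map (chartAt ℂ c').symm ((volume.restrict
      (chartSet c' (chartPiece D i \ Dinf))).withDensity
        fun z => ENNReal.ofReal (areaDensity ε c' z)) Dinf = 0
  rw [Measure.map_apply_of_aemeasurable (hsm.mono_ac (withDensity_absolutelyContinuous _ _)) hD]
  refine withDensity_absolutelyContinuous _ _ ?_
  rw [Measure.restrict_apply' hT]
  convert measure_empty (μ := volume (α := ℂ))
  ext z
  simp only [mem_inter_iff, mem_preimage, mem_empty_iff_false, iff_false, not_and]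
  exact fun h1 h2 => h2.2.2 h1

end AreaMeasure

/-! ## The curvature form -/

section Curvature

variable {D : Type*} [TopologicalSpace D] [ChartedSpace ℂ D]

theorem eventually_notMem_finset {X : Type*} [TopologicalSpace X] [T1Space X] {s : Finset X} {y : X}
    (hy : y ∉ s) : ∀ᶠ x in 𝓝 y, x ∉ s :=
  (s.finite_toSet.isClosed).isOpen_compl.mem_nhds (show y ∈ (s : Set X)ᶜ from hy)

variable [IsManifold 𝓘(ℂ, ℂ) ω D] [T1Space D] {Dinf : Finset D} {ε : D → D → E3}
  (h : IsMinimalImmersion Dinf ε) {c y : D}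

include h

theorem IsMinimalImmersion.holAt_gaussU (hyD : y ∉ Dinf) (hs : normal ε y ≠ -e3) :
    HolAt (gaussU ε) y :=
  h.analyticAt_gaussU hyD (mem_chart_source ℂ y) hs

theorem IsMinimalImmersion.holAt_gaussQ (hyD : y ∉ Dinf) (hs : normal ε y ≠ -e3) :
    HolAt (gaussQ ε) y := by
  have hy := mem_chart_source ℂ y
  have h1 := h.analyticAt_gaussU hyD hy hs
  have h2 := h.analyticAt_factor hyD hy hs
  have h3 := h.factor_ne_zero hyD hy hs
  have hev : ∀ᶠ x in 𝓝 y, x ∉ Dinf ∧ normal ε x ≠ -e3 ∧ x ∈ (chartAt ℂ y).source :=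
    (eventually_notMem_finset hyD).and (((h.continuousAt_normal hyD).eventually_ne hs).and
      (chart_source_mem_nhds ℂ y))
  rw [← eventually_chart] at hev
  refine ((analyticAt_const (v := (-2 : ℂ))).mul h1.deriv |>.div h2 h3).congr ?_
  filter_upwards [hev, (chartAt ℂ y).open_target.mem_nhds (mem_chart_target ℂ y)]
    with z ⟨hz1, hz2, hz3⟩ hz4
  have h4 := h.gaussQ_eq hz1 hz3 hz2
  rw [(chartAt ℂ y).right_inv hz4] at h4
  exact h4.symm

/-- The area density is `|F|² (1 + |u|²)²` and `q = -2 u' / F`. In this form the curvature is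
expressed by functions that do not depend on a chart, which gives its continuity and its sign. -/
theorem IsMinimalImmersion.gaussCurv_eq (hyD : y ∉ Dinf) (hs : normal ε y ≠ -e3) :
    gaussCurv ε y = -(‖gaussQ ε y‖ ^ 2 / (1 + ‖gaussU ε y‖ ^ 2) ^ 4) := by
  have hy := mem_chart_source ℂ y
  have h1 := h.gaussCurv_mul hyD hy hs
  have h2 := h.norm_dMap hyD hy hs 1
  have h3 := norm_ne_zero_iff.2 (h.factor_ne_zero hyD hy hs)
  have h5 := h.gaussQ_eq hyD hy hs
  have h6 : (1 + ‖gaussU ε y‖ ^ 2) ≠ 0 := by positivity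
  rw [(h.isConf_dMap hyD hy).norm_cross, h2, norm_one, mul_one] at h1
  rw [h5, norm_div, norm_mul, norm_neg, Complex.norm_ofNat]
  field_simp at h1 ⊢
  linear_combination h1

theorem IsMinimalImmersion.continuousAt_gaussCurv (hyD : y ∉ Dinf) :
    ContinuousAt (gaussCurv ε) y := by
  have key : ∀ {ε : D → D → E3}, IsMinimalImmersion Dinf ε → normal ε y ≠ -e3 →
      ContinuousAt (gaussCurv ε) y := by
    intro ε h hs
    have hev : ∀ᶠ x in 𝓝 y, x ∉ Dinf ∧ normal ε x ≠ -e3 :=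
      (eventually_notMem_finset hyD).and ((h.continuousAt_normal hyD).eventually_ne hs)
    have h1 : ContinuousAt (fun x => -(‖gaussQ ε x‖ ^ 2 / (1 + ‖gaussU ε x‖ ^ 2) ^ 4)) y :=
      ((((h.holAt_gaussQ hyD hs).continuousAt.norm.pow 2)).div
        ((continuousAt_const.add ((h.holAt_gaussU hyD hs).continuousAt.norm.pow 2)).pow 4)
        (by show (1 + ‖gaussU ε y‖ ^ 2) ^ 4 ≠ 0; positivity)).neg
    refine h1.congr ?_
    filter_upwards [hev] with x hx
    exact (h.gaussCurv_eq hx.1 hx.2).symm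
  by_cases hs : normal ε y = -e3
  · have h1 := key h.flipEps (by
      rw [normal_flipEps, ne_eq, flip_eq_neg_e3, hs]; exact neg_e3_ne_e3)
    exact h1.congr (Eventually.of_forall fun x => gaussCurv_flipEps ε x)
  · exact key h hs

theorem IsMinimalImmersion.gaussCurv_nonpos (hyD : y ∉ Dinf) : gaussCurv ε y ≤ 0 := by
  have key : ∀ {ε : D → D → E3}, IsMinimalImmersion Dinf ε → normal ε y ≠ -e3 →
      gaussCurv ε y ≤ 0 := by
    intro ε h hs
    rw [h.gaussCurv_eq hyD hs, neg_nonpos]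
    positivity
  by_cases hs : normal ε y = -e3
  · rw [← gaussCurv_flipEps]
    exact key h.flipEps (by rw [normal_flipEps, ne_eq, flip_eq_neg_e3, hs]; exact neg_e3_ne_e3)
  · exact key h hs

end Curvature

/-! ## Extension of a Gauss map of finite area across a puncture -/

section Extension

/-- The punctured disc. -/
def pball (z₀ : ℂ) (R : ℝ) : Set ℂ := Metric.ball z₀ R \ {z₀}

theorem isOpen_pball (z₀ : ℂ) (R : ℝ) : IsOpen (pball z₀ R) :=
  Metric.isOpen_ball.sdiff isClosed_singleton

theorem pball_mono {z₀ : ℂ} {r R : ℝ} (h : r ≤ R) : pball z₀ r ⊆ pball z₀ R :=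
  Set.sdiff_subset_sdiff_left (Metric.ball_subset_ball h)

theorem pball_mem {z₀ : ℂ} {R : ℝ} (hR : 0 < R) : pball z₀ R ∈ 𝓝[≠] z₀ :=
  sdiff_mem_nhdsWithin_compl (Metric.ball_mem_nhds z₀ hR) _

theorem circleMap_mem_pball (z₀ : ℂ) {r R : ℝ} (hr : 0 < r) (hR : r < R) (θ : ℝ) :
    circleMap z₀ r θ ∈ pball z₀ R := by
  refine ⟨?_, ?_⟩
  · rw [Metric.mem_ball, dist_eq_norm]
    simpa [circleMap, abs_of_pos hr] using hR
  · simp [circleMap, hr.ne']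

theorem exists_circleMap (z₀ : ℂ) {z : ℂ} :
    ∃ θ ∈ Icc (-Real.pi) Real.pi, circleMap z₀ (dist z z₀) θ = z := by
  refine ⟨Complex.arg (z - z₀), ⟨(Complex.neg_pi_lt_arg _).le, Complex.arg_le_pi _⟩, ?_⟩
  rw [circleMap, dist_eq_norm, Complex.norm_mul_exp_arg_mul_I]
  ring

/-- A density of finite area on a punctured disc is small, in the scale invariant sense, on some
arbitrarily small circles. -/
theorem exists_small_circle {d : ℂ → ℝ} {z₀ : ℂ} {R : ℝ} (hR : 0 < R)
    (hd : ContinuousOn d (pball z₀ R)) (h0 : ∀ z ∈ pball z₀ R, 0 ≤ d z)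
    (hfin : ∫⁻ z in pball z₀ R, ENNReal.ofReal (d z) ≠ ⊤) {δ : ℝ} (hδ : 0 < δ) :
    ∃ᶠ r in 𝓝[>] (0 : ℝ), r < R ∧
      r ^ 2 * ∫ θ in (-Real.pi)..Real.pi, d (circleMap z₀ r θ) < δ := by
  classical
  rw [frequently_iff]
  intro S hS
  obtain ⟨r₁, hr₁, hS⟩ := mem_nhdsGT_iff_exists_Ioo_subset.1 hS
  -- Otherwise `r ∫ d dθ ≥ δ / r` for all small `r`, and in polar coordinates the area would
  -- dominate the divergent integral of `δ / r`.
  by_contra hcon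
  push Not at hcon
  set r₂ := min r₁ R with hr₂
  have hr₂0 : 0 < r₂ := lt_min hr₁ hR
  have hmeas := (isOpen_pball z₀ R).measurableSet
  set f : ℂ → ENNReal := (pball z₀ R).indicator fun z => ENNReal.ofReal (d z) with hf
  have hfm : Measurable f := by
    have h1 : Measurable ((pball z₀ R).piecewise d 0) :=
      ContinuousOn.measurable_piecewise (s := pball z₀ R) hd continuousOn_const hmeas
    have h2 : f = fun z => ENNReal.ofReal ((pball z₀ R).piecewise d 0 z) := by
      ext z
      by_cases hz : z ∈ pball z₀ R
      · simp [hf, hz]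
      · simp [hf, hz]
    rw [h2]
    exact h1.ennreal_ofReal
  have e1 : ∫⁻ z in pball z₀ R, ENNReal.ofReal (d z) =
      ∫⁻ p in polarCoord.target, ENNReal.ofReal p.1 • f (z₀ + Complex.polarCoord.symm p) := by
    rw [← lintegral_indicator hmeas, ← lintegral_add_left_eq_self _ z₀,
      ← Complex.lintegral_comp_polarCoord_symm]
  have hcm : Measurable fun p : ℝ × ℝ => circleMap z₀ p.1 p.2 := by
    have : Continuous fun p : ℝ × ℝ => circleMap z₀ p.1 p.2 := by
      unfold circleMap; fun_prop
    exact this.measurable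
  have e2 : ∀ p : ℝ × ℝ, z₀ + Complex.polarCoord.symm p = circleMap z₀ p.1 p.2 := by
    intro p
    rw [Complex.polarCoord_symm_apply, circleMap, Complex.exp_mul_I]
    simp
  have hgm : Measurable fun p : ℝ × ℝ => ENNReal.ofReal p.1 • f (circleMap z₀ p.1 p.2) :=
    measurable_fst.ennreal_ofReal.mul (hfm.comp hcm)
  have e3 : ∫⁻ r in Ioi (0 : ℝ), ∫⁻ θ in Ioo (-Real.pi) Real.pi,
      ENNReal.ofReal r • f (circleMap z₀ r θ) ≠ ⊤ := by
    rw [← lintegral_prod _ hgm.aemeasurable, Measure.prod_restrict, ← Measure.volume_eq_prod,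
      ← polarCoord_target]
    simp only [e2] at e1
    rw [← e1]
    exact hfin
  have e4 : ∀ r ∈ Ioo 0 r₂, ENNReal.ofReal (δ * r⁻¹) ≤ ∫⁻ θ in Ioo (-Real.pi) Real.pi,
      ENNReal.ofReal r • f (circleMap z₀ r θ) := by
    intro r hr
    have hrR : r < R := hr.2.trans_le (min_le_right _ _)
    have h1 := hcon r (hS ⟨hr.1, hr.2.trans_le (min_le_left _ _)⟩) hrR
    have hc : Continuous fun θ => d (circleMap z₀ r θ) :=
      hd.comp_continuous (continuous_circleMap z₀ r) fun θ => circleMap_mem_pball z₀ hr.1 hrR θ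
    have hm := fun θ => circleMap_mem_pball z₀ hr.1 hrR θ
    have h2 : ∫⁻ θ in Ioo (-Real.pi) Real.pi, ENNReal.ofReal r • f (circleMap z₀ r θ) =
        ENNReal.ofReal (r * ∫ θ in (-Real.pi)..Real.pi, d (circleMap z₀ r θ)) := by
      have h3 : ∀ θ, ENNReal.ofReal r • f (circleMap z₀ r θ) =
          ENNReal.ofReal (r * d (circleMap z₀ r θ)) := fun θ => by
        rw [hf, indicator_of_mem (hm θ), smul_eq_mul, ENNReal.ofReal_mul hr.1.le]
      simp only [h3]
      rw [← ofReal_integral_eq_lintegral_ofReal, integral_const_mul,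
        intervalIntegral.integral_of_le (by linarith [Real.pi_pos]), integral_Ioc_eq_integral_Ioo]
      · exact ((continuous_const.mul hc).integrableOn_Icc).mono_set Ioo_subset_Icc_self
      · exact Eventually.of_forall fun θ => mul_nonneg hr.1.le (h0 _ (hm θ))
    rw [h2]
    apply ENNReal.ofReal_le_ofReal
    have h4 : 0 < r := hr.1
    rw [← div_eq_mul_inv, div_le_iff₀ h4]
    linarith
  have e5 : ∫⁻ r in Ioo 0 r₂, ENNReal.ofReal (δ * r⁻¹) ≠ ⊤ := by
    refine ne_top_of_le_ne_top e3 ?_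
    refine (setLIntegral_mono' measurableSet_Ioo e4).trans ?_
    exact lintegral_mono_set fun r hr => hr.1
  have e6 : IntegrableOn (fun r : ℝ => δ * r⁻¹) (Ioo 0 r₂) := by
    refine ⟨(measurable_const.mul measurable_inv).aestronglyMeasurable, ?_⟩
    rw [hasFiniteIntegral_iff_ofReal]
    · exact e5.lt_top
    · filter_upwards [self_mem_ae_restrict measurableSet_Ioo] with r hr
      have := hr.1
      exact mul_nonneg hδ.le (inv_nonneg.2 this.le)
  have e7 : IntegrableOn (fun r : ℝ => r⁻¹) (Ioo 0 r₂) := by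
    have := e6.const_mul δ⁻¹
    refine this.congr (Eventually.of_forall fun r => ?_)
    show δ⁻¹ * (δ * r⁻¹) = r⁻¹
    field_simp
  have e8 : IntervalIntegrable (fun r : ℝ => r⁻¹) volume 0 r₂ := by
    rw [intervalIntegrable_iff, uIoc_of_le hr₂0.le]
    exact (integrableOn_Ioc_iff_integrableOn_Ioo).2 e7
  rw [intervalIntegrable_inv_iff] at e8
  rcases e8 with e8 | e8
  · exact hr₂0.ne e8
  · exact e8 left_mem_uIcc

/-- The Möbius transformation of the sphere with the zero `a` and the pole `b`. -/
def mob (a b : ℂ) (s : S2) : ℂ :=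
  open Classical in if (s : E3) = -e3 then 1 else (coordU s - a) / (coordU s - b)

theorem mob_of_ne_south (a b : ℂ) {s : S2} (hs : (s : E3) ≠ -e3) :
    mob a b s = (coordU s - a) / (coordU s - b) := by rw [mob, if_neg hs]

theorem mob_of_ne_north (a b : ℂ) {s : S2} (hs : (s : E3) ≠ e3) :
    mob a b s = (1 - a * coordV s) / (1 - b * coordV s) := by
  by_cases h : (s : E3) = -e3
  · rw [mob, if_pos h, h]; simp
  · have hV : coordV s ≠ 0 := coordV_ne_zero h hs
    rw [mob_of_ne_south a b h, coordU_eq_inv, ← mul_div_mul_right _ _ hV, sub_mul, sub_mul,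
      inv_mul_cancel₀ hV]

theorem eq_sph_of_coordU {s : S2} (hs : (s : E3) ≠ -e3) {b : ℂ} (h : coordU s = b) :
    s = sph b := by rw [← h, sph_coordU hs]

theorem coordV_mul_ne {s : S2} (hs : (s : E3) ≠ e3) {b : ℂ} (h : s ≠ sph b) :
    1 - b * coordV s ≠ 0 := by
  intro h0
  by_cases hS : (s : E3) = -e3
  · rw [hS] at h0; simp at h0
  · apply h
    apply eq_sph_of_coordU hS
    have hV : coordV s ≠ 0 := coordV_ne_zero hS hs
    rw [coordU_eq_inv]
    field_simp
    linear_combination h0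

theorem coordU_sub_ne {s : S2} (hs : (s : E3) ≠ -e3) {b : ℂ} (h : s ≠ sph b) :
    coordU s - b ≠ 0 := fun h0 => h (eq_sph_of_coordU hs (sub_eq_zero.1 h0))

theorem continuousAt_mob (a b : ℂ) {s : S2} (h : s ≠ sph b) : ContinuousAt (mob a b) s := by
  by_cases hs : (s : E3) = -e3
  · have hn : (s : E3) ≠ e3 := by rw [hs]; exact neg_e3_ne_e3
    have hv : ContinuousAt (fun s : S2 => coordV s) s :=
      (continuousAt_coordV hn).comp continuous_subtype_val.continuousAt
    have h1 : ContinuousAt (fun s : S2 => (1 - a * coordV s) / (1 - b * coordV s)) s :=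
      (continuousAt_const.sub (continuousAt_const.mul hv)).div
        (continuousAt_const.sub (continuousAt_const.mul hv)) (coordV_mul_ne hn h)
    refine h1.congr ?_
    filter_upwards [continuous_subtype_val.continuousAt.eventually_ne hn] with t ht
    exact (mob_of_ne_north a b ht).symm
  · have hu : ContinuousAt (fun s : S2 => coordU s) s :=
      (continuousAt_coordU hs).comp continuous_subtype_val.continuousAt
    have h1 : ContinuousAt (fun s : S2 => (coordU s - a) / (coordU s - b)) s :=
      (hu.sub continuousAt_const).div (hu.sub continuousAt_const) (coordU_sub_ne hs h)
    refine h1.congr ?_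
    filter_upwards [continuous_subtype_val.continuousAt.eventually_ne hs] with t ht
    exact (mob_of_ne_south a b ht).symm

/-- The inverse of the Möbius transformation `mob`. -/
def mobInv (a b w : ℂ) : S2 :=
  open Classical in if w = 1 then south else sph ((a - b * w) / (1 - w))

theorem mobInv_mob {a b : ℂ} (hab : a ≠ b) {s : S2} (h : s ≠ sph b) :
    mobInv a b (mob a b s) = s := by
  by_cases hs : (s : E3) = -e3
  · rw [mob, if_pos hs, mobInv, if_pos rfl]
    exact (Subtype.ext hs).symm
  · have h1 := coordU_sub_ne hs h
    have h2 : 1 - mob a b s = (a - b) / (coordU s - b) := by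
      rw [mob_of_ne_south a b hs]; field_simp; ring
    have h3 : 1 - mob a b s ≠ 0 := by
      rw [h2]; exact div_ne_zero (sub_ne_zero.2 hab) h1
    rw [mobInv, if_neg fun h' => h3 (by rw [h', sub_self]), h2, mob_of_ne_south a b hs]
    have h4 : (a - b * ((coordU s - a) / (coordU s - b))) / ((a - b) / (coordU s - b)) =
        coordU s := by
      have h5 := sub_ne_zero.2 hab
      field_simp
      ring
    rw [h4, sph_coordU hs]

theorem continuous_mobInv {a b : ℂ} (hab : a ≠ b) : Continuous (mobInv a b) := by
  rw [continuous_iff_continuousAt]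
  intro w
  by_cases hw : w = 1
  · subst hw
    have h1 : ContinuousAt (fun w => flipS (sph ((1 - w) / (a - b * w)))) 1 := by
      refine continuous_flipS.continuousAt.comp (continuous_sph.continuousAt.comp ?_)
      refine (continuousAt_const.sub continuousAt_id).div
        (continuousAt_const.sub (continuousAt_const.mul continuousAt_id)) ?_
      simpa [sub_eq_zero] using hab
    refine h1.congr ?_
    have h2 : ∀ᶠ w in 𝓝 (1 : ℂ), a - b * w ≠ 0 := by
      have : ContinuousAt (fun w => a - b * w) 1 := by fun_prop
      refine this.eventually_ne ?_
      simpa [sub_eq_zero] using hab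
    filter_upwards [h2] with w hw
    by_cases h1 : w = 1
    · subst h1
      rw [mobInv, if_pos rfl, sub_self, zero_div, sph_zero, flipS_north]
    · rw [mobInv, if_neg h1, flipS_sph (div_ne_zero (sub_ne_zero.2 (Ne.symm h1)) hw), inv_div]
  · have h1 : ContinuousAt (fun w => sph ((a - b * w) / (1 - w))) w := by
      refine continuous_sph.continuousAt.comp ?_
      refine ContinuousAt.div (by fun_prop) (by fun_prop) ?_
      exact sub_ne_zero.2 (Ne.symm hw)
    refine h1.congr ?_
    filter_upwards [isOpen_ne.mem_nhds hw] with w hw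
    rw [mobInv, if_neg hw]

/-- A holomorphic function on a punctured disc that is bounded on arbitrarily small circles has a
limit at the puncture. -/
theorem tendsto_of_bounded_circles {F : ℂ → ℂ} {z₀ : ℂ} {R M : ℝ} (hR : 0 < R)
    (hF : DifferentiableOn ℂ F (pball z₀ R))
    (hb : ∃ᶠ r in 𝓝[>] (0 : ℝ), r < R ∧ ∀ θ, ‖F (circleMap z₀ r θ)‖ ≤ M) :
    ∃ L, Tendsto F (𝓝[≠] z₀) (𝓝 L) := by
  obtain ⟨r₁, ⟨hr₁R, hr₁⟩, hr₁0⟩ := (hb.and_eventually self_mem_nhdsWithin).exists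
  have hr₁0' : 0 < r₁ := hr₁0
  -- Given `z`, the maximum principle is applied on the annulus between the fixed circle of radius
  -- `r₁` and a circle of smaller radius than `|z - z₀|` on which the bound also holds.
  have hbd : ∀ z ∈ pball z₀ r₁, ‖F z‖ ≤ M := by
    intro z hz
    have hz0 : 0 < dist z z₀ := dist_pos.2 hz.2
    obtain ⟨r₂, ⟨hr₂R, hr₂⟩, hr₂0, hr₂z⟩ := (hb.and_eventually
      (Ioo_mem_nhdsGT hz0)).exists
    have hmem : ∀ w, dist w z₀ = r₁ ∨ dist w z₀ = r₂ → ‖F w‖ ≤ M := by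
      rintro w hw
      obtain ⟨θ, -, hθ⟩ := exists_circleMap z₀ (z := w)
      rcases hw with hw | hw <;> rw [hw] at hθ <;> rw [← hθ]
      · exact hr₁ θ
      · exact hr₂ θ
    set U := Metric.ball z₀ r₁ \ Metric.closedBall z₀ r₂ with hU
    have hUcl : closure U ⊆ Metric.closedBall z₀ r₁ \ Metric.ball z₀ r₂ := by
      refine closure_minimal (fun w hw => ⟨Metric.ball_subset_closedBall hw.1,
        fun h' => hw.2 (Metric.ball_subset_closedBall h')⟩) ?_
      exact Metric.isClosed_closedBall.sdiff Metric.isOpen_ball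
    have hUo : IsOpen U := Metric.isOpen_ball.sdiff Metric.isClosed_closedBall
    refine Complex.norm_le_of_forall_mem_frontier_norm_le
      (Metric.isBounded_ball.subset Set.sdiff_subset) (f := F) (U := U) ?_ ?_ (subset_closure ?_)
    · refine DifferentiableOn.diffContOnCl (hF.mono (hUcl.trans fun w hw => ⟨?_, ?_⟩))
      · exact lt_of_le_of_lt hw.1 hr₁R
      · rintro rfl
        exact hw.2 (Metric.mem_ball_self hr₂0)
    · intro w hw
      rw [hUo.frontier_eq] at hw
      apply hmem
      have h1 := hUcl hw.1
      have h2 : ¬ (dist w z₀ < r₁ ∧ ¬ dist w z₀ ≤ r₂) := hw.2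
      have h3 : dist w z₀ ≤ r₁ := h1.1
      have h4 : ¬ dist w z₀ < r₂ := h1.2
      by_contra hcon
      push Not at hcon h4 h2
      have := h2 (lt_of_le_of_ne h3 hcon.1)
      exact hcon.2 (le_antisymm this h4)
    · exact ⟨hz.1, fun h' => not_lt.2 (Metric.mem_closedBall.1 h') hr₂z⟩
  refine ⟨_, Complex.tendsto_limUnder_of_differentiable_on_punctured_nhds_of_bounded_under ?_ ?_⟩
  · filter_upwards [pball_mem hR] with z hz
    exact hF.differentiableAt ((isOpen_pball z₀ R).mem_nhds hz)
  · refine ⟨M + ‖F z₀‖, ?_⟩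
    rw [eventually_map]
    filter_upwards [pball_mem hr₁0'] with z hz
    exact (norm_sub_le _ _).trans (add_le_add_left (hbd z hz) _)

end Extension

/-! ### Omitted values, short circles and the limit at the puncture. -/

section Extension

theorem tendsto_volume_ball (z₀ : ℂ) :
    Tendsto (fun r => volume (Metric.ball z₀ r)) (𝓝[>] 0) (𝓝 0) := by
  simp only [Complex.volume_ball]
  have h1 : Tendsto (fun r : ℝ => ENNReal.ofReal r) (𝓝[>] 0) (𝓝 0) := by
    have : Tendsto (fun r : ℝ => ENNReal.ofReal r) (𝓝 0) (𝓝 (ENNReal.ofReal 0)) :=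
      ENNReal.continuous_ofReal.tendsto 0
    rw [ENNReal.ofReal_zero] at this
    exact this.mono_left nhdsWithin_le_nhds
  have h2 := ENNReal.Tendsto.mul_const (b := (NNReal.pi : ENNReal)) (ENNReal.Tendsto.pow (n := 2) h1)
    (Or.inr ENNReal.coe_ne_top)
  simpa using h2

/-- A holomorphic map to the sphere of area less than a quarter of the sphere omits two values. -/
theorem exists_omitted {n : ℂ → S2} {d : ℂ → ℝ} {Ω : Set ℂ} (hΩ : IsOpen Ω)
    (hn : ContinuousOn n Ω)
    (hu : ∀ z ∈ Ω, (n z : E3) ≠ -e3 → AnalyticAt ℂ (fun z => coordU (n z)) z)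
    (hdu : ∀ z ∈ Ω, (n z : E3) ≠ -e3 →
      d z = 4 * ‖deriv (fun z => coordU (n z)) z‖ ^ 2 / (1 + ‖coordU (n z)‖ ^ 2) ^ 2)
    (hfin : ∫⁻ z in Ω, ENNReal.ofReal (d z) < NNReal.pi) :
    ∃ a b : ℂ, a ≠ b ∧ ∀ z ∈ Ω, n z ≠ sph a ∧ n z ≠ sph b := by
  set U : ℂ → ℂ := fun z => coordU (n z) with hU
  set W : Set ℂ := {z ∈ Ω | (n z : E3) ≠ -e3 ∧ ‖U z‖ < 1} with hW
  have hWo : IsOpen W := by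
    rw [isOpen_iff_mem_nhds]
    rintro z ⟨hz, hz1, hz2⟩
    have h1 : ContinuousAt (fun z => (n z : E3)) z :=
      continuous_subtype_val.continuousAt.comp (hn.continuousAt (hΩ.mem_nhds hz))
    filter_upwards [hΩ.mem_nhds hz, h1.eventually_ne hz1,
      (hu z hz hz1).continuousAt.norm.eventually_lt_const hz2] with w k1 k2 k3
    exact ⟨k1, k2, k3⟩
  -- Where `|u| < 1` the spherical density `4 / (1 + |u|²)²` is at least `1`, so the image inside
  -- the unit disc has Euclidean area less than `π`. The part of the disc that is missed has
  -- positive area and contains two points.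
  have hvol : volume (U '' W) < NNReal.pi := by
    refine lt_of_le_of_lt ?_ hfin
    refine (addHaar_image_le_lintegral_abs_det_fderiv volume hWo.measurableSet
      (f' := fun z => mulL (deriv U z)) ?_).trans ?_
    · intro z hz
      refine ((hu z hz.1 hz.2.1).differentiableAt.hasDerivAt.hasFDerivAt.restrictScalars
        ℝ).hasFDerivWithinAt.congr_fderiv ?_
      ext1 v
      simp [mul_comm, hU]
    · refine (setLIntegral_mono' hWo.measurableSet fun z hz => ?_).trans
        (lintegral_mono_set fun z hz => hz.1)
      apply ENNReal.ofReal_le_ofReal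
      rw [det_mulL, abs_of_nonneg (by positivity), hdu z hz.1 hz.2.1]
      have h1 : ‖U z‖ ^ 2 ≤ 1 := pow_le_one₀ (norm_nonneg _) hz.2.2.le
      have h2 : 0 ≤ ‖U z‖ ^ 2 := by positivity
      rw [le_div_iff₀ (by positivity)]
      have h3 : (1 + ‖U z‖ ^ 2) ^ 2 ≤ 4 := by nlinarith
      nlinarith [sq_nonneg ‖deriv U z‖]
  have hns : ¬ (Metric.ball (0 : ℂ) 1 \ U '' W).Subsingleton := by
    intro hs
    have h1 : volume (Metric.ball (0 : ℂ) 1) ≤ volume (U '' W) := by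
      refine (measure_mono (t := (Metric.ball (0 : ℂ) 1 \ U '' W) ∪ U '' W) fun z hz => ?_).trans
        ((measure_union_le _ _).trans ?_)
      · by_cases h : z ∈ U '' W
        · exact Or.inr h
        · exact Or.inl ⟨hz, h⟩
      · rw [hs.measure_zero, zero_add]
    rw [Complex.volume_ball] at h1
    simp only [ENNReal.ofReal_one, one_pow, one_mul] at h1
    exact not_lt.2 h1 hvol
  obtain ⟨a, ha, b, hb, hab⟩ := not_subsingleton_iff.1 hns
  have key : ∀ c ∈ Metric.ball (0 : ℂ) 1 \ U '' W, ∀ z ∈ Ω, n z ≠ sph c := by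
    rintro c ⟨hc, hcW⟩ z hz h
    apply hcW
    have h2 : U z = c := by rw [hU]; simp only; rw [h, coordU_sph]
    refine ⟨z, ⟨hz, ?_, ?_⟩, h2⟩
    · rw [h]; exact sph_ne_south c
    · rw [h2]; simpa using hc
  exact ⟨a, b, hab, fun z hz => ⟨key a ha z hz, key b hb z hz⟩⟩

/-- The diameter of the image of a circle is bounded by the energy. -/
theorem dist_circle_le {f : ℂ → E3} {B : ℂ → ℂ →L[ℝ] E3} {d : ℂ → ℝ} {z₀ : ℂ} {r R : ℝ}
    (hr : 0 < r) (hrR : r < R) (hB : ∀ z ∈ pball z₀ R, HasFDerivAt f (B z) z)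
    (hBd : ∀ z ∈ pball z₀ R, ∀ v, ‖B z v‖ ^ 2 ≤ d z * ‖v‖ ^ 2) (hd : ContinuousOn d (pball z₀ R))
    {κ : ℝ} (hκ : 0 < κ)
    (hsmall : r ^ 2 * ∫ θ in (-Real.pi)..Real.pi, d (circleMap z₀ r θ) <
      κ * (κ / (2 * Real.pi))) {θ : ℝ} (hθ : θ ∈ Icc (-Real.pi) Real.pi) :
    ‖f (circleMap z₀ r θ) - f (circleMap z₀ r (-Real.pi))‖ ≤ κ := by
  have hm := fun θ => circleMap_mem_pball z₀ hr hrR θ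
  have hpi := Real.pi_pos
  set η := κ / (2 * Real.pi) with hη
  have hη0 : 0 < η := by positivity
  have h7 : 2 * Real.pi * η = κ := by rw [hη]; field_simp
  clear_value η
  have hc : Continuous fun θ => d (circleMap z₀ r θ) :=
    hd.comp_continuous (continuous_circleMap z₀ r) hm
  -- The speed is bounded by `X ≤ (η + X² / η) / 2` in place of the Cauchy–Schwarz inequality. With
  -- `η = κ / (2π)` both halves integrate to at most `κ / 2` over the full circle.
  set b : ℝ → ℝ := fun θ => (η + r ^ 2 * d (circleMap z₀ r θ) / η) / 2 with hb
  have hbc : Continuous b :=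
    (continuous_const.add ((continuous_const.mul hc).div_const _)).div_const _
  have h1 : ∀ t, HasDerivAt (fun t => f (circleMap z₀ r t) - f (circleMap z₀ r (-Real.pi)))
      (B (circleMap z₀ r t) (circleMap 0 r t * Complex.I)) t := fun t => by
    have := (hB _ (hm t)).comp_hasDerivAt t (hasDerivAt_circleMap z₀ r t)
    exact this.sub_const _
  have h2 : ∀ t, HasDerivAt (fun t => ∫ s in (-Real.pi)..t, b s) (b t) t := fun t =>
    intervalIntegral.integral_hasDerivAt_right (hbc.intervalIntegrable _ _)
      (hbc.stronglyMeasurableAtFilter _ _) hbc.continuousAt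
  have h3 := image_norm_le_of_norm_deriv_right_le_deriv_boundary'
    (a := -Real.pi) (b := Real.pi)
    (fun t _ => (h1 t).continuousAt.continuousWithinAt) (fun t _ => (h1 t).hasDerivWithinAt)
    (B := fun t => ∫ s in (-Real.pi)..t, b s) (B' := b) (by simp)
    (fun t _ => (h2 t).continuousAt.continuousWithinAt) (fun t _ => (h2 t).hasDerivWithinAt)
    (fun t _ => by
      have k1 := hBd _ (hm t) (circleMap 0 r t * Complex.I)
      rw [norm_mul, norm_circleMap_zero, Complex.norm_I, mul_one, sq_abs] at k1
      set X := ‖B (circleMap z₀ r t) (circleMap 0 r t * Complex.I)‖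
      rw [hb]
      simp only
      rw [le_div_iff₀ two_pos, ← sub_nonneg]
      have k2 : η + r ^ 2 * d (circleMap z₀ r t) / η - X * 2 =
          ((η - X) ^ 2 + (d (circleMap z₀ r t) * r ^ 2 - X ^ 2)) / η := by
        field_simp; ring
      rw [k2]
      exact div_nonneg (add_nonneg (sq_nonneg _) (sub_nonneg.2 k1)) hη0.le) hθ
  refine h3.trans ?_
  have hd0 : ∀ t, 0 ≤ d (circleMap z₀ r t) := fun t => by
    have := hBd _ (hm t) 1
    rw [norm_one, one_pow, mul_one] at this
    exact (sq_nonneg _).trans this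
  have h4 : ∫ s in (-Real.pi)..θ, b s ≤ ∫ s in (-Real.pi)..Real.pi, b s := by
    refine intervalIntegral.integral_mono_interval le_rfl hθ.1 hθ.2
      (Eventually.of_forall fun t => ?_) (hbc.intervalIntegrable _ _)
    have := hd0 t
    show 0 ≤ b t
    rw [hb]; positivity
  refine h4.trans ?_
  have h5 : ∫ s in (-Real.pi)..Real.pi, b s =
      (2 * Real.pi * η + (r ^ 2 * ∫ θ in (-Real.pi)..Real.pi, d (circleMap z₀ r θ)) / η) / 2 := by
    rw [hb, intervalIntegral.integral_div, intervalIntegral.integral_add (by simp)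
      ((hc.const_mul _).div_const _ |>.intervalIntegrable _ _), intervalIntegral.integral_div,
      intervalIntegral.integral_const_mul, intervalIntegral.integral_const, smul_eq_mul]
    ring
  have h6 : (r ^ 2 * ∫ θ in (-Real.pi)..Real.pi, d (circleMap z₀ r θ)) / η ≤ κ := by
    rw [div_le_iff₀ hη0]; exact hsmall.le
  rw [h5, h7]
  linarith

theorem mob_differentiable {n : ℂ → S2} {Ω : Set ℂ} (hΩ : IsOpen Ω) (hn : ContinuousOn n Ω)
    (hu : ∀ z ∈ Ω, (n z : E3) ≠ -e3 → AnalyticAt ℂ (fun z => coordU (n z)) z)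
    (hv : ∀ z ∈ Ω, (n z : E3) ≠ e3 → AnalyticAt ℂ (fun z => coordV (n z)) z) (a : ℂ) {b : ℂ}
    (hb : ∀ z ∈ Ω, n z ≠ sph b) : DifferentiableOn ℂ (fun z => mob a b (n z)) Ω := by
  intro z hz
  have h1 : ContinuousAt (fun z => (n z : E3)) z :=
    continuous_subtype_val.continuousAt.comp (hn.continuousAt (hΩ.mem_nhds hz))
  refine DifferentiableAt.differentiableWithinAt ?_
  by_cases hs : (n z : E3) = -e3
  · have hne : (n z : E3) ≠ e3 := by rw [hs]; exact neg_e3_ne_e3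
    have h2 := (hv z hz hne).differentiableAt
    have h3 : DifferentiableAt ℂ (fun z => (1 - a * coordV (n z)) / (1 - b * coordV (n z))) z :=
      ((differentiableAt_const _).sub ((differentiableAt_const _).mul h2)).div
        ((differentiableAt_const _).sub ((differentiableAt_const _).mul h2))
        (coordV_mul_ne hne (hb z hz))
    refine h3.congr_of_eventuallyEq ?_
    filter_upwards [h1.eventually_ne hne] with w hw
    exact mob_of_ne_north a b hw
  · have h2 := (hu z hz hs).differentiableAt
    have h3 : DifferentiableAt ℂ (fun z => (coordU (n z) - a) / (coordU (n z) - b)) z :=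
      (h2.sub (differentiableAt_const _)).div (h2.sub (differentiableAt_const _))
        (coordU_sub_ne hs (hb z hz))
    refine h3.congr_of_eventuallyEq ?_
    filter_upwards [h1.eventually_ne hs] with w hw
    exact mob_of_ne_south a b hw

theorem mob_bounded (a b : ℂ) {κ : ℝ} (hκ : 0 < κ) :
    ∃ M, ∀ s : S2, κ ≤ dist s (sph b) → ‖mob a b s‖ ≤ M := by
  have hK : IsCompact {s : S2 | κ ≤ dist s (sph b)} :=
    (isClosed_le continuous_const (continuous_id.dist continuous_const)).isCompact
  obtain ⟨M, hM⟩ := hK.exists_bound_of_continuousOn (f := mob a b) fun s hs =>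
    (continuousAt_mob a b (by
      rintro rfl
      have h1 : κ ≤ dist (sph b) (sph b) := hs
      rw [dist_self] at h1
      linarith)).continuousWithinAt
  exact ⟨M, fun s hs => hM s hs⟩

/-- A holomorphic map of finite area from a punctured disc to the sphere extends continuously. -/
theorem exists_tendsto_of_finite_area {n : ℂ → S2} {d : ℂ → ℝ} {z₀ : ℂ} {R : ℝ} (hR : 0 < R)
    (hu : ∀ z ∈ pball z₀ R, (n z : E3) ≠ -e3 → AnalyticAt ℂ (fun z => coordU (n z)) z)
    (hv : ∀ z ∈ pball z₀ R, (n z : E3) ≠ e3 → AnalyticAt ℂ (fun z => coordV (n z)) z)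
    {B : ℂ → ℂ →L[ℝ] E3} (hB : ∀ z ∈ pball z₀ R, HasFDerivAt (fun z => (n z : E3)) (B z) z)
    (hBd : ∀ z ∈ pball z₀ R, ∀ v, ‖B z v‖ ^ 2 ≤ d z * ‖v‖ ^ 2) (hd : ContinuousOn d (pball z₀ R))
    (hdu : ∀ z ∈ pball z₀ R, (n z : E3) ≠ -e3 →
      d z = 4 * ‖deriv (fun z => coordU (n z)) z‖ ^ 2 / (1 + ‖coordU (n z)‖ ^ 2) ^ 2)
    (hfin : ∫⁻ z in pball z₀ R, ENNReal.ofReal (d z) ≠ ⊤) :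
    ∃ s, Tendsto n (𝓝[≠] z₀) (𝓝 s) := by
  obtain ⟨δ, hδ, hδs⟩ := exists_pos_setLIntegral_lt_of_measure_lt
    (μ := volume.restrict (pball z₀ R)) hfin (ε := NNReal.pi)
    (by simpa using NNReal.pi_ne_zero)
  obtain ⟨r₁, hr₁v, hr₁0, hr₁R⟩ := (((tendsto_volume_ball z₀).eventually_lt_const hδ).and
    (Ioo_mem_nhdsGT hR)).exists
  have hsub : pball z₀ r₁ ⊆ pball z₀ R := pball_mono hr₁R.le
  have hcn : ContinuousOn n (pball z₀ r₁) := fun z hz =>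
    (IsInducing.subtypeVal.continuousAt_iff.2 (hB z (hsub hz)).continuousAt).continuousWithinAt
  obtain ⟨a, b, hab, hom⟩ := exists_omitted (isOpen_pball z₀ r₁) hcn
    (fun z hz => hu z (hsub hz)) (fun z hz => hdu z (hsub hz)) (by
      have h1 := hδs (pball z₀ r₁) (lt_of_le_of_lt
        ((Measure.restrict_apply_le _ _).trans (measure_mono Set.sdiff_subset)) hr₁v)
      rwa [Measure.restrict_restrict_of_subset hsub] at h1)
  have hd0 : ∀ z ∈ pball z₀ r₁, 0 ≤ d z := fun z hz => by
    have := hBd _ (hsub hz) 1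
    rw [norm_one, one_pow, mul_one] at this
    exact (sq_nonneg _).trans this
  set ρ := dist (sph a) (sph b) with hρ
  have hρ0 : 0 < ρ := dist_pos.2 fun h => hab (by rw [← coordU_sph a, h, coordU_sph])
  have hκ : 0 < ρ / 3 := by positivity
  have hfr := exists_small_circle hr₁0 (hd.mono hsub) hd0
    (ne_top_of_le_ne_top hfin (lintegral_mono_set hsub))
    (δ := ρ / 3 * (ρ / 3 / (2 * Real.pi))) (by have := Real.pi_pos; positivity)
  obtain ⟨M₁, hM₁⟩ := mob_bounded a b (κ := ρ / 6) (by positivity)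
  obtain ⟨M₂, hM₂⟩ := mob_bounded b a (κ := ρ / 6) (by positivity)
  -- The image of a short circle lies within `ρ/3` of a point `p`, and `p` is at distance at least
  -- `ρ/2` from one of the two omitted points. The circle then stays at distance at least `ρ/6` from
  -- that point, where the Möbius transformation with this pole is bounded. One of the two cases
  -- occurs for arbitrarily small circles.
  have hfr2 : ∃ᶠ r in 𝓝[>] (0 : ℝ),
      (r < r₁ ∧ ∀ θ, ‖mob a b (n (circleMap z₀ r θ))‖ ≤ M₁) ∨
      (r < r₁ ∧ ∀ θ, ‖mob b a (n (circleMap z₀ r θ))‖ ≤ M₂) := by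
    refine (hfr.and_eventually self_mem_nhdsWithin).mono ?_
    rintro r ⟨⟨hr, hs⟩, hr0⟩
    have hr0' : 0 < r := hr0
    set p := n (circleMap z₀ r (-Real.pi))
    have hall : ∀ θ, dist (n (circleMap z₀ r θ)) p ≤ ρ / 3 := by
      intro θ
      obtain ⟨θ', hθ', h'⟩ := exists_circleMap z₀ (z := circleMap z₀ r θ)
      have : dist (circleMap z₀ r θ) z₀ = r := by
        rw [dist_eq_norm]; simp [circleMap, abs_of_pos hr0']
      rw [this] at h'
      rw [← h', Subtype.dist_eq, dist_eq_norm]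
      exact dist_circle_le hr0' hr (fun z hz => hB z (hsub hz)) (fun z hz => hBd z (hsub hz))
        (hd.mono hsub) hκ hs hθ'
    have htri := dist_triangle_left (sph a) (sph b) p
    rcases le_total (ρ / 2) (dist p (sph b)) with hc | hc
    · left
      refine ⟨hr, fun θ => hM₁ _ ?_⟩
      have := dist_triangle_left p (sph b) (n (circleMap z₀ r θ))
      have := hall θ
      linarith
    · right
      refine ⟨hr, fun θ => hM₂ _ ?_⟩
      have := dist_triangle_left p (sph a) (n (circleMap z₀ r θ))
      have := hall θ
      linarith
  have fin : ∀ {a b : ℂ}, a ≠ b → (∀ z ∈ pball z₀ r₁, n z ≠ sph b) → ∀ {M : ℝ},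
      (∃ᶠ r in 𝓝[>] (0 : ℝ), r < r₁ ∧ ∀ θ, ‖mob a b (n (circleMap z₀ r θ))‖ ≤ M) →
      ∃ s, Tendsto n (𝓝[≠] z₀) (𝓝 s) := by
    intro a b hab hb M hfr
    obtain ⟨L, hL⟩ := tendsto_of_bounded_circles hr₁0 (mob_differentiable (isOpen_pball z₀ r₁) hcn
      (fun z hz => hu z (hsub hz)) (fun z hz => hv z (hsub hz)) a hb) hfr
    refine ⟨mobInv a b L, (((continuous_mobInv hab).tendsto L).comp hL).congr' ?_⟩
    filter_upwards [pball_mem hr₁0] with z hz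
    exact mobInv_mob hab (hb z hz)
  rcases frequently_or_distrib.1 hfr2 with h | h
  · exact fin hab (fun z hz => (hom z hz).2) h
  · exact fin hab.symm (fun z hz => (hom z hz).1) h

end Extension

/-! ## The Gauss map at the ends -/

/-- A traceless symmetric endomorphism of a plane satisfies `A² = -det A`, so it multiplies all
lengths by the same factor. Hence `|dn|² = -K |dε|²`, and the energy density of the Gauss map is its
area density. -/
theorem IsFrame.norm_sq_apply {x y n : E3} {A : E3 →L[ℝ] E3} (h : IsFrame x y n)
    (hs : (A : E3 →ₗ[ℝ] E3).IsSymmetric) (hn : A n = 0)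
    (ht : LinearMap.trace ℝ E3 (A : E3 →ₗ[ℝ] E3) = 0) (α β : ℝ) :
    ‖A (α • x + β • y)‖ ^ 2 = -LinearMap.det ((A + (innerSL ℝ n).smulRight n : E3 →L[ℝ] E3) :
        E3 →ₗ[ℝ] E3) * ((α ^ 2 + β ^ 2) * ‖x‖ ^ 2) := by
  have hs' : ∀ a b, inner ℝ (A a) b = inner ℝ a (A b) := hs
  have hx : ‖x‖ ≠ 0 := norm_ne_zero_iff.2 h.ne_zero
  have e1 : ∀ z, inner ℝ (A z) n = 0 := fun z => by rw [hs', hn, inner_zero_right]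
  have hyx : inner ℝ (A y) x = inner ℝ (A x) y := by rw [hs', real_inner_comm]
  rw [h.det_eq hn (e1 x) (e1 y), h.apply_yy hn ht, hyx]
  set a := inner ℝ (A x) x with ha
  set b := inner ℝ (A x) y with hb
  have hyy : inner ℝ (A y) y = -a := h.apply_yy hn ht
  have ex : A x = (‖x‖ ^ 2)⁻¹ • (a • x + b • y) := by
    conv_lhs => rw [h.expand (A x)]
    rw [real_inner_comm (A x) x, real_inner_comm (A x) y, real_inner_comm (A x) n, e1, zero_smul,
      add_zero]
  have ey : A y = (‖x‖ ^ 2)⁻¹ • (b • x + -a • y) := by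
    conv_lhs => rw [h.expand (A y)]
    rw [real_inner_comm (A y) x, real_inner_comm (A y) y, real_inner_comm (A y) n, e1, zero_smul,
      add_zero, hyx, hyy]
  have e2 : A (α • x + β • y) = ((‖x‖ ^ 2)⁻¹ * (α * a + β * b)) • x +
      ((‖x‖ ^ 2)⁻¹ * (α * b - β * a)) • y := by
    rw [map_add, map_smul, map_smul, ex, ey]; module
  rw [e2, norm_add_sq_real, norm_smul, norm_smul, real_inner_smul_left, real_inner_smul_right,
    h.xy, mul_pow, mul_pow, ← h.norm_eq, Real.norm_eq_abs, Real.norm_eq_abs, sq_abs, sq_abs]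
  field_simp
  ring

section Ends

variable {D : Type*} [TopologicalSpace D] [ChartedSpace ℂ D]
  [IsManifold 𝓘(ℂ, ℂ) ω D] [T1Space D] {Dinf : Finset D} {ε : D → D → E3}
  (h : IsMinimalImmersion Dinf ε) {c y : D}

include h

theorem IsMinimalImmersion.hasFDerivAt_normal (hyD : y ∉ Dinf) (hy : y ∈ (chartAt ℂ c).source) :
    HasFDerivAt (normal ε ∘ (chartAt ℂ c).symm) (shape ε y ∘L dMap ε c y) (chartAt ℂ c y) := by
  obtain ⟨U, hm, hyU, -, hU⟩ := h.exists_isMin hy hyD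
  have h1 := hU _ hyU
  rw [(chartAt ℂ c).left_inv hy] at h1
  have h2 : normal ε ∘ (chartAt ℂ c).symm =ᶠ[𝓝 (chartAt ℂ c y)]
      fun w => nrm (fderiv ℝ (ε y ∘ (chartAt ℂ c).symm) w) := by
    filter_upwards [hm.eventually hyU] with w hw
    exact (hU w hw).2.2.1
  refine ((hm.hasFDerivAt_nrm hyU).congr_of_eventuallyEq h2).congr_fderiv ?_
  ext1 v
  show _ = shape ε y (dMap ε c y v)
  rw [h1.2.2.2, h1.2.1, (hm.conf _ hyU).shapeOf_apply]

theorem IsMinimalImmersion.norm_sq_shape (hyD : y ∉ Dinf) (hy : y ∈ (chartAt ℂ c).source) (v : ℂ) :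
    ‖shape ε y (dMap ε c y v)‖ ^ 2 =
      -gaussCurv ε y * areaDensity ε c (chartAt ℂ c y) * ‖v‖ ^ 2 := by
  have hc := h.isConf_dMap hyD hy
  have hf := hc.isFrame
  rw [← h.normal_eq hyD hy] at hf
  obtain ⟨k1, k2, k3⟩ := h.shape_mem hyD
  rw [apply_eq, hf.norm_sq_apply k1 k2 k3, areaDensity, (chartAt ℂ c).left_inv hy, hc.norm_cross,
    gaussCurv, Complex.sq_norm, Complex.normSq_apply]
  ring

omit [IsManifold 𝓘(ℂ, ℂ) ω D] [T1Space D] h in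
open Classical in
/-- The Gauss map with values in the sphere. -/
def gaussMap (ε : D → D → E3) (x : D) : S2 :=
  if hx : normal ε x ∈ Metric.sphere (0 : E3) 1 then ⟨normal ε x, hx⟩ else north

omit [IsManifold 𝓘(ℂ, ℂ) ω D] [T1Space D] in
theorem IsMinimalImmersion.coe_gaussMap (hyD : y ∉ Dinf) : (gaussMap ε y : E3) = normal ε y := by
  have : normal ε y ∈ Metric.sphere (0 : E3) 1 := by simpa using h.norm_normal hyD
  rw [gaussMap, dif_pos this]

omit [IsManifold 𝓘(ℂ, ℂ) ω D] [T1Space D] h in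
/-- A small punctured disc around an end. -/
theorem exists_pball [T1Space D] (Dinf : Finset D) (e : D) {S : Set D} (hS : S ∈ 𝓝 e) :
    ∃ R > 0, Metric.ball (chartAt ℂ e e) R ⊆ (chartAt ℂ e).target ∧
      ∀ z ∈ Metric.ball (chartAt ℂ e e) R, (chartAt ℂ e).symm z ∈ S ∧
        (z ≠ chartAt ℂ e e → (chartAt ℂ e).symm z ∉ Dinf) := by
  classical
  have h1 : ∀ᶠ x in 𝓝 e, x ∈ S ∧ x ∉ Dinf.erase e :=
    Eventually.and hS (eventually_notMem_finset (Finset.notMem_erase e Dinf))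
  rw [← eventually_chart] at h1
  obtain ⟨R, hR, hRs⟩ := Metric.mem_nhds_iff.1
    (h1.and ((chartAt ℂ e).open_target.mem_nhds (mem_chart_target ℂ e)))
  refine ⟨R, hR, fun z hz => (hRs hz).2, fun z hz => ⟨(hRs hz).1.1, fun hne hD => ?_⟩⟩
  refine (hRs hz).1.2 (Finset.mem_erase.2 ⟨fun he => hne ?_, hD⟩)
  rw [← (chartAt ℂ e).right_inv (hRs hz).2, he]

theorem IsMinimalImmersion.measurable_indicator_gaussCurv [MeasurableSpace D] [BorelSpace D] :
    Measurable ((Dinf : Set D)ᶜ.indicator (gaussCurv ε)) := by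
  classical
  have h1 : Measurable ((Dinf : Set D)ᶜ.piecewise (gaussCurv ε) 0) :=
    ContinuousOn.measurable_piecewise (s := (Dinf : Set D)ᶜ)
      (fun x hx => (h.continuousAt_gaussCurv hx).continuousWithinAt) continuousOn_const
      Dinf.measurableSet.compl
  rwa [piecewise_eq_indicator] at h1

variable [CompactSpace D] [Nonempty D] [MeasurableSpace D] [BorelSpace D]

theorem IsMinimalImmersion.lintegral_gaussCurv {c : D} {A : Set D} (hA : MeasurableSet A)
    (hAc : A ⊆ (chartAt ℂ c).source) (hAD : ∀ x ∈ A, x ∉ Dinf) :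
    ∫⁻ x in A, ENNReal.ofReal (-gaussCurv ε x) ∂areaMeasure Dinf ε =
      ∫⁻ z in chartSet c A,
        ENNReal.ofReal (-gaussCurv ε ((chartAt ℂ c).symm z) * areaDensity ε c z) := by
  have hF : Measurable fun x => ENNReal.ofReal (-((Dinf : Set D)ᶜ.indicator (gaussCurv ε) x)) :=
    h.measurable_indicator_gaussCurv.neg.ennreal_ofReal
  have h1 := h.lintegral_areaMeasure hF hA hAc hAD
  have h2 : ∀ x ∈ A, (Dinf : Set D)ᶜ.indicator (gaussCurv ε) x = gaussCurv ε x := fun x hx =>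
    indicator_of_mem (s := (Dinf : Set D)ᶜ) (hAD x hx) _
  rw [setLIntegral_congr_fun hA fun x hx => by rw [h2 x hx]] at h1
  rw [h1]
  refine setLIntegral_congr_fun (measurableSet_chartSet c hA) fun z hz => ?_
  rw [h2 _ hz.2, ← ENNReal.ofReal_mul (neg_nonneg.2 (h.gaussCurv_nonpos (hAD _ hz.2)))]

omit h [IsManifold 𝓘(ℂ, ℂ) ω D] [T1Space D] [CompactSpace D] [Nonempty D] [MeasurableSpace D]
  [BorelSpace D] in
theorem chartSet_image {c : D} {V : Set ℂ} (hV : V ⊆ (chartAt ℂ c).target) :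
    chartSet c ((chartAt ℂ c).symm '' V) = V := by
  ext z
  constructor
  · rintro ⟨hz, w, hw, hwz⟩
    rwa [← (chartAt ℂ c).symm.injOn (hV hw) hz hwz]
  · exact fun hz => ⟨hV hz, z, hz, rfl⟩

/-- The Gauss map has a limit at an end of finite total curvature. -/
theorem IsMinimalImmersion.exists_tendsto_gaussMap {e : D}
    (hint : IntegrableAtFilter (gaussCurv ε) (𝓝 e) (areaMeasure Dinf ε)) :
    ∃ s, Tendsto (gaussMap ε) (𝓝[≠] e) (𝓝 s) := by
  obtain ⟨S, hS, hSi⟩ := hint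
  obtain ⟨R, hR, hRt, hRS⟩ := exists_pball Dinf e hS
  set z₀ := chartAt ℂ e e with hz₀
  set φ := chartAt ℂ e with hφ
  have hsub : pball z₀ R ⊆ φ.target := Set.sdiff_subset.trans hRt
  have hD : ∀ z ∈ pball z₀ R, φ.symm z ∉ Dinf := fun z hz => (hRS z hz.1).2 hz.2
  have hsrc : ∀ z ∈ pball z₀ R, φ.symm z ∈ φ.source := fun z hz => φ.map_target (hsub hz)
  have hri : ∀ z ∈ pball z₀ R, φ (φ.symm z) = z := fun z hz => φ.right_inv (hsub hz)
  have hcoe : ∀ z ∈ pball z₀ R, (gaussMap ε (φ.symm z) : E3) = normal ε (φ.symm z) := fun z hz =>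
    h.coe_gaussMap (hD z hz)
  have hnhds : ∀ z ∈ pball z₀ R, ∀ᶠ w in 𝓝 z, w ∈ pball z₀ R := fun z hz =>
    (isOpen_pball z₀ R).mem_nhds hz
  -- The energy density is `-K` times the area density of the chart, and its integral over the
  -- punctured disc is the total curvature there, up to sign.
  have key : ∃ s, Tendsto (fun z => gaussMap ε (φ.symm z)) (𝓝[≠] z₀) (𝓝 s) := by
    refine exists_tendsto_of_finite_area (B := fun z => shape ε (φ.symm z) ∘L dMap ε e (φ.symm z))
      (d := fun z => -gaussCurv ε (φ.symm z) * areaDensity ε e z) hR ?_ ?_ ?_ ?_ ?_ ?_ ?_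
    · intro z hz hs
      rw [hcoe z hz] at hs
      have h1 := h.analyticAt_gaussU (hD z hz) (hsrc z hz) hs
      rw [hri z hz] at h1
      refine h1.congr ?_
      filter_upwards [hnhds z hz] with w hw
      rw [hcoe w hw]; rfl
    · intro z hz hs
      rw [hcoe z hz] at hs
      have h1 := h.flipEps.analyticAt_gaussU (hD z hz) (hsrc z hz) (by
        rw [normal_flipEps, ne_eq, flip_eq_neg_e3]; exact hs)
      rw [hri z hz] at h1
      refine h1.congr ?_
      filter_upwards [hnhds z hz] with w hw
      rw [hcoe w hw]
      show coordU (normal (MinSurf.flipEps ε) _) = _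
      rw [normal_flipEps, coordU_flip]
    · intro z hz
      have h1 := h.hasFDerivAt_normal (hD z hz) (hsrc z hz)
      rw [hri z hz] at h1
      refine h1.congr_of_eventuallyEq ?_
      filter_upwards [hnhds z hz] with w hw
      exact hcoe w hw
    · intro z hz v
      have h1 := h.norm_sq_shape (hD z hz) (hsrc z hz) v
      rw [hri z hz] at h1
      exact h1.le
    · intro z hz
      have h1 := h.continuousAt_areaDensity (hD z hz) (hsrc z hz)
      rw [hri z hz] at h1
      exact (((h.continuousAt_gaussCurv (hD z hz)).comp
        (φ.continuousAt_symm (hsub hz))).neg.mul h1).continuousWithinAt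
    · intro z hz hs
      rw [hcoe z hz] at hs
      have h1 := h.gaussCurv_mul (hD z hz) (hsrc z hz) hs
      rw [hri z hz] at h1
      have h2 : (fun z => coordU (gaussMap ε (φ.symm z) : E3)) =ᶠ[𝓝 z]
          gaussU ε ∘ φ.symm := by
        filter_upwards [hnhds z hz] with w hw
        rw [hcoe w hw]; rfl
      rw [h2.deriv_eq, hcoe z hz, areaDensity, neg_mul, h1, neg_neg]
      rfl
    · have hA : IsOpen (φ.symm '' pball z₀ R) :=
        φ.symm.isOpen_image_of_subset_source (isOpen_pball z₀ R) hsub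
      have h1 := h.lintegral_gaussCurv (c := e) hA.measurableSet
        (by rintro _ ⟨z, hz, rfl⟩; exact hsrc z hz) (by rintro _ ⟨z, hz, rfl⟩; exact hD z hz)
      rw [chartSet_image hsub] at h1
      rw [← h1]
      refine ne_top_of_le_ne_top hSi.2.ne ((lintegral_mono fun x => ?_).trans
        (lintegral_mono_set (s := φ.symm '' pball z₀ R) (t := S) ?_))
      · rw [← enorm_neg]; exact Real.ofReal_le_enorm _
      · rintro _ ⟨z, hz, rfl⟩
        exact (hRS z hz.1).1
  obtain ⟨s, hs⟩ := key
  refine ⟨s, (hs.comp (?_ : Tendsto φ (𝓝[≠] e) (𝓝[≠] z₀))).congr' ?_⟩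
  · refine tendsto_nhdsWithin_iff.2 ⟨(φ.continuousAt (mem_chart_source ℂ e)).mono_left
      nhdsWithin_le_nhds, ?_⟩
    filter_upwards [self_mem_nhdsWithin, mem_nhdsWithin_of_mem_nhds (chart_source_mem_nhds ℂ e)]
      with x hx hxs
    exact fun hx' => hx (φ.injOn hxs (mem_chart_source ℂ e) hx')
  · filter_upwards [mem_nhdsWithin_of_mem_nhds (chart_source_mem_nhds ℂ e)] with x hx
    simp only [Function.comp_apply]
    rw [φ.left_inv hx]

end Ends

/-! ## Complete flat ends -/

section Lifting

variable {E X : Type*} [TopologicalSpace E] [T2Space E] [TopologicalSpace X] [T2Space X] {p : E → X}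

/-- A path can be lifted through a local homeomorphism if the partial lifts do not leave every
compact set. -/
theorem exists_path_lift (hp : IsLocalHomeomorph p) {f : ℝ → X} (hf : Continuous f) {e₀ : E}
    (h0 : p e₀ = f 0)
    (hlim : ∀ T ∈ Ioc (0 : ℝ) 1, ∀ g : ℝ → E, ContinuousOn g (Ico 0 T) → g 0 = e₀ →
      (∀ s ∈ Ico 0 T, p (g s) = f s) → ∃ L, Tendsto g (𝓝[<] T) (𝓝 L)) :
    ∃ g : ℝ → E, ContinuousOn g (Icc 0 1) ∧ g 0 = e₀ ∧ ∀ s ∈ Icc (0 : ℝ) 1, p (g s) = f s := by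
  classical
  -- `S` consists of the times up to which a lift exists. It is closed because partial lifts have
  -- limits, and it can be continued to the right by a local inverse.
  set S : Set ℝ := {t | ∃ g : ℝ → E, ContinuousOn g (Icc 0 t) ∧ g 0 = e₀ ∧
    ∀ s ∈ Icc (0 : ℝ) t, p (g s) = f s} with hS
  have mono : ∀ {s t : ℝ}, s ≤ t → t ∈ S → s ∈ S := by
    rintro s t hst ⟨g, h1, h2, h3⟩
    exact ⟨g, h1.mono (Icc_subset_Icc_right hst), h2,
      fun r hr => h3 r ⟨hr.1, hr.2.trans hst⟩⟩
  suffices Icc (0 : ℝ) 1 ⊆ S from this (right_mem_Icc.2 zero_le_one)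
  refine IsClosed.Icc_subset_of_forall_mem_nhdsWithin ?_ ?_ ?_
  · refine isClosed_of_closure_subset fun T hT => ?_
    have hT1 : T ∈ Icc (0 : ℝ) 1 := closure_minimal inter_subset_right isClosed_Icc hT
    by_contra hTS
    have hTS' : T ∉ S := fun h => hTS ⟨h, hT1⟩
    have hlt : ∀ t < T, t ∈ S := by
      intro t ht
      obtain ⟨s, hs, hs'⟩ := mem_closure_iff_nhds.1 hT (Ioi t) (Ioi_mem_nhds ht)
      exact mono (le_of_lt hs) hs'.1
    have hT0 : 0 < T := by
      refine hT1.1.lt_of_ne fun h => hTS' ?_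
      subst h
      exact ⟨fun _ => e₀, continuousOn_const, rfl, fun s hs => by
        rw [le_antisymm hs.2 hs.1]; exact h0⟩
    have : Nonempty E := ⟨e₀⟩
    choose! G hGc hG0 hGl using hlt
    -- Lifts with the same starting point agree, so the chosen lifts `G t` on the intervals `[0, t]`
    -- glue to the diagonal `s ↦ G s s`.
    have hagree : ∀ t < T, 0 ≤ t → ∀ s ∈ Icc 0 t, G s s = G t s := by
      intro t ht ht0 s hs
      refine IsSeparatedMap.eqOn_of_comp_eqOn (p := p) (s := Icc 0 s) (T2Space.isSeparatedMap p)
        hp.isLocallyInjective isPreconnected_Icc (hGc s (hs.2.trans_lt ht))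
        ((hGc t ht).mono (Icc_subset_Icc_right hs.2)) ?_ (left_mem_Icc.2 hs.1)
        ((hG0 s (hs.2.trans_lt ht)).trans (hG0 t ht).symm) (right_mem_Icc.2 hs.1)
      intro r hr
      exact (hGl s (hs.2.trans_lt ht) r hr).trans (hGl t ht r ⟨hr.1, hr.2.trans hs.2⟩).symm
    have hgc : ContinuousOn (fun s => G s s) (Ico 0 T) := by
      intro s hs
      obtain ⟨t, hst, htT⟩ := exists_between hs.2
      have h1 : ContinuousWithinAt (fun s => G s s) (Icc 0 t) s :=
        ((hGc t htT).congr fun r hr => hagree t htT (hr.1.trans hr.2) r hr) s ⟨hs.1, hst.le⟩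
      refine h1.mono_of_mem_nhdsWithin ?_
      filter_upwards [self_mem_nhdsWithin, mem_nhdsWithin_of_mem_nhds (Iio_mem_nhds hst)]
        with r hr hr' using ⟨hr.1, le_of_lt hr'⟩
    have hgl : ∀ s ∈ Ico 0 T, p (G s s) = f s := fun s hs => hGl s hs.2 s ⟨hs.1, le_rfl⟩
    obtain ⟨L, hL⟩ := hlim T ⟨hT0, hT1.2⟩ (fun s => G s s) hgc (hG0 0 hT0) hgl
    have hpL : p L = f T := by
      have h1 : Tendsto (fun s => p (G s s)) (𝓝[<] T) (𝓝 (p L)) :=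
        (hp.continuous.tendsto L).comp hL
      have h2 : Tendsto (fun s => p (G s s)) (𝓝[<] T) (𝓝 (f T)) := by
        refine ((hf.tendsto T).mono_left nhdsWithin_le_nhds).congr' ?_
        filter_upwards [Ioo_mem_nhdsLT hT0] with s hs
        exact (hgl s ⟨hs.1.le, hs.2⟩).symm
      exact tendsto_nhds_unique h1 h2
    refine hTS' ⟨fun s => if s < T then G s s else L, ?_, by simp [hT0, hG0], ?_⟩
    · intro s hs
      rcases hs.2.lt_or_eq with h | rfl
      · have h1 := hgc s ⟨hs.1, h⟩
        refine (h1.mono_of_mem_nhdsWithin (?_ : Ico 0 T ∈ 𝓝[Icc 0 T] s)).congr_of_eventuallyEq ?_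
          (if_pos h)
        · filter_upwards [self_mem_nhdsWithin, mem_nhdsWithin_of_mem_nhds (Iio_mem_nhds h)]
            with r hr hr' using ⟨hr.1, hr'⟩
        · filter_upwards [mem_nhdsWithin_of_mem_nhds (Iio_mem_nhds h)] with r hr using if_pos hr
      · rw [← Ico_union_right hs.1, continuousWithinAt_union]
        refine ⟨?_, continuousWithinAt_singleton⟩
        have h1 : Tendsto (fun r => if r < s then G r r else L) (𝓝[<] s) (𝓝 L) := by
          refine hL.congr' ?_
          filter_upwards [self_mem_nhdsWithin] with r hr using (if_pos hr).symm
        rw [ContinuousWithinAt, if_neg (lt_irrefl s)]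
        exact h1.mono_left (nhdsWithin_mono _ Ico_subset_Iio_self)
    · intro s hs
      by_cases h : s < T
      · simp only [if_pos h]; exact hgl s ⟨hs.1, h⟩
      · simp only [if_neg h]; rw [hpL, le_antisymm hs.2 (not_lt.1 h)]
  · exact ⟨fun _ => e₀, continuousOn_const, rfl, fun s hs => by
      rw [le_antisymm hs.2 hs.1]; exact h0⟩
  · rintro t ⟨⟨g, hg1, hg2, hg3⟩, ht⟩
    obtain ⟨q, hq, rfl⟩ := hp (g t)
    have htm : f t ∈ q.target := by
      rw [← hg3 t ⟨ht.1, le_rfl⟩]; exact q.map_source hq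
    obtain ⟨δ, hδ, hball⟩ := Metric.mem_nhds_iff.1
      (hf.continuousAt.preimage_mem_nhds (q.open_target.mem_nhds htm))
    refine mem_of_superset (Ioo_mem_nhdsGT (show t < t + δ by linarith)) fun t' ht' => ?_
    have hmem : ∀ s ∈ Icc t t', f s ∈ q.target := fun s hs => hball (by
      have h1 := hs.1
      have h2 := hs.2.trans_lt ht'.2
      rw [Metric.mem_ball, Real.dist_eq, abs_lt]
      exact ⟨by linarith, by linarith⟩)
    have hgt : q.symm (f t) = g t := by
      rw [← hg3 t ⟨ht.1, le_rfl⟩, q.left_inv hq]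
    have hcs : ContinuousOn (fun s => q.symm (f s)) (Icc t t') :=
      q.continuousOn_symm.comp hf.continuousOn hmem
    refine ⟨fun s => if s ≤ t then g s else q.symm (f s), ?_, by simp [ht.1, hg2], ?_⟩
    · refine ContinuousOn.if ?_ ?_ ?_
      · rintro s ⟨hs, hfr⟩
        have := frontier_le_subset_eq continuous_id continuous_const hfr
        have hst : s = t := this
        rw [hst, hgt]
      · refine hg1.mono ?_
        rintro s ⟨hs, hs'⟩
        have : s ∈ Iic t := closure_minimal (fun r hr => hr) isClosed_Iic hs'
        exact ⟨hs.1, this⟩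
      · refine hcs.mono ?_
        rintro s ⟨hs, hs'⟩
        have : s ∈ Ici t := closure_minimal (fun r hr => le_of_lt (not_le.1 hr)) isClosed_Ici hs'
        exact ⟨this, hs.2⟩
    · intro s hs
      by_cases h : s ≤ t
      · simp only [if_pos h]; exact hg3 s ⟨hs.1, h⟩
      · simp only [if_neg h]; exact q.right_inv (hmem s ⟨(not_le.1 h).le, hs.2⟩)

/-- A local homeomorphism to `ℂ` has a section on a disc if it has the path lifting property for the
radii of this disc. -/
theorem exists_section_ball {p : E → ℂ} (hp : IsLocalHomeomorph p) {e₀ : E} {ρ : ℝ}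
    (hlim : ∀ ζ ∈ Metric.ball (0 : ℂ) ρ, ∀ T ∈ Ioc (0 : ℝ) 1, ∀ g : ℝ → E,
      ContinuousOn g (Ico 0 T) → g 0 = e₀ → (∀ s ∈ Ico (0 : ℝ) T, p (g s) = p e₀ + s * ζ) →
      ∃ L, Tendsto g (𝓝[<] T) (𝓝 L)) (hρ : 0 < ρ) :
    ∃ ψ : ℂ → E, ContinuousOn ψ (Metric.ball 0 ρ) ∧ ψ 0 = e₀ ∧
      ∀ ζ ∈ Metric.ball (0 : ℂ) ρ, p (ψ ζ) = p e₀ + ζ := by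
  have h1 : ∀ a : Metric.ball (0 : ℂ) ρ, ∃ g : ℝ → E, ContinuousOn g (Icc 0 1) ∧ g 0 = e₀ ∧
      ∀ s ∈ Icc (0 : ℝ) 1, p (g s) = p e₀ + s * a := fun a =>
    exists_path_lift hp (f := fun s : ℝ => p e₀ + s * a) (by fun_prop) (by simp)
      (fun T hT g => hlim a a.2 T hT g)
  choose g hgc hg0 hgl using h1
  -- Lifts of the radii depend continuously on the endpoint; the section is the value of the lift at
  -- time `1`.
  have hcont : Continuous fun x : unitInterval × Metric.ball (0 : ℂ) ρ => g x.2 x.1 := by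
    refine hp.continuous_lift (T2Space.isSeparatedMap p)
      (f := ⟨fun x : unitInterval × Metric.ball (0 : ℂ) ρ => p e₀ + (x.1 : ℝ) * (x.2 : ℂ),
        by fun_prop⟩) ?_ ?_ ?_
    · ext1 x
      exact hgl x.2 x.1 x.1.2
    · exact continuous_const.congr fun a => (hg0 a).symm
    · intro a
      exact (hgc a).comp_continuous continuous_subtype_val fun x => x.2
  have hψ : Continuous fun a : Metric.ball (0 : ℂ) ρ => g a 1 :=
    hcont.comp (continuous_const.prodMk continuous_id : Continuous fun a => ((1 : unitInterval), a))
  have h0m : (0 : ℂ) ∈ Metric.ball (0 : ℂ) ρ := Metric.mem_ball_self hρ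
  classical
  refine ⟨fun ζ => if h : ζ ∈ Metric.ball (0 : ℂ) ρ then g ⟨ζ, h⟩ 1 else e₀, ?_, ?_, ?_⟩
  · rw [continuousOn_iff_continuous_domRestrict]
    refine hψ.congr fun a => ?_
    rw [Set.domRestrict_apply, dif_pos a.2]
  · simp only [dif_pos h0m]
    -- The radius to the centre is a constant path, and so is its lift.
    have := IsSeparatedMap.constOn_of_comp (p := p) (T2Space.isSeparatedMap p)
      hp.isLocallyInjective isPreconnected_Icc (hgc ⟨0, h0m⟩) (fun s hs s' hs' => by
        rw [hgl _ s hs, hgl _ s' hs']; simp) (left_mem_Icc.2 zero_le_one)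
        (right_mem_Icc.2 zero_le_one)
    rw [← this, hg0]
  · intro ζ hζ
    simp only [dif_pos hζ]
    rw [hgl _ 1 (right_mem_Icc.2 zero_le_one)]
    simp

end Lifting

/-! ### Complete flat metrics on a punctured disc. -/

section FlatEnd

/-- A holomorphic function on a half-plane has a primitive. -/
theorem exists_primitive_halfPlane {H : ℂ → ℂ} {c : ℝ} (hH : ∀ w, w.re < c → DifferentiableAt ℂ H w) :
    ∃ F : ℂ → ℂ, ∀ w, w.re < c → HasDerivAt F (H w) w := by
  have hball : ∀ ξ ∈ Metric.ball (0 : ℂ) 1, ξ - 1 ≠ 0 ∧ (c + (ξ + 1) / (ξ - 1)).re < c := by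
    intro ξ hξ
    have h1 : ξ - 1 ≠ 0 := by
      rintro h
      rw [sub_eq_zero.1 h] at hξ; simp at hξ
    refine ⟨h1, ?_⟩
    have h2 : Complex.normSq ξ < 1 := by
      rw [← Complex.sq_norm]
      have : ‖ξ‖ < 1 := by simpa using hξ
      exact pow_lt_one₀ (norm_nonneg _) this two_ne_zero
    have h3 := Complex.normSq_pos.2 h1
    have h4 : ((ξ + 1) / (ξ - 1)).re = (Complex.normSq ξ - 1) / Complex.normSq (ξ - 1) := by
      rw [Complex.div_re, ← add_div, Complex.normSq_apply ξ]
      congr 1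
      simp
      ring
    rw [Complex.add_re, Complex.ofReal_re, h4]
    have := div_neg_of_neg_of_pos (sub_neg.2 h2) h3
    linarith
  -- The map `ξ ↦ c + (ξ + 1)/(ξ - 1)` takes the unit disc to the half-plane and has derivative
  -- `-2/(ξ - 1)²`. The form `H dw` is pulled back to the disc, integrated there, and the primitive
  -- is carried back by the inverse map.
  obtain ⟨G, hG⟩ := DifferentiableOn.isExactOn_ball (c := (0 : ℂ)) (r := 1)
    (f := fun ξ => H (c + (ξ + 1) / (ξ - 1)) * (-2 / (ξ - 1) ^ 2)) (by
      intro ξ hξ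
      obtain ⟨h1, h2⟩ := hball ξ hξ
      have h3 : DifferentiableAt ℂ (fun ξ : ℂ => (c : ℂ) + (ξ + 1) / (ξ - 1)) ξ :=
        (differentiableAt_const _).add ((differentiableAt_id.add_const _).div
          (differentiableAt_id.sub_const _) h1)
      refine DifferentiableAt.differentiableWithinAt (DifferentiableAt.mul ?_ ?_)
      · exact (hH _ h2).comp ξ h3
      · exact (differentiableAt_const _).div ((differentiableAt_id.sub_const _).pow 2)
          (pow_ne_zero 2 h1))
  refine ⟨fun w => G ((w - c + 1) / (w - c - 1)), fun w hw => ?_⟩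
  have h1 : w - c - 1 ≠ 0 := by
    intro h
    have := congrArg Complex.re h
    simp at this
    linarith
  have h2 : (w - c + 1) / (w - c - 1) ∈ Metric.ball (0 : ℂ) 1 := by
    rw [mem_ball_zero_iff, norm_div, div_lt_one (norm_pos_iff.2 h1),
      ← sq_lt_sq₀ (norm_nonneg _) (norm_nonneg _), Complex.sq_norm, Complex.sq_norm,
      Complex.normSq_apply, Complex.normSq_apply]
    simp
    nlinarith
  have h3 := hG _ h2
  have h4 : HasDerivAt (fun w : ℂ => (w - c + 1) / (w - c - 1)) (-2 / (w - c - 1) ^ 2) w := by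
    have := (((hasDerivAt_id' w).sub_const (c : ℂ)).add_const 1).fun_div
      (((hasDerivAt_id' w).sub_const (c : ℂ)).sub_const 1) h1
    refine this.congr_deriv ?_
    ring
  refine (h3.comp w h4).congr_deriv ?_
  have h5 : (w - c + 1) / (w - c - 1) - 1 = 2 / (w - c - 1) := by
    field_simp; ring
  have h6 : (c : ℂ) + ((w - c + 1) / (w - c - 1) + 1) / ((w - c + 1) / (w - c - 1) - 1) = w := by
    rw [h5]; field_simp; ring
  simp only [h6]
  rw [h5]
  field_simp

/-- Rays of finite length do not converge to an end which is complete with respect to the flat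
metric `|h| |dz|`. -/
def FlatComplete (h : ℂ → ℂ) (z₀ : ℂ) (R : ℝ) : Prop :=
  ∀ γ : ℝ → ℂ, ContDiffOn ℝ 1 γ (Ici 0) → (∀ t ∈ Ici (0 : ℝ), γ t ∈ pball z₀ R) →
    Tendsto γ atTop (𝓝 z₀) →
    ∫⁻ t in Ici (0 : ℝ), ‖h (γ t) * derivWithin γ (Ici 0) t‖ₑ = ⊤

variable {h : ℂ → ℂ} {z₀ : ℂ} {R : ℝ}

theorem annulus_bound (hh : ContinuousOn h (pball z₀ R)) (hne : ∀ z ∈ pball z₀ R, h z ≠ 0) {a b : ℝ}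
    (ha : 0 < a) (hb : b < R) :
    ∃ K > 0, ∀ z, a ≤ ‖z - z₀‖ → ‖z - z₀‖ ≤ b → ‖(h z)⁻¹‖ ≤ K := by
  have hc : IsCompact (Metric.closedBall z₀ b ∩ {z | a ≤ ‖z - z₀‖}) :=
    (isCompact_closedBall z₀ b).inter_right
      (isClosed_le continuous_const ((continuous_id.sub continuous_const).norm))
  have hsub : Metric.closedBall z₀ b ∩ {z | a ≤ ‖z - z₀‖} ⊆ pball z₀ R := by
    rintro z ⟨hz, hz'⟩
    refine ⟨lt_of_le_of_lt hz hb, ?_⟩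
    rintro rfl
    have : a ≤ ‖z - z‖ := hz'
    rw [sub_self, norm_zero] at this
    linarith
  obtain ⟨K, hK⟩ := hc.exists_bound_of_continuousOn (f := fun z => (h z)⁻¹)
    ((hh.mono hsub).inv₀ fun z hz => hne z (hsub hz))
  refine ⟨max K 1, by positivity, fun z h1 h2 => (hK z ⟨?_, h1⟩).trans (le_max_left _ _)⟩
  rwa [Metric.mem_closedBall, dist_eq_norm]

theorem lintegral_inv_one_add_sq_lt_top (C : ℝ) :
    ∫⁻ t in Ici (0 : ℝ), ENNReal.ofReal (C * (1 + t ^ 2)⁻¹) < ⊤ := by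
  have h1 : Integrable (fun t : ℝ => C * (1 + t ^ 2)⁻¹) := integrable_inv_one_add_sq.const_mul C
  exact lt_of_le_of_lt (setLIntegral_le_lintegral _ _) h1.lintegral_lt_top

/-- A curve of finite length in the metric `|h| |dz|`, parametrized by arc length, does not converge
to a complete end. -/
theorem not_tendsto_of_flatComplete (hh : ContinuousOn h (pball z₀ R))
    (hne : ∀ z ∈ pball z₀ R, h z ≠ 0) (hcomp : FlatComplete h z₀ R) {ζ : ℂ} {T : ℝ} (hT : 0 < T)
    {z : ℝ → ℂ} (hz : ∀ s ∈ Ico 0 T, HasDerivWithinAt z (ζ / h (z s)) (Ico 0 T) s)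
    (hzm : ∀ s ∈ Ico 0 T, z s ∈ pball z₀ R) : ¬ Tendsto z (𝓝[<] T) (𝓝 z₀) := by
  intro hlim
  -- A reparametrization of the curve by `[0, ∞)`. It is defined on `(-1, ∞)` with values in the
  -- open interval `(0, T)`, so the new curve is `C¹` up to the endpoint `0`. Its length density is
  -- `T |ζ| / (t + 2)²`, which is integrable, in contradiction to completeness.
  set σ : ℝ → ℝ := fun t => T * ((t + 1) / (t + 2)) with hσ
  have hσm : ∀ t ∈ Ioi (-1 : ℝ), σ t ∈ Ioo 0 T := by
    intro t ht
    have ht' : -1 < t := ht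
    have h1 : 0 < (t + 1) / (t + 2) := div_pos (by linarith) (by linarith)
    have h2 : (t + 1) / (t + 2) < 1 := by rw [div_lt_one (by linarith)]; linarith
    exact ⟨mul_pos hT h1, by rw [hσ]; nlinarith⟩
  have hσd : ∀ t ∈ Ioi (-1 : ℝ), HasDerivAt σ (T * (1 / (t + 2) ^ 2)) t := by
    intro t ht
    have ht' : -1 < t := ht
    have h1 := (((hasDerivAt_id' t).add_const 1).fun_div ((hasDerivAt_id' t).add_const 2)
      (show t + 2 ≠ 0 by linarith)).const_mul T
    refine h1.congr_deriv ?_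
    ring
  have hzd : ∀ s ∈ Ioo 0 T, HasDerivAt z (ζ / h (z s)) s := fun s hs =>
    (hz s ⟨hs.1.le, hs.2⟩).hasDerivAt (mem_of_superset (Ioo_mem_nhds hs.1 hs.2)
      Ioo_subset_Ico_self)
  have hγd : ∀ t ∈ Ioi (-1 : ℝ),
      HasDerivAt (z ∘ σ) ((T * (1 / (t + 2) ^ 2)) • (ζ / h (z (σ t)))) t := fun t ht =>
    (hzd _ (hσm t ht)).scomp t (hσd t ht)
  have hIci : ∀ t ∈ Ici (0 : ℝ), t ∈ Ioi (-1 : ℝ) := fun t ht => by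
    have : (0 : ℝ) ≤ t := ht
    exact lt_of_lt_of_le (by norm_num) this
  have hmem : ∀ t ∈ Ioi (-1 : ℝ), z (σ t) ∈ pball z₀ R := fun t ht =>
    hzm _ (Ioo_subset_Ico_self (hσm t ht))
  have hγc : ContDiffOn ℝ 1 (z ∘ σ) (Ioi (-1)) := by
    rw [contDiffOn_one_iff_derivWithin (uniqueDiffOn_Ioi _)]
    refine ⟨fun t ht => (hγd t ht).differentiableAt.differentiableWithinAt, ?_⟩
    have h1 : ContinuousOn (fun t => (T * (1 / (t + 2) ^ 2)) • (ζ / h (z (σ t))))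
        (Ioi (-1 : ℝ)) := by
      have h2 : ContinuousOn (fun t => h (z (σ t))) (Ioi (-1 : ℝ)) := hh.comp (f := z ∘ σ)
        (fun t ht => (hγd t ht).continuousAt.continuousWithinAt) hmem
      refine ContinuousOn.fun_smul ?_ (continuousOn_const.div h2 fun t ht => hne _ (hmem t ht))
      refine continuousOn_const.mul (continuousOn_const.div (by fun_prop) fun t ht => ?_)
      have ht' : -1 < t := ht
      have : 0 < t + 2 := by linarith
      positivity
    refine h1.congr fun t ht => ?_
    rw [derivWithin_of_isOpen isOpen_Ioi ht, (hγd t ht).deriv]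
  have htend : Tendsto σ atTop (𝓝[<] T) := by
    refine tendsto_nhdsWithin_iff.2 ⟨?_, ?_⟩
    · have h1 : Tendsto (fun t : ℝ => T * (1 - 1 / (t + 2))) atTop (𝓝 (T * (1 - 0))) :=
        (tendsto_const_nhds.sub (tendsto_const_nhds.div_atTop
          (tendsto_atTop_add_const_right _ _ tendsto_id))).const_mul T
      rw [sub_zero, mul_one] at h1
      refine h1.congr' ?_
      filter_upwards [eventually_gt_atTop (0 : ℝ)] with t ht
      rw [hσ]
      field_simp
      ring
    · filter_upwards [eventually_ge_atTop (0 : ℝ)] with t ht using (hσm t (hIci t ht)).2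
  have h1 := hcomp (z ∘ σ) (hγc.mono hIci) (fun t ht => hmem t (hIci t ht)) (hlim.comp htend)
  refine (lintegral_inv_one_add_sq_lt_top (T * ‖ζ‖)).ne (top_unique ?_)
  rw [← h1]
  refine setLIntegral_mono' measurableSet_Ici fun t ht => ?_
  have ht' : (0 : ℝ) ≤ t := ht
  rw [((hγd t (hIci t ht)).hasDerivWithinAt.derivWithin (uniqueDiffOn_Ici 0 t ht)),
    ← ofReal_norm]
  apply ENNReal.ofReal_le_ofReal
  have h2 := norm_ne_zero_iff.2 (hne _ (hmem t (hIci t ht)))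
  rw [Function.comp_apply, norm_mul, norm_smul, norm_div, Real.norm_eq_abs,
    abs_of_nonneg (by positivity)]
  have h3 : 1 / (t + 2) ^ 2 ≤ (1 + t ^ 2)⁻¹ := by
    rw [one_div]
    exact inv_anti₀ (by positivity) (by nlinarith)
  have h4 : ‖h (z (σ t))‖ * (T * (1 / (t + 2) ^ 2) * (‖ζ‖ / ‖h (z (σ t))‖)) =
      T * ‖ζ‖ * (1 / (t + 2) ^ 2) := by field_simp
  rw [h4]
  exact mul_le_mul_of_nonneg_left h3 (by positivity)

/-- A short curve in a complete end, parametrized by arc length, stays away from the puncture and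
from the outer boundary. -/
theorem flat_path_confined (hh : ContinuousOn h (pball z₀ R)) (hne : ∀ z ∈ pball z₀ R, h z ≠ 0)
    (hcomp : FlatComplete h z₀ R) {K : ℝ}
    (hK : ∀ z, R / 4 ≤ ‖z - z₀‖ → ‖z - z₀‖ ≤ R / 2 → ‖(h z)⁻¹‖ ≤ K) {ζ : ℂ} {T : ℝ} (hT : 0 < T)
    (hT1 : T ≤ 1) (hR : 0 < R) (hζ : ‖ζ‖ * K < R / 4)
    {z : ℝ → ℂ} (hz : ∀ s ∈ Ico 0 T, HasDerivWithinAt z (ζ / h (z s)) (Ico 0 T) s)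
    (hzm : ∀ s ∈ Ico 0 T, z s ∈ pball z₀ R) (hz0 : ‖z 0 - z₀‖ ≤ R / 4) :
    ∃ a ∈ Ico 0 T, ∃ κ > 0, ∀ s ∈ Ico a T, κ ≤ ‖z s - z₀‖ ∧ ‖z s - z₀‖ ≤ R / 2 := by
  have hzr : ∀ s ∈ Ico 0 T, HasDerivWithinAt z (ζ / h (z s)) (Ici s) s := fun s hs =>
    (hz s hs).mono_of_mem_nhdsWithin (mem_of_superset (Ico_mem_nhdsGE hs.2)
      (Ico_subset_Ico_left hs.1))
  have hzc : ContinuousOn z (Ico 0 T) := fun s hs => (hz s hs).continuousWithinAt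
  -- Barrier argument with `R/4 + (R/4) s`. On touching the barrier the curve is in the annulus
  -- between `R/4` and `R/2`, where its speed is at most `|ζ| K < R/4`; and the time is at most `1`.
  have hup : ∀ s ∈ Ico 0 T, ‖z s - z₀‖ ≤ R / 2 := by
    intro s hs
    have hlt : ∀ x ∈ Ico 0 s, x ∈ Ico 0 T := fun x hx => ⟨hx.1, hx.2.trans hs.2⟩
    have h1 := image_norm_le_of_norm_deriv_right_lt_deriv_boundary' (f := fun s => z s - z₀)
      (f' := fun s => ζ / h (z s)) (a := 0) (b := s)
      (B := fun s => R / 4 + R / 4 * s) (B' := fun _ => R / 4)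
      ((hzc.mono fun x hx => ⟨hx.1, hx.2.trans_lt hs.2⟩).sub continuousOn_const)
      (fun x hx => (hzr x (hlt x hx)).sub_const _) (by simpa using hz0)
      (by fun_prop)
      (fun x hx => by
        have := ((hasDerivAt_id' x).const_mul (R / 4)).const_add (R / 4)
        rw [mul_one] at this
        exact this.hasDerivWithinAt)
      (fun x hx hB => by
        have hx1 : x < 1 := (hx.2.trans hs.2).trans_le hT1
        have hx0 := hx.1
        have k1 := hK (z x) (by rw [hB]; nlinarith) (by rw [hB]; nlinarith)
        rw [div_eq_mul_inv, norm_mul]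
        exact lt_of_le_of_lt (mul_le_mul_of_nonneg_left k1 (norm_nonneg _)) hζ)
      (right_mem_Icc.2 hs.1)
    refine h1.trans ?_
    have : s < 1 := hs.2.trans_le hT1
    nlinarith
  -- Completeness says that the curve does not converge to the puncture, so it is at distance at
  -- least `κ` at times arbitrarily close to `T`.
  have hnt := not_tendsto_of_flatComplete hh hne hcomp hT hz hzm
  rw [Metric.nhds_basis_ball.tendsto_right_iff] at hnt
  push Not at hnt
  obtain ⟨κ, hκ, hfr⟩ := hnt
  obtain ⟨K', hK'0, hK'⟩ := annulus_bound hh hne (a := κ / 2) (b := R / 2) (by positivity)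
    (by linarith)
  -- `L` exceeds the speed as long as the distance from the puncture is at least `κ/2`. The time `a`
  -- is taken so late that `L (T - a) < κ/2`, so the curve cannot come closer than `κ/2` afterwards.
  set L := ‖ζ‖ * K' + 1 with hL
  have hL0 : 0 < L := by positivity
  obtain ⟨a, haκ, ha1, ha2⟩ := (hfr.and_eventually (Ioo_mem_nhdsLT
    (show max 0 (T - κ / (2 * L)) < T from max_lt hT (sub_lt_self _ (by positivity))))).exists
  have ha0 : 0 < a := (le_max_left _ _).trans_lt ha1
  have haT : T - κ / (2 * L) < a := (le_max_right _ _).trans_lt ha1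
  have haκ' : κ ≤ ‖z a - z₀‖ := by simpa [dist_eq_norm] using haκ
  refine ⟨a, ⟨ha0.le, ha2⟩, κ / 2, by positivity, fun s hs => ⟨?_, hup s ⟨ha0.le.trans hs.1, hs.2⟩⟩⟩
  have hsm : L * (s - a) ≤ κ / 2 := by
    have h1 : s - a < κ / (2 * L) := by linarith [hs.2]
    have h2 : L * (s - a) < L * (κ / (2 * L)) := mul_lt_mul_of_pos_left h1 hL0
    have h3 : L * (κ / (2 * L)) = κ / 2 := by field_simp
    linarith
  have hge : ∀ x : ℝ, ‖z x - z a‖ ≤ κ / 2 → κ / 2 ≤ ‖z x - z₀‖ := fun x hx => by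
    have := norm_sub_norm_le (z a - z₀) (z a - z x)
    rw [sub_sub_sub_cancel_left, norm_sub_rev (z a) (z x)] at this
    linarith
  have hlt : ∀ x ∈ Ico a s, x ∈ Ico 0 T := fun x hx => ⟨ha0.le.trans hx.1, hx.2.trans hs.2⟩
  have h1 := image_norm_le_of_norm_deriv_right_lt_deriv_boundary' (f := fun s => z s - z a)
    (f' := fun s => ζ / h (z s)) (a := a) (b := s)
    (B := fun s => L * (s - a)) (B' := fun _ => L)
    ((hzc.mono fun x hx => ⟨ha0.le.trans hx.1, hx.2.trans_lt hs.2⟩).sub continuousOn_const)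
    (fun x hx => (hzr x (hlt x hx)).sub_const _) (by simp)
    (by fun_prop)
    (fun x hx => by
      have := ((hasDerivAt_id' x).sub_const a).const_mul L
      rw [mul_one] at this
      exact this.hasDerivWithinAt)
    (fun x hx hB => by
      have hx1 : x < s := hx.2
      have k1 := hK' (z x) (hge x (by rw [hB]; nlinarith)) (hup x (hlt x hx))
      rw [div_eq_mul_inv, norm_mul]
      have := mul_le_mul_of_nonneg_left k1 (norm_nonneg ζ)
      linarith)
    (right_mem_Icc.2 hs.1)
  exact hge s (h1.trans hsm)

end FlatEnd

section FlatEnd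

theorem isLocalHomeomorphOn_of_deriv {F H : ℂ → ℂ} {U : Set ℂ} (hU : IsOpen U)
    (hF : ∀ w ∈ U, HasDerivAt F (H w) w) (hH : ∀ w ∈ U, H w ≠ 0) : IsLocalHomeomorphOn F U := by
  intro w hw
  have h1 : HasStrictDerivAt F (H w) w := by
    have h2 : AnalyticAt ℂ F w := DifferentiableOn.analyticAt
      (fun w hw => (hF w hw).differentiableAt.differentiableWithinAt) (hU.mem_nhds hw)
    have := h2.hasStrictDerivAt
    rwa [(hF w hw).deriv] at this
  refine ⟨(h1.hasStrictFDerivAt_equiv (hH w hw)).toOpenPartialHomeomorph F, ?_, rfl⟩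
  exact (h1.hasStrictFDerivAt_equiv (hH w hw)).mem_toOpenPartialHomeomorph_source

theorem hasDerivWithinAt_lift {F H : ℂ → ℂ} {U : Set ℂ} (hU : IsOpen U)
    (hF : ∀ w ∈ U, HasDerivAt F (H w) w) (hH : ∀ w ∈ U, H w ≠ 0) {g : ℝ → ℂ} {S : Set ℝ}
    (hg : ContinuousOn g S) (hgU : ∀ s ∈ S, g s ∈ U) {b ζ : ℂ}
    (hgF : ∀ s ∈ S, F (g s) = b + s * ζ) {s : ℝ} (hs : s ∈ S) :
    HasDerivWithinAt g (ζ / H (g s)) S s := by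
  set w := g s with hw
  have hwU : w ∈ U := hgU s hs
  have h1 : HasStrictDerivAt F (H w) w := by
    have h2 : AnalyticAt ℂ F w := DifferentiableOn.analyticAt
      (fun w hw => (hF w hw).differentiableAt.differentiableWithinAt) (hU.mem_nhds hwU)
    have := h2.hasStrictDerivAt
    rwa [(hF w hwU).deriv] at this
  have h2 := (h1.to_localInverse (hH w hwU)).hasDerivAt
  have hFw : F w = b + s * ζ := hgF s hs
  rw [hFw] at h2
  have h3 : HasDerivAt (fun s : ℝ => b + s * ζ) ζ s := by
    have := ((Complex.ofRealCLM.hasDerivAt (x := s)).mul_const ζ).const_add b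
    simpa using this
  have h4 := (h2.comp s h3).hasDerivWithinAt (s := S)
  rw [inv_mul_eq_div] at h4
  refine h4.congr_of_eventuallyEq ?_ ?_
  · have h5 : ∀ᶠ s' in 𝓝[S] s, h1.localInverse F (H w) w (hH w hwU) (F (g s')) = g s' :=
      (hg s hs).eventually (h1.eventually_left_inverse (hH w hwU))
    filter_upwards [h5, self_mem_nhdsWithin] with s' hs' hsS
    rw [Function.comp_apply, ← hgF s' hsS]
    exact hs'.symm
  · rw [Function.comp_apply, ← hFw]
    exact (h1.eventually_left_inverse (hH w hwU)).self_of_nhds.symm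

variable {h : ℂ → ℂ} {z₀ : ℂ} {R : ℝ}

/-- The factor of a complete flat metric is bounded away from zero. -/
theorem inv_bounded_of_flatComplete (hR : 0 < R) (hh : DifferentiableOn ℂ h (pball z₀ R))
    (hne : ∀ z ∈ pball z₀ R, h z ≠ 0) (hcomp : FlatComplete h z₀ R) :
    ∃ M, ∀ z ∈ pball z₀ (R / 4), ‖(h z)⁻¹‖ ≤ M := by
  obtain ⟨K, hK0, hK⟩ := annulus_bound hh.continuousOn hne (a := R / 4) (b := R / 2)
    (by positivity) (by linarith)
  -- Straight segments of length less than `ρ` satisfy `|ζ| K < R/4`, the condition of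
  -- `flat_path_confined`.
  set ρ := R / (4 * K) with hρ
  have hρ0 : 0 < ρ := by positivity
  refine ⟨R / (ρ / 2), fun z hz => ?_⟩
  -- The universal covering `w ↦ z₀ + exp w` of the punctured disc by a half-plane. There the form
  -- `h dz` becomes `H dw` and has a primitive `F`, the developing map of the flat metric, which is
  -- a local homeomorphism.
  set U : Set ℂ := {w | w.re < Real.log R} with hUdef
  have hU : IsOpen U := isOpen_lt Complex.continuous_re continuous_const
  have hexp : ∀ w ∈ U, ‖Complex.exp w‖ < R := fun w hw => by
    rw [Complex.norm_exp, ← Real.lt_log_iff_exp_lt hR]; exact hw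
  have hmem : ∀ w ∈ U, z₀ + Complex.exp w ∈ pball z₀ R := fun w hw => by
    refine ⟨?_, ?_⟩
    · simpa [dist_eq_norm] using hexp w hw
    · simp [Complex.exp_ne_zero]
  set H : ℂ → ℂ := fun w => h (z₀ + Complex.exp w) * Complex.exp w with hH
  have hHne : ∀ w ∈ U, H w ≠ 0 := fun w hw => mul_ne_zero (hne _ (hmem w hw)) (Complex.exp_ne_zero w)
  obtain ⟨F, hF⟩ := exists_primitive_halfPlane (H := H) (c := Real.log R) (fun w hw => by
    have h1 := hh.differentiableAt ((isOpen_pball z₀ R).mem_nhds (hmem w hw))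
    have h2 : DifferentiableAt ℂ (fun w => z₀ + Complex.exp w) w :=
      (differentiableAt_const _).add Complex.differentiableAt_exp
    exact (DifferentiableAt.comp (g := h) w h1 h2).mul Complex.differentiableAt_exp)
  have hp : IsLocalHomeomorph (fun w : U => F w) := by
    rw [isLocalHomeomorph_iff_isLocalHomeomorphOn_univ]
    exact (isLocalHomeomorphOn_of_deriv hU hF hHne).comp
      (hU.isOpenEmbedding_subtypeVal.isLocalHomeomorph.isLocalHomeomorphOn (s := univ))
      (fun w _ => w.2)
  have hz0 : z - z₀ ≠ 0 := sub_ne_zero.2 hz.2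
  have hzR : ‖z - z₀‖ < R / 4 := by simpa [dist_eq_norm] using hz.1
  have hexpz : z₀ + Complex.exp (Complex.log (z - z₀)) = z := by rw [Complex.exp_log hz0]; ring
  set e₀ : U := ⟨Complex.log (z - z₀), by
    show (Complex.log (z - z₀)).re < Real.log R
    rw [Complex.log_re]
    exact Real.log_lt_log (norm_pos_iff.2 hz0) (by linarith)⟩ with he₀
  obtain ⟨ψ, hψc, hψ0, hψF⟩ := exists_section_ball hp (e₀ := e₀) (ρ := ρ) (by
    intro ζ hζ T hT g hgc hg0 hgF
    have hζ' : ‖ζ‖ * K < R / 4 := by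
      have h1 : ‖ζ‖ < ρ := by simpa using hζ
      rw [hρ, lt_div_iff₀ (by positivity)] at h1
      linarith
    have hgc' : ContinuousOn (fun s => (g s : ℂ)) (Ico 0 T) :=
      continuous_subtype_val.comp_continuousOn hgc
    have hgd : ∀ s ∈ Ico 0 T, HasDerivWithinAt (fun s => (g s : ℂ)) (ζ / H (g s)) (Ico 0 T) s :=
      fun s hs => hasDerivWithinAt_lift hU hF hHne hgc' (fun s _ => (g s).2) hgF hs
    set y : ℝ → ℂ := fun s => z₀ + Complex.exp (g s) with hy
    have hyn : ∀ s, ‖y s - z₀‖ = Real.exp (g s : ℂ).re := fun s => by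
      rw [hy]; simp [Complex.norm_exp]
    have hyd : ∀ s ∈ Ico 0 T, HasDerivWithinAt y (ζ / h (y s)) (Ico 0 T) s := by
      intro s hs
      have h1 := (Complex.hasDerivAt_exp (g s)).comp_hasDerivWithinAt s (hgd s hs)
      refine (h1.const_add z₀).congr_deriv ?_
      have h2 := hne _ (hmem _ (g s).2)
      have h3 := Complex.exp_ne_zero (g s)
      rw [hH, hy]
      field_simp
    obtain ⟨a, ha, κ, hκ, hconf⟩ := flat_path_confined hh.continuousOn hne hcomp hK hT.1 hT.2 hR hζ'
      hyd (fun s _ => hmem _ (g s).2) (by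
        rw [hy]
        simp only
        rw [hg0, he₀, hexpz]
        exact hzR.le)
    obtain ⟨K', hK'0, hK'⟩ := annulus_bound hh.continuousOn hne (b := R / 2) hκ (by linarith)
    have hsub : Ico a T ⊆ Ico 0 T := Ico_subset_Ico_left ha.1
    have hbound : ∀ s ∈ Ico a T, ‖ζ / H (g s)‖₊ ≤ Real.toNNReal (‖ζ‖ * K' / κ) := by
      intro s hs
      rw [← NNReal.coe_le_coe, coe_nnnorm, Real.coe_toNNReal _ (by positivity)]
      obtain ⟨h1, h2⟩ := hconf s hs
      have h3 := hK' (y s) h1 h2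
      have h4 : ‖Complex.exp (g s)‖ = ‖y s - z₀‖ := by rw [hy]; simp
      have h5 : ζ / H (g s) = ζ * (h (y s))⁻¹ / Complex.exp (g s) := by
        rw [hH, hy]; simp only; rw [div_eq_mul_inv, mul_inv, div_eq_mul_inv]; ring
      rw [h5, norm_div, norm_mul, h4]
      exact div_le_div₀ (by positivity) (mul_le_mul_of_nonneg_left h3 (norm_nonneg _)) hκ h1
    have hlip := (convex_Ico a T).lipschitzOnWith_of_nnnorm_hasDerivWithin_le
      (fun s hs => (hgd s (hsub hs)).mono hsub) hbound
    have hIco : Ico a T ∈ 𝓝[<] T := Ico_mem_nhdsLT ha.2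
    -- The curve is confined to a compact annulus near the end of its time interval, so the lift has
    -- bounded velocity there. It is Lipschitz, and hence has a limit, which still lies in the
    -- half-plane.
    have hcau : Cauchy (map (fun s => (g s : ℂ)) (𝓝[<] T)) :=
      Cauchy.map_of_le (cauchy_nhds.mono nhdsWithin_le_nhds) hlip.uniformContinuousOn
        (le_principal_iff.2 hIco)
    obtain ⟨L, hL⟩ := CompleteSpace.complete hcau
    have hLU : L ∈ U := by
      have h1 : Tendsto (fun s => ‖y s - z₀‖) (𝓝[<] T) (𝓝 (Real.exp L.re)) := by
        simp only [hyn]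
        exact (Real.continuous_exp.tendsto _).comp ((Complex.continuous_re.tendsto L).comp hL)
      have h2 : Real.exp L.re ≤ R / 2 := le_of_tendsto h1 (by
        filter_upwards [hIco] with s hs using (hconf s hs).2)
      show L.re < Real.log R
      rw [Real.lt_log_iff_exp_lt hR]
      linarith
    exact ⟨⟨L, hLU⟩, tendsto_subtype_rng.2 hL⟩) hρ0
  have hΦ : ∀ ζ ∈ Metric.ball (0 : ℂ) ρ, HasDerivAt (fun ζ => Complex.exp (ψ ζ))
      (Complex.exp (ψ ζ) * (H (ψ ζ))⁻¹) ζ := by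
    intro ζ hζ
    have h1 : HasDerivAt (fun ζ => (ψ ζ : ℂ)) (H (ψ ζ))⁻¹ ζ := by
      have h2 : HasDerivAt (fun w => F w - F e₀) (H (ψ ζ)) (ψ ζ) := (hF _ (ψ ζ).2).sub_const _
      refine HasDerivAt.of_local_left_inverse
        (continuous_subtype_val.continuousAt.comp
          (hψc.continuousAt (Metric.isOpen_ball.mem_nhds hζ))) h2 (hHne _ (ψ ζ).2) ?_
      filter_upwards [Metric.isOpen_ball.mem_nhds hζ] with ζ' hζ'
      rw [hψF ζ' hζ']
      ring
    exact (Complex.hasDerivAt_exp _).comp ζ h1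
  have hsub : Metric.closedBall (0 : ℂ) (ρ / 2) ⊆ Metric.ball 0 ρ :=
    Metric.closedBall_subset_ball (by linarith)
  -- The function `exp ∘ ψ` is the local inverse of the developing map, seen in the disc. It is
  -- bounded by `R` on the disc of radius `ρ`, and its derivative at `0` is `1 / h z`; Cauchy's
  -- estimate on radius `ρ/2` gives a bound independent of `z`.
  have hest := Complex.norm_deriv_le_of_forall_mem_sphere_norm_le (c := (0 : ℂ)) (R := ρ / 2)
    (C := R) (f := fun ζ => Complex.exp (ψ ζ)) (by positivity)
    (DifferentiableOn.diffContOnCl (by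
      rw [closure_ball _ (by positivity)]
      exact fun ζ hζ => (hΦ ζ (hsub hζ)).differentiableAt.differentiableWithinAt))
    (fun ζ _ => (hexp _ (ψ ζ).2).le)
  rw [(hΦ 0 (Metric.mem_ball_self hρ0)).deriv, hψ0] at hest
  have hfin : Complex.exp (e₀ : ℂ) * (H e₀)⁻¹ = (h z)⁻¹ := by
    rw [hH, he₀]
    simp only
    rw [hexpz, mul_inv, mul_comm (h z)⁻¹, ← mul_assoc,
      mul_inv_cancel₀ (Complex.exp_ne_zero _), one_mul]
  rwa [hfin] at hest

/-- The factor of a complete flat metric at a puncture tends to infinity. -/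
theorem tendsto_inv_of_flatComplete (hR : 0 < R) (hh : DifferentiableOn ℂ h (pball z₀ R))
    (hne : ∀ z ∈ pball z₀ R, h z ≠ 0) (hcomp : FlatComplete h z₀ R) :
    Tendsto (fun z => (h z)⁻¹) (𝓝[≠] z₀) (𝓝 0) := by
  obtain ⟨M, hM⟩ := inv_bounded_of_flatComplete hR hh hne hcomp
  have hlim : ∃ L, Tendsto (fun z => (h z)⁻¹) (𝓝[≠] z₀) (𝓝 L) := by
    refine ⟨_, Complex.tendsto_limUnder_of_differentiable_on_punctured_nhds_of_bounded_under ?_ ?_⟩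
    · filter_upwards [pball_mem hR] with z hz
      exact (hh.differentiableAt ((isOpen_pball z₀ R).mem_nhds hz)).inv (hne z hz)
    · refine ⟨M + ‖(h z₀)⁻¹‖, ?_⟩
      rw [eventually_map]
      filter_upwards [pball_mem (show 0 < R / 4 by positivity)] with z hz
      exact (norm_sub_le _ _).trans (add_le_add_left (hM z hz) _)
  obtain ⟨L, hL⟩ := hlim
  by_cases hL0 : L = 0
  · rwa [hL0] at hL
  exfalso
  -- If the limit of `1/h` were nonzero, `h` would be bounded near the puncture, and the radial
  -- curve `z₀ + (r/2)/(1 + t)` would have finite length.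
  have h1 : Tendsto h (𝓝[≠] z₀) (𝓝 L⁻¹) := (hL.inv₀ hL0).congr fun z => inv_inv (h z)
  have h2 : ∀ᶠ z in 𝓝[≠] z₀, ‖h z‖ < ‖L⁻¹‖ + 1 := h1.norm.eventually_lt_const (by linarith)
  obtain ⟨r, hr, hrb⟩ := Metric.mem_nhdsWithin_iff.1 (h2.and (pball_mem hR))
  have hmem : ∀ t : ℝ, 0 ≤ t → ((z₀ + (r / 2 / (1 + t) : ℝ) : ℂ)) ∈ Metric.ball z₀ r ∩ {z₀}ᶜ := by
    intro t ht
    have hp : 0 < r / 2 / (1 + t) := by positivity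
    refine ⟨?_, ?_⟩
    · rw [mem_ball_iff_norm, add_sub_cancel_left, Complex.norm_real, Real.norm_eq_abs, abs_of_pos hp,
        div_lt_iff₀ (by positivity)]
      nlinarith
    · simp only [mem_compl_iff, mem_singleton_iff, add_eq_left, Complex.ofReal_eq_zero]
      exact hp.ne'
  set γ : ℝ → ℂ := fun t => z₀ + (r / 2 / (1 + t) : ℝ) with hγ
  have hγd : ∀ t, 0 ≤ t → HasDerivAt γ ((-(r / 2) / (1 + t) ^ 2 : ℝ) : ℂ) t := by
    intro t ht
    have h3 : HasDerivAt (fun t : ℝ => r / 2 / (1 + t)) (-(r / 2) / (1 + t) ^ 2) t := by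
      have := (hasDerivAt_const t (r / 2)).fun_div ((hasDerivAt_id' t).const_add 1)
        (show 1 + t ≠ 0 by positivity)
      refine this.congr_deriv ?_
      ring
    exact h3.ofReal_comp.const_add z₀
  have hγc : ContDiffOn ℝ 1 γ (Ici 0) := by
    refine contDiffOn_const.add (Complex.ofRealCLM.contDiff.comp_contDiffOn
      (contDiffOn_const.div (contDiffOn_const.add contDiffOn_id) fun t ht => ?_))
    have : (0 : ℝ) ≤ t := ht
    positivity
  have hγt : Tendsto γ atTop (𝓝 z₀) := by
    have h3 : Tendsto (fun t : ℝ => r / 2 / (1 + t)) atTop (𝓝 0) :=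
      tendsto_const_nhds.div_atTop (tendsto_atTop_add_const_left _ _ tendsto_id)
    have h4 := ((Complex.continuous_ofReal.tendsto 0).comp h3).const_add z₀
    rwa [Complex.ofReal_zero, add_zero] at h4
  have h5 := hcomp γ hγc (fun t ht => (hrb (hmem t ht)).2) hγt
  refine (lintegral_inv_one_add_sq_lt_top ((‖L⁻¹‖ + 1) * (r / 2))).ne (top_unique ?_)
  rw [← h5]
  refine setLIntegral_mono' measurableSet_Ici fun t ht => ?_
  have ht' : (0 : ℝ) ≤ t := ht
  rw [(hγd t ht').hasDerivWithinAt.derivWithin (uniqueDiffOn_Ici 0 t ht), ← ofReal_norm]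
  apply ENNReal.ofReal_le_ofReal
  rw [norm_mul, Complex.norm_real, Real.norm_eq_abs, neg_div, abs_neg, abs_of_nonneg (by positivity),
    mul_assoc]
  refine mul_le_mul (hrb (hmem t ht')).1.le ?_ (by positivity) (by positivity)
  rw [div_eq_mul_inv]
  exact mul_le_mul_of_nonneg_left (inv_anti₀ (by positivity) (by nlinarith)) (by positivity)

end FlatEnd

/-- The point of `Q` over `s` given by the endomorphism `A`. -/
def Q.mk (s : S2) (A : E3 →L[ℝ] E3) (hA : (A : E3 →ₗ[ℝ] E3).IsSymmetric ∧ A (s : E3) = 0 ∧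
    LinearMap.trace ℝ E3 (A : E3 →ₗ[ℝ] E3) = 0) : Q := ⟨(s, A), hA⟩

/-! ### Extension of the derivative of the Gauss map across the ends. -/

section Extension

variable {D : Type*} [TopologicalSpace D] [ChartedSpace ℂ D]

theorem eventually_ne_notMem_finset {X : Type*} [TopologicalSpace X] [T1Space X] (s : Finset X)
    (y : X) : ∀ᶠ x in 𝓝[≠] y, x ∉ s := by
  classical
  filter_upwards [mem_nhdsWithin_of_mem_nhds
    (eventually_notMem_finset (Finset.notMem_erase y s)), self_mem_nhdsWithin] with x hx hxy hxs
  exact hx (Finset.mem_erase.2 ⟨hxy, hxs⟩)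

/-- Removable singularities. -/
theorem holAt_of_punctured [IsManifold 𝓘(ℂ, ℂ) ω D] {g : D → ℂ} {p : D}
    (h1 : ∀ᶠ x in 𝓝[≠] p, HolAt g x) (h2 : ContinuousAt g p) : HolAt g p := by
  refine Complex.analyticAt_of_differentiable_on_punctured_nhds_of_continuousAt ?_ ?_
  · rw [← eventually_chart_ne] at h1
    filter_upwards [h1, mem_nhdsWithin_of_mem_nhds
      ((chartAt ℂ p).open_target.mem_nhds (mem_chart_target ℂ p))] with z hz hzt
    rw [holAt_iff ((chartAt ℂ p).map_target hzt), (chartAt ℂ p).right_inv hzt] at hz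
    exact hz.differentiableAt
  · refine ContinuousAt.comp (g := g) ?_ ((chartAt ℂ p).continuousAt_symm (mem_chart_target ℂ p))
    rwa [(chartAt ℂ p).left_inv (mem_chart_source ℂ p)]

theorem isFlatPointAtInfinity_flipEps [CompactSpace D] [Nonempty D] [MeasurableSpace D]
    {Dinf : Finset D} {ε : D → D → E3} {e : D} (h : IsFlatPointAtInfinity Dinf ε e) :
    IsFlatPointAtInfinity Dinf (flipEps ε) e := by
  have hd : ∀ c y v, dMap (flipEps ε) c y v = flip (dMap ε c y v) := fun c y v => by
    rw [dMap_flipEps]; rfl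
  have hm : areaMeasure Dinf (flipEps ε) = areaMeasure Dinf ε := by
    simp only [areaMeasure, hd, cross_flip, flip.norm_map]
  have hK : gaussCurv (flipEps ε) = gaussCurv ε := funext (gaussCurv_flipEps ε)
  refine ⟨by rw [hm, hK]; exact h.1, fun γ h1 h2 h3 => ?_⟩
  rw [← h.2 γ h1 h2 h3]
  refine lintegral_congr fun t => ?_
  rw [hd, ← ofReal_norm, ← ofReal_norm, flip.norm_map]

variable [IsManifold 𝓘(ℂ, ℂ) ω D] [T1Space D] {Dinf : Finset D} {ε : D → D → E3}
  (h : IsMinimalImmersion Dinf ε)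

include h

/-- The derivative of the Gauss map tends to zero at a complete end. -/
theorem IsMinimalImmersion.tendsto_gaussQ [CompactSpace D] [Nonempty D] [MeasurableSpace D]
    {e : D} (he : IsFlatPointAtInfinity Dinf ε e) {s : S2}
    (hs : Tendsto (gaussMap ε) (𝓝[≠] e) (𝓝 s)) (hS : (s : E3) ≠ -e3) :
    Tendsto (gaussQ ε) (𝓝[≠] e) (𝓝 0) := by
  set φ := chartAt ℂ e with hφ
  set z₀ := φ e with hz₀
  have hDe := eventually_ne_notMem_finset Dinf e
  have hn : Tendsto (fun x => (gaussMap ε x : E3)) (𝓝[≠] e) (𝓝 (s : E3)) :=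
    (continuous_subtype_val.tendsto s).comp hs
  have hu : Tendsto (gaussU ε) (𝓝[≠] e) (𝓝 (coordU s)) := by
    refine (((continuousAt_coordU hS).tendsto).comp hn).congr' ?_
    filter_upwards [hDe] with x hx
    rw [Function.comp_apply, h.coe_gaussMap hx]; rfl
  have hgood : ∀ᶠ x in 𝓝[≠] e, x ∉ Dinf ∧ normal ε x ≠ -e3 ∧ ‖gaussU ε x‖ < ‖coordU s‖ + 1 := by
    filter_upwards [hDe, hn.eventually_ne hS, hu.norm.eventually_lt_const (lt_add_one _)]
      with x h1 h2 h3
    exact ⟨h1, by rwa [h.coe_gaussMap h1] at h2, h3⟩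
  rw [eventually_nhdsWithin_iff] at hgood
  obtain ⟨R, hR, hRt, hRS⟩ := exists_pball Dinf e hgood
  have hsub : pball z₀ R ⊆ φ.target := Set.sdiff_subset.trans hRt
  have hne : ∀ z ∈ pball z₀ R, φ.symm z ≠ e := fun z hz h' => hz.2 (by
    rw [mem_singleton_iff, ← φ.right_inv (hsub hz), h'])
  have hgd : ∀ z ∈ pball z₀ R, φ.symm z ∉ Dinf ∧ normal ε (φ.symm z) ≠ -e3 ∧
      ‖gaussU ε (φ.symm z)‖ < ‖coordU s‖ + 1 := fun z hz => (hRS z hz.1).1 (hne z hz)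
  have hsrc : ∀ z ∈ pball z₀ R, φ.symm z ∈ φ.source := fun z hz => φ.map_target (hsub hz)
  have hri : ∀ z ∈ pball z₀ R, φ (φ.symm z) = z := fun z hz => φ.right_inv (hsub hz)
  have hf : DifferentiableOn ℂ (factor ε e) (pball z₀ R) := fun z hz => by
    have h1 := h.analyticAt_factor (hgd z hz).1 (hsrc z hz) (hgd z hz).2.1
    rw [hri z hz] at h1
    exact h1.differentiableAt.differentiableWithinAt
  have hf0 : ∀ z ∈ pball z₀ R, factor ε e z ≠ 0 := fun z hz => by
    have h1 := h.factor_ne_zero (hgd z hz).1 (hsrc z hz) (hgd z hz).2.1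
    rwa [hri z hz] at h1
  -- `|dε| = |F| (1 + |u|²) |dz|`, and `u` is bounded near the end because the limit normal is not
  -- `-e₃`; so infinite length on the surface means infinite length for `|F| |dz|`.
  have hcomp : FlatComplete (factor ε e) z₀ R := by
    intro γ hγ hγm hγt
    have h1 := he.2 γ hγ (fun t ht => ⟨hsub (hγm t ht), (hgd _ (hγm t ht)).1⟩) hγt
    set C := 1 + (‖coordU s‖ + 1) ^ 2 with hC
    have h2 : ∫⁻ t in Ici (0 : ℝ), ‖dMap ε e (φ.symm (γ t)) (derivWithin γ (Ici 0) t)‖ₑ ≤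
        ENNReal.ofReal C *
          ∫⁻ t in Ici (0 : ℝ), ‖factor ε e (γ t) * derivWithin γ (Ici 0) t‖ₑ := by
      rw [← lintegral_const_mul' _ _ ENNReal.ofReal_ne_top]
      refine setLIntegral_mono' measurableSet_Ici fun t ht => ?_
      obtain ⟨k1, k2, k3⟩ := hgd _ (hγm t ht)
      have h3 := h.norm_dMap k1 (hsrc _ (hγm t ht)) k2 (derivWithin γ (Ici 0) t)
      rw [hri _ (hγm t ht)] at h3
      rw [← ofReal_norm, ← ofReal_norm, h3, ← ENNReal.ofReal_mul (by positivity), norm_mul]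
      apply ENNReal.ofReal_le_ofReal
      have h4 : 1 + ‖gaussU ε (φ.symm (γ t))‖ ^ 2 ≤ C := by
        rw [hC]; gcongr
      calc _ = (1 + ‖gaussU ε (φ.symm (γ t))‖ ^ 2) *
            (‖factor ε e (γ t)‖ * ‖derivWithin γ (Ici 0) t‖) := by ring
        _ ≤ _ := mul_le_mul_of_nonneg_right h4 (by positivity)
    rw [h1, top_le_iff] at h2
    by_contra h3
    exact ENNReal.mul_ne_top ENNReal.ofReal_ne_top h3 h2
  have hinv := tendsto_inv_of_flatComplete hR hf hf0 hcomp
  -- With the limit as its value at the end, `u` is analytic there, so `u'` stays bounded and `q =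
  -- -2 u' / F` tends to zero together with `1/F`.
  set U : ℂ → ℂ := Function.update (gaussU ε ∘ φ.symm) z₀ (coordU s) with hU
  have hUe : ∀ z ∈ pball z₀ R, U =ᶠ[𝓝 z] gaussU ε ∘ φ.symm := fun z hz => by
    filter_upwards [isOpen_ne.mem_nhds hz.2] with w hw
    rw [hU, Function.update_of_ne hw]
  have hUan : ∀ z ∈ pball z₀ R, AnalyticAt ℂ (gaussU ε ∘ φ.symm) z := fun z hz => by
    have h1 := h.analyticAt_gaussU (hgd z hz).1 (hsrc z hz) (hgd z hz).2.1
    rwa [hri z hz] at h1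
  have hU0 : AnalyticAt ℂ U z₀ := by
    refine Complex.analyticAt_of_differentiable_on_punctured_nhds_of_continuousAt ?_ ?_
    · filter_upwards [pball_mem hR] with z hz
      exact ((hUan z hz).congr (hUe z hz).symm).differentiableAt
    · rw [hU, continuousAt_update_same]
      rw [Filter.tendsto_def] at hu ⊢
      exact fun S hS => eventually_chart_ne.2 (hu S hS)
  have hdU : Tendsto (deriv U) (𝓝[≠] z₀) (𝓝 (deriv U z₀)) :=
    hU0.deriv.continuousAt.mono_left nhdsWithin_le_nhds
  have hlim : Tendsto (fun z => gaussQ ε (φ.symm z)) (𝓝[≠] z₀) (𝓝 0) := by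
    have h1 := (hdU.const_mul (-2)).mul hinv
    rw [mul_zero] at h1
    refine h1.congr' ?_
    filter_upwards [pball_mem hR] with z hz
    have h2 := h.gaussQ_eq (hgd z hz).1 (hsrc z hz) (hgd z hz).2.1
    rw [hri z hz] at h2
    rw [h2, (hUe z hz).deriv_eq, div_eq_mul_inv]
  rw [Filter.tendsto_def] at hlim ⊢
  exact fun S hS => eventually_chart_ne.1 (hlim S hS)

/-- The derivative of the Gauss map as a map to `Q`, extended by `0` over the points `s e` at the
ends `e`. -/
def contactMap (s : D → S2) (x : D) : Q :=
  open Classical in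
  if hx : x ∈ Dinf then
    Q.mk (s x) 0 ⟨fun _ _ => by simp, by simp, by simp⟩
  else
    Q.mk (gaussMap ε x) (shape ε x) ⟨(h.shape_mem hx).1, by
      rw [h.coe_gaussMap hx]; exact (h.shape_mem hx).2.1, (h.shape_mem hx).2.2⟩

theorem contactMap_base_end {s : D → S2} {x : D} (hx : x ∈ Dinf) :
    (contactMap h s x).base = s x := by rw [contactMap, dif_pos hx]; rfl

theorem contactMap_endo_end {s : D → S2} {x : D} (hx : x ∈ Dinf) :
    (contactMap h s x).endo = 0 := by rw [contactMap, dif_pos hx]; rfl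

theorem contactMap_base {s : D → S2} {x : D} (hx : x ∉ Dinf) :
    (contactMap h s x).base = gaussMap ε x := by rw [contactMap, dif_neg hx]; rfl

theorem contactMap_endo {s : D → S2} {x : D} (hx : x ∉ Dinf) :
    (contactMap h s x).endo = shape ε x := by rw [contactMap, dif_neg hx]; rfl

theorem contactMap_u {s : D → S2} {x : D} (hx : x ∉ Dinf) :
    (contactMap h s x).u = gaussU ε x := by
  rw [Q.u, contactMap_base h hx, h.coe_gaussMap hx]; rfl

theorem contactMap_q {s : D → S2} {x : D} (hx : x ∉ Dinf) :
    (contactMap h s x).q = gaussQ ε x := by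
  rw [Q.q, contactMap_u h hx, contactMap_endo h hx]; rfl

theorem contactMap_flip (s : D → S2) (x : D) :
    (contactMap h s x).flip = contactMap h.flipEps (fun x => flipS (s x)) x := by
  apply Subtype.ext
  apply Prod.ext
  · show (contactMap h s x).flip.base = (contactMap h.flipEps _ x).base
    by_cases hx : x ∈ Dinf
    · rw [Q.base_flip, contactMap_base_end h hx, contactMap_base_end h.flipEps hx]
    · rw [Q.base_flip, contactMap_base h hx, contactMap_base h.flipEps hx]
      apply Subtype.ext
      rw [coe_flipS, h.coe_gaussMap hx, h.flipEps.coe_gaussMap hx, normal_flipEps]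
  · show (contactMap h s x).flip.endo = (contactMap h.flipEps _ x).endo
    by_cases hx : x ∈ Dinf
    · rw [Q.endo_flip, contactMap_endo_end h hx, contactMap_endo_end h.flipEps hx]
      ext1; simp
    · rw [Q.endo_flip, contactMap_endo h hx, contactMap_endo h.flipEps hx, shape_flipEps]

theorem continuousAt_contactMap_base {s : D → S2}
    (hs : ∀ e ∈ Dinf, Tendsto (gaussMap ε) (𝓝[≠] e) (𝓝 (s e))) (p : D) :
    ContinuousAt (fun x => (contactMap h s x).base) p := by
  by_cases hp : p ∈ Dinf
  · rw [continuousAt_iff_punctured_nhds, contactMap_base_end h hp]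
    refine (hs p hp).congr' ?_
    filter_upwards [eventually_ne_notMem_finset Dinf p] with x hx
    exact (contactMap_base h hx).symm
  · rw [IsInducing.subtypeVal.continuousAt_iff]
    refine (h.continuousAt_normal hp).congr ?_
    filter_upwards [eventually_notMem_finset hp] with x hx
    rw [Function.comp_apply, contactMap_base h hx, h.coe_gaussMap hx]

variable [CompactSpace D] [Nonempty D] [MeasurableSpace D]

/-- On the surface this is the Weierstrass representation. At an end `u` and `q` are holomorphic on
a punctured neighbourhood and continuous at the end, the first by the choice of `s` and the second
by completeness, so the singularity is removable. -/
theorem holAt_contactMap {s : D → S2}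
    (hs : ∀ e ∈ Dinf, Tendsto (gaussMap ε) (𝓝[≠] e) (𝓝 (s e)))
    (hinf : ∀ e ∈ Dinf, IsFlatPointAtInfinity Dinf ε e) {p : D}
    (hp : ((contactMap h s p).base : E3) ≠ -e3) :
    HolAt (fun x => (contactMap h s x).u) p ∧ HolAt (fun x => (contactMap h s x).q) p := by
  have hreg : ∀ {p : D}, p ∉ Dinf → ((contactMap h s p).base : E3) ≠ -e3 →
      HolAt (fun x => (contactMap h s x).u) p ∧ HolAt (fun x => (contactMap h s x).q) p := by
    intro p hp hS
    rw [contactMap_base h hp, h.coe_gaussMap hp] at hS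
    refine ⟨(h.holAt_gaussU hp hS).congr ?_, (h.holAt_gaussQ hp hS).congr ?_⟩
    · filter_upwards [eventually_notMem_finset hp] with x hx using (contactMap_u h hx).symm
    · filter_upwards [eventually_notMem_finset hp] with x hx using (contactMap_q h hx).symm
  by_cases hpD : p ∈ Dinf
  · have hb := continuousAt_contactMap_base h hs p
    have hb' : ContinuousAt (fun x => ((contactMap h s x).base : E3)) p :=
      continuous_subtype_val.continuousAt.comp hb
    have hDe := eventually_ne_notMem_finset Dinf p
    have hev : ∀ᶠ x in 𝓝[≠] p, HolAt (fun x => (contactMap h s x).u) x ∧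
        HolAt (fun x => (contactMap h s x).q) x := by
      filter_upwards [hDe, mem_nhdsWithin_of_mem_nhds (hb'.eventually_ne hp)] with x h1 h2
      exact hreg h1 h2
    refine ⟨holAt_of_punctured (hev.mono fun x hx => hx.1) ?_,
      holAt_of_punctured (hev.mono fun x hx => hx.2) ?_⟩
    · exact ContinuousAt.comp (f := fun x => ((contactMap h s x).base : E3))
        (continuousAt_coordU hp) hb'
    · have h0 : (contactMap h s p).q = 0 := (Q.q_eq_zero_iff hp).2 (contactMap_endo_end h hpD)
      rw [continuousAt_iff_punctured_nhds, h0]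
      rw [contactMap_base_end h hpD] at hp
      refine (h.tendsto_gaussQ (hinf p hpD) (hs p hpD) hp).congr' ?_
      filter_upwards [hDe] with x hx using (contactMap_q h hx).symm
  · exact hreg hpD hp

omit h [IsManifold 𝓘(ℂ, ℂ) ω D] [T1Space D] [CompactSpace D] [Nonempty D] [MeasurableSpace D]
  [ChartedSpace ℂ D] in
theorem continuousAt_of_coord {N : D → Q} {p : D} (hb : ContinuousAt (fun x => (N x).base) p)
    (hp : ((N p).base : E3) ≠ -e3) (hq : ContinuousAt (fun x => (N x).q) p) :
    ContinuousAt N p := by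
  have hb' : ContinuousAt (fun x => ((N x).base : E3)) p :=
    continuous_subtype_val.continuousAt.comp hb
  have hu : ContinuousAt (fun x => (N x).u) p :=
    ContinuousAt.comp (f := fun x => ((N x).base : E3)) (continuousAt_coordU hp) hb'
  have he : ContinuousAt (fun x => (N x).endo) p := by
    refine ((continuous_endoUQ.continuousAt (x := ((N p).u, (N p).q))).comp
      (f := fun x => ((N x).u, (N x).q)) (hu.prodMk hq)).congr ?_
    filter_upwards [hb'.eventually_ne hp] with x hx using (Q.endo_eq hx).symm
  exact IsInducing.subtypeVal.continuousAt_iff.2 (hb.prodMk he)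

omit h [IsManifold 𝓘(ℂ, ℂ) ω D] [T1Space D] [CompactSpace D] [Nonempty D] [MeasurableSpace D]
  [ChartedSpace ℂ D] [TopologicalSpace D] in
theorem continuous_Q_flip : Continuous Q.flip := by
  refine Continuous.subtype_mk ?_ _
  exact (continuous_flipS.comp (continuous_fst.comp continuous_subtype_val)).prodMk
    (continuous_flipE.comp (continuous_snd.comp continuous_subtype_val))

omit h [IsManifold 𝓘(ℂ, ℂ) ω D] [T1Space D] [CompactSpace D] [Nonempty D] [MeasurableSpace D]
  [ChartedSpace ℂ D] [TopologicalSpace D] in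
theorem Q.flip_flip (p : Q) : p.flip.flip = p :=
  Subtype.ext (Prod.ext (flipS_flipS _) (flipE_flipE _))

/-- The coordinates `v`, `r` of the map are the coordinates `u`, `q` of the map belonging to the
rotated surface, whose ends are again flat points at infinity. -/
theorem holomorphicToQ_contactMap {s : D → S2}
    (hs : ∀ e ∈ Dinf, Tendsto (gaussMap ε) (𝓝[≠] e) (𝓝 (s e)))
    (hinf : ∀ e ∈ Dinf, IsFlatPointAtInfinity Dinf ε e) : HolomorphicToQ (contactMap h s) := by
  have hs' : ∀ e ∈ Dinf, Tendsto (gaussMap (MinSurf.flipEps ε)) (𝓝[≠] e) (𝓝 (flipS (s e))) := by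
    intro e he
    refine ((continuous_flipS.tendsto _).comp (hs e he)).congr' ?_
    filter_upwards [eventually_ne_notMem_finset Dinf e] with x hxD
    apply Subtype.ext
    rw [Function.comp_apply, coe_flipS, h.coe_gaussMap hxD, h.flipEps.coe_gaussMap hxD,
      normal_flipEps]
  have hinf' : ∀ e ∈ Dinf, IsFlatPointAtInfinity Dinf (MinSurf.flipEps ε) e := fun e he =>
    isFlatPointAtInfinity_flipEps (hinf e he)
  have key : ∀ {p : D}, ((contactMap h s p).base : E3) ≠ e3 →
      HolAt (fun x => (contactMap h s x).v) p ∧ HolAt (fun x => (contactMap h s x).r) p ∧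
      ContinuousAt (contactMap h s) p := by
    intro p hp
    have hp' : ((contactMap h.flipEps (fun x => flipS (s x)) p).base : E3) ≠ -e3 := by
      rw [← contactMap_flip, Q.base_flip, coe_flipS, ne_eq, flip_eq_neg_e3]; exact hp
    have h1 := holAt_contactMap h.flipEps hs' hinf' hp'
    have h2 := continuousAt_of_coord (continuousAt_contactMap_base h.flipEps hs' p) hp'
      h1.2.continuousAt
    have hfun : contactMap h.flipEps (fun x => flipS (s x)) = fun x => (contactMap h s x).flip :=
      funext fun x => (contactMap_flip h s x).symm
    rw [hfun] at h1 h2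
    have hu : (fun x => (contactMap h s x).flip.u) = fun x => (contactMap h s x).v :=
      funext fun x => Q.u_flip _
    have hq : (fun x => (contactMap h s x).flip.q) = fun x => (contactMap h s x).r :=
      funext fun x => Q.q_flip _
    rw [hu, hq] at h1
    refine ⟨h1.1, h1.2, ?_⟩
    have h3 : ContinuousAt (fun x => (contactMap h s x).flip.flip) p :=
      ContinuousAt.comp (g := Q.flip) continuous_Q_flip.continuousAt h2
    have h4 : (fun x => (contactMap h s x).flip.flip) = contactMap h s :=
      funext fun x => Q.flip_flip _
    rwa [h4] at h3
  refine ⟨continuous_iff_continuousAt.2 fun p => ?_, fun p => ⟨fun hp => holAt_contactMap h hs hinf hp,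
    fun hp => ⟨(key hp).1, (key hp).2.1⟩⟩⟩
  by_cases hp : ((contactMap h s p).base : E3) = -e3
  · exact (key (by rw [hp]; exact neg_e3_ne_e3)).2.2
  · exact continuousAt_of_coord (continuousAt_contactMap_base h hs p) hp
      (holAt_contactMap h hs hinf hp).2.continuousAt

end Extension

/-! ## The Gauss map is not constant -/

section Nonconstant

variable {D : Type*} [TopologicalSpace D] [ChartedSpace ℂ D]
  [IsManifold 𝓘(ℂ, ℂ) ω D] [T1Space D] {Dinf : Finset D} {ε : D → D → E3}
  (h : IsMinimalImmersion Dinf ε)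

include h

theorem IsMinimalImmersion.shape_eq_zero_of_eventually_const {x : D} (hx : x ∉ Dinf) {n : E3}
    (hn : ∀ᶠ y in 𝓝 x, normal ε y = n) : shape ε x = 0 := by
  have hxs := mem_chart_source ℂ x
  have hf := (h.isConf_dMap hx hxs).isFrame
  rw [← h.normal_eq hx hxs] at hf
  have h1 := h.hasFDerivAt_normal hx hxs
  have h2 : HasFDerivAt (normal ε ∘ (chartAt ℂ x).symm) (0 : ℂ →L[ℝ] E3) (chartAt ℂ x x) := by
    refine (hasFDerivAt_const n (chartAt ℂ x x)).congr_of_eventuallyEq ?_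
    rw [← eventually_chart] at hn
    exact hn
  have h3 : ∀ v, shape ε x (dMap ε x x v) = 0 := fun v =>
    DFunLike.congr_fun (h1.unique h2) v
  ext1 z
  rw [hf.expand z, map_add, map_smul, map_add, map_smul, map_smul, map_smul, h3, h3,
    (h.shape_mem hx).2.1]
  simp

/-- If the Gauss map were constant, its derivative would vanish identically, and the surface would
be flat. -/
theorem isSection_contactMap [PreconnectedSpace D] [CompactSpace D] [Nonempty D]
    [MeasurableSpace D] {s : D → S2} (hflat : NonFlat Dinf ε)
    (hs : ∀ e ∈ Dinf, Tendsto (gaussMap ε) (𝓝[≠] e) (𝓝 (s e)))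
    (hinf : ∀ e ∈ Dinf, IsFlatPointAtInfinity Dinf ε e) :
    IsSection (fun x => (contactMap h s x).base) (fun x => (contactMap h s x).q)
      (fun x => (contactMap h s x).r) := by
  obtain ⟨x, hx, hx0⟩ := hflat
  refine (holomorphicToQ_contactMap h hs hinf).isSection ?_ ⟨x, by rwa [contactMap_endo h hx]⟩
  rintro ⟨t, ht⟩
  refine hx0 (h.shape_eq_zero_of_eventually_const hx (n := t) ?_)
  filter_upwards [eventually_notMem_finset hx] with y hy
  rw [← ht y, contactMap_base h hy, h.coe_gaussMap hy]

end Nonconstant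

/-! ## The area of the sphere -/

/-- The area density of the sphere in the coordinate `u`. -/
def sphereDensity (w : ℂ) : ℝ := 4 / (1 + ‖w‖ ^ 2) ^ 2

theorem continuous_sphereDensity : Continuous sphereDensity := by
  unfold sphereDensity
  refine continuous_const.div (by fun_prop) fun w => by positivity

/-- In polar coordinates `4 r / (1 + r²)²` has the primitive `-2 / (1 + r²)`, so the radial integral
is `2` and the angular one `2π`. -/
theorem lintegral_sphereDensity :
    ∫⁻ w, ENNReal.ofReal (sphereDensity w) = ENNReal.ofReal (4 * Real.pi) := by
  have hd : ∀ r ∈ Ioi (0 : ℝ), HasDerivAt (fun r : ℝ => -2 / (1 + r ^ 2))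
      (r * (4 / (1 + r ^ 2) ^ 2)) r := by
    intro r _
    have h0 : (1 + r ^ 2) ≠ 0 := by positivity
    refine (((hasDerivAt_const r (-2 : ℝ)).fun_div
      (((hasDerivAt_id' r).fun_pow 2).const_add 1) h0)).congr_deriv ?_
    field_simp
    ring
  have hc : ContinuousWithinAt (fun r : ℝ => -2 / (1 + r ^ 2)) (Ici 0) 0 :=
    (Continuous.div (by fun_prop) (by fun_prop) fun r => by positivity).continuousWithinAt
  have hpos : ∀ r ∈ Ioi (0 : ℝ), 0 ≤ r * (4 / (1 + r ^ 2) ^ 2) := fun r hr =>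
    mul_nonneg (le_of_lt hr) (by positivity)
  have hlim : Tendsto (fun r : ℝ => -2 / (1 + r ^ 2)) atTop (𝓝 0) :=
    tendsto_const_nhds.div_atTop
      (tendsto_atTop_add_const_left _ _ (tendsto_pow_atTop two_ne_zero))
  have hI := integral_Ioi_of_hasDerivAt_of_nonneg hc hd hpos hlim
  have hint := integrableOn_Ioi_deriv_of_nonneg hc hd hpos hlim
  have hr : ∫⁻ r in Ioi (0 : ℝ), ENNReal.ofReal (r * (4 / (1 + r ^ 2) ^ 2)) =
      ENNReal.ofReal 2 := by
    rw [← ofReal_integral_eq_lintegral_ofReal hint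
      ((ae_restrict_iff' measurableSet_Ioi).2 (ae_of_all _ hpos)), hI]
    norm_num
  have htgt : polarCoord.target = Ioi (0 : ℝ) ×ˢ Ioo (-Real.pi) Real.pi := rfl
  rw [← Complex.lintegral_comp_polarCoord_symm, htgt, Measure.volume_eq_prod,
    ← Measure.prod_restrict]
  have e1 : ∀ p : ℝ × ℝ, ENNReal.ofReal p.1 • ENNReal.ofReal (sphereDensity
      (Complex.polarCoord.symm p)) = ENNReal.ofReal (p.1 * (4 / (1 + p.1 ^ 2) ^ 2)) * 1 := by
    intro p
    rw [sphereDensity, Complex.norm_polarCoord_symm, sq_abs, smul_eq_mul, mul_one,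
      ENNReal.ofReal_mul' (by positivity)]
  simp only [e1]
  rw [lintegral_prod_mul (f := fun r : ℝ => ENNReal.ofReal (r * (4 / (1 + r ^ 2) ^ 2)))
    (g := fun _ : ℝ => 1) (by fun_prop) (by fun_prop), hr, lintegral_const, one_mul,
    Measure.restrict_apply_univ, Real.volume_Ioo, ← ENNReal.ofReal_mul (by norm_num)]
  congr 1
  ring

/-! ## Unramified points -/

section Unramified

variable {D : Type*} [TopologicalSpace D] [ChartedSpace ℂ D]

theorem HolToS2.exists_injOn {f : D → S2} (hf : HolToS2 f) {x : D} (hx : (f x : E3) ≠ -e3)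
    (h1 : localDegree f x = 1) : ∃ U, IsOpen U ∧ x ∈ U ∧ U ⊆ (chartAt ℂ x).source ∧
      InjOn (fun y => coordU (f y : E3)) U := by
  set g : ℂ → ℂ := (fun y => coordU (f y : E3)) ∘ (chartAt ℂ x).symm with hg
  have hxs := mem_chart_source ℂ x
  have hga : AnalyticAt ℂ g (chartAt ℂ x x) := (hf.2 x).1 hx
  have hgx : g (chartAt ℂ x x) = coordU (f x : E3) := by
    rw [hg, Function.comp_apply, (chartAt ℂ x).left_inv hxs]
  have hord : analyticOrderAt (fun z => g z - g (chartAt ℂ x x)) (chartAt ℂ x x) = 1 := by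
    rw [← h1, localDegree_of_ne_south hx, ordAt, hgx]; rfl
  have hd : deriv g (chartAt ℂ x x) ≠ 0 := by
    have h2 := hga.analyticOrderAt_deriv_add_one
    rw [hord] at h2
    rw [← hga.deriv.analyticOrderAt_eq_zero]
    simpa using h2
  have hs : HasStrictFDerivAt g ((ContinuousLinearEquiv.unitsEquivAut ℂ (Units.mk0 _ hd) :
      ℂ ≃L[ℂ] ℂ) : ℂ →L[ℂ] ℂ) (chartAt ℂ x x) := hga.hasStrictDerivAt.hasStrictFDerivAt_equiv hd
  set e := hs.toOpenPartialHomeomorph g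
  have he : chartAt ℂ x x ∈ e.source := hs.mem_toOpenPartialHomeomorph_source
  refine ⟨(chartAt ℂ x).source ∩ chartAt ℂ x ⁻¹' e.source,
    (chartAt ℂ x).isOpen_inter_preimage e.open_source, ⟨hxs, he⟩, inter_subset_left, ?_⟩
  rintro y ⟨hy, hye⟩ z ⟨hz, hze⟩ hyz
  refine (chartAt ℂ x).injOn hy hz (e.injOn hye hze ?_)
  show g _ = g _
  simpa only [hg, Function.comp_apply, (chartAt ℂ x).left_inv hy, (chartAt ℂ x).left_inv hz]
    using hyz

end Unramified

/-! ## The total curvature -/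

section TotalCurvature

variable {D : Type*} [TopologicalSpace D] [ChartedSpace ℂ D]
  [IsManifold 𝓘(ℂ, ℂ) ω D] [T2Space D] {Dinf : Finset D} {ε : D → D → E3}
  (h : IsMinimalImmersion Dinf ε) [CompactSpace D] [Nonempty D] [MeasurableSpace D] [BorelSpace D]

include h

theorem IsMinimalImmersion.nullSingletonClass_areaMeasure : NullSingletonClass (areaMeasure Dinf ε) := by
  refine ⟨fun x => ?_⟩
  by_cases hx : x ∈ Dinf
  · exact measure_mono_null (singleton_subset_iff.2 hx) (areaMeasure_ends Dinf ε)
  · have h1 := h.lintegral_areaMeasure (c := x) (F := fun _ => 1) measurable_const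
      (measurableSet_singleton x) (singleton_subset_iff.2 (mem_chart_source ℂ x))
      (fun y hy => by rwa [mem_singleton_iff.1 hy])
    have h2 : chartSet x {x} ⊆ {chartAt ℂ x x} := fun z hz => by
      rw [mem_singleton_iff, ← (chartAt ℂ x).right_inv hz.1, show (chartAt ℂ x).symm z = x from hz.2]
    rw [setLIntegral_one, Measure.restrict_eq_zero.2
      (measure_mono_null h2 (measure_singleton _)), lintegral_zero_measure] at h1
    exact h1

/-- The curvature integral over a set on which the Gauss map is injective is the area of the image
of the set under the Gauss map. -/
theorem IsMinimalImmersion.lintegral_gaussCurv_of_injOn {c : D} {A : Set D} (hA : MeasurableSet A)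
    (hAc : A ⊆ (chartAt ℂ c).source) (hAD : ∀ x ∈ A, x ∉ Dinf) (hAs : ∀ x ∈ A, normal ε x ≠ -e3)
    (hinj : InjOn (gaussU ε) A) : MeasurableSet (gaussU ε '' A) ∧
      ∫⁻ x in A, ENNReal.ofReal (-gaussCurv ε x) ∂areaMeasure Dinf ε =
        ∫⁻ w in gaussU ε '' A, ENNReal.ofReal (sphereDensity w) := by
  set U : ℂ → ℂ := gaussU ε ∘ (chartAt ℂ c).symm with hU
  have hZ := measurableSet_chartSet c hA
  have himg : U '' chartSet c A = gaussU ε '' A := by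
    have h1 : (chartAt ℂ c).symm '' chartSet c A = A := by
      ext x
      constructor
      · rintro ⟨z, hz, rfl⟩; exact hz.2
      · intro hx
        refine ⟨chartAt ℂ c x, ⟨(chartAt ℂ c).map_source (hAc hx), ?_⟩,
          (chartAt ℂ c).left_inv (hAc hx)⟩
        rwa [mem_preimage, (chartAt ℂ c).left_inv (hAc hx)]
    rw [hU, image_comp, h1]
  have hinj' : InjOn U (chartSet c A) := fun z hz w hw hzw =>
    (chartAt ℂ c).symm.injOn hz.1 hw.1 (hinj hz.2 hw.2 hzw)
  have hder : ∀ z ∈ chartSet c A, HasFDerivWithinAt U (mulL (deriv U z)) (chartSet c A) z := by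
    intro z hz
    have h1 := h.analyticAt_gaussU (hAD _ hz.2) (hAc hz.2) (hAs _ hz.2)
    rw [(chartAt ℂ c).right_inv hz.1] at h1
    refine ((h1.differentiableAt.hasDerivAt.hasFDerivAt.restrictScalars ℝ).congr_fderiv
      ?_).hasFDerivWithinAt
    ext1 v
    simp [hU, mul_comm]
  rw [← himg]
  refine ⟨measurable_image_of_fderivWithin hZ hder hinj', ?_⟩
  rw [h.lintegral_gaussCurv hA hAc hAD, lintegral_image_eq_lintegral_abs_det_fderiv_mul _ hZ hder
    hinj']
  refine setLIntegral_congr_fun hZ fun z hz => ?_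
  have h1 := h.gaussCurv_mul (hAD _ hz.2) (hAc hz.2) (hAs _ hz.2)
  rw [(chartAt ℂ c).right_inv hz.1] at h1
  show ENNReal.ofReal (-gaussCurv ε ((chartAt ℂ c).symm z) * areaDensity ε c z) = _
  rw [det_mulL, abs_of_nonneg (by positivity), ← ENNReal.ofReal_mul (by positivity), areaDensity,
    neg_mul, h1, neg_neg, sphereDensity]
  congr 1
  show 4 * ‖deriv U z‖ ^ 2 / _ = _
  rw [hU, Function.comp_apply]
  ring

/-- Off a finite set, which has measure zero, `f` is locally injective. The rest of `D` is cut into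
countably many pieces on which `f` is injective and each of which contributes the spherical area of
its image. Almost every `w` lies in the images of exactly `deg f` pieces, counted as points of the
fibre. -/
theorem IsMinimalImmersion.lintegral_neg_gaussCurv {f : D → S2} (hf : NonconstHol f)
    (hfn : ∀ x ∉ Dinf, (f x : E3) = normal ε x) :
    ∫⁻ x, ENNReal.ofReal (-gaussCurv ε x) ∂areaMeasure Dinf ε =
      (deg f : ENNReal) * ENNReal.ofReal (4 * Real.pi) := by
  classical
  have := h.nullSingletonClass_areaMeasure
  have := ChartedSpace.secondCountable_of_sigmaCompact ℂ D
  set B : Set D := Dinf ∪ ({x | f x = south} ∪ f ⁻¹' branchValues f) with hB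
  have hBf : B.Finite := Dinf.finite_toSet.union ((hf.finite south).union
    (hf.branchValues_finite.preimage' fun s _ => hf.finite s))
  have hBm : MeasurableSet B := hBf.measurableSet
  have hGs : ∀ x ∈ Bᶜ, x ∉ Dinf ∧ (f x : E3) ≠ -e3 ∧ f x ∉ branchValues f := fun x hx =>
    ⟨fun h' => hx (Or.inl h'), (ne_south_iff _).1 fun h' => hx (Or.inr (Or.inl h')),
      fun h' => hx (Or.inr (Or.inr h'))⟩
  have hUx : ∀ x, ∃ U : Set D, IsOpen U ∧ (x ∈ Bᶜ → x ∈ U) ∧ U ⊆ (chartAt ℂ x).source ∧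
      InjOn (fun y => coordU (f y : E3)) U := by
    intro x
    by_cases hx : x ∈ Bᶜ
    · obtain ⟨-, h2, h3⟩ := hGs x hx
      have h1 : localDegree f x = 1 := by
        rw [hf.localDegree_eq]
        have : locDeg f x = 1 := by
          by_contra h'
          exact h3 ⟨x, rfl, h'⟩
        rw [this]; rfl
      obtain ⟨U, hUo, hxU, hUs, hUi⟩ := hf.hol.exists_injOn h2 h1
      exact ⟨U, hUo, fun _ => hxU, hUs, hUi⟩
    · exact ⟨∅, isOpen_empty, fun h' => absurd h' hx, empty_subset _, injOn_empty _⟩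
  choose U hUo hUm hUs hUi using hUx
  obtain ⟨t, -, htc, htU⟩ := TopologicalSpace.countable_cover_nhdsWithin (s := Bᶜ) (f := U)
    fun x hx => mem_nhdsWithin_of_mem_nhds ((hUo x).mem_nhds (hUm x hx))
  obtain ⟨c, hc⟩ := countable_iff_exists_subset_range.1 htc
  set A : ℕ → Set D := fun i => disjointed (fun i => U (c i)) i ∩ Bᶜ with hAdef
  have hAm : ∀ i, MeasurableSet (A i) := fun i =>
    (MeasurableSet.disjointed (fun i => (hUo (c i)).measurableSet) i).inter hBm.compl
  have hAU : ∀ i, A i ⊆ U (c i) := fun i => inter_subset_left.trans (disjointed_subset _ i)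
  have hAd : Pairwise (Function.onFun Disjoint A) := fun i j hij =>
    (disjoint_disjointed (fun i => U (c i)) hij).mono inter_subset_left inter_subset_left
  have hAun : ⋃ i, A i = Bᶜ := by
    rw [hAdef, ← iUnion_inter, iUnion_disjointed, inter_eq_right]
    intro x hx
    obtain ⟨y, hy, hxy⟩ := mem_iUnion₂.1 (htU hx)
    obtain ⟨i, rfl⟩ := hc hy
    exact mem_iUnion.2 ⟨i, hxy⟩
  have hAG : ∀ i, ∀ x ∈ A i, x ∉ Dinf ∧ (f x : E3) ≠ -e3 ∧ f x ∉ branchValues f := fun i x hx =>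
    hGs x hx.2
  have hgU : ∀ x ∉ Dinf, gaussU ε x = coordU (f x : E3) := fun x hx => by rw [hfn x hx]; rfl
  have hinj : ∀ i, InjOn (gaussU ε) (A i) := fun i x hx y hy hxy => by
    rw [hgU x (hAG i x hx).1, hgU y (hAG i y hy).1] at hxy
    exact hUi (c i) (hAU i hx) (hAU i hy) hxy
  have hpiece := fun i => h.lintegral_gaussCurv_of_injOn (hAm i) ((hAU i).trans (hUs (c i)))
    (fun x hx => (hAG i x hx).1) (fun x hx => by
      rw [← hfn x (hAG i x hx).1]; exact (hAG i x hx).2.1) (hinj i)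
  have hae : ∀ᵐ x ∂areaMeasure Dinf ε, x ∈ ⋃ i, A i := by
    rw [hAun]
    exact measure_eq_zero_iff_ae_notMem.1 (hBf.measure_zero _)
  rw [← Measure.restrict_eq_self_of_ae_mem hae, lintegral_iUnion hAm hAd]
  have hσ : Measurable fun w => ENNReal.ofReal (sphereDensity w) :=
    continuous_sphereDensity.measurable.ennreal_ofReal
  simp only [(hpiece _).2, ← lintegral_indicator (hpiece _).1]
  rw [← lintegral_tsum fun i => (hσ.indicator (hpiece i).1).aemeasurable,
    ← lintegral_sphereDensity, ← lintegral_const_mul _ hσ]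
  refine lintegral_congr_ae ?_
  have hS : (((fun x => coordU (f x : E3)) '' B).Finite) := hBf.image _
  filter_upwards [measure_eq_zero_iff_ae_notMem.1 (hS.measure_zero volume)] with w hw
  have hwf : ∀ x ∈ fib f (sph w), x ∈ Bᶜ := fun x hx hxB => hw ⟨x, hxB, by
    show coordU (f x : E3) = w
    rw [hf.mem_fib.1 hx, coordU_sph]⟩
  have hwb : sph w ∉ branchValues f := by
    rintro ⟨x, hx, hx'⟩
    exact hwf x (hf.mem_fib.2 hx) (Or.inr (Or.inr ⟨x, rfl, hx'⟩))
  have hfx : ∀ i, ∀ x ∈ A i, (gaussU ε x = w ↔ f x = sph w) := fun i x hx => by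
    rw [hgU x (hAG i x hx).1]
    exact ⟨fun h' => by rw [← h', sph_coordU (hAG i x hx).2.1], fun h' => by rw [h', coordU_sph]⟩
  -- By injectivity a piece contains at most one point over `w`, so the indicator of the image of
  -- the piece at `w` is the sum of the indicators of the piece over the fibre. Summing over the
  -- disjoint pieces counts every point of the fibre once.
  have key : ∀ i, (gaussU ε '' A i).indicator (fun w => ENNReal.ofReal (sphereDensity w)) w =
      ∑ x ∈ fib f (sph w), (A i).indicator (fun _ => ENNReal.ofReal (sphereDensity w)) x := by
    intro i
    by_cases hwi : w ∈ gaussU ε '' A i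
    · obtain ⟨x, hx, hxw⟩ := hwi
      have hwi : w ∈ gaussU ε '' A i := ⟨x, hx, hxw⟩
      rw [indicator_of_mem hwi, Finset.sum_eq_single x, indicator_of_mem hx]
      · intro y hy hyx
        refine indicator_of_notMem (fun hyA => hyx (hinj i hyA hx ?_)) _
        rw [hxw, hfx i y hyA]
        exact hf.mem_fib.1 hy
      · intro hx'
        exact absurd (hf.mem_fib.2 ((hfx i x hx).1 hxw)) hx'
    · rw [indicator_of_notMem hwi, Finset.sum_eq_zero]
      intro y hy
      exact indicator_of_notMem (fun hyA => hwi ⟨y, hyA, (hfx i y hyA).2 (hf.mem_fib.1 hy)⟩) _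
  simp only [key]
  rw [Summable.tsum_finsetSum fun _ _ => ENNReal.summable, ← hf.card_fib hwb, ← nsmul_eq_mul,
    ← Finset.sum_const]
  refine Finset.sum_congr rfl fun x hx => ?_
  have hxA : x ∈ ⋃ i, A i := by rw [hAun]; exact hwf x hx
  obtain ⟨i, hi⟩ := mem_iUnion.1 hxA
  rw [tsum_eq_single i, indicator_of_mem hi]
  intro j hj
  exact indicator_of_notMem (fun hxj => (hAd hj).le_bot ⟨hxj, hi⟩) _

theorem IsMinimalImmersion.integral_gaussCurv {f : D → S2} (hf : NonconstHol f)
    (hfn : ∀ x ∉ Dinf, (f x : E3) = normal ε x) :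
    Integrable (gaussCurv ε) (areaMeasure Dinf ε) ∧
      ∫ x, gaussCurv ε x ∂areaMeasure Dinf ε = -4 * Real.pi * deg f := by
  have hDae : ∀ᵐ x ∂areaMeasure Dinf ε, x ∉ Dinf :=
    measure_eq_zero_iff_ae_notMem.1 (areaMeasure_ends Dinf ε)
  have hmeas : AEStronglyMeasurable (fun x => -gaussCurv ε x) (areaMeasure Dinf ε) := by
    refine h.measurable_indicator_gaussCurv.neg.aestronglyMeasurable.congr ?_
    filter_upwards [hDae] with x hx
    rw [Pi.neg_apply, indicator_of_mem (s := (Dinf : Set D)ᶜ) hx]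
  have hpos : 0 ≤ᵐ[areaMeasure Dinf ε] fun x => -gaussCurv ε x := by
    filter_upwards [hDae] with x hx
    exact neg_nonneg.2 (h.gaussCurv_nonpos hx)
  have hl := h.lintegral_neg_gaussCurv hf hfn
  have hfin : (deg f : ENNReal) * ENNReal.ofReal (4 * Real.pi) ≠ ⊤ :=
    ENNReal.mul_ne_top (ENNReal.natCast_ne_top _) ENNReal.ofReal_ne_top
  have hint : Integrable (fun x => -gaussCurv ε x) (areaMeasure Dinf ε) := by
    rw [← lintegral_ofReal_ne_top_iff_integrable hmeas hpos, hl]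
    exact hfin
  refine ⟨by simpa using hint.neg, ?_⟩
  have h1 := integral_eq_lintegral_of_nonneg_ae hpos hmeas
  rw [hl, integral_neg, ENNReal.toReal_mul, ENNReal.toReal_natCast,
    ENNReal.toReal_ofReal (by positivity)] at h1
  linarith

end TotalCurvature

end MinSurf

end

theorem mainTheorem5 {D : Type*} [TopologicalSpace D] [T2Space D] [CompactSpace D]
    [ConnectedSpace D] [ChartedSpace ℂ D] [IsManifold 𝓘(ℂ, ℂ) ω D]
    [MeasurableSpace D] [BorelSpace D]
    (Dinf : Finset D) (ε : D → D → MinSurf.E3)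
    (hε : MinSurf.IsMinimalImmersion Dinf ε)
    (hflat : MinSurf.NonFlat Dinf ε)
    (hinf : ∀ e ∈ Dinf, MinSurf.IsFlatPointAtInfinity Dinf ε e) :
    -- `N` is the extension of `n'` to `D`; `π ∘ N` is the extension of the Gauss map
    ∃ N : D → MinSurf.Q, MinSurf.HolomorphicToQ N ∧
      (∀ x ∉ Dinf, ((N x).base : MinSurf.E3) = MinSurf.normal ε x ∧
        (N x).endo = MinSurf.shape ε x) ∧
      (∀ e ∈ Dinf, N e ∈ MinSurf.zeroSection) ∧
      -- `d` is the degree of the Gauss map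
      ∃ d : ℕ, 0 < d ∧ MinSurf.HasDegree (fun x => (N x).base) d ∧
        -- the total curvature
        Integrable (MinSurf.gaussCurv ε) (MinSurf.areaMeasure Dinf ε) ∧
        ∫ x, MinSurf.gaussCurv ε x ∂(MinSurf.areaMeasure Dinf ε) = -4 * Real.pi * d ∧
        -- the number of finite flat points plus flat points at infinity, with multiplicity
        (MinSurf.flatPoints Dinf ε).Finite ∧
        (∑ᶠ x ∈ MinSurf.flatPoints Dinf ε, MinSurf.zeroOrder N x) +
          (∑ e ∈ Dinf, MinSurf.zeroOrder N e) = 4 * (d : ℕ∞) ∧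
        -- the algebraic curve `C = N(D)`, over which `D` lies with `m` sheets,
        -- and its intersection number with the zero section
        MinSurf.IsAlgebraic (range N) ∧
        ∃ m : ℕ, 0 < m ∧ {c ∈ range N | {x | N x = c}.ncard ≠ m}.Finite ∧
          (m : ℕ∞) * MinSurf.intersectionZeroSection (range N) = 4 * (d : ℕ∞) := by
  have hlim : ∀ e, ∃ s, e ∈ Dinf → Tendsto (MinSurf.gaussMap ε) (𝓝[≠] e) (𝓝 s) := by
    intro e
    by_cases he : e ∈ Dinf
    · obtain ⟨s, hs⟩ := hε.exists_tendsto_gaussMap (hinf e he).1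
      exact ⟨s, fun _ => hs⟩
    · exact ⟨MinSurf.north, fun h => absurd h he⟩
  choose s hs using hlim
  have hbase : ∀ x ∉ Dinf, ((MinSurf.contactMap hε s x).base : MinSurf.E3) =
      MinSurf.normal ε x := fun x hx => by
    rw [MinSurf.contactMap_base hε hx, hε.coe_gaussMap hx]
  have hN := MinSurf.holomorphicToQ_contactMap hε hs hinf
  have hsec := MinSurf.isSection_contactMap hε hflat hs hinf
  have hcurv := hε.integral_gaussCurv hsec.base hbase
  have hzero := MinSurf.sum_zeroOrder hN hsec Dinf
  have hflatPoints : {x | x ∉ Dinf ∧ (MinSurf.contactMap hε s x).endo = 0} =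
      MinSurf.flatPoints Dinf ε := by
    ext x
    exact and_congr_right fun hx => by rw [MinSurf.contactMap_endo hε hx]
  rw [hflatPoints] at hzero
  obtain ⟨halg, hm⟩ := MinSurf.HolomorphicToQ.image_curve hsec
  exact ⟨MinSurf.contactMap hε s, hN, fun x hx => ⟨hbase x hx, MinSurf.contactMap_endo hε hx⟩,
    fun e he => MinSurf.contactMap_endo_end hε he, _, hsec.base.deg_pos, hsec.base.hasDegree,
    hcurv.1, hcurv.2, hzero.1, hzero.2, halg, hm⟩
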